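/- Let $m>1$ and let $(\mathbb V,g)$ be Minkowski space of dimension $2m+2$, i.e. a real vector space with a symmetric bilinear form of signature $(2m+1,1)$. Let $\mathbb N\subset{}^{\mathbb C}\mathbb V=\mathbb C\otimes\mathbb V$ be a Robinson structure: $\mathbb N=\mathbb N^\perp$ and $\dim_{\mathbb C}(\mathbb N\cap\overline{\mathbb N})=1$. Put $\mathbb K=\mathbb N\cap\mathbb V$ (a real null line), and let $\mathbb V_0:=\mathbb K^\perp/\mathbb K$ be the screen space with the induced positive-definite form $h$ and the Hermitian structure for which ${}^{\mathbb C}\mathbb V_0=\mathbb V_0^{(1,0)}\oplus\mathbb V_0^{(0,1)}$, $\mathbb V_0^{(0,1)}=\mathbb N/{}^{\mathbb C}\mathbb K$, $\mathbb V_0^{(1,0)}=\overline{\mathbb N}/{}^{\mathbb C}\mathbb K$. Let $\mathfrak g=\mathfrak{so}(\mathbb V,g)$, let $Q\subset SO^0(\mathbb V,g)$ be the stabiliser of $\mathbb N$ and of the orientation of $\mathbb K$, and let $\mathfrak q=\{X\in\mathfrak g: X\mathbb N\subset\mathbb N\}$ be its Lie algebra. Let $Q_0=\mathbb R_{>0}\times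 U(m)$, where $U(m)$ is the unitary group of $\mathbb V_0$, and let $Q\to Q_0$ be the homomorphism $q\mapsto(c,\psi)$ such that $q$ acts on $\mathbb K$ as multiplication by $c^{-1}$ and on $\mathbb V_0$ as $\psi$; $Q_0$-modules are regarded as $Q$-modules through it. For $w\in\mathbb Z$ let $\mathbb R(w)$ be $\mathbb R$ with $(c,\psi)$ acting as $c^w$ (so $\mathbb K\cong\mathbb R(-1)$). Consider the filtrations $$\mathbb V=\mathbb V^{-1}\supset\mathbb V^0=\mathbb K^\perp\supset\mathbb V^1=\mathbb K\supset \mathbb V^2=0,\qquad (\mathbb V^*)^i=\mathrm{Ann}(\mathbb V^{1-i}),\qquad \mathfrak g^i=\{X\in\mathfrak g: X\mathbb V^j\subset\mathbb V^{j+i}\ \forall j\},$$ (with $\mathbb V^i=\mathbb V$ for $i\le-1$ and $\mathbb V^i=0$ for $i\ge2$), and let $(\mathfrak g/\mathfrak q)^i$ be the image of $\mathfrak g^i$ in $\mathfrak g/\mathfrak q$. On the $Q$-module $\mathbb G=\mathbb V^*\otimes(\mathfrak g/\mathfrak q)$ of algebraic intrinsic torsions put $$\mathbb G^i=\sum_{j\in\mathbb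 Z}(\mathbb V^*)^{j}\otimes(\mathfrak g/\mathfrak q)^{i-j}.$$ **Theorem.** The $\mathbb G^i$ are $Q$-submodules forming a filtration $0=\mathbb G^2\subset\mathbb G^1\subset\mathbb G^0\subset\mathbb G^{-1}\subset\mathbb G^{-2}=\mathbb G$. Each graded piece $\mathrm{gr}_i(\mathbb G)=\mathbb G^i/\mathbb G^{i+1}$ (so $\mathrm{gr}_1(\mathbb G)=\mathbb G^1$; the pieces of degree outside $\{-2,-1,0,1\}$ vanish) is the direct sum of $Q$-submodules $\mathrm{gr}_i^{j,k}(\mathbb G)$, one for each row $\mathbb G_i^{j,k}$ of degree $i$ of the following table, and $\mathrm{gr}_i^{j,k}(\mathbb G)$ is isomorphic as a $Q$-module to the $Q_0$-module $\mathbb G_i^{j,k}$, which has the indicated real dimension: $$\begin{array}{lll} \mathbb G_{-2}^{0,0} & \mathbb V_0^*\otimes\mathbb R(2) & 2m\\ \mathbb G_{-1}^{0,0} & \mathbb R(1) & 1\\ \mathbb G_{-1}^{1,0} & \mathbb R(1) & 1\\ \mathbb G_{-1}^{1,1} & [\![\bigwedge^{(2,0)}\mathbb V_0^*]\!]\otimes\mathbb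 R(1) & m(m-1)\\ \mathbb G_{-1}^{1,2} & [\bigwedge^{(1,1)}_\circ\mathbb V_0^*]\otimes\mathbb R(1) & (m+1)(m-1)\\ \mathbb G_{-1}^{2,0} & [\bigwedge^{(1,1)}_\circ\mathbb V_0^*]\otimes\mathbb R(1) & (m+1)(m-1)\\ \mathbb G_{-1}^{2,1} & [\![\bigodot^{(2,0)}\mathbb V_0^*]\!]\otimes\mathbb R(1) & m(m+1)\\ \mathbb G_{-1}^{3,0} & [\![\bigwedge^{(2,0)}\mathbb V_0^*]\!]\otimes\mathbb R(1) & m(m-1)\\ \mathbb G_{0}^{0,0} & \mathbb V_0^* & 2m\\ \mathbb G_{0}^{1,0} & [\![\bigwedge^{(1,0)}\mathbb V_0^*]\!] & 2m\\ \mathbb G_{0}^{1,1} & [\![\bigwedge^{(3,0)}\mathbb V_0^*]\!] & \tfrac13m(m-1)(m-2)\\ \mathbb G_{0}^{1,2} & [\![Y(\mathbb V_0^*)]\!] & \tfrac23m(m+1)(m-1)\\ \mathbb G_{0}^{1,3} & [\![\bigwedge^{(1,2)}_\circ\mathbb V_0^*]\!] & m(m+1)(m-2)\\ \mathbb G_{1}^{0,0}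 & [\![\bigwedge^{(2,0)}\mathbb V_0^*]\!]\otimes\mathbb R(-1) & m(m-1) \end{array}$$ For $m>2$ all the $\mathbb G_i^{j,k}$ are irreducible $Q_0$-modules and all the $\mathrm{gr}_i^{j,k}(\mathbb G)$ are irreducible $Q$-modules. For $m=2$ the modules $\mathrm{gr}_0^{1,1}(\mathbb G)$ and $\mathrm{gr}_0^{1,3}(\mathbb G)$ do not occur (they are zero), and all the others are irreducible. Here $\bigwedge^{(p,q)}\mathbb V_0^*=\bigwedge^p(\mathbb V_0^{(1,0)})^*\otimes\bigwedge^q(\mathbb V_0^{(0,1)})^*$, similarly $\bigodot^{(p,q)}$ with symmetric powers; $\circ$ denotes the subspace of tracefree elements with respect to the Hermitian form; $Y(\mathbb V_0^*)$ is the kernel of the skew-symmetrisation $\bigwedge^{(1,0)}\otimes\bigwedge^{(2,0)}\to\bigwedge^{(3,0)}$ (Young diagram with rows of lengths $2,1$); $[\![E]\!]$ is the real module with $[\![E]\!]\otimes\mathbb C=E\oplus\overline E$, i.e. $E$ regarded as a real module; and $[\bigwedge^{(1,1)}_\circ\mathbb V_0^*]$ is the real module of real tracefree $(1,1)$-forms.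 -/

import Mathlib

open scoped TensorProduct

noncomputable section

namespace Robinson

/-! ### Complexification -/

/-- Complex conjugation on the complexification `ℂ ⊗ W` of a real vector space `W`. -/
def conjC (W : Type*) [AddCommGroup W] [Module ℝ W] : (ℂ ⊗[ℝ] W) →ₗ[ℝ] (ℂ ⊗[ℝ] W) :=
  LinearMap.rTensor W Complex.conjAe.toLinearMap

section Complexification

variable {W W' : Type*} [AddCommGroup W] [Module ℝ W] [AddCommGroup W'] [Module ℝ W']

@[simp]
theorem conjC_tmul (z : ℂ) (w : W) :
    conjC W (z ⊗ₜ[ℝ] w) = (starRingEnd ℂ z) ⊗ₜ[ℝ] w := rfl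

@[simp]
theorem conjC_smul (c : ℂ) (x : ℂ ⊗[ℝ] W) :
    conjC W (c • x) = (starRingEnd ℂ c) • conjC W x := by
  induction x using TensorProduct.induction_on with
  | zero => simp
  | tmul z w => simp [TensorProduct.smul_tmul']
  | add x y hx hy => simp [smul_add, hx, hy]

theorem conjC_baseChange (f : W →ₗ[ℝ] W') (x : ℂ ⊗[ℝ] W) :
    conjC W' (f.baseChange ℂ x) = f.baseChange ℂ (conjC W x) := by
  induction x using TensorProduct.induction_on with
  | zero => simp
  | tmul z w => simp
  | add x y hx hy => simp [hx, hy]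

/-- The complex conjugate `{v | v̄ ∈ A}` of a complex subspace `A` of `ℂ ⊗ W`. -/
def conjSub (A : Submodule ℂ (ℂ ⊗[ℝ] W)) : Submodule ℂ (ℂ ⊗[ℝ] W) where
  carrier := {v | conjC W v ∈ A}
  add_mem' hx hy := by
    simp only [Set.mem_ofPred_eq, map_add] at *
    exact A.add_mem hx hy
  zero_mem' := by simp
  smul_mem' c x hx := by
    simp only [Set.mem_ofPred_eq, conjC_smul] at *
    exact A.smul_mem _ hx

@[simp]
theorem mem_conjSub {A : Submodule ℂ (ℂ ⊗[ℝ] W)} {v : ℂ ⊗[ℝ] W} :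
    v ∈ conjSub A ↔ conjC W v ∈ A := Iff.rfl

end Complexification

/-! ### Minkowski space and Robinson structures -/

/-- A Minkowski metric: a symmetric bilinear form of signature `(2m+1, 1)` on a real vector space
of dimension `2m+2` (in particular it is non-degenerate). -/
structure MinkowskiMetric (m : ℕ) (V : Type*) [AddCommGroup V] [Module ℝ V] where
  g : LinearMap.BilinForm ℝ V
  symm : ∀ x y, g x y = g y x
  finrank_eq : Module.finrank ℝ V = 2 * m + 2
  sigPos_eq : sigPos (LinearMap.BilinMap.toQuadraticMap g) = 2 * m + 1
  sigNeg_eq : sigNeg (LinearMap.BilinMap.toQuadraticMap g) = 1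

end Robinson

/-- A Robinson structure on Minkowski space: a maximal totally null subspace `N = N^⊥` of the
complexification, of real index one, i.e. `dim_ℂ (N ∩ N̄) = 1`. -/
structure RobinsonStructure {m : ℕ} {V : Type*} [AddCommGroup V] [Module ℝ V]
    (M : Robinson.MinkowskiMetric m V) where
  N : Submodule ℂ (ℂ ⊗[ℝ] V)
  orthogonal_eq : (M.g.baseChange ℂ).orthogonal N = N
  real_index : Module.finrank ℂ ↥(N ⊓ Robinson.conjSub N) = 1

namespace RobinsonStructure

open Robinson

variable {m : ℕ} {V : Type*} [AddCommGroup V] [Module ℝ V] {M : MinkowskiMetric m V}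
  (R : RobinsonStructure M)

/-- The real null line `K = N ∩ V`. -/
def K : Submodule ℝ V where
  carrier := {v | (1 : ℂ) ⊗ₜ[ℝ] v ∈ R.N}
  add_mem' hx hy := by
    simp only [Set.mem_ofPred_eq, TensorProduct.tmul_add] at *
    exact R.N.add_mem hx hy
  zero_mem' := by simp
  smul_mem' c x hx := by
    simp only [Set.mem_ofPred_eq] at *
    rw [TensorProduct.tmul_smul]
    exact R.N.smul_of_tower_mem c hx

theorem mem_K {v : V} : v ∈ R.K ↔ (1 : ℂ) ⊗ₜ[ℝ] v ∈ R.N := Iff.rfl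

/-- The orthogonal complement `K^⊥`. -/
def Kperp : Submodule ℝ V := M.g.orthogonal R.K

theorem mem_Kperp {v : V} : v ∈ R.Kperp ↔ ∀ k ∈ R.K, M.g k v = 0 := Iff.rfl

/-! ### The stabiliser `Q` -/

/-- The stabiliser `Q` of the Robinson structure: the linear isometries of determinant one which
map `N` onto itself and preserve the orientation of the line `K`. (Such an isometry preserves the
time-orientation because it fixes a null ray, so `Q` lies in the identity component of the
Lorentz group.) -/
def Q : Subgroup (LinearMap.GeneralLinearGroup ℝ V) where
  carrier := {A | (∀ x y, M.g (A.1 x) (A.1 y) = M.g x y) ∧ LinearMap.det A.1 = 1 ∧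
    (∀ z, A.1.baseChange ℂ z ∈ R.N ↔ z ∈ R.N) ∧ ∃ c : ℝ, 0 < c ∧ ∀ k ∈ R.K, A.1 k = c • k}
  mul_mem' := by
    rintro A B ⟨hA, dA, nA, c, hc, kA⟩ ⟨hB, dB, nB, d, hd, kB⟩
    refine ⟨fun x y => ?_, ?_, fun z => ?_, c * d, mul_pos hc hd, fun k hk => ?_⟩
    · simp [hA, hB]
    · simp [dA, dB]
    · simp [LinearMap.baseChange_mul, nA, nB]
    · simp [kB k hk, kA k hk, smul_smul, mul_comm]
  one_mem' := ⟨by simp, by simp, by simp, 1, one_pos, by simp⟩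
  inv_mem' := by
    rintro A ⟨hA, dA, nA, c, hc, kA⟩
    have h1 : ∀ x, A.1 (A⁻¹.1 x) = x := fun x => by
      rw [← Module.End.mul_apply]; simp
    have h2 : A.1 * A⁻¹.1 = 1 := by simp
    have h3 : ∀ z, A.1.baseChange ℂ (A⁻¹.1.baseChange ℂ z) = z := fun z => by
      rw [← Module.End.mul_apply, ← LinearMap.baseChange_mul, h2]; simp
    refine ⟨fun x y => ?_, ?_, fun z => ?_, c⁻¹, inv_pos.mpr hc, fun k hk => ?_⟩
    · rw [← hA, h1, h1]
    · have := congrArg LinearMap.det h2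
      rw [map_mul, dA, one_mul, map_one] at this
      exact this
    · rw [← nA, h3]
    · have h4 : A⁻¹.1 (A.1 k) = k := by rw [← Module.End.mul_apply]; simp
      rw [kA k hk, map_smul] at h4
      rw [← h4, smul_smul, inv_mul_cancel₀ hc.ne', one_smul, h4]

/-- The standard representation of `Q` on `V`. -/
def repV : Representation ℝ R.Q V :=
  (Units.coeHom (Module.End ℝ V)).comp R.Q.subtype

theorem repV_apply (q : R.Q) (v : V) : R.repV q v = q.1.1 v := rfl

theorem repV_isometry (q : R.Q) (x y : V) : M.g (R.repV q x) (R.repV q y) = M.g x y :=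
  q.2.1 x y

theorem repV_mem_N (q : R.Q) (z : ℂ ⊗[ℝ] V) : (R.repV q).baseChange ℂ z ∈ R.N ↔ z ∈ R.N :=
  q.2.2.2.1 z

theorem repV_K (q : R.Q) : R.K ≤ R.K.comap (R.repV q) := by
  obtain ⟨c, -, h⟩ := q.2.2.2.2
  intro k hk
  rw [Submodule.mem_comap, repV_apply, h k hk]
  exact R.K.smul_mem c hk

theorem repV_Kperp (q : R.Q) : R.Kperp ≤ R.Kperp.comap (R.repV q) := by
  intro x hx k hk
  have h := hx _ (R.repV_K q⁻¹ hk)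
  have hh : M.g (R.repV q⁻¹ k) x = 0 := h
  rw [← R.repV_isometry q, Representation.self_inv_apply] at hh
  exact hh

/-! ### The screen space `H = K^⊥ / K` and the group `Q₀ = ℝ_{>0} × U(m)` -/

/-- The screen space `H = K^⊥ / K`. -/
abbrev H : Type _ := R.Kperp ⧸ R.K.submoduleOf R.Kperp

/-- The positive-definite bilinear form `h` induced by `g` on the screen space. -/
def h : LinearMap.BilinForm ℝ R.H :=
  Submodule.liftQ _
    (LinearMap.flip (Submodule.liftQ _
      (LinearMap.flip (LinearMap.domRestrict₁₂ M.g R.Kperp R.Kperp)) (by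
        intro k hk
        ext x
        exact (M.symm _ _).trans (x.2 _ hk))))
    (by
      intro k hk
      ext x
      exact x.2 _ hk)

theorem h_mk (x y : R.Kperp) :
    R.h (Submodule.Quotient.mk x) (Submodule.Quotient.mk y) = M.g x y := rfl

/-- The subspace `H^{(0,1)} = N / ᶜK` of the complexified screen space. -/
def H01 : Submodule ℂ (ℂ ⊗[ℝ] R.H) :=
  (R.N.comap (R.Kperp.subtype.baseChange ℂ)).map
    ((R.K.submoduleOf R.Kperp).mkQ.baseChange ℂ)

/-- The subspace `H^{(1,0)} = N̄ / ᶜK` of the complexified screen space. -/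
def H10 : Submodule ℂ (ℂ ⊗[ℝ] R.H) := conjSub R.H01

/-- The unitary group `U(m)` of the Hermitian vector space `H`: the isometries of `(H, h)` whose
complexification preserves `H^{(0,1)}`, i.e. which commute with the complex structure. -/
def U : Subgroup (LinearMap.GeneralLinearGroup ℝ R.H) where
  carrier := {A | (∀ x y, R.h (A.1 x) (A.1 y) = R.h x y) ∧
    ∀ z, A.1.baseChange ℂ z ∈ R.H01 ↔ z ∈ R.H01}
  mul_mem' := by
    rintro A B ⟨hA, nA⟩ ⟨hB, nB⟩
    exact ⟨fun x y => by simp [hA, hB], fun z => by simp [LinearMap.baseChange_mul, nA, nB]⟩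
  one_mem' := ⟨by simp, by simp⟩
  inv_mem' := by
    rintro A ⟨hA, nA⟩
    have h2 : A.1 * A⁻¹.1 = 1 := by simp
    have h1 : ∀ x, A.1 (A⁻¹.1 x) = x := fun x => by
      rw [← Module.End.mul_apply, h2]; simp
    have h3 : ∀ z, A.1.baseChange ℂ (A⁻¹.1.baseChange ℂ z) = z := fun z => by
      rw [← Module.End.mul_apply, ← LinearMap.baseChange_mul, h2]; simp
    exact ⟨fun x y => by rw [← hA, h1, h1], fun z => by rw [← nA, h3]⟩

/-- The group `Q₀ = ℝ_{>0} × U(m)`. -/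
abbrev Q₀ : Type _ := {c : ℝ // 0 < c} × R.U

/-- The representation of `Q` on the line `K`. -/
def repK : Representation ℝ R.Q R.K := R.repV.subrepresentation R.K R.repV_K

theorem det_repK_pos (q : R.Q) : 0 < LinearMap.det (R.repK q) := by
  obtain ⟨c, hc, h⟩ := q.2.2.2.2
  have : R.repK q = c • (1 : Module.End ℝ R.K) := by
    ext k
    exact h k k.2
  rw [this, LinearMap.det_smul, map_one, mul_one]
  positivity

/-- The homomorphism `Q → ℝ_{>0}` such that `q` acts on the line `K` as multiplication by the
inverse of the image of `q`. -/
def scale : R.Q →* {c : ℝ // 0 < c} where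
  toFun q := ⟨LinearMap.det (R.repK q), R.det_repK_pos q⟩⁻¹
  map_one' := by
    rw [inv_eq_one]
    exact Subtype.ext (by simp)
  map_mul' p q := by
    rw [← mul_inv]
    congr 1
    exact Subtype.ext (by simp)

/-- The representation of `Q` on the screen space. -/
def repH : Representation ℝ R.Q R.H :=
  (R.repV.subrepresentation R.Kperp R.repV_Kperp).quotient (R.K.submoduleOf R.Kperp)
    (fun q _ hx => R.repV_K q hx)

theorem repH_H01 (q : R.Q) {z : ℂ ⊗[ℝ] R.H} (hz : z ∈ R.H01) :
    (R.repH q).baseChange ℂ z ∈ R.H01 := by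
  obtain ⟨y, hy, rfl⟩ := hz
  refine ⟨(R.repV.subrepresentation R.Kperp R.repV_Kperp q).baseChange ℂ y, ?_, ?_⟩
  · have := (R.repV_mem_N q _).mpr hy
    rw [← LinearMap.comp_apply, ← LinearMap.baseChange_comp] at this
    change (R.Kperp.subtype.baseChange ℂ) _ ∈ R.N
    rw [← LinearMap.comp_apply, ← LinearMap.baseChange_comp]
    exact this
  · rw [← LinearMap.comp_apply, ← LinearMap.comp_apply, ← LinearMap.baseChange_comp,
      ← LinearMap.baseChange_comp]
    rfl

/-- The homomorphism `Q → U(m)` given by the action of `Q` on the screen space. -/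
def toU : R.Q →* R.U :=
  R.repH.asGroupHom.codRestrict R.U (by
    intro q
    refine ⟨?_, fun z => ⟨fun hz => ?_, fun hz => R.repH_H01 q hz⟩⟩
    · intro x y
      obtain ⟨x, rfl⟩ := Submodule.Quotient.mk_surjective _ x
      obtain ⟨y, rfl⟩ := Submodule.Quotient.mk_surjective _ y
      exact R.repV_isometry q x y
    · have := R.repH_H01 q⁻¹ hz
      rw [Representation.asGroupHom_apply, ← Module.End.mul_apply, ← LinearMap.baseChange_mul,
        ← map_mul, inv_mul_cancel, map_one] at this
      simpa using this)

/-- The projection of `Q` onto its reductive part `Q₀`. -/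
def toQ₀ : R.Q →* R.Q₀ := R.scale.prod R.toU

/-! ### Tensors on the complexified screen space -/

/-- The `k`-fold tensor power of `ᶜH^*`. -/
abbrev Tensors (k : ℕ) : Type _ := MultilinearMap ℂ (fun _ : Fin k => ℂ ⊗[ℝ] R.H) ℂ

/-- The real representation of `Q₀` on the `k`-fold tensor power of `ᶜH^*`; the factor `ℝ_{>0}`
acts trivially. -/
def tensorRep (k : ℕ) : Representation ℝ R.Q₀ (R.Tensors k) where
  toFun q :=
    { toFun T := T.compLinearMap fun _ => (q.2⁻¹).1.1.baseChange ℂ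
      map_add' _ _ := rfl
      map_smul' _ _ := rfl }
  map_one' := by
    ext T x
    simp
  map_mul' p q := by
    ext T x
    simp [LinearMap.baseChange_mul]

theorem tensorRep_apply (k : ℕ) (q : R.Q₀) (T : R.Tensors k) (x : Fin k → ℂ ⊗[ℝ] R.H) :
    R.tensorRep k q T x = T fun i => (q.2⁻¹).1.1.baseChange ℂ (x i) := rfl

theorem inv_mem_H01 (A : R.U) {z : ℂ ⊗[ℝ] R.H} (hz : z ∈ R.H01) :
    (A⁻¹).1.1.baseChange ℂ z ∈ R.H01 := ((A⁻¹).2.2 z).mpr hz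

/-- Tensors of type `(1,0)` in the slot `a`: those which vanish on `H^{(0,1)}` in that slot. -/
def type10 (k : ℕ) (a : Fin k) : Subrepresentation (R.tensorRep k) where
  toSubmodule :=
    { carrier := {T | ∀ x, x a ∈ R.H01 → T x = 0}
      add_mem' hS hT x hx := by simp [hS x hx, hT x hx]
      zero_mem' := by simp
      smul_mem' c T hT x hx := by simp [hT x hx] }
  apply_mem_toSubmodule q T hT x hx := hT _ (R.inv_mem_H01 q.2 hx)

/-- Tensors of type `(0,1)` in the slot `a`: those which vanish on `H^{(1,0)}` in that slot. -/
def type01 (k : ℕ) (a : Fin k) : Subrepresentation (R.tensorRep k) where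
  toSubmodule :=
    { carrier := {T | ∀ x, x a ∈ R.H10 → T x = 0}
      add_mem' hS hT x hx := by simp [hS x hx, hT x hx]
      zero_mem' := by simp
      smul_mem' c T hT x hx := by simp [hT x hx] }
  apply_mem_toSubmodule q T hT x hx := hT _ (by
    change conjC _ _ ∈ R.H01
    rw [conjC_baseChange]
    exact R.inv_mem_H01 q.2 hx)

/-- Tensors which change by the factor `s` when the slots `a` and `b` are exchanged: symmetric in
these slots for `s = 1`, skew-symmetric for `s = -1`. -/
def swapSign (s : ℝ) (k : ℕ) (a b : Fin k) : Subrepresentation (R.tensorRep k) where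
  toSubmodule :=
    { carrier := {T | ∀ x, T (fun i => x (Equiv.swap a b i)) = s • T x}
      add_mem' hS hT x := by simp [hS x, hT x]
      zero_mem' := by simp
      smul_mem' c T hT x := by simp [hT x, mul_left_comm] }
  apply_mem_toSubmodule q T hT x := hT fun i => (q.2⁻¹).1.1.baseChange ℂ (x i)

/-- Tensors whose total skew-symmetrisation vanishes. -/
def noSkewPart (k : ℕ) : Subrepresentation (R.tensorRep k) where
  toSubmodule :=
    { carrier := {T | ∀ x : Fin k → ℂ ⊗[ℝ] R.H, ∑ σ : Equiv.Perm (Fin k),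
        ((Equiv.Perm.sign σ : ℤ) : ℂ) * T (fun i => x (σ i)) = 0}
      add_mem' hS hT x := by simp [mul_add, Finset.sum_add_distrib, hS x, hT x]
      zero_mem' := by simp
      smul_mem' c T hT x := by
        have := hT x
        simp only [_root_.smul_apply, Complex.real_smul, mul_left_comm _ (c : ℂ)]
        rw [← Finset.mul_sum, this, mul_zero] }
  apply_mem_toSubmodule q T hT x := by
    have := hT fun i => (q.2⁻¹).1.1.baseChange ℂ (x i)
    exact this

/-- Tensors whose contraction of the slots `a` and `b` with `h⁻¹` vanishes; the contraction is
computed in an arbitrary `h`-orthonormal basis of the `2m`-dimensional space `H`. -/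
def traceFree (k : ℕ) (a b : Fin k) : Subrepresentation (R.tensorRep k) where
  toSubmodule :=
    { carrier := {T | ∀ e : Fin (2 * m) → R.H, (∀ i j, R.h (e i) (e j) = if i = j then 1 else 0) →
        ∀ x, ∑ i, T (Function.update (Function.update x a (1 ⊗ₜ e i)) b (1 ⊗ₜ e i)) = 0}
      add_mem' hS hT e he x := by simp [Finset.sum_add_distrib, hS e he x, hT e he x]
      zero_mem' := by simp
      smul_mem' c T hT e he x := by
        have := hT e he x
        simp only [_root_.smul_apply]
        rw [← Finset.smul_sum, this, smul_zero] }
  apply_mem_toSubmodule q T hT e he x := by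
    have := hT (fun i => (q.2⁻¹).1.1 (e i)) (fun i j => by rw [(q.2⁻¹).2.1, he])
      (fun i => (q.2⁻¹).1.1.baseChange ℂ (x i))
    refine Eq.trans (Finset.sum_congr rfl fun i _ => ?_) this
    rw [tensorRep_apply]
    congr 1
    funext j
    by_cases hb : j = b
    · subst hb; simp
    · by_cases ha : j = a
      · subst ha; simp [hb]
      · simp [ha, hb]

/-- Real tensors: `T(x̄₁, …, x̄ₖ)` is the complex conjugate of `T(x₁, …, xₖ)`. -/
def realTensors (k : ℕ) : Subrepresentation (R.tensorRep k) where
  toSubmodule :=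
    { carrier := {T | ∀ x, T (fun i => conjC _ (x i)) = starRingEnd ℂ (T x)}
      add_mem' hS hT x := by simp [hS x, hT x]
      zero_mem' := by simp
      smul_mem' c T hT x := by simp [hT x] }
  apply_mem_toSubmodule q T hT x := by
    have := hT fun i => (q.2⁻¹).1.1.baseChange ℂ (x i)
    simp only [conjC_baseChange] at this
    exact this

/-- The tensors `T` of rank two with `T(x, y) = - conj T(ȳ, x̄)`. When `α ⊗ β̄` of type
`(1,0) ⊗ (0,1)` is read as the `(1,1)`-form `α ∧ β̄`, these are the real `(1,1)`-forms. -/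
def real11 : Subrepresentation (R.tensorRep 2) where
  toSubmodule :=
    { carrier := {T | ∀ x y, T ![x, y] = - starRingEnd ℂ (T ![conjC _ y, conjC _ x])}
      add_mem' {S T} hS hT x y := by
        rw [_root_.add_apply, _root_.add_apply, hS x y, hT x y, map_add]; ring
      zero_mem' := by simp
      smul_mem' c T hT x y := by
        rw [_root_.smul_apply, _root_.smul_apply, hT x y]; simp }
  apply_mem_toSubmodule q T hT x y := by
    have := hT ((q.2⁻¹).1.1.baseChange ℂ x) ((q.2⁻¹).1.1.baseChange ℂ y)
    simp only [conjC_baseChange] at this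
    rw [tensorRep_apply, tensorRep_apply]
    have key : ∀ u v : ℂ ⊗[ℝ] R.H, (fun i => (q.2⁻¹).1.1.baseChange ℂ (![u, v] i)) =
        ![(q.2⁻¹).1.1.baseChange ℂ u, (q.2⁻¹).1.1.baseChange ℂ v] := by
      intro u v
      funext i
      fin_cases i <;> rfl
    rw [key, key]
    exact this

/-! ### The table of irreducible modules

For a complex module `E` of tensors which is not of type `(p,p)`, the real module `⟦E⟧` with
`⟦E⟧ ⊗ ℂ = E ⊕ Ē` is `E` regarded as a real module. -/

/-- `ℝ`, as the real tensors of rank zero. -/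
def formsR : Subrepresentation (R.tensorRep 0) := R.realTensors 0

/-- `V₀^*`: the real `1`-forms. -/
def formsV : Subrepresentation (R.tensorRep 1) := R.realTensors 1

/-- `⟦⋀^{(1,0)} V₀^*⟧`. -/
def forms10 : Subrepresentation (R.tensorRep 1) := R.type10 1 0

/-- `⟦⋀^{(2,0)} V₀^*⟧`. -/
def forms20 : Subrepresentation (R.tensorRep 2) :=
  R.type10 2 0 ⊓ R.type10 2 1 ⊓ R.swapSign (-1) 2 0 1

/-- `⟦⨀^{(2,0)} V₀^*⟧`. -/
def sym20 : Subrepresentation (R.tensorRep 2) :=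
  R.type10 2 0 ⊓ R.type10 2 1 ⊓ R.swapSign 1 2 0 1

/-- `[⋀^{(1,1)}_∘ V₀^*]`: the real tracefree `(1,1)`-forms. -/
def forms11 : Subrepresentation (R.tensorRep 2) :=
  R.type10 2 0 ⊓ R.type01 2 1 ⊓ R.real11 ⊓ R.traceFree 2 0 1

/-- `⟦⋀^{(3,0)} V₀^*⟧`. -/
def forms30 : Subrepresentation (R.tensorRep 3) :=
  R.type10 3 0 ⊓ R.type10 3 1 ⊓ R.type10 3 2 ⊓ R.swapSign (-1) 3 0 1 ⊓ R.swapSign (-1) 3 1 2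

/-- The kernel of the projection `⋀^{(1,0)} ⊗ ⋀^{(2,0)} → ⋀^{(3,0)}`, whose Young diagram has rows
of lengths `2` and `1`. -/
def young21 : Subrepresentation (R.tensorRep 3) :=
  R.type10 3 0 ⊓ R.type10 3 1 ⊓ R.type10 3 2 ⊓ R.swapSign (-1) 3 1 2 ⊓ R.noSkewPart 3

/-- `⟦⋀^{(1,2)}_∘ V₀^*⟧`: the tracefree elements of `⋀^{(1,0)} ⊗ ⋀^{(0,2)}`. -/
def forms12 : Subrepresentation (R.tensorRep 3) :=
  R.type10 3 0 ⊓ R.type01 3 1 ⊓ R.type01 3 2 ⊓ R.swapSign (-1) 3 1 2 ⊓ R.traceFree 3 0 1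

end RobinsonStructure

namespace Robinson

/-- The labels of the irreducible modules `G_i^{j,k}`: the degree `i` in words, then the two digits
`j` and `k`; for example `neg1_12` stands for `G_{-1}^{1,2}`. -/
inductive Label : Type
  | neg2_00
  | neg1_00
  | neg1_10
  | neg1_11
  | neg1_12
  | neg1_20
  | neg1_21
  | neg1_30
  | zero_00
  | zero_10
  | zero_11
  | zero_12
  | zero_13
  | one_00

namespace Label

/-- The degree `i` of `G_i^{j,k}`. -/
def degree : Label → ℤ
  | neg2_00 => -2
  | neg1_00 => -1
  | neg1_10 => -1
  | neg1_11 => -1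
  | neg1_12 => -1
  | neg1_20 => -1
  | neg1_21 => -1
  | neg1_30 => -1
  | zero_00 => 0
  | zero_10 => 0
  | zero_11 => 0
  | zero_12 => 0
  | zero_13 => 0
  | one_00 => 1

/-- The tensor rank of the module in the table. -/
def rank : Label → ℕ
  | neg2_00 => 1
  | neg1_00 => 0
  | neg1_10 => 0
  | neg1_11 => 2
  | neg1_12 => 2
  | neg1_20 => 2
  | neg1_21 => 2
  | neg1_30 => 2
  | zero_00 => 1
  | zero_10 => 1
  | zero_11 => 3
  | zero_12 => 3
  | zero_13 => 3
  | one_00 => 2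

/-- The weight `w` of the factor `ℝ(w)` of the module in the table. -/
def weight : Label → ℤ
  | neg2_00 => 2
  | neg1_00 => 1
  | neg1_10 => 1
  | neg1_11 => 1
  | neg1_12 => 1
  | neg1_20 => 1
  | neg1_21 => 1
  | neg1_30 => 1
  | zero_00 => 0
  | zero_10 => 0
  | zero_11 => 0
  | zero_12 => 0
  | zero_13 => 0
  | one_00 => -1

/-- The dimension given in the table. -/
def dim (m : ℚ) : Label → ℚ
  | neg2_00 => 2 * m
  | neg1_00 => 1
  | neg1_10 => 1
  | neg1_11 => m * (m - 1)
  | neg1_12 => (m + 1) * (m - 1)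
  | neg1_20 => (m + 1) * (m - 1)
  | neg1_21 => m * (m + 1)
  | neg1_30 => m * (m - 1)
  | zero_00 => 2 * m
  | zero_10 => 2 * m
  | zero_11 => 1 / 3 * m * (m - 1) * (m - 2)
  | zero_12 => 2 / 3 * m * (m + 1) * (m - 1)
  | zero_13 => m * (m + 1) * (m - 2)
  | one_00 => m * (m - 1)

/-- For `m = 2` the modules `G_0^{1,1}` and `G_0^{1,3}` do not occur; all others always do. -/
def Occurs (m : ℕ) (l : Label) : Prop := ¬ (m = 2 ∧ (l = zero_11 ∨ l = zero_13))

end Label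

end Robinson

namespace RobinsonStructure

open Robinson

variable {m : ℕ} {V : Type*} [AddCommGroup V] [Module ℝ V] {M : MinkowskiMetric m V}
  (R : RobinsonStructure M)

/-- The tensor factor of the module with label `l` in the table. -/
def tableForms : (l : Label) → Subrepresentation (R.tensorRep l.rank)
  | .neg2_00 => R.formsV
  | .neg1_00 => R.formsR
  | .neg1_10 => R.formsR
  | .neg1_11 => R.forms20
  | .neg1_12 => R.forms11
  | .neg1_20 => R.forms11
  | .neg1_21 => R.sym20
  | .neg1_30 => R.forms20
  | .zero_00 => R.formsV
  | .zero_10 => R.forms10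
  | .zero_11 => R.forms30
  | .zero_12 => R.young21
  | .zero_13 => R.forms12
  | .one_00 => R.forms20

/-- The one-dimensional representation `ℝ(w)`: `(c, ψ) ∈ ℝ_{>0} × U(m)` acts as `c ^ w`. -/
def weightRep (w : ℤ) : Representation ℝ R.Q₀ ℝ where
  toFun q := ((q.1 : ℝ) ^ w) • (1 : Module.End ℝ ℝ)
  map_one' := by simp
  map_mul' p q := by
    ext
    simp [mul_zpow, mul_comm]

/-- The underlying space of the module with label `l` in the table. -/
def TableModule (l : Label) : Type _ := (R.tableForms l).toSubmodule ⊗[ℝ] ℝ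

instance (l : Label) : AddCommGroup (R.TableModule l) :=
  inferInstanceAs (AddCommGroup ((R.tableForms l).toSubmodule ⊗[ℝ] ℝ))

instance (l : Label) : Module ℝ (R.TableModule l) :=
  inferInstanceAs (Module ℝ ((R.tableForms l).toSubmodule ⊗[ℝ] ℝ))

/-- The `Q₀`-module with label `l` in the table: its tensor factor times `ℝ(w)`. -/
def tableRep (l : Label) : Representation ℝ R.Q₀ (R.TableModule l) :=
  (R.tableForms l).toRepresentation.tprod (R.weightRep l.weight)

/-! ### The module of algebraic intrinsic torsions -/

variable (M) in
/-- The Lie algebra `𝔤 = 𝔰𝔬(V, g)`. -/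
def so : Submodule ℝ (Module.End ℝ V) := M.g.skewAdjointSubmodule

variable (M) in
theorem mem_so {X : Module.End ℝ V} : X ∈ so M ↔ ∀ x y, M.g (X x) y = - M.g x (X y) := by
  simp only [so, LinearMap.mem_skewAdjointSubmodule, LinearMap.IsSkewAdjoint,
    LinearMap.IsAdjointPair]
  simp

/-- The Lie algebra `𝔮` of `Q`: the elements of `𝔤` which preserve `N`. -/
def q : Submodule ℝ (so M) where
  carrier := {X | ∀ z ∈ R.N, X.1.baseChange ℂ z ∈ R.N}
  add_mem' hX hY z hz := by
    simpa [LinearMap.baseChange_add] using R.N.add_mem (hX z hz) (hY z hz)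
  zero_mem' z hz := by simp
  smul_mem' c X hX z hz := by
    simpa [LinearMap.baseChange_smul] using R.N.smul_of_tower_mem c (hX z hz)

theorem adjoint_so (p : R.Q) : so M ≤ (so M).comap (R.repV.linHom R.repV p) := by
  intro X hX
  rw [Submodule.mem_comap, mem_so]
  rw [mem_so] at hX
  intro x y
  rw [Representation.linHom_apply]
  simp only [LinearMap.comp_apply]
  rw [← R.repV_isometry p⁻¹, Representation.inv_self_apply, hX, ← R.repV_isometry p,
    Representation.self_inv_apply]

/-- The adjoint action of `Q` on `𝔤`. -/
def repSo : Representation ℝ R.Q (so M) :=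
  (R.repV.linHom R.repV).subrepresentation (so M) R.adjoint_so

theorem adjoint_q (p : R.Q) : R.q ≤ R.q.comap (R.repSo p) := by
  intro X hX z hz
  have h1 := (R.repV_mem_N p⁻¹ z).mpr hz
  have h2 := (R.repV_mem_N p _).mpr (hX _ h1)
  rw [← LinearMap.comp_apply, ← LinearMap.comp_apply, ← LinearMap.baseChange_comp,
    ← LinearMap.baseChange_comp] at h2
  exact h2

/-- The space `𝔾 = V^* ⊗ (𝔤/𝔮)` of algebraic intrinsic torsions. -/
def Torsion : Type _ := Module.Dual ℝ V ⊗[ℝ] (so M ⧸ R.q)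

instance : AddCommGroup R.Torsion :=
  inferInstanceAs (AddCommGroup (Module.Dual ℝ V ⊗[ℝ] (so M ⧸ R.q)))

instance : Module ℝ R.Torsion :=
  inferInstanceAs (Module ℝ (Module.Dual ℝ V ⊗[ℝ] (so M ⧸ R.q)))

/-- The element `α ⊗ x` of `𝔾`. -/
def pureTensor (α : Module.Dual ℝ V) (x : so M ⧸ R.q) : R.Torsion := α ⊗ₜ[ℝ] x

/-- The representation of `Q` on `𝔾`. -/
def torsionRep : Representation ℝ R.Q R.Torsion :=
  R.repV.dual.tprod (R.repSo.quotient R.q R.adjoint_q)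

/-- The filtration `V = V^{-1} ⊃ V^0 = K^⊥ ⊃ V^1 = K ⊃ V^2 = 0`. -/
def filV (i : ℤ) : Submodule ℝ V :=
  if i ≤ -1 then ⊤ else if i = 0 then R.Kperp else if i = 1 then R.K else ⊥

/-- The dual filtration `(V^*)^i = Ann(V^{1-i})`, i.e. `V^* = (V^*)^{-1} ⊃ (V^*)^0 = Ann(K) ⊃
(V^*)^1 = Ann(K^⊥) ⊃ 0`. -/
def filDual (i : ℤ) : Submodule ℝ (Module.Dual ℝ V) := (R.filV (1 - i)).dualAnnihilator

/-- The filtration `𝔤^i = {X | X(V^j) ⊆ V^{j+i} for all j}` of `𝔤`. -/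
def filSo (i : ℤ) : Submodule ℝ (so M) where
  carrier := {X | ∀ j, ∀ v ∈ R.filV j, X.1 v ∈ R.filV (j + i)}
  add_mem' hX hY j v hv := by
    simpa using (R.filV (j + i)).add_mem (hX j v hv) (hY j v hv)
  zero_mem' j v hv := by simp
  smul_mem' c X hX j v hv := by
    simpa using (R.filV (j + i)).smul_mem c (hX j v hv)

/-- The induced filtration of `𝔤/𝔮`. -/
def filQuot (i : ℤ) : Submodule ℝ (so M ⧸ R.q) := (R.filSo i).map R.q.mkQ

/-- The tensor product filtration `𝔾^i = ∑_j (V^*)^j ⊗ (𝔤/𝔮)^{i-j}` of `𝔾`. -/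
def fil (i : ℤ) : Submodule ℝ R.Torsion :=
  ⨆ j : ℤ, Submodule.span ℝ
    {t | ∃ α ∈ R.filDual j, ∃ x ∈ R.filQuot (i - j), t = R.pureTensor α x}

/-- The graded piece `gr_i(𝔾) = 𝔾^i / 𝔾^{i+1}` as a vector space. -/
abbrev Gr (i : ℤ) : Type _ := R.fil i ⧸ (R.fil (i + 1)).submoduleOf (R.fil i)

/-- The representation of `Q` on `gr_i(𝔾)`, for a filtration by `Q`-submodules. -/
def grRep (hinv : ∀ i p, R.fil i ≤ (R.fil i).comap (R.torsionRep p)) (i : ℤ) :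
    Representation ℝ R.Q (R.Gr i) :=
  (R.torsionRep.subrepresentation (R.fil i) (hinv i)).quotient
    ((R.fil (i + 1)).submoduleOf (R.fil i)) (fun p _ hx => hinv (i + 1) p hx)

end RobinsonStructure

end

noncomputable section

namespace Robinson

/-! ### Complexified vector spaces -/

section Complexification

variable {W W' : Type*} [AddCommGroup W] [Module ℝ W] [AddCommGroup W'] [Module ℝ W']

/-! A null vector k spanning K, a null vector l with g(k,l) = 1 and the screen space H split V as ℝk
⊕ ℝl ⊕ H (`NullPair`). The group Q does not preserve this splitting, but all computations can be
done in it. Since N = N^⊥, an element X of 𝔤 lies in 𝔮 exactly when the skew form g(Xv, w) vanishes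
on N. Hence 𝔤/𝔮 embeds into the skew forms on N (`form_injective`), and an intrinsic torsion becomes
a trilinear form t(u, v, w) with u in ᶜV and v, w in N, skew in v and w (`ev`).

In these terms each step of the filtration is a set of vanishing conditions, and what remains on
gr_i is a list of leading components: t(k,k,·) in degree -2; t(k,·,·) and t(x,k,·) in degree -1;
t(l,k,·) and t(x,·,·) in degree 0; t(l,·,·) in degree 1. Here the dots stand for vectors of
H^{(0,1)} and x for a screen vector of either type. An element of Q changes screen vectors by
multiples of k, and l by multiples of k and screen vectors. These corrections only involve
components that already vanish on 𝔾^i, so the leading components are Q-equivariant through Q₀, and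
the weight is the number of k's minus the number of l's. Splitting them into traces and tracefree
parts, symmetric and skew parts, cyclic sums and their complements, real and imaginary parts gives
one equivariant map from gr_i to each module of the table, and these maps are jointly injective
(`mem_fil_add_one_iff`).

No preimages are constructed for surjectivity; it comes from counting. Explicit endomorphisms
(`endo`) give dim 𝔤/𝔮 ≥ 2m + m(m-1), and the dimensions in the table add up to (2m+2)(2m + m(m-1)).
So the inequalities between dim gr_i and the dimension of the degree i part of the table become
equalities after summation over i, hence each of them is one (`pi_grComp_bijective`).

For irreducibility, tensors are replaced by their arrays of components in a unitary frame.
Differentiating along one-parameter groups in U(m) shows that an invariant real subspace is stable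
under multiplication by i whenever the numbers of (1,0) and (0,1) slots differ
(`I_smul_mem_of_mact_mem`), and that an invariant complex subspace is stable under all elementary
matrices (`arrInvariant_of_mact_mem`). Then a weight argument applies (`arr_irreducible`): an
extremal weight space is one-dimensional and every nonzero submodule meets it, while a proper
submodule and its orthogonal complement cannot both do so. For real (1,1)-forms the numbers of slots
agree, so the argument is run on the complex module of tracefree (1,1)-forms and real forms are
recovered at the end (`irreducible_forms11`). Surjectivity of Q → Q₀ transfers irreducibility from
Q₀ to Q. -/

@[simp]
theorem conjC_conjC (x : ℂ ⊗[ℝ] W) : conjC W (conjC W x) = x := by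
  induction x using TensorProduct.induction_on with
  | zero => simp
  | tmul z w => simp
  | add x y hx hy => simp [hx, hy]

/-- The real part `ℂ ⊗ W → W`. -/
def reC (W : Type*) [AddCommGroup W] [Module ℝ W] : (ℂ ⊗[ℝ] W) →ₗ[ℝ] W :=
  (TensorProduct.lid ℝ W).toLinearMap ∘ₗ LinearMap.rTensor W Complex.reLm

@[simp]
theorem reC_tmul (z : ℂ) (w : W) : reC W (z ⊗ₜ[ℝ] w) = z.re • w := by
  simp [reC]

theorem one_tmul_reC (x : ℂ ⊗[ℝ] W) :
    (1 : ℂ) ⊗ₜ[ℝ] reC W x = (1 / 2 : ℂ) • (x + conjC W x) := by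
  induction x using TensorProduct.induction_on with
  | zero => simp
  | tmul z w =>
    rw [reC_tmul, conjC_tmul, ← TensorProduct.add_tmul, TensorProduct.smul_tmul',
      ← TensorProduct.smul_tmul]
    congr 1
    apply Complex.ext <;> simp
    ring
  | add x y hx hy => rw [map_add, TensorProduct.tmul_add, hx, hy, map_add, ← smul_add]; congr 1; abel

theorem one_tmul_reC_of_conjC_eq {x : ℂ ⊗[ℝ] W} (hx : conjC W x = x) :
    (1 : ℂ) ⊗ₜ[ℝ] reC W x = x := by
  rw [one_tmul_reC, hx, ← two_smul ℂ, smul_smul]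
  norm_num

theorem reC_add_I_smul_im (x : ℂ ⊗[ℝ] W) :
    (1 : ℂ) ⊗ₜ[ℝ] reC W x + Complex.I • ((1 : ℂ) ⊗ₜ[ℝ] reC W (-Complex.I • x)) = x := by
  rw [one_tmul_reC, one_tmul_reC, conjC_smul]
  simp only [smul_add, smul_smul]
  have e1 : Complex.I * ((1 / 2) * -Complex.I) = 1 / 2 := by
    linear_combination (-1 / 2) * Complex.I_mul_I
  have e2 : Complex.I * ((1 / 2) * (starRingEnd ℂ) (-Complex.I)) = -(1 / 2) := by
    rw [map_neg, Complex.conj_I]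
    linear_combination (1 / 2) * Complex.I_mul_I
  rw [e1, e2]
  module

theorem one_tmul_injective : Function.Injective fun w : W => (1 : ℂ) ⊗ₜ[ℝ] w := by
  intro a b h
  simpa using congrArg (reC W) h

/-- A complex linear map which commutes with complex conjugation comes from a real one. -/
def descend (f : (ℂ ⊗[ℝ] W) →ₗ[ℂ] (ℂ ⊗[ℝ] W')) : W →ₗ[ℝ] W' :=
  reC W' ∘ₗ f.restrictScalars ℝ ∘ₗ TensorProduct.mk ℝ ℂ W 1

theorem baseChange_descend {f : (ℂ ⊗[ℝ] W) →ₗ[ℂ] (ℂ ⊗[ℝ] W')}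
    (hf : ∀ x, f (conjC W x) = conjC W' (f x)) : (descend f).baseChange ℂ = f := by
  ext w
  simp only [descend, TensorProduct.AlgebraTensorModule.curry_apply, TensorProduct.curry_apply,
    LinearMap.coe_restrictScalars, LinearMap.baseChange_tmul,
    LinearMap.comp_apply, TensorProduct.mk_apply]
  apply one_tmul_reC_of_conjC_eq
  rw [← hf]
  simp

theorem baseChange_injective' {f f' : W →ₗ[ℝ] W'} (h : f.baseChange ℂ = f'.baseChange ℂ) :
    f = f' := by
  ext w
  have := LinearMap.congr_fun h (1 ⊗ₜ w)
  simpa using one_tmul_injective (by simpa using this)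

theorem ext_real {E : Type*} [AddCommGroup E] [Module ℂ E] {f f' : (ℂ ⊗[ℝ] W) →ₗ[ℂ] E}
    (h : ∀ w : W, f (1 ⊗ₜ w) = f' (1 ⊗ₜ w)) : f = f' := by
  refine LinearMap.ext fun x => ?_
  rw [← reC_add_I_smul_im x]
  simp only [map_add, map_smul, h]

theorem baseChange_form_conj (B : LinearMap.BilinForm ℝ W) (x y : ℂ ⊗[ℝ] W) :
    B.baseChange ℂ (conjC W x) (conjC W y) = starRingEnd ℂ (B.baseChange ℂ x y) := by
  induction x using TensorProduct.induction_on with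
  | zero => simp
  | add x y hx hy => simp [hx, hy]
  | tmul z w =>
    induction y using TensorProduct.induction_on with
    | zero => simp
    | add x y hx hy => rw [map_add, map_add, hx, hy, map_add, map_add]
    | tmul z' w' => simp [LinearMap.BilinForm.baseChange_tmul]

theorem baseChange_form_symm {B : LinearMap.BilinForm ℝ W} (hB : ∀ x y, B x y = B y x)
    (x y : ℂ ⊗[ℝ] W) : B.baseChange ℂ x y = B.baseChange ℂ y x := by
  induction x using TensorProduct.induction_on with
  | zero => simp
  | add x y hx hy => simp [hx, hy]
  | tmul z w =>
    induction y using TensorProduct.induction_on with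
    | zero => simp
    | add x y hx hy => rw [map_add, hx, hy, map_add]; simp
    | tmul z' w' => simp [LinearMap.BilinForm.baseChange_tmul, hB w w', mul_comm]

theorem baseChange_form_comp {B : LinearMap.BilinForm ℝ W} {B' : LinearMap.BilinForm ℝ W'}
    {f f' : W →ₗ[ℝ] W'} (h : ∀ x y, B' (f x) (f' y) = B x y) (x y : ℂ ⊗[ℝ] W) :
    B'.baseChange ℂ (f.baseChange ℂ x) (f'.baseChange ℂ y) = B.baseChange ℂ x y := by
  induction x using TensorProduct.induction_on with
  | zero => simp
  | add x y hx hy => simp [hx, hy]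
  | tmul z w =>
    induction y using TensorProduct.induction_on with
    | zero => simp
    | add x y hx hy => rw [map_add, map_add, hx, hy, map_add]
    | tmul z' w' => simp [LinearMap.BilinForm.baseChange_tmul, h]

theorem form_baseChange_skew {B : LinearMap.BilinForm ℝ W} {X : W →ₗ[ℝ] W}
    (h : ∀ x y, B (X x) y = - B x (X y)) (x y : ℂ ⊗[ℝ] W) :
    B.baseChange ℂ (X.baseChange ℂ x) y = - B.baseChange ℂ x (X.baseChange ℂ y) := by
  induction x using TensorProduct.induction_on with
  | zero => simp
  | add x y hx hy => simp [hx, hy]; ring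
  | tmul z w =>
    induction y using TensorProduct.induction_on with
    | zero => simp
    | add x y hx hy => rw [map_add, map_add, hx, hy, map_add]; ring
    | tmul z' w' => simp [LinearMap.BilinForm.baseChange_tmul, h]

end Complexification

/-! ### Tangent vectors of curves in subspaces -/

/-- A curve of the form `θ ↦ ∑ f_j(θ) v_j` which stays in a subspace has its derivatives in it. -/
theorem derivative_mem_of_curve_mem {E ι : Type*} [AddCommGroup E] [Module ℂ E] [Module ℝ E]
    [IsScalarTower ℝ ℂ E] (s : Finset ι) (W : Submodule ℝ E) (f : ι → ℝ → ℂ) (f' : ι → ℂ)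
    (v : ι → E) (hf : ∀ j ∈ s, HasDerivAt (f j) (f' j) 0)
    (hW : ∀ t, ∑ j ∈ s, f j t • v j ∈ W) : ∑ j ∈ s, f' j • v j ∈ W := by
  -- A vector outside W is separated from W by a real functional φ. Along the curve φ is identically
  -- zero, so its derivative, the value of φ on the tangent vector, is zero as well.
  by_contra hn
  obtain ⟨φ, h1, h2⟩ := Submodule.exists_le_ker_of_notMem hn
  apply h1
  have key : ∀ (c : ℂ) (w : E), φ (c • w) = c.re * φ w + c.im * φ (Complex.I • w) := by
    intro c w
    conv_lhs => rw [← Complex.re_add_im c]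
    rw [add_smul, mul_smul, map_add]
    congr 1
    · rw [← Complex.coe_algebraMap, algebraMap_smul, map_smul, smul_eq_mul]
    · rw [← Complex.coe_algebraMap, algebraMap_smul, map_smul, smul_eq_mul]
  have hd : HasDerivAt (fun t => ∑ j ∈ s, ((f j t).re * φ (v j) + (f j t).im * φ (Complex.I • v j)))
      (∑ j ∈ s, ((f' j).re * φ (v j) + (f' j).im * φ (Complex.I • v j))) 0 := by
    apply HasDerivAt.fun_sum
    intro j hj
    have hre : HasDerivAt (fun t => (f j t).re) (f' j).re 0 :=
      (Complex.reCLM.hasFDerivAt.comp_hasDerivAt (0 : ℝ) (hf j hj))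
    have him : HasDerivAt (fun t => (f j t).im) (f' j).im 0 :=
      (Complex.imCLM.hasFDerivAt.comp_hasDerivAt (0 : ℝ) (hf j hj))
    exact (hre.mul_const _).add (him.mul_const _)
  have h0 : (fun t => ∑ j ∈ s, ((f j t).re * φ (v j) + (f j t).im * φ (Complex.I • v j))) =
      fun _ => 0 := by
    funext t
    have := h2 (hW t)
    rw [LinearMap.mem_ker, map_sum, Finset.sum_congr rfl fun j _ => key (f j t) (v j)] at this
    exact this
  rw [h0] at hd
  rw [map_sum, Finset.sum_congr rfl fun j _ => key (f' j) (v j)]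
  exact hd.unique (hasDerivAt_const _ _)

/-! ### Representations -/

section Representations

variable {G X : Type*} [Group G] [AddCommGroup X] [Module ℝ X]

theorem isIrreducible_iff (ρ : Representation ℝ G X) :
    ρ.IsIrreducible ↔ Nontrivial X ∧
      ∀ W : Submodule ℝ X, (∀ g, ∀ x ∈ W, ρ g x ∈ W) → W = ⊥ ∨ W = ⊤ := by
  constructor
  · intro h
    refine ⟨?_, fun W hW => ?_⟩
    · by_contra hn
      rw [not_nontrivial_iff_subsingleton] at hn
      exact bot_ne_top (α := Subrepresentation ρ)
        (Subrepresentation.toSubmodule_injective (Subsingleton.elim _ _))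
    · rcases h.eq_bot_or_eq_top ⟨W, hW⟩ with h | h
      · exact Or.inl (congrArg Subrepresentation.toSubmodule h)
      · exact Or.inr (congrArg Subrepresentation.toSubmodule h)
  · rintro ⟨hn, h⟩
    have : Nontrivial (Subrepresentation ρ) :=
      ⟨⊥, ⊤, fun e => bot_ne_top (α := Submodule ℝ X) (congrArg Subrepresentation.toSubmodule e)⟩
    refine ⟨fun a => ?_⟩
    rcases h a.toSubmodule a.apply_mem_toSubmodule with h | h
    · exact Or.inl (Subrepresentation.toSubmodule_injective h)
    · exact Or.inr (Subrepresentation.toSubmodule_injective h)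

/-- An invariant subspace for ρ' pulls back to one for ρ as soon as every operator of ρ is matched
by some operator of ρ'. No homomorphism between the groups is needed, so weight factors can be
discarded and actions compared along Q → Q₀. -/
theorem isIrreducible_of_linearEquiv {G' X' : Type*} [Group G'] [AddCommGroup X'] [Module ℝ X']
    {ρ : Representation ℝ G X} {ρ' : Representation ℝ G' X'} (e : X ≃ₗ[ℝ] X')
    (he : ∀ g, ∃ g', ∀ x, e (ρ g x) = ρ' g' (e x)) (h : ρ.IsIrreducible) : ρ'.IsIrreducible := by
  rw [isIrreducible_iff] at h ⊢
  obtain ⟨h1, h2⟩ := h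
  refine ⟨e.symm.toEquiv.nontrivial, fun W hW => ?_⟩
  rcases h2 (W.comap e.toLinearMap) (fun g x hx => by
    obtain ⟨g', hg⟩ := he g
    simp only [Submodule.mem_comap, LinearEquiv.coe_coe] at hx ⊢
    rw [hg]
    exact hW _ _ hx) with h | h
  · left
    rw [eq_bot_iff]
    intro x hx
    have : e.symm x ∈ W.comap e.toLinearMap := by simpa using hx
    rw [h] at this
    simpa using this
  · right
    rw [eq_top_iff]
    intro x _
    have : e.symm x ∈ W.comap e.toLinearMap := by rw [h]; trivial
    simpa using this

/-- A finite family of intertwining maps which is jointly bijective decomposes a representation. -/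
theorem exists_decomposition {ι : Type*} [Finite ι] {Y : ι → Type*} [∀ l, AddCommGroup (Y l)]
    [∀ l, Module ℝ (Y l)] (ρ : Representation ℝ G X) (σ : ∀ l, Representation ℝ G (Y l))
    (f : ∀ l, X →ₗ[ℝ] Y l) (hf : ∀ l g x, f l (ρ g x) = σ l g (f l x))
    (hb : Function.Bijective (LinearMap.pi f)) :
    ∃ S : ι → Subrepresentation ρ, iSupIndep (fun l => (S l).toSubmodule) ∧
      (⨆ l, (S l).toSubmodule) = ⊤ ∧ ∀ l, Nonempty ((S l).toRepresentation.Equiv (σ l)) := by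
  classical
  have := Fintype.ofFinite ι
  let e : X ≃ₗ[ℝ] (∀ l, Y l) := LinearEquiv.ofBijective _ hb
  have he : ∀ x l, e x l = f l x := fun x l => rfl
  -- The summand with index l is the common kernel of all the other maps.
  let S : ι → Subrepresentation ρ := fun l =>
    ⟨⨅ l' ∈ ({l}ᶜ : Set ι), LinearMap.ker (f l'), by
      intro g x hx
      simp only [Submodule.mem_iInf, LinearMap.mem_ker] at hx ⊢
      intro l' hl'
      rw [hf, hx l' hl', map_zero]⟩
  have hS : ∀ l x, x ∈ (S l).toSubmodule ↔ ∀ l', l' ≠ l → f l' x = 0 := by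
    intro l x
    simp [S, Submodule.mem_iInf]
  have hs : ∀ l (y : Y l), e.symm (Pi.single l y) ∈ (S l).toSubmodule := by
    intro l y
    rw [hS]
    intro l' hl'
    rw [← he, LinearEquiv.apply_symm_apply, Pi.single_eq_of_ne hl']
  have hsum : ∀ x, x = ∑ l, e.symm (Pi.single l (f l x)) := by
    intro x
    apply e.injective
    rw [map_sum]
    simp only [LinearEquiv.apply_symm_apply]
    exact (Finset.univ_sum_single (e x)).symm
  refine ⟨S, ?_, ?_, fun l => ⟨?_⟩⟩
  · rw [iSupIndep_def]
    intro l
    rw [Submodule.disjoint_def]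
    intro x hx hx'
    have h1 : f l x = 0 := by
      have : (⨆ j, ⨆ (_ : j ≠ l), (S j).toSubmodule) ≤ LinearMap.ker (f l) := by
        refine iSup₂_le fun j hj y hy => ?_
        exact (hS j y).mp hy l (Ne.symm hj)
      exact this hx'
    apply e.injective
    funext l'
    rw [he, map_zero, Pi.zero_apply]
    by_cases h : l' = l
    · subst h; exact h1
    · exact (hS l x).mp hx l' h
  · rw [eq_top_iff]
    intro x _
    rw [hsum x]
    exact Submodule.sum_mem _ fun l _ =>
      (le_iSup (fun l => (S l).toSubmodule) l) (hs l _)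
  · refine Representation.Equiv.mk (LinearEquiv.ofBijective ((f l).domRestrict (S l).toSubmodule)
      ⟨?_, fun y => ⟨⟨_, hs l y⟩, ?_⟩⟩) fun g => ?_
    · rw [← LinearMap.ker_eq_bot, eq_bot_iff]
      rintro ⟨x, hx⟩ h
      rw [Submodule.mem_bot, Submodule.mk_eq_zero]
      apply e.injective
      funext l'
      rw [he, map_zero, Pi.zero_apply]
      by_cases h' : l' = l
      · subst h'; exact h
      · exact (hS l x).mp hx l' h'
    · rw [LinearMap.domRestrict_apply, ← he]
      simp
    · ext x
      exact hf l g x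

end Representations

end Robinson

/-! ### Consequences of the Lorentzian signature -/

namespace Robinson.MinkowskiMetric

variable {m : ℕ} {V : Type*} [AddCommGroup V] [Module ℝ V]

theorem finite (M : MinkowskiMetric m V) : Module.Finite ℝ V :=
  Module.finite_of_finrank_pos (by rw [M.finrank_eq]; omega)

/-- The signature uses up the whole dimension, (2m+1) + 1 = 2m+2, and leaves no room for a radical.
-/
theorem eq_zero_of_forall (M : MinkowskiMetric m V) {x : V} (h : ∀ y, M.g x y = 0) : x = 0 := by
  have := M.finite
  have h1 := QuadraticForm.sigPos_add_sigNeg_add_radical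
    (Q := LinearMap.BilinMap.toQuadraticMap M.g)
  rw [M.sigPos_eq, M.sigNeg_eq, M.finrank_eq] at h1
  have h2 : (LinearMap.BilinMap.toQuadraticMap M.g).radical = ⊥ :=
    Submodule.finrank_eq_zero.mp (by omega)
  rw [← Submodule.mem_bot ℝ, ← h2, QuadraticMap.mem_radical_iff']
  refine ⟨by simp [h], fun n => ?_⟩
  simp [h, M.symm n x]

/-- There is no negative definite plane. -/
theorem not_neg_neg (M : MinkowskiMetric m V) {a b : V} (ha : M.g a a < 0) (hb : M.g b b < 0) (hab : M.g a b = 0) :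
    False := by
  have := M.finite
  have hba : M.g b a = 0 := by rw [M.symm, hab]
  have hli : LinearIndependent ℝ ![a, b] := by
    rw [LinearIndependent.pair_iff]
    intro s t h
    have h1 : M.g a (s • a + t • b) = 0 := by rw [h, map_zero]
    have h2 : M.g b (s • a + t • b) = 0 := by rw [h, map_zero]
    simp only [map_add, map_smul, smul_eq_mul, hab, hba, mul_zero, add_zero, zero_add,
      mul_eq_zero] at h1 h2
    exact ⟨h1.resolve_right ha.ne, h2.resolve_right hb.ne⟩
  -- The negative index bounds the dimension of every negative definite subspace, so a plane of this
  -- kind would give 2 ≤ 1.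
  have h := le_sigNeg_of_negDef (LinearMap.BilinMap.toQuadraticMap M.g)
    (V := Submodule.span ℝ (Set.range ![a, b])) (by
      rintro ⟨x, hx⟩ hx0
      rw [Matrix.range_cons, Matrix.range_cons, Matrix.range_empty, Set.union_empty,
        Set.singleton_union, Submodule.mem_span_pair] at hx
      obtain ⟨s, t, rfl⟩ := hx
      simp only [QuadraticMap.restrict_apply, _root_.neg_apply,
        LinearMap.BilinMap.toQuadraticMap_apply, map_add, map_smul, LinearMap.add_apply,
        LinearMap.smul_apply, smul_eq_mul, hab, hba]
      by_cases hs : s = 0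
      · have ht : t ≠ 0 := by rintro rfl; simp [hs] at hx0
        have := mul_pos_of_neg_of_neg hb (neg_neg_of_pos (mul_self_pos.mpr ht))
        subst hs
        nlinarith
      · have := mul_pos_of_neg_of_neg ha (neg_neg_of_pos (mul_self_pos.mpr hs))
        nlinarith [mul_self_nonneg t])
  rw [M.sigNeg_eq, finrank_span_eq_card hli] at h
  simp at h

end Robinson.MinkowskiMetric

/-! ### The null line K, null pairs and the splitting of V -/

namespace RobinsonStructure

open Robinson

variable {m : ℕ} {V : Type*} [AddCommGroup V] [Module ℝ V] {M : MinkowskiMetric m V}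
  (R : RobinsonStructure M)

variable (M) in
/-- The complexified metric. -/
abbrev gC : LinearMap.BilinForm ℂ (ℂ ⊗[ℝ] V) := M.g.baseChange ℂ

/-- The complexified screen metric. -/
abbrev hC : LinearMap.BilinForm ℂ (ℂ ⊗[ℝ] R.H) := R.h.baseChange ℂ

theorem gC_symm (x y : ℂ ⊗[ℝ] V) : gC M x y = gC M y x := baseChange_form_symm M.symm x y

theorem gC_one_tmul (x y : V) : gC M (1 ⊗ₜ x) (1 ⊗ₜ y) = (M.g x y : ℂ) := by
  simp [LinearMap.BilinForm.baseChange_tmul]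

theorem gC_N {x y : ℂ ⊗[ℝ] V} (hx : x ∈ R.N) (hy : y ∈ R.N) : gC M x y = 0 := by
  rw [← R.orthogonal_eq] at hy
  exact hy x hx

theorem mem_N_of_forall {y : ℂ ⊗[ℝ] V} (h : ∀ x ∈ R.N, gC M x y = 0) : y ∈ R.N := by
  rw [← R.orthogonal_eq]
  exact h

/-- N ∩ N̄ is stable under conjugation, so real parts of its elements are real points of N. If z ≠ 0
has vanishing real part, then -iz does not. -/
theorem exists_mem_K : ∃ k ∈ R.K, k ≠ 0 := by
  have h1 : R.N ⊓ conjSub R.N ≠ ⊥ := by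
    intro h
    have := R.real_index
    rw [h] at this
    simp at this
  obtain ⟨z, ⟨hz, hz'⟩, hz0⟩ := (Submodule.ne_bot_iff _).mp h1
  have h2 : ∀ w, w ∈ R.N → conjC V w ∈ R.N → reC V w ∈ R.K := fun w hw hw' => by
    rw [R.mem_K, one_tmul_reC]
    exact R.N.smul_mem _ (R.N.add_mem hw hw')
  by_cases h : reC V z = 0
  · refine ⟨_, h2 (-Complex.I • z) (R.N.smul_mem _ hz) ?_, fun h' => hz0 ?_⟩
    · rw [conjC_smul]; exact R.N.smul_mem _ hz'
    · rw [← reC_add_I_smul_im z, h, h']; simp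
  · exact ⟨_, h2 z hz hz', h⟩

theorem conjC_one_tmul_mem {k : V} (hk : k ∈ R.K) : conjC V (1 ⊗ₜ k) ∈ R.N := by
  rw [conjC_tmul, map_one]
  exact hk

/-- Real index one says that N ∩ N̄ is a complex line, and 1 ⊗ k is a nonzero vector on it. -/
theorem eq_smul_of_mem_N {k : V} (hk : k ∈ R.K) (hk0 : k ≠ 0) {z : ℂ ⊗[ℝ] V} (hz : z ∈ R.N)
    (hz' : conjC V z ∈ R.N) : ∃ c : ℂ, z = c • (1 ⊗ₜ k) := by
  have h1 := (finrank_eq_one_iff_of_nonzero' (K := ℂ)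
    (⟨1 ⊗ₜ k, hk, R.conjC_one_tmul_mem hk⟩ : ↥(R.N ⊓ conjSub R.N)) (by
      intro h
      exact hk0 (one_tmul_injective ((congrArg Subtype.val h).trans (TensorProduct.tmul_zero _ _).symm)))).mp R.real_index
  obtain ⟨c, hc⟩ := h1 ⟨z, hz, hz'⟩
  exact ⟨c, (congrArg Subtype.val hc).symm⟩

/-- A pair of null vectors `k ∈ K` and `l` with `g(k,l) = 1`. -/
structure NullPair where
  k : V
  l : V
  k_mem : k ∈ R.K
  g_kl : M.g k l = 1
  g_ll : M.g l l = 0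

theorem g_K {k k' : V} (hk : k ∈ R.K) (hk' : k' ∈ R.K) : M.g k k' = 0 := by
  have := R.gC_N hk hk'
  rw [gC_one_tmul] at this
  exact_mod_cast this

theorem exists_nullPair : Nonempty R.NullPair := by
  obtain ⟨k, hk, hk0⟩ := R.exists_mem_K
  obtain ⟨x, hx⟩ : ∃ x, M.g k x ≠ 0 := by
    by_contra! h
    exact hk0 (M.eq_zero_of_forall h)
  have hkk := R.g_K hk hk
  set y := (M.g k x)⁻¹ • x with hy
  have hky : M.g k y = 1 := by simp [hy, hx]
  -- As g(k,k) = 0 and g(k,y) = 1, subtracting g(y,y)/2 times k makes y null and keeps its product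
  -- with k.
  refine ⟨⟨k, y - (M.g y y / 2) • k, hk, by simp [hky, hkk], ?_⟩⟩
  simp only [map_sub, map_smul, LinearMap.sub_apply, LinearMap.smul_apply, smul_eq_mul, hky, hkk,
    M.symm y k]
  ring

namespace NullPair

variable {R} (P : R.NullPair)

theorem g_lk : M.g P.l P.k = 1 := by rw [M.symm, P.g_kl]

theorem g_kk : M.g P.k P.k = 0 := R.g_K P.k_mem P.k_mem

theorem k_ne_zero : P.k ≠ 0 := fun h => by simpa [h] using P.g_kl

theorem eq_smul_of_mem_K {x : V} (hx : x ∈ R.K) : x = M.g P.l x • P.k := by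
  obtain ⟨c, hc⟩ := R.eq_smul_of_mem_N P.k_mem P.k_ne_zero hx (R.conjC_one_tmul_mem hx)
  have h1 : x = c.re • P.k := by
    have := congrArg (reC V) hc
    simpa [TensorProduct.smul_tmul'] using this
  have h2 : M.g P.l x = c.re := by rw [h1]; simp [P.g_lk]
  rw [h2, ← h1]

theorem mem_Kperp_iff {x : V} : x ∈ R.Kperp ↔ M.g P.k x = 0 := by
  refine ⟨fun h => h _ P.k_mem, fun h y hy => ?_⟩
  rw [P.eq_smul_of_mem_K hy]
  simp [h]

/-- The vector k - l has square -2, so a negative vector orthogonal to k and l would complete it to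
a negative definite plane. Hence g is semidefinite there, and a nonzero null vector y is excluded
because some w + sy would be negative. -/
theorem g_pos {y : V} (h1 : M.g P.k y = 0) (h2 : M.g P.l y = 0) (hy : y ≠ 0) : 0 < M.g y y := by
  have hneg : ∀ z, M.g P.k z = 0 → M.g P.l z = 0 → 0 ≤ M.g z z := by
    intro z h1 h2
    by_contra! h
    refine M.not_neg_neg (a := P.k - P.l) (b := z) ?_ h ?_
    · simp [P.g_kk, P.g_kl, P.g_lk, P.g_ll]
    · simp [h1, h2]
  refine lt_of_le_of_ne (hneg y h1 h2) fun h0 => ?_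
  obtain ⟨x, hx⟩ : ∃ x, M.g y x ≠ 0 := by
    by_contra! h
    exact hy (M.eq_zero_of_forall h)
  set w := x - M.g P.l x • P.k - M.g P.k x • P.l with hw
  have hyk : M.g y P.k = 0 := by rw [M.symm, h1]
  have hyl : M.g y P.l = 0 := by rw [M.symm, h2]
  have hyw : M.g y w = M.g y x := by simp [hw, hyk, hyl]
  have hkw : M.g P.k w = 0 := by simp [hw, P.g_kk, P.g_kl]
  have hlw : M.g P.l w = 0 := by simp [hw, P.g_lk, P.g_ll]
  -- Chosen so that g(w + sy, w + sy) = -1 when g(y,y) = 0.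
  set s := -(M.g w w + 1) / (2 * M.g y x) with hs
  have h3 := hneg (w + s • y) (by simp [hkw, h1]) (by simp [hlw, h2])
  simp only [map_add, map_smul, LinearMap.add_apply, LinearMap.smul_apply, smul_eq_mul, ← h0,
    M.symm w y, hyw] at h3
  have h4 : s * M.g y x = -(M.g w w + 1) / 2 := by rw [hs]; field_simp
  nlinarith

/-- The representative of a vector of the screen space which is orthogonal to `l`. -/
def σ : R.H →ₗ[ℝ] V :=
  Submodule.liftQ _ (R.Kperp.subtype -
      ((M.g P.l).comp R.Kperp.subtype).smulRight P.k) (by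
    intro x hx
    simp only [LinearMap.mem_ker, LinearMap.sub_apply, Submodule.subtype_apply,
      LinearMap.smulRight_apply, LinearMap.comp_apply, sub_eq_zero]
    exact P.eq_smul_of_mem_K hx)

theorem σ_mk (x : R.Kperp) : P.σ (Submodule.Quotient.mk x) = x - M.g P.l x • P.k := rfl

/-- The projection of the space onto `K^⊥` along `l` followed by that onto the screen space. -/
def τ : V →ₗ[ℝ] R.H :=
  (R.K.submoduleOf R.Kperp).mkQ ∘ₗ LinearMap.codRestrict R.Kperp
    (LinearMap.id - (M.g P.l).smulRight P.k - (M.g P.k).smulRight P.l) (by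
      intro v
      rw [P.mem_Kperp_iff]
      simp [P.g_kk, P.g_kl])

theorem g_k_σ (x : R.H) : M.g P.k (P.σ x) = 0 := by
  obtain ⟨x, rfl⟩ := Submodule.Quotient.mk_surjective _ x
  simp [σ_mk, P.g_kk, P.mem_Kperp_iff.mp x.2]

theorem g_l_σ (x : R.H) : M.g P.l (P.σ x) = 0 := by
  obtain ⟨x, rfl⟩ := Submodule.Quotient.mk_surjective _ x
  simp [σ_mk, P.g_lk]

theorem σ_τ (v : V) : P.σ (P.τ v) = v - M.g P.l v • P.k - M.g P.k v • P.l := by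
  change P.σ (Submodule.Quotient.mk _) = _
  rw [σ_mk]
  simp [P.g_lk, P.g_ll]

theorem τ_σ (x : R.H) : P.τ (P.σ x) = x := by
  obtain ⟨x, rfl⟩ := Submodule.Quotient.mk_surjective _ x
  rw [σ_mk]
  change Submodule.Quotient.mk _ = _
  rw [Submodule.Quotient.eq]
  have h := P.mem_Kperp_iff.mp x.2
  change ((x : V) - M.g P.l x • P.k) - M.g P.l (x - M.g P.l x • P.k) • P.k -
    M.g P.k (x - M.g P.l x • P.k) • P.l - x ∈ R.K
  have : ((x : V) - M.g P.l x • P.k) - M.g P.l (x - M.g P.l x • P.k) • P.k -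
      M.g P.k (x - M.g P.l x • P.k) • P.l - x = -(M.g P.l x) • P.k := by
    simp [P.g_lk, h, P.g_kk]
  rw [this]
  exact R.K.smul_mem _ P.k_mem

theorem τ_k : P.τ P.k = 0 := by
  rw [← P.τ_σ (P.τ P.k), P.σ_τ]
  simp [P.g_lk, P.g_kk]

theorem τ_l : P.τ P.l = 0 := by
  rw [← P.τ_σ (P.τ P.l), P.σ_τ]
  simp [P.g_kl, P.g_ll]

theorem τ_mk (x : R.Kperp) : P.τ x = Submodule.Quotient.mk x := by
  rw [← P.τ_σ (Submodule.Quotient.mk x), σ_mk, map_sub, map_smul, P.τ_k, smul_zero, sub_zero]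

theorem σ_mem (x : R.H) : P.σ x ∈ R.Kperp := P.mem_Kperp_iff.mpr (P.g_k_σ x)

theorem mk_σ (x : R.H) : Submodule.Quotient.mk ⟨P.σ x, P.σ_mem x⟩ = x := by
  rw [← P.τ_mk, P.τ_σ]

theorem h_eq (x y : R.H) : M.g (P.σ x) (P.σ y) = R.h x y := by
  conv_rhs => rw [← P.mk_σ x, ← P.mk_σ y, R.h_mk]

theorem eq_add (v : V) : v = M.g P.l v • P.k + M.g P.k v • P.l + P.σ (P.τ v) := by
  rw [P.σ_τ]; abel

/-- The splitting of the space into `K`, the line of `l` and the screen space. -/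
def splitting : V ≃ₗ[ℝ] ℝ × ℝ × R.H where
  toFun v := (M.g P.l v, M.g P.k v, P.τ v)
  map_add' x y := by simp
  map_smul' c x := by simp
  invFun x := x.1 • P.k + x.2.1 • P.l + P.σ x.2.2
  left_inv v := (P.eq_add v).symm
  right_inv x := by
    simp [P.g_lk, P.g_ll, P.g_kk, P.g_kl, P.g_k_σ, P.g_l_σ, P.τ_k, P.τ_l, P.τ_σ]

end NullPair

theorem h_symm (x y : R.H) : R.h x y = R.h y x := by
  obtain ⟨P⟩ := R.exists_nullPair
  rw [← P.h_eq, M.symm, P.h_eq]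

theorem h_pos {x : R.H} (hx : x ≠ 0) : 0 < R.h x x := by
  obtain ⟨P⟩ := R.exists_nullPair
  rw [← P.h_eq]
  refine P.g_pos (P.g_k_σ x) (P.g_l_σ x) fun h => hx ?_
  rw [← P.τ_σ x, h, map_zero]

instance finite_H : Module.Finite ℝ R.H := by
  have := M.finite
  infer_instance

theorem finrank_H : Module.finrank ℝ R.H = 2 * m := by
  have := M.finite
  obtain ⟨P⟩ := R.exists_nullPair
  have := P.splitting.finrank_eq
  rw [M.finrank_eq, Module.finrank_prod, Module.finrank_prod, Module.finrank_self] at this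
  omega

end RobinsonStructure

theorem Robinson.ofReal_smul_tensor {W : Type*} [AddCommGroup W] [Module ℝ W] (r : ℝ)
    (x : ℂ ⊗[ℝ] W) : (r : ℂ) • x = r • x := algebraMap_smul ℂ r x

namespace RobinsonStructure

open Robinson

variable {m : ℕ} {V : Type*} [AddCommGroup V] [Module ℝ V] {M : MinkowskiMetric m V}
  {R : RobinsonStructure M}

namespace NullPair

variable (P : R.NullPair)

/-- The complexification of `σ`. -/
def σC : (ℂ ⊗[ℝ] R.H) →ₗ[ℂ] (ℂ ⊗[ℝ] V) := P.σ.baseChange ℂ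

/-- The complexification of `τ`. -/
def τC : (ℂ ⊗[ℝ] V) →ₗ[ℂ] (ℂ ⊗[ℝ] R.H) := P.τ.baseChange ℂ

theorem conjC_σC (x : ℂ ⊗[ℝ] R.H) : conjC V (P.σC x) = P.σC (conjC R.H x) :=
  conjC_baseChange _ _

theorem τC_σC (x : ℂ ⊗[ℝ] R.H) : P.τC (P.σC x) = x := by
  rw [τC, σC, ← LinearMap.comp_apply, ← LinearMap.baseChange_comp,
    show P.τ ∘ₗ P.σ = LinearMap.id from LinearMap.ext P.τ_σ]
  simp

theorem gC_σC (x y : ℂ ⊗[ℝ] R.H) : gC M (P.σC x) (P.σC y) = R.hC x y :=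
  baseChange_form_comp P.h_eq x y

theorem gC_k_σC (x : ℂ ⊗[ℝ] R.H) : gC M (1 ⊗ₜ P.k) (P.σC x) = 0 := by
  have : (gC M (1 ⊗ₜ P.k)).comp P.σC = 0 :=
    ext_real fun w => by simp [σC, P.g_k_σ]
  exact LinearMap.congr_fun this x

theorem gC_l_σC (x : ℂ ⊗[ℝ] R.H) : gC M (1 ⊗ₜ P.l) (P.σC x) = 0 := by
  have : (gC M (1 ⊗ₜ P.l)).comp P.σC = 0 :=
    ext_real fun w => by simp [σC, P.g_l_σ]
  exact LinearMap.congr_fun this x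

theorem eq_add_C (v : ℂ ⊗[ℝ] V) : v = gC M (1 ⊗ₜ P.l) v • ((1 : ℂ) ⊗ₜ P.k) +
    gC M (1 ⊗ₜ P.k) v • ((1 : ℂ) ⊗ₜ P.l) + P.σC (P.τC v) := by
  have : LinearMap.id = (gC M (1 ⊗ₜ P.l)).smulRight ((1 : ℂ) ⊗ₜ[ℝ] P.k) +
      (gC M (1 ⊗ₜ P.k)).smulRight ((1 : ℂ) ⊗ₜ[ℝ] P.l) + P.σC ∘ₗ P.τC := by
    refine ext_real fun w => ?_
    simp only [LinearMap.id_apply, LinearMap.add_apply, LinearMap.smulRight_apply, gC_one_tmul,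
      LinearMap.comp_apply, σC, τC, LinearMap.baseChange_tmul]
    conv_lhs => rw [P.eq_add w]
    simp only [TensorProduct.tmul_add, TensorProduct.tmul_smul, ofReal_smul_tensor]
  exact LinearMap.congr_fun this v

theorem k_mem_N : (1 : ℂ) ⊗ₜ[ℝ] P.k ∈ R.N := P.k_mem

theorem eq_add_of_mem_N {v : ℂ ⊗[ℝ] V} (hv : v ∈ R.N) :
    v = gC M (1 ⊗ₜ P.l) v • ((1 : ℂ) ⊗ₜ P.k) + P.σC (P.τC v) := by
  conv_lhs => rw [P.eq_add_C v, R.gC_N P.k_mem_N hv, zero_smul, add_zero]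

theorem σC_τC_mem {v : ℂ ⊗[ℝ] V} (hv : v ∈ R.N) : P.σC (P.τC v) ∈ R.N := by
  have := P.eq_add_of_mem_N hv
  rw [← sub_eq_iff_eq_add'] at this
  rw [← this]
  exact R.N.sub_mem hv (R.N.smul_mem _ P.k_mem_N)

/-- An element of N has no l-component, and its k-component lies in N, so its screen part lies in N
again. This allows H^{(0,1)} to be handled inside ᶜV. -/
theorem mem_H01_iff {x : ℂ ⊗[ℝ] R.H} : x ∈ R.H01 ↔ P.σC x ∈ R.N := by
  constructor
  · rintro ⟨y, hy, rfl⟩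
    have h : (R.K.submoduleOf R.Kperp).mkQ.baseChange ℂ y =
        P.τC (R.Kperp.subtype.baseChange ℂ y) := by
      rw [τC, ← LinearMap.comp_apply, ← LinearMap.baseChange_comp]
      congr 2
      exact LinearMap.ext fun z => (P.τ_mk z).symm
    rw [h]
    exact P.σC_τC_mem hy
  · intro h
    refine ⟨(LinearMap.codRestrict R.Kperp P.σ P.σ_mem).baseChange ℂ x, ?_, ?_⟩
    · change R.Kperp.subtype.baseChange ℂ _ ∈ R.N
      rw [← LinearMap.comp_apply, ← LinearMap.baseChange_comp]
      exact h
    · rw [← LinearMap.comp_apply, ← LinearMap.baseChange_comp,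
        show (R.K.submoduleOf R.Kperp).mkQ ∘ₗ LinearMap.codRestrict R.Kperp P.σ P.σ_mem =
          LinearMap.id from LinearMap.ext P.mk_σ]
      simp

end NullPair

theorem hC_symm (x y : ℂ ⊗[ℝ] R.H) : R.hC x y = R.hC y x := baseChange_form_symm R.h_symm x y

theorem hC_conj (x y : ℂ ⊗[ℝ] R.H) :
    R.hC (conjC _ x) (conjC _ y) = starRingEnd ℂ (R.hC x y) := baseChange_form_conj _ _ _

theorem hC_H01 {x y : ℂ ⊗[ℝ] R.H} (hx : x ∈ R.H01) (hy : y ∈ R.H01) : R.hC x y = 0 := by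
  obtain ⟨P⟩ := R.exists_nullPair
  rw [P.mem_H01_iff] at hx hy
  rw [← P.gC_σC]
  exact R.gC_N hx hy

theorem mem_H10 {x : ℂ ⊗[ℝ] R.H} : x ∈ R.H10 ↔ conjC _ x ∈ R.H01 := Iff.rfl

theorem conjC_mem_H10 {x : ℂ ⊗[ℝ] R.H} : conjC _ x ∈ R.H10 ↔ x ∈ R.H01 := by
  rw [mem_H10, conjC_conjC]

theorem hC_H10 {x y : ℂ ⊗[ℝ] R.H} (hx : x ∈ R.H10) (hy : y ∈ R.H10) : R.hC x y = 0 := by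
  have := hC_H01 (mem_H10.mp hx) (mem_H10.mp hy)
  rw [hC_conj] at this
  simpa using this

/-- The equality N^⊥ = N descends to the screen space, because an element of N pairs with a lifted
screen vector only through its own screen part. -/
theorem mem_H01_of_forall {y : ℂ ⊗[ℝ] R.H} (h : ∀ x ∈ R.H01, R.hC x y = 0) : y ∈ R.H01 := by
  obtain ⟨P⟩ := R.exists_nullPair
  rw [P.mem_H01_iff]
  refine R.mem_N_of_forall fun n hn => ?_
  rw [P.eq_add_of_mem_N hn, map_add, LinearMap.add_apply, map_smul, LinearMap.smul_apply,
    P.gC_k_σC, smul_zero, zero_add, P.gC_σC]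
  exact h _ (P.mem_H01_iff.mpr (P.σC_τC_mem hn))

/-- The lift lies in N ∩ N̄, hence is a multiple of k; being orthogonal to l, it is zero. -/
theorem eq_zero_of_mem_H01_of_mem_H10 {x : ℂ ⊗[ℝ] R.H} (hx : x ∈ R.H01) (hx' : x ∈ R.H10) :
    x = 0 := by
  obtain ⟨P⟩ := R.exists_nullPair
  rw [mem_H10, P.mem_H01_iff, ← P.conjC_σC] at hx'
  obtain ⟨c, hc⟩ := R.eq_smul_of_mem_N P.k_mem P.k_ne_zero (P.mem_H01_iff.mp hx) hx'
  have h1 := P.gC_l_σC x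
  rw [hc, map_smul, gC_one_tmul, P.g_lk] at h1
  have h2 : c = 0 := by simpa using h1
  rw [← P.τC_σC x, hc, h2]
  simp

/-- The value of the Hermitian form on a vector, in terms of its real and imaginary part. -/
theorem hC_conj_self (x : ℂ ⊗[ℝ] R.H) : R.hC (conjC _ x) x =
    (R.h (reC _ x) (reC _ x) + R.h (reC _ (-Complex.I • x)) (reC _ (-Complex.I • x)) : ℝ) := by
  have h : ∀ a b : R.H, R.hC (conjC _ (1 ⊗ₜ a + Complex.I • (1 ⊗ₜ b)))
      (1 ⊗ₜ a + Complex.I • (1 ⊗ₜ b)) = (R.h a a + R.h b b : ℝ) := by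
    intro a b
    simp only [map_add, conjC_smul, conjC_tmul, LinearMap.add_apply, map_smul,
      LinearMap.smul_apply, LinearMap.BilinForm.baseChange_tmul, Complex.conj_I, map_one, mul_one,
      smul_eq_mul, R.h_symm b a, Complex.real_smul, Complex.ofReal_add]
    linear_combination (-(R.h b b : ℂ)) * Complex.I_mul_I
  conv_lhs => rw [← reC_add_I_smul_im x]
  exact h _ _

theorem re_hC_conj_self_nonneg (x : ℂ ⊗[ℝ] R.H) : 0 ≤ (R.hC (conjC _ x) x).re := by
  have : ∀ y, 0 ≤ R.h y y := fun y => by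
    by_cases hy : y = 0
    · simp [hy]
    · exact (R.h_pos hy).le
  rw [hC_conj_self, Complex.ofReal_re]
  exact add_nonneg (this _) (this _)

theorem eq_zero_of_hC_conj_self {x : ℂ ⊗[ℝ] R.H} (hx : R.hC (conjC _ x) x = 0) : x = 0 := by
  have h0 : ∀ y, 0 ≤ R.h y y := fun y => by
    by_cases hy : y = 0
    · simp [hy]
    · exact (R.h_pos hy).le
  rw [hC_conj_self, Complex.ofReal_eq_zero] at hx
  have h1 : ∀ y, R.h y y = 0 → y = 0 := fun y h => by
    by_contra hy
    exact (R.h_pos hy).ne' h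
  have h2 := h1 _ (le_antisymm (by linarith [h0 (reC _ (-Complex.I • x))]) (h0 (reC _ x)))
  have h3 := h1 _ (le_antisymm (by linarith [h0 (reC _ x)]) (h0 (reC _ (-Complex.I • x))))
  rw [← reC_add_I_smul_im x, h2, h3]
  simp

theorem finrank_HC : Module.finrank ℂ (ℂ ⊗[ℝ] R.H) = 2 * m := by
  rw [Module.finrank_baseChange, R.finrank_H]

/-- A subspace equal to its own orthogonal for a nondegenerate form has half the dimension. -/
theorem finrank_H01 : Module.finrank ℂ R.H01 = m := by
  have h1 := LinearMap.BilinForm.finrank_add_finrank_orthogonal' (B := R.hC) R.H01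
  have h2 : LinearMap.BilinForm.orthogonal R.hC R.H01 = R.H01 := by
    ext y
    exact ⟨fun h => mem_H01_of_forall h, fun h x hx => hC_H01 hx h⟩
  have h3 : LinearMap.ker R.hC = ⊥ := by
    rw [eq_bot_iff]
    intro x hx
    refine eq_zero_of_hC_conj_self ?_
    rw [hC_symm, LinearMap.mem_ker.mp hx]
    rfl
  rw [h2, h3, inf_bot_eq, finrank_bot, finrank_HC] at h1
  omega

/-- The Hermitian inner product on `H^{(0,1)}`. -/
abbrev innerCore (R : RobinsonStructure M) : InnerProductSpace.Core ℂ R.H01 where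
  inner x y := R.hC (conjC _ x) y
  conj_inner_symm x y := by
    rw [← hC_conj, conjC_conjC, hC_symm]
  re_inner_nonneg x := re_hC_conj_self_nonneg _
  add_left x y z := by simp
  smul_left x y r := by simp
  definite x hx := Subtype.ext (eq_zero_of_hC_conj_self hx)

variable (R) in
/-- A unitary frame of `H^{(1,0)}`. -/
structure UnitaryFrame where
  z : Fin m → ℂ ⊗[ℝ] R.H
  mem : ∀ a, z a ∈ R.H10
  hC_z : ∀ a b, R.hC (z a) (conjC _ (z b)) = if a = b then 1 else 0
  expand : ∀ x, x = ∑ a, R.hC (conjC _ (z a)) x • z a + ∑ a, R.hC (z a) x • conjC _ (z a)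

-- The frame is the complex conjugate of an orthonormal basis of H^{(0,1)} for the Hermitian product
-- h(x̄, y). Expansion in the frame amounts to ᶜH = H^{(1,0)} ⊕ H^{(0,1)}, which follows from
-- trivial intersection and m + m = 2m.
variable (R) in
theorem exists_unitaryFrame : Nonempty R.UnitaryFrame := by
  let := R.innerCore
  let : NormedAddCommGroup R.H01 := InnerProductSpace.Core.toNormedAddCommGroup (𝕜 := ℂ)
  let : InnerProductSpace ℂ R.H01 := InnerProductSpace.ofCore R.innerCore.toCore
  let b := (stdOrthonormalBasis ℂ R.H01).reindex (finCongr finrank_H01)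
  have hin : ∀ x y : R.H01, inner ℂ x y = R.hC (conjC _ x) y := fun x y => rfl
  have h01 : ∀ x ∈ R.H01, x = ∑ a, R.hC (conjC _ (b a : ℂ ⊗[ℝ] R.H)) x • (b a : ℂ ⊗[ℝ] R.H) := by
    intro x hx
    have := congrArg Subtype.val (b.sum_repr' ⟨x, hx⟩)
    rw [Submodule.coe_sum] at this
    exact this.symm
  have h10 : ∀ x ∈ R.H10, x = ∑ a, R.hC (b a : ℂ ⊗[ℝ] R.H) x • conjC _ (b a : ℂ ⊗[ℝ] R.H) := by
    intro x hx
    have := congrArg (conjC _) (h01 _ (mem_H10.mp hx))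
    simpa [map_sum, hC_conj] using this
  refine ⟨⟨fun a => conjC _ (b a), fun a => ?_, fun a c => ?_, fun x => ?_⟩⟩
  · rw [conjC_mem_H10]; exact (b a).2
  · rw [conjC_conjC, ← hin]
    exact b.inner_eq_ite a c
  · have htop : R.H10 ⊔ R.H01 = ⊤ := by
      refine Submodule.eq_top_of_disjoint _ _ ?_ ?_
      · have h3 : Module.finrank ℂ R.H10 = m := by
          -- Conjugation is only real linear, so the two dimensions are compared over ℝ.
          have e1 := (finrank_real_of_complex R.H10).symm.trans (LinearEquiv.finrank_eq
            (LinearEquiv.ofBijective (LinearMap.restrict (p := R.H10.restrictScalars ℝ)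
              (q := R.H01.restrictScalars ℝ) (conjC R.H) (fun x hx => hx)) ⟨fun x y h => ?_,
                fun x => ⟨⟨conjC _ x, conjC_mem_H10.mpr x.2⟩, Subtype.ext (conjC_conjC _)⟩⟩))
          · have e2 := finrank_real_of_complex R.H01
            rw [finrank_H01] at e2
            have e3 := e1.trans e2
            omega
          · apply Subtype.ext
            rw [← conjC_conjC (x : ℂ ⊗[ℝ] R.H), ← conjC_conjC (y : ℂ ⊗[ℝ] R.H)]
            exact congrArg (conjC _) (congrArg Subtype.val h)
        rw [finrank_HC, finrank_H01, h3]
        omega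
      · rw [Submodule.disjoint_def]
        exact fun x h h' => eq_zero_of_mem_H01_of_mem_H10 h' h
    obtain ⟨y, hy, w, hw, rfl⟩ := Submodule.mem_sup.mp (htop ▸ Submodule.mem_top : x ∈ R.H10 ⊔ R.H01)
    have e1 : ∀ a, R.hC (b a) w = 0 := fun a => hC_H01 (b a).2 hw
    have e2 : ∀ a, R.hC (conjC _ (b a : ℂ ⊗[ℝ] R.H)) y = 0 :=
      fun a => hC_H10 (conjC_mem_H10.mpr (b a).2) hy
    simp only [conjC_conjC, map_add, e1, e2, add_zero, zero_add]
    rw [← h01 w hw, ← h10 y hy]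

end RobinsonStructure

/-! ### Types of screen vectors, and U(m) as matrices in a unitary frame -/

namespace RobinsonStructure

open Robinson

variable {m : ℕ} {V : Type*} [AddCommGroup V] [Module ℝ V] {M : MinkowskiMetric m V}
  {R : RobinsonStructure M}

theorem U_hC (A : R.U) (x y : ℂ ⊗[ℝ] R.H) :
    R.hC (A.1.1.baseChange ℂ x) (A.1.1.baseChange ℂ y) = R.hC x y :=
  baseChange_form_comp A.2.1 x y

theorem U_H01 (A : R.U) {x : ℂ ⊗[ℝ] R.H} (hx : x ∈ R.H01) : A.1.1.baseChange ℂ x ∈ R.H01 :=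
  (A.2.2 x).mpr hx

theorem U_H10 (A : R.U) {x : ℂ ⊗[ℝ] R.H} (hx : x ∈ R.H10) : A.1.1.baseChange ℂ x ∈ R.H10 := by
  rw [mem_H10, conjC_baseChange]
  exact U_H01 A hx

variable (R) in
/-- `H^{(1,0)}` for `s = true` and `H^{(0,1)}` for `s = false`. -/
def typeSub (s : Bool) : Submodule ℂ (ℂ ⊗[ℝ] R.H) := if s then R.H10 else R.H01

@[simp] theorem typeSub_true : R.typeSub true = R.H10 := rfl
@[simp] theorem typeSub_false : R.typeSub false = R.H01 := rfl

theorem conjC_mem_typeSub {s : Bool} {x : ℂ ⊗[ℝ] R.H} (hx : x ∈ R.typeSub s) :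
    conjC _ x ∈ R.typeSub (!s) := by
  cases s
  · exact conjC_mem_H10.mpr hx
  · exact hx

theorem U_typeSub (A : R.U) {s : Bool} {x : ℂ ⊗[ℝ] R.H} (hx : x ∈ R.typeSub s) :
    A.1.1.baseChange ℂ x ∈ R.typeSub s := by
  cases s
  · exact U_H01 A hx
  · exact U_H10 A hx

namespace UnitaryFrame

variable (F : R.UnitaryFrame)

/-- The vectors `z_a` of the frame and their complex conjugates. -/
def ζ (s : Bool) (a : Fin m) : ℂ ⊗[ℝ] R.H := if s then F.z a else conjC _ (F.z a)

theorem ζ_mem (s : Bool) (a : Fin m) : F.ζ s a ∈ R.typeSub s := by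
  cases s
  · exact F.mem a
  · exact F.mem a

@[simp] theorem conjC_ζ (s : Bool) (a : Fin m) : conjC _ (F.ζ s a) = F.ζ (!s) a := by
  cases s <;> simp [ζ]

theorem hC_ζ (s s' : Bool) (a b : Fin m) :
    R.hC (F.ζ s a) (F.ζ s' b) = if s ≠ s' ∧ a = b then 1 else 0 := by
  cases s <;> cases s'
  · simpa using hC_H01 (F.ζ_mem false a) (F.ζ_mem false b)
  · rw [hC_symm]
    simp only [ζ]
    simpa [eq_comm] using F.hC_z b a
  · simpa [ζ] using F.hC_z a b
  · simpa using hC_H10 (F.ζ_mem true a) (F.ζ_mem true b)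

/-- The coordinate functionals of the frame. -/
def co (s : Bool) (a : Fin m) : (ℂ ⊗[ℝ] R.H) →ₗ[ℂ] ℂ := R.hC (F.ζ (!s) a)

theorem co_ζ (s s' : Bool) (a b : Fin m) :
    F.co s a (F.ζ s' b) = if s = s' ∧ a = b then 1 else 0 := by
  rw [co, hC_ζ]
  cases s <;> cases s' <;> simp

theorem co_conjC (s : Bool) (a : Fin m) (x : ℂ ⊗[ℝ] R.H) :
    F.co s a (conjC _ x) = starRingEnd ℂ (F.co (!s) a x) := by
  rw [co, co, ← hC_conj]
  simp

theorem co_eq_zero {s : Bool} {x : ℂ ⊗[ℝ] R.H} (hx : x ∈ R.typeSub (!s)) (a : Fin m) :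
    F.co s a x = 0 := by
  cases s
  · exact hC_H10 (F.ζ_mem true a) hx
  · exact hC_H01 (F.ζ_mem false a) hx

theorem expand_ζ (x : ℂ ⊗[ℝ] R.H) :
    x = ∑ a, F.co true a x • F.ζ true a + ∑ a, F.co false a x • F.ζ false a := F.expand x

/-- The projection onto `H^{(1,0)}` or `H^{(0,1)}`. -/
def pr (s : Bool) : (ℂ ⊗[ℝ] R.H) →ₗ[ℂ] (ℂ ⊗[ℝ] R.H) := ∑ a, (F.co s a).smulRight (F.ζ s a)

theorem pr_apply (s : Bool) (x : ℂ ⊗[ℝ] R.H) : F.pr s x = ∑ a, F.co s a x • F.ζ s a := by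
  simp [pr]

theorem pr_mem (s : Bool) (x : ℂ ⊗[ℝ] R.H) : F.pr s x ∈ R.typeSub s := by
  rw [pr_apply]
  exact Submodule.sum_mem _ fun a _ => Submodule.smul_mem _ _ (F.ζ_mem s a)

theorem pr_add_pr (s : Bool) (x : ℂ ⊗[ℝ] R.H) : F.pr s x + F.pr (!s) x = x := by
  cases s
  · rw [add_comm, pr_apply, pr_apply]; exact (F.expand_ζ x).symm
  · rw [pr_apply, pr_apply]; exact (F.expand_ζ x).symm

theorem pr_eq_zero {s : Bool} {x : ℂ ⊗[ℝ] R.H} (hx : x ∈ R.typeSub (!s)) : F.pr s x = 0 := by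
  rw [pr_apply]
  exact Finset.sum_eq_zero fun a _ => by rw [F.co_eq_zero hx, zero_smul]

theorem pr_eq_self {s : Bool} {x : ℂ ⊗[ℝ] R.H} (hx : x ∈ R.typeSub s) : F.pr s x = x := by
  have h := F.pr_add_pr s x
  rwa [F.pr_eq_zero (s := !s) (by rwa [Bool.not_not]), add_zero] at h

theorem pr_ζ (s : Bool) (a : Fin m) : F.pr s (F.ζ s a) = F.ζ s a := F.pr_eq_self (F.ζ_mem s a)

theorem conjC_pr (s : Bool) (x : ℂ ⊗[ℝ] R.H) : conjC _ (F.pr s x) = F.pr (!s) (conjC _ x) := by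
  simp [pr_apply, map_sum, co_conjC]

theorem pr_U (A : R.U) (s : Bool) (x : ℂ ⊗[ℝ] R.H) :
    F.pr s (A.1.1.baseChange ℂ x) = A.1.1.baseChange ℂ (F.pr s x) := by
  conv_lhs => rw [← F.pr_add_pr s x, map_add, map_add]
  rw [F.pr_eq_self (U_typeSub A (F.pr_mem s x)), F.pr_eq_zero (U_typeSub A (F.pr_mem (!s) x)),
    add_zero]

theorem ext_ζ {E : Type*} [AddCommGroup E] [Module ℂ E] {f f' : (ℂ ⊗[ℝ] R.H) →ₗ[ℂ] E}
    (h : ∀ s a, f (F.ζ s a) = f' (F.ζ s a)) : f = f' := by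
  refine LinearMap.ext fun x => ?_
  rw [F.expand_ζ x]
  simp only [map_add, map_sum, map_smul, h]

/-- The entries of a matrix or their complex conjugates. -/
def entry (u : Matrix (Fin m) (Fin m) ℂ) (s : Bool) (b a : Fin m) : ℂ :=
  if s then u b a else starRingEnd ℂ (u b a)

theorem conj_entry (u : Matrix (Fin m) (Fin m) ℂ) (s : Bool) (b a : Fin m) :
    starRingEnd ℂ (entry u s b a) = entry u (!s) b a := by
  cases s <;> simp [entry]

/-- The endomorphism with a given matrix in a unitary frame. -/
def ofMatrixC (u : Matrix (Fin m) (Fin m) ℂ) : (ℂ ⊗[ℝ] R.H) →ₗ[ℂ] (ℂ ⊗[ℝ] R.H) :=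
  ∑ s : Bool, ∑ a, (F.co s a).smulRight (∑ b, entry u s b a • F.ζ s b)

theorem ofMatrixC_ζ (u : Matrix (Fin m) (Fin m) ℂ) (s : Bool) (a : Fin m) :
    F.ofMatrixC u (F.ζ s a) = ∑ b, entry u s b a • F.ζ s b := by
  simp only [ofMatrixC, LinearMap.sum_apply, LinearMap.smulRight_apply, co_ζ]
  rw [Finset.sum_eq_single s, Finset.sum_eq_single a]
  · simp
  · intro b _ hb; simp [hb]
  · simp
  · intro s' _ hs; simp [hs]
  · simp

theorem ofMatrixC_conjC (u : Matrix (Fin m) (Fin m) ℂ) (x : ℂ ⊗[ℝ] R.H) :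
    F.ofMatrixC u (conjC _ x) = conjC _ (F.ofMatrixC u x) := by
  simp only [ofMatrixC, LinearMap.sum_apply, LinearMap.smulRight_apply, map_sum, conjC_smul,
    co_conjC, conjC_ζ, conj_entry, Fintype.sum_bool, Bool.not_true, Bool.not_false,
    LinearMap.add_apply, map_add]
  exact add_comm _ _

theorem ofMatrixC_mul (u v : Matrix (Fin m) (Fin m) ℂ) :
    F.ofMatrixC (u * v) = F.ofMatrixC u ∘ₗ F.ofMatrixC v := by
  refine F.ext_ζ fun s a => ?_
  simp only [LinearMap.comp_apply, ofMatrixC_ζ, map_sum, map_smul, Finset.smul_sum, smul_smul]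
  rw [Finset.sum_comm]
  refine Finset.sum_congr rfl fun b _ => ?_
  rw [← Finset.sum_smul]
  congr 1
  cases s <;> simp [entry, Matrix.mul_apply, mul_comm]

theorem ofMatrixC_one : F.ofMatrixC 1 = LinearMap.id := by
  refine F.ext_ζ fun s a => ?_
  rw [ofMatrixC_ζ, Finset.sum_eq_single a]
  · cases s <;> simp [entry]
  · intro b _ hb
    cases s <;> simp [entry, hb]
  · simp

theorem ofMatrixC_H01 (u : Matrix (Fin m) (Fin m) ℂ) {x : ℂ ⊗[ℝ] R.H} (hx : x ∈ R.H01) :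
    F.ofMatrixC u x ∈ R.H01 := by
  rw [← F.pr_eq_self (s := false) hx, pr_apply, map_sum]
  refine Submodule.sum_mem _ fun a _ => ?_
  rw [map_smul, ofMatrixC_ζ]
  exact Submodule.smul_mem _ _ (Submodule.sum_mem _ fun b _ =>
    Submodule.smul_mem _ _ (F.ζ_mem false b))

theorem hC_ofMatrixC {u : Matrix (Fin m) (Fin m) ℂ} (hu : star u * u = 1) (x y : ℂ ⊗[ℝ] R.H) :
    R.hC (F.ofMatrixC u x) (F.ofMatrixC u y) = R.hC x y := by
  have hu' : ∀ a b, ∑ c, starRingEnd ℂ (u c a) * u c b = if a = b then 1 else 0 := by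
    intro a b
    have := congrFun (congrFun hu a) b
    simpa [Matrix.mul_apply, Matrix.one_apply, Matrix.star_apply] using this
  have : R.hC.compl₁₂ (F.ofMatrixC u) (F.ofMatrixC u) = R.hC := by
    refine F.ext_ζ fun s a => F.ext_ζ fun s' b => ?_
    simp only [LinearMap.compl₁₂_apply, ofMatrixC_ζ, map_sum, LinearMap.sum_apply, map_smul,
      LinearMap.smul_apply, hC_ζ, smul_eq_mul]
    cases s <;> cases s' <;> simp [entry]
    · simpa [mul_comm] using hu' a b
    · simpa [mul_comm, eq_comm] using hu' b a
  exact LinearMap.congr_fun₂ this x y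

/-- The real endomorphism of the screen space with a given matrix in a unitary frame. -/
def ofMatrix (u : Matrix (Fin m) (Fin m) ℂ) : R.H →ₗ[ℝ] R.H := descend (F.ofMatrixC u)

theorem baseChange_ofMatrix (u : Matrix (Fin m) (Fin m) ℂ) :
    (F.ofMatrix u).baseChange ℂ = F.ofMatrixC u := baseChange_descend (F.ofMatrixC_conjC u)

theorem ofMatrix_mul (u v : Matrix (Fin m) (Fin m) ℂ) :
    F.ofMatrix (u * v) = F.ofMatrix u * F.ofMatrix v := by
  apply baseChange_injective'
  rw [LinearMap.baseChange_mul, baseChange_ofMatrix, baseChange_ofMatrix, baseChange_ofMatrix,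
    ofMatrixC_mul]
  rfl

theorem ofMatrix_one : F.ofMatrix 1 = 1 := by
  apply baseChange_injective'
  rw [baseChange_ofMatrix, ofMatrixC_one, LinearMap.baseChange_one]
  rfl

/-- The element of `U(m)` with a given unitary matrix in a unitary frame. -/
def ofUnitary (u : Matrix.unitaryGroup (Fin m) ℂ) : R.U :=
  ⟨⟨F.ofMatrix u.1, F.ofMatrix (star u.1), by
      rw [← ofMatrix_mul, Unitary.mul_star_self_of_mem u.2, ofMatrix_one], by
      rw [← ofMatrix_mul, Unitary.star_mul_self_of_mem u.2, ofMatrix_one]⟩, by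
    refine ⟨fun x y => ?_, fun z => ⟨fun h => ?_, fun h => ?_⟩⟩
    · have := F.hC_ofMatrixC (Unitary.star_mul_self_of_mem u.2) (1 ⊗ₜ x) (1 ⊗ₜ y)
      rw [← baseChange_ofMatrix] at this
      simpa [LinearMap.BilinForm.baseChange_tmul] using this
    · change (F.ofMatrix u.1).baseChange ℂ z ∈ R.H01 at h
      rw [baseChange_ofMatrix] at h
      have h1 := F.ofMatrixC_H01 (star u.1) h
      rw [← LinearMap.comp_apply, ← ofMatrixC_mul, Unitary.star_mul_self_of_mem u.2,
        ofMatrixC_one] at h1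
      exact h1
    · change (F.ofMatrix u.1).baseChange ℂ z ∈ R.H01
      rw [baseChange_ofMatrix]
      exact F.ofMatrixC_H01 _ h⟩

theorem baseChange_ofUnitary (u : Matrix.unitaryGroup (Fin m) ℂ) :
    (F.ofUnitary u).1.1.baseChange ℂ = F.ofMatrixC u.1 := F.baseChange_ofMatrix u.1

theorem ofUnitary_ζ (u : Matrix.unitaryGroup (Fin m) ℂ) (s : Bool) (a : Fin m) :
    (F.ofUnitary u).1.1.baseChange ℂ (F.ζ s a) = ∑ b, entry u.1 s b a • F.ζ s b := by
  rw [baseChange_ofUnitary, ofMatrixC_ζ]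

/-- An element of U is real and preserves types, so it is determined by its matrix on H^{(1,0)},
with the conjugate matrix on H^{(0,1)}. Pairing H^{(0,1)} with H^{(1,0)} shows that this matrix is
unitary. -/
theorem exists_ofUnitary (A : R.U) : ∃ u, F.ofUnitary u = A := by
  obtain ⟨u, hu0⟩ : ∃ u : Matrix (Fin m) (Fin m) ℂ,
      ∀ b a, u b a = F.co true b (A.1.1.baseChange ℂ (F.ζ true a)) := ⟨fun b a => _, fun _ _ => rfl⟩
  have hA : ∀ s a, A.1.1.baseChange ℂ (F.ζ s a) = ∑ b, entry u s b a • F.ζ s b := by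
    intro s a
    rw [← F.pr_eq_self (U_typeSub A (F.ζ_mem s a)), pr_apply]
    refine Finset.sum_congr rfl fun b _ => ?_
    cases s
    · have := F.co_conjC false b (A.1.1.baseChange ℂ (F.ζ true a))
      rw [conjC_baseChange, conjC_ζ] at this
      rw [show entry u false b a = starRingEnd ℂ (u b a) from rfl, hu0]
      exact congrArg (· • F.ζ false b) this
    · rw [show entry u true b a = u b a from rfl, hu0]
  have hu : star u * u = 1 := by
    ext a b
    have h1 := U_hC A (F.ζ false a) (F.ζ true b)
    rw [hA, hA, hC_ζ] at h1
    simp only [map_sum, LinearMap.sum_apply, map_smul, LinearMap.smul_apply, hC_ζ,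
      smul_eq_mul] at h1
    simpa [entry, Matrix.mul_apply, Matrix.one_apply, Matrix.star_apply, mul_comm] using h1
  refine ⟨⟨u, Matrix.mem_unitaryGroup_iff'.mpr hu⟩, ?_⟩
  apply Subtype.ext
  apply Units.ext
  apply baseChange_injective'
  rw [baseChange_ofUnitary]
  exact F.ext_ζ fun s a => by rw [ofMatrixC_ζ, hA]

/-- The coordinates in a unitary frame and its complex conjugate. -/
def coords : (ℂ ⊗[ℝ] R.H) ≃ₗ[ℂ] (Fin m ⊕ Fin m → ℂ) where
  toFun x := Sum.elim (fun a => F.co true a x) (fun a => F.co false a x)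
  map_add' x y := by ext (i | i) <;> simp
  map_smul' c x := by ext (i | i) <;> simp
  invFun c := ∑ a, c (Sum.inl a) • F.ζ true a + ∑ a, c (Sum.inr a) • F.ζ false a
  left_inv x := (F.expand_ζ x).symm
  right_inv c := by ext (i | i) <;> simp [co_ζ]

theorem coords_apply (x : ℂ ⊗[ℝ] R.H) :
    F.coords x = Sum.elim (fun a => F.co true a x) (fun a => F.co false a x) := rfl

theorem coords_symm_apply (c : Fin m ⊕ Fin m → ℂ) : F.coords.symm c =
    ∑ a, c (Sum.inl a) • F.ζ true a + ∑ a, c (Sum.inr a) • F.ζ false a := rfl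

/-- The basis of the complexified screen space which consists of a unitary frame and its
complex conjugate. -/
def basis : Module.Basis (Fin m ⊕ Fin m) ℂ (ℂ ⊗[ℝ] R.H) := Module.Basis.ofEquivFun F.coords

theorem basis_inl (a : Fin m) : F.basis (Sum.inl a) = F.ζ true a := by
  rw [basis, Module.Basis.coe_ofEquivFun]
  beta_reduce
  rw [coords_symm_apply]
  simp [Pi.single_apply]

theorem basis_inr (a : Fin m) : F.basis (Sum.inr a) = F.ζ false a := by
  rw [basis, Module.Basis.coe_ofEquivFun]
  beta_reduce
  rw [coords_symm_apply]
  simp [Pi.single_apply]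

theorem basis_repr (x : ℂ ⊗[ℝ] R.H) (i : Fin m ⊕ Fin m) : F.basis.repr x i = F.coords x i := by
  rw [← Module.Basis.equivFun_apply, basis, Module.Basis.equivFun_ofEquivFun]

/-- In the frame and its conjugate the complexified map is block diagonal with blocks u and ū. The
consequence is that elements of U have determinant one, as required for lifting them to Q. -/
theorem det_ofMatrix (u : Matrix (Fin m) (Fin m) ℂ) :
    ((LinearMap.det (F.ofMatrix u) : ℝ) : ℂ) = u.det * starRingEnd ℂ u.det := by
  have h1 : LinearMap.toMatrix F.basis F.basis (F.ofMatrixC u) =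
      Matrix.fromBlocks u 0 0 (u.map (starRingEnd ℂ)) := by
    ext (i | i) (j | j) <;>
    simp [LinearMap.toMatrix_apply, basis_inl, basis_inr, ofMatrixC_ζ, basis_repr, coords_apply, co_ζ,
      entry]
  have h2 := LinearMap.det_baseChange (A := ℂ) (F.ofMatrix u)
  rw [Complex.coe_algebraMap] at h2
  rw [← h2, baseChange_ofMatrix, ← LinearMap.det_toMatrix F.basis, h1,
    Matrix.det_fromBlocks_zero₂₁]
  congr 1
  exact (RingHom.map_det _ _).symm

end UnitaryFrame

/-! ### Surjectivity of Q → Q₀ -/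

theorem det_U (A : R.U) : LinearMap.det A.1.1 = 1 := by
  obtain ⟨F⟩ := R.exists_unitaryFrame
  obtain ⟨u, rfl⟩ := F.exists_ofUnitary A
  have h := F.det_ofMatrix u.1
  have h1 : u.1.det * starRingEnd ℂ u.1.det = 1 := by
    have := congrArg Matrix.det (Unitary.mul_star_self_of_mem u.2)
    rw [Matrix.det_mul, Matrix.det_one, Matrix.star_eq_conjTranspose,
      Matrix.det_conjTranspose] at this
    exact this
  rw [h1] at h
  exact_mod_cast h

/-- K is a line, so the determinant which defines `scale` is simply the eigenvalue. The inverse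
appears because group elements act on forms through q⁻¹. -/
theorem scale_smul (q : R.Q) {k : V} (hk : k ∈ R.K) : R.repV q⁻¹ k = (R.scale q : ℝ) • k := by
  obtain ⟨c, hc, h⟩ := (q⁻¹).2.2.2.2
  obtain ⟨P⟩ := R.exists_nullPair
  have h1 : R.repK q⁻¹ = c • (1 : Module.End ℝ R.K) := by
    ext k
    exact h k k.2
  have h2 : Module.finrank ℝ R.K = 1 := by
    rw [finrank_eq_one_iff_of_nonzero' (⟨P.k, P.k_mem⟩ : R.K) (fun h => P.k_ne_zero
      (congrArg Subtype.val h))]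
    intro w
    exact ⟨_, Subtype.ext (P.eq_smul_of_mem_K w.2).symm⟩
  have h3 : (R.scale q : ℝ) = c := by
    have e1 : R.scale q = (R.scale q⁻¹)⁻¹ := by rw [map_inv, inv_inv]
    rw [e1]
    change ((⟨LinearMap.det (R.repK q⁻¹), R.det_repK_pos q⁻¹⟩ : {c : ℝ // 0 < c})⁻¹)⁻¹.1 = c
    rw [inv_inv]
    change LinearMap.det (R.repK q⁻¹) = c
    rw [h1, LinearMap.det_smul, h2, map_one, mul_one, pow_one]
  rw [h3]
  exact h k hk

namespace NullPair

variable (P : R.NullPair)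

/-- The isometry which scales `k` by `c⁻¹` and `l` by `c` and acts on the screen space by `A`. -/
def lift (c : ℝ) (A : R.H →ₗ[ℝ] R.H) : V →ₗ[ℝ] V :=
  c⁻¹ • (M.g P.l).smulRight P.k + c • (M.g P.k).smulRight P.l + P.σ ∘ₗ A ∘ₗ P.τ

theorem lift_apply (c : ℝ) (A : R.H →ₗ[ℝ] R.H) (v : V) :
    P.lift c A v = (c⁻¹ * M.g P.l v) • P.k + (c * M.g P.k v) • P.l + P.σ (A (P.τ v)) := by
  simp [lift, mul_smul]

theorem lift_mul (c d : ℝ) (A B : R.H →ₗ[ℝ] R.H) :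
    P.lift c A * P.lift d B = P.lift (c * d) (A * B) := by
  ext v
  rw [Module.End.mul_apply, P.lift_apply d, P.lift_apply, P.lift_apply]
  simp only [map_add, map_smul, P.g_lk, P.g_ll, P.g_l_σ, P.g_kl, P.g_kk, P.g_k_σ, P.τ_k, P.τ_l,
    P.τ_σ, smul_eq_mul, mul_zero, mul_one, add_zero, zero_add, smul_zero, Module.End.mul_apply,
    mul_inv]
  congr 3 <;> ring

theorem lift_one : P.lift 1 1 = 1 := by
  ext v
  rw [lift_apply]
  simpa using (P.eq_add v).symm

theorem g_lift {c : ℝ} (hc : c ≠ 0) {A : R.H →ₗ[ℝ] R.H} (hA : ∀ x y, R.h (A x) (A y) = R.h x y)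
    (v w : V) : M.g (P.lift c A v) (P.lift c A w) = M.g v w := by
  have e : ∀ (a b a' b' : ℝ) (x y : R.H), M.g (a • P.k + b • P.l + P.σ x)
      (a' • P.k + b' • P.l + P.σ y) = a * b' + b * a' + R.h x y := by
    intro a b a' b' x y
    simp only [map_add, map_smul, LinearMap.add_apply, LinearMap.smul_apply, P.g_lk, P.g_ll,
      P.g_l_σ, P.g_kl, P.g_kk, P.g_k_σ, P.h_eq, smul_eq_mul, M.symm (P.σ x) P.k,
      M.symm (P.σ x) P.l]
    ring
  conv_rhs => rw [P.eq_add v, P.eq_add w, e]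
  rw [lift_apply, lift_apply, e, hA]
  field_simp

/-- In the splitting the map is block diagonal with blocks c⁻¹, c and A, and the first two cancel.
-/
theorem det_lift {c : ℝ} (hc : c ≠ 0) (A : R.H →ₗ[ℝ] R.H) :
    LinearMap.det (P.lift c A) = LinearMap.det A := by
  have h : P.splitting.toLinearMap ∘ₗ P.lift c A ∘ₗ P.splitting.symm.toLinearMap =
      LinearMap.prodMap (c⁻¹ • LinearMap.id) (LinearMap.prodMap (c • LinearMap.id) A) := by
    refine LinearMap.ext fun x => ?_
    obtain ⟨v, rfl⟩ := P.splitting.surjective x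
    have hs : ∀ v, P.splitting v = (M.g P.l v, M.g P.k v, P.τ v) := fun _ => rfl
    simp only [LinearMap.comp_apply, LinearEquiv.coe_coe, LinearEquiv.symm_apply_apply]
    simp only [hs, lift_apply]
    simp [P.g_lk, P.g_ll, P.g_l_σ, P.g_kl, P.g_kk, P.g_k_σ, P.τ_k, P.τ_l, P.τ_σ]
  have := M.finite
  rw [← LinearMap.det_conj (P.lift c A) P.splitting, h, LinearMap.det_prodMap,
    LinearMap.det_prodMap, LinearMap.det_smul, LinearMap.det_smul]
  simp [hc]

theorem lift_mem_N {c : ℝ} {A : R.H →ₗ[ℝ] R.H} (hA : ∀ z ∈ R.H01, A.baseChange ℂ z ∈ R.H01)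
    {v : ℂ ⊗[ℝ] V} (hv : v ∈ R.N) : (P.lift c A).baseChange ℂ v ∈ R.N := by
  have hk : P.lift c A P.k = c⁻¹ • P.k := by
    rw [lift_apply]; simp [P.g_lk, P.g_kk, P.τ_k]
  have h1 : P.lift c A ∘ₗ P.σ = P.σ ∘ₗ A := by
    ext x
    simp [lift_apply, P.g_l_σ, P.g_k_σ, P.τ_σ]
  rw [P.eq_add_of_mem_N hv, map_add, map_smul, LinearMap.baseChange_tmul, hk, σC,
    ← LinearMap.comp_apply, ← LinearMap.baseChange_comp, h1, LinearMap.baseChange_comp,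
    LinearMap.comp_apply]
  refine R.N.add_mem (R.N.smul_mem _ ?_) (P.mem_H01_iff.mp (hA _ ?_))
  · rw [TensorProduct.tmul_smul]
    exact R.N.smul_of_tower_mem _ P.k_mem
  · exact P.mem_H01_iff.mpr (P.σC_τC_mem hv)

/-- The element of `Q` given by an element of `Q₀`. -/
def liftQ (q : R.Q₀) : R.Q :=
  ⟨⟨P.lift q.1 q.2.1.1, P.lift (q.1 : ℝ)⁻¹ (q.2⁻¹).1.1, by
      rw [lift_mul, mul_inv_cancel₀ q.1.2.ne', ← Units.val_mul, ← Subgroup.coe_mul,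
        mul_inv_cancel]
      exact P.lift_one, by
      rw [lift_mul, inv_mul_cancel₀ q.1.2.ne', ← Units.val_mul, ← Subgroup.coe_mul,
        inv_mul_cancel]
      exact P.lift_one⟩, by
    refine ⟨P.g_lift q.1.2.ne' q.2.2.1, (P.det_lift q.1.2.ne' _).trans (det_U q.2),
      fun z => ⟨fun h => ?_, fun h => P.lift_mem_N (fun z hz => U_H01 _ hz) h⟩,
      (q.1 : ℝ)⁻¹, inv_pos.mpr q.1.2, fun k hk => ?_⟩
    · have h1 := P.lift_mem_N (c := (q.1 : ℝ)⁻¹) (A := (q.2⁻¹).1.1) (fun z hz => U_H01 _ hz) h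
      rw [← Module.End.mul_apply, ← LinearMap.baseChange_mul, lift_mul,
        inv_mul_cancel₀ q.1.2.ne', ← Units.val_mul, ← Subgroup.coe_mul, inv_mul_cancel] at h1
      have h2 : P.lift 1 ((1 : R.U) : LinearMap.GeneralLinearGroup ℝ R.H).1 = 1 := P.lift_one
      rw [h2, LinearMap.baseChange_one] at h1
      exact h1
    · change P.lift q.1 q.2.1.1 k = _
      rw [P.eq_smul_of_mem_K hk, map_smul, lift_apply]
      simp [P.g_lk, P.g_kk, P.τ_k, smul_smul, mul_comm]⟩

end NullPair

/-- Once a null pair is chosen, the block-diagonal elements `liftQ` give a section. -/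
theorem toQ₀_surjective : Function.Surjective R.toQ₀ := by
  obtain ⟨P⟩ := R.exists_nullPair
  intro q
  refine ⟨P.liftQ q, Prod.ext ?_ ?_⟩
  · apply Subtype.ext
    have h1 := scale_smul (P.liftQ q) P.k_mem
    have h2 : R.repV (P.liftQ q)⁻¹ P.k = (q.1 : ℝ) • P.k := by
      change P.lift (q.1 : ℝ)⁻¹ (q.2⁻¹).1.1 P.k = _
      rw [P.lift_apply]
      simp [P.g_lk, P.g_kk, P.τ_k]
    rw [h2] at h1
    exact (smul_left_injective ℝ P.k_ne_zero h1).symm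
  · apply Subtype.ext
    apply Units.ext
    refine LinearMap.ext fun x => ?_
    rw [← P.mk_σ x]
    change Submodule.Quotient.mk (p := R.K.submoduleOf R.Kperp) (⟨P.lift q.1 q.2.1.1 (P.σ x), _⟩ : R.Kperp) = _
    rw [P.mk_σ, ← P.τ_mk]
    simp [P.lift_apply, P.g_l_σ, P.g_k_σ, P.τ_σ]

end RobinsonStructure

namespace Robinson

/-! ### Arrays and the action of elementary matrices -/

section Arrays

variable {k m : ℕ}

/-- Complex arrays with `k` indices in `Fin m`. -/
abbrev Arr (k m : ℕ) : Type := (Fin k → Fin m) → ℂ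

/-- The action of a matrix, as an element of `𝔤𝔩(m)`, on arrays; the index in the slot `i` is
covariant if `ε i` is true and contravariant otherwise. -/
def act (ε : Fin k → Bool) (X : Matrix (Fin m) (Fin m) ℂ) (A : Arr k m) : Arr k m := fun a =>
  ∑ i, ∑ b, (if ε i then X b (a i) else - X (a i) b) * A (Function.update a i b)

/-- The action of the elementary matrix with entry `1` at `(p, q)`. -/
def elemAct (ε : Fin k → Bool) (p q : Fin m) (A : Arr k m) : Arr k m := fun a =>
  ∑ i, if ε i then (if a i = q then A (Function.update a i p) else 0)
    else - (if a i = p then A (Function.update a i q) else 0)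

theorem act_single (ε : Fin k → Bool) (p q : Fin m) (A : Arr k m) :
    act ε (Matrix.single p q 1) A = elemAct ε p q A := by
  funext a
  refine Finset.sum_congr rfl fun i _ => ?_
  cases ε i
  · simp only [Bool.false_eq_true, if_false, Matrix.single_apply]
    by_cases h : a i = p
    · simp [h]
    · simp [h, Ne.symm h]
  · simp only [if_true, Matrix.single_apply]
    by_cases h : a i = q
    · simp [h]
    · simp [h, Ne.symm h]

/-- The weight of an index for the diagonal torus. -/
def wt (ε : Fin k → Bool) (p : Fin m) (a : Fin k → Fin m) : ℤ :=
  ∑ i, if a i = p then (if ε i then 1 else -1) else 0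

theorem elemAct_self (ε : Fin k → Bool) (p : Fin m) (A : Arr k m) (a : Fin k → Fin m) :
    elemAct ε p p A a = wt ε p a * A a := by
  rw [elemAct, wt, Int.cast_sum, Finset.sum_mul]
  refine Finset.sum_congr rfl fun i _ => ?_
  by_cases h : a i = p
  · subst h
    cases ε i <;> simp
  · cases ε i <;> simp [h]

/-- Subspaces of arrays which are invariant under the elementary matrices and the permutation
matrices. -/
structure ArrInvariant (ε : Fin k → Bool) (W : Submodule ℂ (Arr k m)) : Prop where
  elem : ∀ p q, ∀ A ∈ W, elemAct ε p q A ∈ W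
  perm : ∀ s : Equiv.Perm (Fin m), ∀ A ∈ W, (fun a => A (s ∘ a)) ∈ W

variable {ε : Fin k → Bool} {W E : Submodule ℂ (Arr k m)}

/-- The diagonal elementary matrix multiplies each entry by its weight, so a polynomial in this
operator multiplies entries by the value of the polynomial at the weight. -/
theorem ArrInvariant.polynomial_mem (hW : ArrInvariant ε W) (p : Fin m) (f : Polynomial ℂ)
    {A : Arr k m} (hA : A ∈ W) : (fun a => f.eval (wt ε p a : ℂ) * A a) ∈ W := by
  induction f using Polynomial.induction_on' with
  | add f g hf hg =>
    convert! W.add_mem hf hg using 1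
    funext a
    simp [add_mul]
  | monomial n c =>
    have : ∀ n : ℕ, (fun a => (wt ε p a : ℂ) ^ n * A a) ∈ W := by
      intro n
      induction n with
      | zero => simpa using hA
      | succ n ih =>
        convert! hW.elem p p _ ih using 1
        funext a
        rw [elemAct_self]
        ring
    convert! W.smul_mem c (this n) using 1
    funext a
    simp [mul_assoc]

/-- Lagrange basis polynomials in the diagonal operators, applied for one p after the other, project
onto the simultaneous weight space of x. They take the value one at the weight of x, so the entry at
x survives. -/
theorem ArrInvariant.weight_mem (hW : ArrInvariant ε W) (x : Fin k → Fin m) {A : Arr k m}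
    (hA : A ∈ W) : ∃ B ∈ W, B x = A x ∧ ∀ a, B a ≠ 0 → ∀ p, wt ε p a = wt ε p x := by
  classical
  have key : ∀ s : Finset (Fin m),
      ∃ B ∈ W, B x = A x ∧ ∀ a, B a ≠ 0 → ∀ p ∈ s, wt ε p a = wt ε p x := by
    intro s
    induction s using Finset.induction_on with
    | empty => exact ⟨A, hA, rfl, by simp⟩
    | insert p s _ ih =>
      obtain ⟨B, hB, hx, hs⟩ := ih
      let S : Finset ℂ := Finset.univ.image fun a => (wt ε p a : ℂ)
      have hmem : ∀ a, (wt ε p a : ℂ) ∈ S := fun a => Finset.mem_image_of_mem _ (Finset.mem_univ a)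
      refine ⟨_, hW.polynomial_mem p (Lagrange.basis S id (wt ε p x : ℂ)) hB, ?_, ?_⟩
      · have := Lagrange.eval_basis_self (s := S) (v := id) (Set.injOn_id _) (hmem x)
        simp only [id] at this
        simp [this, hx]
      · intro a ha q hq
        rcases Finset.mem_insert.mp hq with rfl | hq
        · by_contra hne
          have hne' : (wt ε q x : ℂ) ≠ (wt ε q a : ℂ) := fun h => hne (by exact_mod_cast h.symm)
          have := Lagrange.eval_basis_of_ne (s := S) (v := id) hne' (hmem a)
          simp only [id] at this
          simp [this] at ha
        · exact hs a (right_ne_zero_of_mul ha) q hq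
  obtain ⟨B, hB, hx, hs⟩ := key Finset.univ
  exact ⟨B, hB, hx, fun a ha p => hs a ha p (Finset.mem_univ p)⟩

/-- The standard Hermitian product of arrays. -/
def arrDot (A B : Arr k m) : ℂ := ∑ a, starRingEnd ℂ (A a) * B a

/-- The adjoint of E_pq is E_qp, so orthogonal complements of invariant subspaces are invariant. -/
theorem arrDot_elemAct (p q : Fin m) (A B : Arr k m) :
    arrDot A (elemAct ε p q B) = arrDot (elemAct ε q p A) B := by
  have key : ∀ (i : Fin k) (p q : Fin m), ∑ a, starRingEnd ℂ (A a) *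
      (if a i = q then B (Function.update a i p) else 0) =
      ∑ a, (if a i = p then starRingEnd ℂ (A (Function.update a i q)) else 0) * B a := by
    intro i p q
    simp only [mul_ite, mul_zero, ite_mul, zero_mul, ← Finset.sum_filter]
    refine Finset.sum_nbij' (fun a => Function.update a i p) (fun a => Function.update a i q)
      ?_ ?_ ?_ ?_ ?_
    · simp
    · simp
    · intro a ha
      have : a i = q := by simpa using ha
      simp [← this]
    · intro a ha
      have : a i = p := by simpa using ha
      simp [← this]
    · intro a ha
      have : a i = q := by simpa using ha
      simp [← this]
  simp only [arrDot, elemAct, map_sum, Finset.sum_mul, Finset.mul_sum]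
  rw [Finset.sum_comm]
  conv_rhs => rw [Finset.sum_comm]
  refine Finset.sum_congr rfl fun i _ => ?_
  cases ε i
  · simp only [Bool.false_eq_true, if_false, mul_neg, map_neg, neg_mul, Finset.sum_neg_distrib,
      apply_ite (starRingEnd ℂ), map_zero]
    rw [key i q p]
  · simp only [if_true, apply_ite (starRingEnd ℂ), map_zero]
    rw [key i p q]

theorem exists_arrDot_eq_zero (h : W ≤ E) (hne : W ≠ E) :
    ∃ B ∈ E, B ≠ 0 ∧ ∀ A ∈ W, arrDot A B = 0 := by
  obtain ⟨v, hvE, hvW⟩ := SetLike.exists_of_lt (lt_of_le_of_ne h hne)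
  let e := WithLp.linearEquiv 2 ℂ (Arr k m)
  let W' : Submodule ℂ (EuclideanSpace ℂ (Fin k → Fin m)) := W.comap e.toLinearMap
  have hdot : ∀ x y, inner ℂ x y = arrDot (e x) (e y) := by
    intro x y
    rw [PiLp.inner_apply]
    exact Finset.sum_congr rfl fun a _ => mul_comm _ _
  have hp : e (W'.starProjection (e.symm v)) ∈ W := W'.starProjection_apply_mem (e.symm v)
  refine ⟨v - e (W'.starProjection (e.symm v)), E.sub_mem hvE (h hp), fun h0 => hvW ?_, ?_⟩
  · rw [sub_eq_zero] at h0
    rw [h0]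
    exact hp
  · intro A hA
    have := W'.sub_starProjection_mem_orthogonal (e.symm v) (e.symm A) (by simpa [W'] using hA)
    rw [hdot] at this
    simpa using this

/-- An irreducibility criterion for modules of arrays: a weight space of the module is spanned by
one vector, and every non-zero submodule contains a vector whose component in this weight space
is non-zero. -/
theorem arr_irreducible (x : Fin k → Fin m) (hE : ArrInvariant ε E)
    (h1 : ∀ S ∈ E, (∀ a, S a ≠ 0 → ∀ p, wt ε p a = wt ε p x) → S x = 0 → S = 0)
    (h2 : ∀ T ∈ E, T ≠ 0 → ∃ s : Equiv.Perm (Fin m), T (s ∘ x) ≠ 0 ∨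
      ∃ p q, elemAct ε p q T (s ∘ x) ≠ 0)
    (hW : ArrInvariant ε W) (hWE : W ≤ E) : W = ⊥ ∨ W = E := by
  -- By `h2` some element of W has a nonzero entry at a permutation of x. A permutation matrix moves
  -- this entry to x, and the weight projection then isolates the weight space.
  have claim : ∀ W : Submodule ℂ (Arr k m), ArrInvariant ε W → W ≤ E → W ≠ ⊥ →
      ∃ B ∈ W, B x ≠ 0 ∧ ∀ a, B a ≠ 0 → ∀ p, wt ε p a = wt ε p x := by
    intro W hW hWE hne
    obtain ⟨T, hT, hT0⟩ := (Submodule.ne_bot_iff _).mp hne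
    have h3 : ∃ T' ∈ W, ∃ s : Equiv.Perm (Fin m), T' (s ∘ x) ≠ 0 := by
      obtain ⟨s, h | ⟨p, q, h⟩⟩ := h2 T (hWE hT) hT0
      · exact ⟨T, hT, s, h⟩
      · exact ⟨_, hW.elem p q T hT, s, h⟩
    obtain ⟨T', hT', s, hs⟩ := h3
    obtain ⟨B, hB, hBx, hBs⟩ := hW.weight_mem x (hW.perm s T' hT')
    exact ⟨B, hB, by rw [hBx]; exact hs, hBs⟩
  by_contra! hcon
  obtain ⟨hb, hne⟩ := hcon
  -- The orthogonal complement of W in E. It is invariant and nonzero when W ≠ E, so the claim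
  -- applies to W and W' alike.
  let W' : Submodule ℂ (Arr k m) :=
    { carrier := {B | B ∈ E ∧ ∀ A ∈ W, arrDot A B = 0}
      add_mem' := fun {B C} hB hC => ⟨E.add_mem hB.1 hC.1, fun A hA => by
        have e : arrDot A (B + C) = arrDot A B + arrDot A C := by
          simp [arrDot, mul_add, Finset.sum_add_distrib]
        rw [e, hB.2 A hA, hC.2 A hA, add_zero]⟩
      zero_mem' := ⟨E.zero_mem, fun A _ => by simp [arrDot]⟩
      smul_mem' := fun c B hB => ⟨E.smul_mem c hB.1, fun A hA => by
        have e : arrDot A (c • B) = c * arrDot A B := by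
          simp [arrDot, Finset.mul_sum, mul_left_comm]
        rw [e, hB.2 A hA, mul_zero]⟩ }
  have hW' : ArrInvariant ε W' := by
    refine ⟨fun p q B hB => ⟨hE.elem p q B hB.1, fun A hA => ?_⟩,
      fun s B hB => ⟨hE.perm s B hB.1, fun A hA => ?_⟩⟩
    · rw [arrDot_elemAct]
      exact hB.2 _ (hW.elem q p A hA)
    · rw [← hB.2 _ (hW.perm s⁻¹ A hA)]
      refine Fintype.sum_equiv (Equiv.arrowCongr (Equiv.refl _) s) _ _ fun a => ?_
      have : (s⁻¹ : Equiv.Perm (Fin m)) ∘ (s ∘ a) = a := by ext i; simp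
      simp [Equiv.arrowCongr, ← Function.comp_assoc s.symm]
  obtain ⟨w, hw, hwx, hws⟩ := claim W hW hWE hb
  obtain ⟨B, hBE, hB0, hB⟩ := exists_arrDot_eq_zero hWE hne
  obtain ⟨w', hw', hwx', hws'⟩ := claim W' hW' (fun _ h => h.1)
    ((Submodule.ne_bot_iff _).mpr ⟨B, ⟨hBE, hB⟩, hB0⟩)
  -- This combination has the weight of x and vanishes at x, hence is zero by `h1`. So w and w' are
  -- proportional as well as orthogonal, which forces w = 0.
  have h0 := h1 (w' x • w - w x • w') (E.sub_mem (E.smul_mem _ (hWE hw)) (E.smul_mem _ hw'.1))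
    (by
      intro a ha
      by_cases h : w a = 0
      · refine hws' a fun h' => ha ?_
        simp [h, h']
      · exact hws a h) (by simp [mul_comm])
  have h4 : arrDot w w' = 0 := hw'.2 w hw
  have h5 : w x * arrDot w w' = w' x * arrDot w w := by
    simp only [arrDot, Finset.mul_sum]
    refine Finset.sum_congr rfl fun a _ => ?_
    have : w' x * w a - w x * w' a = 0 := congrFun h0 a
    linear_combination (-starRingEnd ℂ (w a)) * this
  rw [h4, mul_zero, eq_comm, mul_eq_zero] at h5
  have h6 : arrDot w w = ((∑ a, Complex.normSq (w a) : ℝ) : ℂ) := by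
    rw [arrDot, Complex.ofReal_sum]
    exact Finset.sum_congr rfl fun a _ => by rw [Complex.normSq_eq_conj_mul_self]
  have h7 := h5.resolve_left hwx'
  rw [h6, Complex.ofReal_eq_zero, Finset.sum_eq_zero_iff_of_nonneg
    (fun a _ => Complex.normSq_nonneg _)] at h7
  exact hwx (Complex.normSq_eq_zero.mp (h7 x (Finset.mem_univ x)))

end Arrays

end Robinson

/-! ### From the unitary group to elementary matrices -/

namespace Robinson

open RobinsonStructure.UnitaryFrame

section Arrays

variable {k m : ℕ}

/-- The action of a matrix, as an element of `GL(m)`, on arrays. -/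
def mact (ε : Fin k → Bool) (u : Matrix (Fin m) (Fin m) ℂ) (A : Arr k m) : Arr k m := fun a =>
  ∑ b : Fin k → Fin m, (∏ i, entry u (ε i) (b i) (a i)) * A b

variable {ε : Fin k → Bool}

theorem mact_add (u : Matrix (Fin m) (Fin m) ℂ) (A B : Arr k m) :
    mact ε u (A + B) = mact ε u A + mact ε u B := by
  funext a
  simp [mact, mul_add, Finset.sum_add_distrib]

theorem mact_smul (u : Matrix (Fin m) (Fin m) ℂ) (c : ℂ) (A : Arr k m) :
    mact ε u (c • A) = c • mact ε u A := by
  funext a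
  simp [mact, Finset.mul_sum, mul_left_comm]

theorem mact_perm (s : Equiv.Perm (Fin m)) (A : Arr k m) :
    mact ε (Matrix.of fun b a => if b = s a then 1 else 0) A = fun a => A (s ∘ a) := by
  funext a
  simp only [mact]
  rw [Finset.sum_eq_single (s ∘ a)]
  · rw [Finset.prod_eq_one, one_mul]
    intro i _
    cases ε i <;> simp [entry]
  · intro b _ hb
    obtain ⟨i, hi⟩ := Function.ne_iff.mp hb
    rw [Finset.prod_eq_zero (Finset.mem_univ i), zero_mul]
    have : ¬ b i = s (a i) := hi
    cases ε i <;> simp [entry, this]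
  · simp

/-- The form in which the product rule appears at the identity matrix: all slots but one carry
Kronecker deltas, and a sum over the index in the remaining slot is left. -/
theorem sum_prod_erase_delta (a : Fin k → Fin m) (i : Fin k) (f : (Fin k → Fin m) → ℂ) :
    ∑ b : Fin k → Fin m, (∏ j ∈ Finset.univ.erase i, if b j = a j then (1 : ℂ) else 0) * f b =
      ∑ c, f (Function.update a i c) := by
  have h : ∀ b : Fin k → Fin m, (∏ j ∈ Finset.univ.erase i, if b j = a j then (1 : ℂ) else 0) =
      if Function.update a i (b i) = b then 1 else 0 := by
    intro b
    split_ifs with h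
    · refine Finset.prod_eq_one fun j hj => ?_
      rw [← h, Function.update_of_ne (Finset.ne_of_mem_erase hj)]
      simp
    · obtain ⟨j, hj⟩ := Function.ne_iff.mp h
      have hji : j ≠ i := by rintro rfl; simp at hj
      refine Finset.prod_eq_zero (Finset.mem_erase.mpr ⟨hji, Finset.mem_univ j⟩) ?_
      rw [Function.update_of_ne hji] at hj
      simp [Ne.symm hj]
  simp only [h, ite_mul, one_mul, zero_mul, ← Finset.sum_filter]
  refine Finset.sum_nbij' (fun b => b i) (fun c => Function.update a i c) ?_ ?_ ?_ ?_ ?_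
  · simp
  · simp
  · intro b hb
    simpa using hb
  · simp
  · intro b hb
    have : Function.update a i (b i) = b := by simpa using hb
    rw [this]

/-- A real subspace of arrays which is invariant under the unitary group is invariant under its
Lie algebra. -/
theorem act_mem_of_mact_mem {W : Submodule ℝ (Arr k m)}
    (hW : ∀ u ∈ Matrix.unitaryGroup (Fin m) ℂ, ∀ A ∈ W, mact ε u A ∈ W)
    {P : Matrix (Fin m) (Fin m) ℂ} (hP : P.conjTranspose = P) (hPP : P * P = P) {A : Arr k m}
    (hA : A ∈ W) : Complex.I • act ε P A ∈ W := by
  have hPc : ∀ a b, starRingEnd ℂ (P a b) = P b a := fun a b => congrFun (congrFun hP b) a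
  -- For a Hermitian idempotent P this is exp(itP) in closed form: a curve of unitary matrices with
  -- derivative iP at t = 0.
  let u : ℝ → Matrix (Fin m) (Fin m) ℂ := fun t => 1 + (Complex.exp (t * Complex.I) - 1) • P
  have hu : ∀ t, u t ∈ Matrix.unitaryGroup (Fin m) ℂ := by
    intro t
    rw [Matrix.mem_unitaryGroup_iff']
    have h1 : star (u t) = 1 + (Complex.exp (-(t * Complex.I)) - 1) • P := by
      rw [Matrix.star_eq_conjTranspose, Matrix.conjTranspose_add, Matrix.conjTranspose_smul, hP,
        Matrix.conjTranspose_one, star_sub, star_one]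
      congr 3
      change starRingEnd ℂ _ = _
      rw [← Complex.exp_conj]
      simp
    have h2 : Complex.exp (-(t * Complex.I)) * Complex.exp (t * Complex.I) = 1 := by
      rw [← Complex.exp_add]; simp
    rw [h1]
    simp only [u]
    rw [add_mul, mul_add, mul_add, one_mul, mul_one, one_mul, smul_mul_smul_comm, hPP, add_assoc,
      ← add_smul, ← add_smul]
    have : Complex.exp (t * Complex.I) - 1 + (Complex.exp (-(t * Complex.I)) - 1 +
      (Complex.exp (-(t * Complex.I)) - 1) * (Complex.exp (t * Complex.I) - 1)) = 0 := by
        linear_combination h2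
    rw [this, zero_smul, add_zero]
  have hexp : HasDerivAt (fun t : ℝ => Complex.exp (t * Complex.I)) Complex.I 0 := by
    have := ((hasDerivAt_id (0 : ℝ)).ofReal_comp.mul_const Complex.I).cexp
    simpa using this
  have hent : ∀ s b a, HasDerivAt (fun t => entry (u t) s b a)
      (Complex.I * (if s then P b a else - P a b)) 0 := by
    intro s b a
    have h1 : HasDerivAt (fun t => u t b a) (Complex.I * P b a) 0 := by
      have := ((hexp.sub_const 1).mul_const (P b a)).const_add ((1 : Matrix _ _ ℂ) b a)
      simpa [u] using this
    cases s
    · have h2 := (Complex.conjCLE.toContinuousLinearMap.hasFDerivAt.comp_hasDerivAt (0 : ℝ) h1)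
      simp only [entry, Bool.false_eq_true, if_false]
      convert! h2 using 1
      simp [hPc]
    · simpa [entry] using h1
  have hent0 : ∀ s b a, entry (u 0) s b a = if b = a then 1 else 0 := by
    intro s b a
    cases s <;> by_cases h : b = a <;> simp [entry, u, h]
  obtain ⟨c, hc⟩ : ∃ c : Fin k → Fin m → Fin m → ℂ,
      ∀ i b a, Complex.I * (if ε i then P b a else - P a b) = c i b a := ⟨_, fun _ _ _ => rfl⟩
  have hprod : ∀ b a : Fin k → Fin m, HasDerivAt (fun t => ∏ i, entry (u t) (ε i) (b i) (a i))
      (∑ i, (∏ j ∈ Finset.univ.erase i, if b j = a j then (1 : ℂ) else 0) * c i (b i) (a i)) 0 := by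
    intro b a
    simp only [← hc]
    have := HasDerivAt.fun_finsetProd (u := Finset.univ)
      (fun i _ => hent (ε i) (b i) (a i))
    simpa only [hent0, smul_eq_mul] using this
  -- The curve u(t)·A is written as a sum over pairs j = (a, b), whose fixed vector is the unit
  -- array at a times the entry of A at b.
  have hmem := derivative_mem_of_curve_mem (Finset.univ : Finset ((Fin k → Fin m) × (Fin k → Fin m)))
    W (fun j t => ∏ i, entry (u t) (ε i) (j.2 i) (j.1 i)) _
    (fun j => A j.2 • Pi.single j.1 (1 : ℂ)) (fun j _ => hprod j.2 j.1) (by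
      intro t
      convert! hW (u t) (hu t) A hA using 1
      rw [Fintype.sum_prod_type]
      funext a
      simp [Finset.sum_apply, mact, Pi.single_apply])
  convert! hmem using 1
  rw [Fintype.sum_prod_type]
  funext a
  simp only [Finset.sum_apply, Pi.smul_apply, Pi.single_apply, smul_eq_mul, mul_ite, mul_one,
    mul_zero]
  rw [Finset.sum_comm]
  simp only [Finset.sum_ite_eq, Finset.mem_univ, if_true, Finset.sum_mul, mul_assoc]
  rw [Finset.sum_comm, act, Finset.mul_sum]
  refine Finset.sum_congr rfl fun i _ => ?_
  rw [sum_prod_erase_delta a i (fun b => c i (b i) (a i) * A b), Finset.mul_sum]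
  simp only [Function.update_self, ← hc, mul_assoc]

theorem act_one (A : Arr k m) : act ε 1 A = ((∑ i, if ε i then 1 else -1 : ℤ) : ℂ) • A := by
  funext a
  simp only [act, Matrix.one_apply, Pi.smul_apply, smul_eq_mul, Int.cast_sum, Finset.sum_mul]
  refine Finset.sum_congr rfl fun i _ => ?_
  cases ε i <;> simp

/-- The tangent of the circle of scalar matrices acts as i times the number of covariant slots minus
the number of contravariant ones. If this number is not zero, an invariant real subspace is
automatically complex; for type (1,1) nothing is gained. -/
theorem I_smul_mem_of_mact_mem {W : Submodule ℝ (Arr k m)}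
    (hW : ∀ u ∈ Matrix.unitaryGroup (Fin m) ℂ, ∀ A ∈ W, mact ε u A ∈ W)
    (hε : (∑ i, if ε i then 1 else -1 : ℤ) ≠ 0) {A : Arr k m} (hA : A ∈ W) :
    Complex.I • A ∈ W := by
  have h := act_mem_of_mact_mem hW (Matrix.conjTranspose_one) (one_mul 1) hA
  rw [act_one] at h
  have h2 := W.smul_mem (((∑ i, if ε i then 1 else -1 : ℤ) : ℝ)⁻¹) h
  have hne : ((∑ i, if ε i then 1 else -1 : ℤ) : ℝ) ≠ 0 := by exact_mod_cast hε
  convert! h2 using 1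
  rw [smul_comm Complex.I, ← Complex.coe_smul, smul_smul, Complex.ofReal_inv]
  rw [Complex.ofReal_intCast, inv_mul_cancel₀, one_smul]
  exact_mod_cast hε

/-- Hermitian idempotents span all complex matrices over ℂ, so a complex subspace that is invariant
under the unitary group is invariant under every elementary matrix. Permutation matrices are
themselves unitary. -/
theorem arrInvariant_of_mact_mem {W : Submodule ℂ (Arr k m)}
    (hW : ∀ u ∈ Matrix.unitaryGroup (Fin m) ℂ, ∀ A ∈ W, mact ε u A ∈ W) : ArrInvariant ε W := by
  have h0 : ∀ P : Matrix (Fin m) (Fin m) ℂ, P.conjTranspose = P → P * P = P → ∀ A ∈ W,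
      act ε P A ∈ W := by
    intro P hP hPP A hA
    have := act_mem_of_mact_mem (W := W.restrictScalars ℝ) hW hP hPP hA
    have h2 := W.smul_mem (-Complex.I) this
    rwa [smul_smul, neg_mul, Complex.I_mul_I, neg_neg, one_smul] at h2
  have hadd : ∀ (X Y : Matrix (Fin m) (Fin m) ℂ) A, act ε (X + Y) A = act ε X A + act ε Y A := by
    intro X Y A
    funext a
    simp only [act, Pi.add_apply, ← Finset.sum_add_distrib]
    refine Finset.sum_congr rfl fun i _ => Finset.sum_congr rfl fun b _ => ?_
    cases ε i <;> simp <;> ring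
  have hsmul : ∀ (c : ℂ) (X : Matrix (Fin m) (Fin m) ℂ) A, act ε (c • X) A = c • act ε X A := by
    intro c X A
    funext a
    simp only [act, Pi.smul_apply, Finset.smul_sum]
    refine Finset.sum_congr rfl fun i _ => Finset.sum_congr rfl fun b _ => ?_
    cases ε i <;> simp <;> ring
  refine ⟨fun p q A hA => ?_, fun s A hA => ?_⟩
  · rw [← act_single]
    have hd : ∀ p : Fin m, act ε (Matrix.single p p 1) A ∈ W := fun p =>
      h0 _ (by rw [Matrix.conjTranspose_single, star_one]) (by
        rw [Matrix.single_mul_single_same, one_mul]) A hA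
    by_cases hpq : p = q
    · subst hpq; exact hd p
    -- For |w| = 1 the matrix ½(E_pp + E_qq + wE_pq + w̄E_qp) is a Hermitian idempotent; its
    -- diagonal part is already under control.
    have hw : ∀ w : ℂ, starRingEnd ℂ w * w = 1 →
        w • act ε (Matrix.single p q 1) A + starRingEnd ℂ w • act ε (Matrix.single q p 1) A ∈ W := by
      intro w hw
      have hw' : w * starRingEnd ℂ w = 1 := by rw [mul_comm, hw]
      have h1 := h0 ((1 / 2 : ℂ) • (Matrix.single p p 1 + Matrix.single q q 1 +
        Matrix.single p q w + Matrix.single q p (starRingEnd ℂ w))) (by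
          rw [Matrix.conjTranspose_smul]
          simp only [Matrix.conjTranspose_add, Matrix.conjTranspose_single,
            ← starRingEnd_apply, Complex.conj_conj, map_div₀, map_one, map_ofNat]
          congr 1; abel) (by
          rw [smul_mul_smul_comm]
          simp only [mul_add, add_mul, Matrix.single_mul_single_same,
            Matrix.single_mul_single_of_ne _ _ _ _ hpq,
            Matrix.single_mul_single_of_ne _ _ _ _ (Ne.symm hpq), hw, hw', one_mul, mul_one,
            add_zero, zero_add]
          module) A hA
      have e : ∀ (p q : Fin m) (w : ℂ), Matrix.single p q w = w • Matrix.single p q (1 : ℂ) := by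
        intro p q w; rw [Matrix.smul_single, smul_eq_mul, mul_one]
      rw [hsmul, hadd, hadd, hadd, e p q w, e q p (starRingEnd ℂ w), hsmul, hsmul] at h1
      have h2 := W.sub_mem (W.sub_mem (W.smul_mem 2 h1) (hd p)) (hd q)
      convert! h2 using 1
      module
    have h1 := hw 1 (by simp)
    have h2 := hw Complex.I (by simp)
    -- The cases w = 1 and w = i give E_pq + E_qp and i(E_pq - E_qp), which combine to E_pq.
    have h3 := W.smul_mem (1 / 2 : ℂ) (W.sub_mem h1 (W.smul_mem Complex.I h2))
    convert! h3 using 1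
    simp only [map_one, one_smul, Complex.conj_I, smul_add, smul_smul, neg_smul, smul_neg,
      Complex.I_mul_I]
    module
  · rw [← mact_perm (ε := ε)]
    refine hW _ ?_ A hA
    rw [Matrix.mem_unitaryGroup_iff']
    ext a b
    rw [Matrix.mul_apply, Matrix.one_apply]
    simp [Matrix.star_apply, eq_comm]

end Arrays

end Robinson

/-! ### Typed tensors and their components in a unitary frame -/

namespace RobinsonStructure

open Robinson

variable {m : ℕ} {V : Type*} [AddCommGroup V] [Module ℝ V] {M : MinkowskiMetric m V}
  {R : RobinsonStructure M} {k : ℕ}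

variable (R) in
/-- Tensors of type `(1,0)` in the slots `i` with `ε i = true` and of type `(0,1)` in the other
slots. -/
def typed (ε : Fin k → Bool) : Submodule ℂ (R.Tensors k) where
  carrier := {T | ∀ i x, x i ∈ R.typeSub (!(ε i)) → T x = 0}
  add_mem' hS hT i x hx := by simp [hS i x hx, hT i x hx]
  zero_mem' := by simp
  smul_mem' c T hT i x hx := by simp [hT i x hx]

theorem typed_compLinearMap {ε : Fin k → Bool} {T : R.Tensors k} (hT : T ∈ R.typed ε) (A : R.U) :
    (T.compLinearMap fun _ => A.1.1.baseChange ℂ) ∈ R.typed ε :=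
  fun i _ hx => hT i _ (U_typeSub A hx)

namespace UnitaryFrame

variable (F : R.UnitaryFrame)

/-- In each slot the complementary type contributes zero, so the arguments can be projected one slot
at a time. -/
theorem typed_apply_pr {ε : Fin k → Bool} {T : R.Tensors k} (hT : T ∈ R.typed ε)
    (x : Fin k → ℂ ⊗[ℝ] R.H) : T (fun i => F.pr (ε i) (x i)) = T x := by
  classical
  have key : ∀ s : Finset (Fin k), T (fun i => if i ∈ s then F.pr (ε i) (x i) else x i) = T x := by
    intro s
    induction s using Finset.induction_on with
    | empty => simp
    | insert j s hj ih =>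
      rw [← ih]
      set y : Fin k → ℂ ⊗[ℝ] R.H := fun i => if i ∈ s then F.pr (ε i) (x i) else x i with hy
      have e1 : (fun i => if i ∈ insert j s then F.pr (ε i) (x i) else x i) =
          Function.update y j (F.pr (ε j) (x j)) := by
        funext i
        by_cases h : i = j
        · subst h; simp
        · simp [h, hy]
      have hx : F.pr (ε j) (x j) + F.pr (!(ε j)) (x j) = y j := by
        rw [F.pr_add_pr]; simp [hy, hj]
      have h0 : T (Function.update y j (F.pr (!(ε j)) (x j))) = 0 :=
        hT j _ (by rw [Function.update_self]; exact F.pr_mem _ _)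
      have h1 := T.map_update_add y j (F.pr (ε j) (x j)) (F.pr (!(ε j)) (x j))
      rw [h0, add_zero, hx, Function.update_eq_self] at h1
      rw [e1, h1]
  simpa using key Finset.univ

/-- The components of a tensor with respect to a unitary frame. -/
def arr (ε : Fin k → Bool) : R.Tensors k →ₗ[ℂ] Arr k m where
  toFun T a := T fun i => F.ζ (ε i) (a i)
  map_add' _ _ := rfl
  map_smul' _ _ := rfl

theorem arr_apply (ε : Fin k → Bool) (T : R.Tensors k) (a : Fin k → Fin m) :
    F.arr ε T a = T fun i => F.ζ (ε i) (a i) := rfl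

theorem apply_eq_sum_arr {ε : Fin k → Bool} {T : R.Tensors k} (hT : T ∈ R.typed ε)
    (x : Fin k → ℂ ⊗[ℝ] R.H) :
    T x = ∑ a : Fin k → Fin m, (∏ i, F.co (ε i) (a i) (x i)) * F.arr ε T a := by
  rw [← F.typed_apply_pr hT]
  simp only [pr_apply]
  rw [T.map_sum]
  refine Finset.sum_congr rfl fun a _ => ?_
  rw [T.map_smul_univ]
  rfl

theorem eq_of_arr_eq {ε : Fin k → Bool} {S T : R.Tensors k} (hS : S ∈ R.typed ε)
    (hT : T ∈ R.typed ε) (h : F.arr ε S = F.arr ε T) : S = T := by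
  ext x
  rw [F.apply_eq_sum_arr hS, F.apply_eq_sum_arr hT, h]

/-- The tensor with given components. -/
def ofArr (ε : Fin k → Bool) (A : Arr k m) : R.Tensors k :=
  ∑ a : Fin k → Fin m, A a • (MultilinearMap.mkPiAlgebra ℂ (Fin k) ℂ).compLinearMap
    fun i => F.co (ε i) (a i)

theorem ofArr_apply (ε : Fin k → Bool) (A : Arr k m) (x : Fin k → ℂ ⊗[ℝ] R.H) :
    F.ofArr ε A x = ∑ a : Fin k → Fin m, (∏ i, F.co (ε i) (a i) (x i)) * A a := by
  simp [ofArr, mul_comm]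

theorem ofArr_mem (ε : Fin k → Bool) (A : Arr k m) : F.ofArr ε A ∈ R.typed ε := by
  intro i x hx
  rw [ofArr_apply]
  refine Finset.sum_eq_zero fun a _ => ?_
  rw [Finset.prod_eq_zero (Finset.mem_univ i) (F.co_eq_zero hx (a i)), zero_mul]

theorem arr_ofArr (ε : Fin k → Bool) (A : Arr k m) : F.arr ε (F.ofArr ε A) = A := by
  funext a
  rw [arr_apply, ofArr_apply, Finset.sum_eq_single a]
  · simp [co_ζ]
  · intro b _ hb
    obtain ⟨i, hi⟩ := Function.ne_iff.mp hb
    rw [Finset.prod_eq_zero (Finset.mem_univ i), zero_mul]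
    rw [co_ζ]
    simp [hi]
  · simp

theorem arr_compLinearMap (ε : Fin k → Bool) (T : R.Tensors k)
    (u : Matrix.unitaryGroup (Fin m) ℂ) :
    F.arr ε (T.compLinearMap fun _ => (F.ofUnitary u).1.1.baseChange ℂ) =
      mact ε u.1 (F.arr ε T) := by
  funext a
  rw [arr_apply, MultilinearMap.compLinearMap_apply]
  simp only [ofUnitary_ζ]
  rw [T.map_sum]
  refine Finset.sum_congr rfl fun b _ => ?_
  rw [T.map_smul_univ]
  rfl

theorem mact_mem_map {ε : Fin k → Bool} {W : Submodule ℝ (R.Tensors k)}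
    (hW : ∀ q, ∀ T ∈ W, R.tensorRep k q T ∈ W) {u : Matrix (Fin m) (Fin m) ℂ}
    (hu : u ∈ Matrix.unitaryGroup (Fin m) ℂ) {A : Arr k m}
    (hA : A ∈ W.map ((F.arr ε).restrictScalars ℝ)) :
    mact ε u A ∈ W.map ((F.arr ε).restrictScalars ℝ) := by
  obtain ⟨T, hT, rfl⟩ := hA
  -- The inverse compensates for the inverse in `tensorRep`.
  refine ⟨_, hW ((1, (F.ofUnitary ⟨u, hu⟩)⁻¹) : R.Q₀) T hT, ?_⟩
  change F.arr ε (T.compLinearMap fun _ => ((F.ofUnitary ⟨u, hu⟩)⁻¹⁻¹).1.1.baseChange ℂ) = _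
  rw [inv_inv, arr_compLinearMap]
  rfl

/-- The complex subspace of arrays spanned by the components of the tensors in a subspace. -/
def arrSpan (ε : Fin k → Bool) (W : Submodule ℝ (R.Tensors k)) : Submodule ℂ (Arr k m) :=
  Submodule.span ℂ (W.map ((F.arr ε).restrictScalars ℝ) : Set (Arr k m))

theorem arrInvariant_arrSpan (ε : Fin k → Bool) {W : Submodule ℝ (R.Tensors k)}
    (hW : ∀ q, ∀ T ∈ W, R.tensorRep k q T ∈ W) : ArrInvariant ε (F.arrSpan ε W) := by
  refine arrInvariant_of_mact_mem fun u hu A hA => ?_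
  induction hA using Submodule.span_induction with
  | mem A hA => exact Submodule.subset_span (F.mact_mem_map hW hu hA)
  | zero =>
    have : mact ε u (0 : Arr k m) = 0 := by simpa using mact_smul (ε := ε) u 0 (0 : Arr k m)
    rw [this]
    exact Submodule.zero_mem _
  | add A B _ _ hA hB => rw [mact_add]; exact Submodule.add_mem _ hA hB
  | smul c A _ hA => rw [mact_smul]; exact Submodule.smul_mem _ _ hA

/-- For unbalanced types the components of W are already closed under multiplication by i, so
passing to the complex span adds nothing. -/
theorem mem_of_arr_mem_arrSpan {ε : Fin k → Bool} (hε : (∑ i, if ε i then 1 else -1 : ℤ) ≠ 0)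
    {W : Submodule ℝ (R.Tensors k)} (hW : ∀ q, ∀ T ∈ W, R.tensorRep k q T ∈ W)
    (hWt : ∀ T ∈ W, T ∈ R.typed ε) {T : R.Tensors k} (hT : T ∈ R.typed ε)
    (h : F.arr ε T ∈ F.arrSpan ε W) : T ∈ W := by
  have key : ∀ A ∈ F.arrSpan ε W, A ∈ W.map ((F.arr ε).restrictScalars ℝ) := by
    intro A hA
    induction hA using Submodule.span_induction with
    | mem A hA => exact hA
    | zero => exact Submodule.zero_mem _
    | add A B _ _ hA hB => exact Submodule.add_mem _ hA hB
    | smul c A _ hA =>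
      have h1 := I_smul_mem_of_mact_mem (fun u hu A hA => F.mact_mem_map hW hu hA) hε hA
      rw [← Complex.re_add_im c, add_smul, mul_smul, Complex.coe_smul, Complex.coe_smul]
      exact Submodule.add_mem _ (Submodule.smul_mem _ _ hA) (Submodule.smul_mem _ _ h1)
  obtain ⟨S, hS, hST⟩ := key _ h
  rwa [← F.eq_of_arr_eq (hWt S hS) hT hST]

/-- The condition on a module of tensors which implies the criterion `arr_irreducible`. -/
structure HasExtremalVector (ε : Fin k → Bool) (E : Submodule ℝ (R.Tensors k))
    (x : Fin k → Fin m) : Prop where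
  typed : ∀ T ∈ E, T ∈ R.typed ε
  I_smul : ∀ T ∈ E, Complex.I • T ∈ E
  unique : ∀ T ∈ E, (∀ a, F.arr ε T a ≠ 0 → ∀ p, wt ε p a = wt ε p x) → F.arr ε T x = 0 →
    F.arr ε T = 0
  reach : ∀ T ∈ E, F.arr ε T ≠ 0 → ∃ s : Equiv.Perm (Fin m), F.arr ε T (s ∘ x) ≠ 0 ∨
      ∃ p q, elemAct ε p q (F.arr ε T) (s ∘ x) ≠ 0

theorem smul_mem_of_I_smul_mem {E : Submodule ℝ (R.Tensors k)} (h : ∀ T ∈ E, Complex.I • T ∈ E)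
    (c : ℂ) {T : R.Tensors k} (hT : T ∈ E) : c • T ∈ E := by
  rw [← Complex.re_add_im c, add_smul, mul_smul]
  exact E.add_mem (E.smul_mem c.re hT) (E.smul_mem c.im (h T hT))

theorem mem_arrSpan_iff {ε : Fin k → Bool} {E : Submodule ℝ (R.Tensors k)}
    (h : ∀ T ∈ E, Complex.I • T ∈ E) {A : Arr k m} :
    A ∈ F.arrSpan ε E ↔ ∃ T ∈ E, F.arr ε T = A := by
  constructor
  · intro hA
    induction hA using Submodule.span_induction with
    | mem A hA => exact hA
    | zero => exact ⟨0, E.zero_mem, map_zero _⟩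
    | add A B _ _ hA hB =>
      obtain ⟨S, hS, rfl⟩ := hA
      obtain ⟨T, hT, rfl⟩ := hB
      exact ⟨S + T, E.add_mem hS hT, map_add _ _ _⟩
    | smul c A _ hA =>
      obtain ⟨T, hT, rfl⟩ := hA
      exact ⟨c • T, smul_mem_of_I_smul_mem h c hT, map_smul _ _ _⟩
  · exact fun hA => Submodule.subset_span hA

/-- The conclusion concerns complex spans only. It therefore needs no condition on the type, which
is what makes it usable for (1,1)-forms. -/
theorem HasExtremalVector.arrSpan_eq {ε : Fin k → Bool} {E W : Submodule ℝ (R.Tensors k)}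
    {x : Fin k → Fin m} (h : F.HasExtremalVector ε E x)
    (hE : ∀ q, ∀ T ∈ E, R.tensorRep k q T ∈ E) (hW : ∀ q, ∀ T ∈ W, R.tensorRep k q T ∈ W)
    (hWE : W ≤ E) : F.arrSpan ε W = ⊥ ∨ F.arrSpan ε W = F.arrSpan ε E := by
  refine arr_irreducible x (F.arrInvariant_arrSpan ε hE) ?_ ?_ (F.arrInvariant_arrSpan ε hW)
    (Submodule.span_mono (Submodule.map_mono hWE))
  · intro S hS
    obtain ⟨T, hT, rfl⟩ := (F.mem_arrSpan_iff h.I_smul).mp hS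
    exact h.unique T hT
  · intro S hS
    obtain ⟨T, hT, rfl⟩ := (F.mem_arrSpan_iff h.I_smul).mp hS
    exact h.reach T hT

theorem eq_bot_of_arrSpan_eq_bot {ε : Fin k → Bool} {W : Submodule ℝ (R.Tensors k)}
    (hWt : ∀ T ∈ W, T ∈ R.typed ε) (h : F.arrSpan ε W = ⊥) : W = ⊥ := by
  rw [eq_bot_iff]
  intro T hT
  have : F.arr ε T ∈ F.arrSpan ε W := Submodule.subset_span ⟨T, hT, rfl⟩
  rw [h, Submodule.mem_bot] at this
  exact F.eq_of_arr_eq (hWt T hT) (Submodule.zero_mem _) (by rw [this, map_zero])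

theorem isIrreducible_subrepresentation_iff (E : Subrepresentation (R.tensorRep k)) :
    E.toRepresentation.IsIrreducible ↔ Nontrivial E.toSubmodule ∧
      ∀ W ≤ E.toSubmodule, (∀ q, ∀ T ∈ W, R.tensorRep k q T ∈ W) → W = ⊥ ∨ W = E.toSubmodule := by
  rw [isIrreducible_iff]
  refine and_congr_right fun _ => ⟨fun h W hWE hW => ?_, fun h W hW => ?_⟩
  · rcases h (W.comap E.toSubmodule.subtype) (fun q x hx => hW q x hx) with h | h
    · left
      rw [eq_bot_iff]
      intro x hx
      have hx' : (⟨x, hWE hx⟩ : E.toSubmodule) ∈ W.comap E.toSubmodule.subtype := hx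
      rw [h, Submodule.mem_bot] at hx'
      exact congrArg Subtype.val hx'
    · right
      exact le_antisymm hWE (Submodule.comap_subtype_eq_top.mp h)
  · rcases h (W.map E.toSubmodule.subtype) (Submodule.map_subtype_le _ _) (by
      rintro q _ ⟨x, hx, rfl⟩
      exact ⟨_, hW q x hx, rfl⟩) with h | h
    · left
      rw [eq_bot_iff]
      intro x hx
      have hx' : (x : R.Tensors k) ∈ W.map E.toSubmodule.subtype := ⟨x, hx, rfl⟩
      rw [h, Submodule.mem_bot] at hx'
      exact Subtype.ext hx'
    · right
      apply Submodule.map_injective_of_injective (Submodule.injective_subtype E.toSubmodule)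
      rw [h, Submodule.map_subtype_top]

theorem HasExtremalVector.isIrreducible {ε : Fin k → Bool} {E : Subrepresentation (R.tensorRep k)}
    {x : Fin k → Fin m} (h : F.HasExtremalVector ε E.toSubmodule x)
    (hε : (∑ i, if ε i then 1 else -1 : ℤ) ≠ 0) (hn : Nontrivial E.toSubmodule) :
    E.toRepresentation.IsIrreducible := by
  rw [isIrreducible_subrepresentation_iff]
  refine ⟨hn, fun W hWE hW => ?_⟩
  rcases h.arrSpan_eq F (fun q T hT => E.apply_mem_toSubmodule q hT) hW hWE with h' | h'
  · exact Or.inl (F.eq_bot_of_arrSpan_eq_bot (fun T hT => h.typed T (hWE hT)) h')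
  · refine Or.inr (le_antisymm hWE fun T hT => ?_)
    refine F.mem_of_arr_mem_arrSpan hε hW (fun T hT => h.typed T (hWE hT)) (h.typed T hT) ?_
    rw [h']
    exact Submodule.subset_span ⟨T, hT, rfl⟩

end UnitaryFrame

end RobinsonStructure

namespace Robinson

/-! ### Arrays with two and three indices -/

section SmallArrays

variable {m : ℕ}

theorem vec1_eta {α : Type*} (a : Fin 1 → α) : a = ![a 0] := by
  funext i; fin_cases i; rfl

theorem vec2_eta {α : Type*} (a : Fin 2 → α) : a = ![a 0, a 1] := by
  funext i; fin_cases i <;> rfl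

theorem vec3_eta {α : Type*} (a : Fin 3 → α) : a = ![a 0, a 1, a 2] := by
  funext i; fin_cases i <;> rfl

section Update

variable {α : Type*} (a b c d : α)

theorem update2_0 : Function.update ![a, b] 0 d = ![d, b] := by
  funext i; fin_cases i <;> simp

theorem update2_1 : Function.update ![a, b] 1 d = ![a, d] := by
  funext i; fin_cases i <;> simp

theorem update3_0 : Function.update ![a, b, c] 0 d = ![d, b, c] := by
  funext i; fin_cases i <;> simp

theorem update3_1 : Function.update ![a, b, c] 1 d = ![a, d, c] := by
  funext i; fin_cases i <;> simp

theorem update3_2 : Function.update ![a, b, c] 2 d = ![a, b, d] := by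
  funext i; fin_cases i <;> simp

theorem swap2_01 : (fun i => ![a, b] (Equiv.swap 0 1 i)) = ![b, a] := by
  funext i; fin_cases i <;> simp

theorem swap3_01 : (fun i => ![a, b, c] (Equiv.swap 0 1 i)) = ![b, a, c] := by
  funext i; fin_cases i <;> simp [Equiv.swap_apply_def]

theorem swap3_12 : (fun i => ![a, b, c] (Equiv.swap 1 2 i)) = ![a, c, b] := by
  funext i; fin_cases i <;> simp [Equiv.swap_apply_def]

end Update

theorem elemAct2 (ε : Fin 2 → Bool) (p q : Fin m) (A : Arr 2 m) (a b : Fin m) :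
    elemAct ε p q A ![a, b] =
      (if ε 0 then (if a = q then A ![p, b] else 0) else - (if a = p then A ![q, b] else 0)) +
      (if ε 1 then (if b = q then A ![a, p] else 0) else - (if b = p then A ![a, q] else 0)) := by
  simp only [elemAct, Fin.sum_univ_two, update2_0, update2_1, Matrix.cons_val_zero,
    Matrix.cons_val_one]

theorem elemAct3 (ε : Fin 3 → Bool) (p q : Fin m) (A : Arr 3 m) (a b c : Fin m) :
    elemAct ε p q A ![a, b, c] =
      (if ε 0 then (if a = q then A ![p, b, c] else 0)
        else - (if a = p then A ![q, b, c] else 0)) +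
      (if ε 1 then (if b = q then A ![a, p, c] else 0)
        else - (if b = p then A ![a, q, c] else 0)) +
      (if ε 2 then (if c = q then A ![a, b, p] else 0)
        else - (if c = p then A ![a, b, q] else 0)) := by
  simp [elemAct, Fin.sum_univ_three, update3_0, update3_1, update3_2]

theorem wt1 (ε : Fin 1 → Bool) (p a : Fin m) :
    wt ε p ![a] = if a = p then (if ε 0 then 1 else -1) else 0 := by
  simp [wt]

theorem wt2 (ε : Fin 2 → Bool) (p a b : Fin m) :
    wt ε p ![a, b] = (if a = p then (if ε 0 then 1 else -1) else 0) +
      (if b = p then (if ε 1 then 1 else -1) else 0) := by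
  rw [wt, Fin.sum_univ_two]; rfl

theorem wt3 (ε : Fin 3 → Bool) (p a b c : Fin m) :
    wt ε p ![a, b, c] = (if a = p then (if ε 0 then 1 else -1) else 0) +
      (if b = p then (if ε 1 then 1 else -1) else 0) +
      (if c = p then (if ε 2 then 1 else -1) else 0) := by
  rw [wt, Fin.sum_univ_three]; rfl

theorem exists_perm1 (a a' : Fin m) : ∃ s : Equiv.Perm (Fin m), s a = a' :=
  ⟨Equiv.swap a a', Equiv.swap_apply_left _ _⟩

theorem exists_perm2 {a b a' b' : Fin m} (h : a ≠ b) (h' : a' ≠ b') :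
    ∃ s : Equiv.Perm (Fin m), s a = a' ∧ s b = b' := by
  refine ⟨(Equiv.swap a a').trans (Equiv.swap (Equiv.swap a a' b) b'), ?_, ?_⟩
  · rw [Equiv.trans_apply, Equiv.swap_apply_left, Equiv.swap_apply_of_ne_of_ne _ h']
    intro h2
    rw [eq_comm, Equiv.swap_apply_eq_iff, Equiv.swap_apply_right] at h2
    exact h h2.symm
  · simp

theorem exists_perm3 {a b c a' b' c' : Fin m} (h1 : a ≠ b) (h2 : a ≠ c) (h3 : b ≠ c)
    (h1' : a' ≠ b') (h2' : a' ≠ c') (h3' : b' ≠ c') :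
    ∃ s : Equiv.Perm (Fin m), s a = a' ∧ s b = b' ∧ s c = c' := by
  obtain ⟨s, rfl, rfl⟩ := exists_perm2 h1 h1'
  have ha : s c ≠ s a := fun h => h2 (s.injective h).symm
  have hb : s c ≠ s b := fun h => h3 (s.injective h).symm
  refine ⟨s.trans (Equiv.swap (s c) c'), ?_, ?_, ?_⟩
  · rw [Equiv.trans_apply, Equiv.swap_apply_of_ne_of_ne ha.symm h2']
  · rw [Equiv.trans_apply, Equiv.swap_apply_of_ne_of_ne hb.symm h3']
  · simp

/-- Skew-symmetric arrays. -/
theorem skew2_unique {A : Arr 2 m} (hA : ∀ a b, A ![b, a] = - A ![a, b]) {i j : Fin m}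
    (hs : ∀ a, A a ≠ 0 → ∀ p, wt (fun _ => true) p a = wt (fun _ => true) p ![i, j])
    (h0 : A ![i, j] = 0) : A = 0 := by
  funext a
  rw [vec2_eta a, Pi.zero_apply]
  by_contra h
  have := hs _ h
  simp only [wt2, if_true] at this
  have e1 := this (a 0)
  have e2 := this (a 1)
  have e3 := hA (a 0) (a 0)
  grind

theorem sym2_unique {A : Arr 2 m} {i : Fin m}
    (hs : ∀ a, A a ≠ 0 → ∀ p, wt (fun _ => true) p a = wt (fun _ => true) p ![i, i])
    (h0 : A ![i, i] = 0) : A = 0 := by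
  funext a
  rw [vec2_eta a, Pi.zero_apply]
  by_contra h
  have := hs _ h
  simp only [wt2, if_true] at this
  have e1 := this (a 0)
  have e2 := this (a 1)
  grind

theorem skew3_unique {A : Arr 3 m} (h01 : ∀ a b c, A ![b, a, c] = - A ![a, b, c])
    (h12 : ∀ a b c, A ![a, c, b] = - A ![a, b, c]) {i j l : Fin m}
    (hs : ∀ a, A a ≠ 0 → ∀ p, wt (fun _ => true) p a = wt (fun _ => true) p ![i, j, l])
    (h0 : A ![i, j, l] = 0) : A = 0 := by
  funext a
  rw [vec3_eta a, Pi.zero_apply]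
  by_contra h
  have := hs _ h
  simp only [wt3, if_true] at this
  have e1 := this (a 0)
  have e2 := this (a 1)
  have e4 := this (a 2)
  have e3 := h01 (a 0) (a 0) (a 2)
  have e5 := h12 (a 0) (a 1) (a 1)
  have e6 : A ![a 0, a 1, a 0] = 0 := by
    have := h01 (a 0) (a 1) (a 0)
    have := h12 (a 1) (a 0) (a 0)
    grind
  have f1 := h01 i j l
  have f2 := h12 i j l
  have f3 := h12 j i l
  have f4 := h01 i l j
  have f5 := h12 l i j
  grind

/-- The indices with the weight of (i,i,j) are its rearrangements. Skew symmetry in the last two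
slots relates iij to iji and annihilates jii. -/
theorem young_unique {A : Arr 3 m} (h12 : ∀ a b c, A ![a, c, b] = - A ![a, b, c]) {i j : Fin m}
    (hs : ∀ a, A a ≠ 0 → ∀ p, wt (fun _ => true) p a = wt (fun _ => true) p ![i, i, j])
    (h0 : A ![i, i, j] = 0) : A = 0 := by
  funext a
  rw [vec3_eta a, Pi.zero_apply]
  by_contra h
  have := hs _ h
  simp only [wt3, if_true] at this
  have e1 := this (a 0)
  have e2 := this (a 1)
  have e4 := this (a 2)
  have e5 := h12 (a 0) (a 1) (a 1)
  have f1 := h12 i i j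
  have f2 := h12 j i i
  grind

/-- For i ≠ j the covariant and contravariant weights do not cancel, so no other index has the
weight of (i,j). -/
theorem mixed2_unique {A : Arr 2 m} {i j : Fin m} (hij : i ≠ j)
    (hs : ∀ a, A a ≠ 0 → ∀ p, wt ![true, false] p a = wt ![true, false] p ![i, j])
    (h0 : A ![i, j] = 0) : A = 0 := by
  funext a
  rw [vec2_eta a, Pi.zero_apply]
  by_contra h
  have := hs _ h
  simp [wt2] at this
  have e1 := this (a 0)
  have e2 := this (a 1)
  have e3 := this i
  have e4 := this j
  grind

/-- For distinct i, j, l only (i,j,l) and (i,l,j) have this weight, and skew symmetry relates their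
entries. -/
theorem mixed3_unique {A : Arr 3 m} (h12 : ∀ a b c, A ![a, c, b] = - A ![a, b, c])
    {i j l : Fin m} (hij : i ≠ j) (hil : i ≠ l) (hjl : j ≠ l)
    (hs : ∀ a, A a ≠ 0 → ∀ p,
      wt ![true, false, false] p a = wt ![true, false, false] p ![i, j, l])
    (h0 : A ![i, j, l] = 0) : A = 0 := by
  funext a
  rw [vec3_eta a, Pi.zero_apply]
  by_contra h
  have := hs _ h
  simp [wt3] at this
  have e1 := this i
  have e2 := this j
  have e3 := this l
  have f1 := h12 i j l
  grind

theorem skew2_reach {A : Arr 2 m} (hA : ∀ a b, A ![b, a] = - A ![a, b]) (h : A ≠ 0) :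
    ∃ a b, a ≠ b ∧ A ![a, b] ≠ 0 := by
  obtain ⟨a, ha⟩ := Function.ne_iff.mp h
  rw [vec2_eta a] at ha
  refine ⟨a 0, a 1, fun h => ha ?_, ha⟩
  have := hA (a 0) (a 1)
  rw [h] at this ⊢
  exact self_eq_neg.mp this

/-- The elementary action which substitutes one index turns an entry at (a,b) into twice that entry
at the diagonal position (a,a). -/
theorem sym2_reach {A : Arr 2 m} (hA : ∀ a b, A ![b, a] = A ![a, b]) (h : A ≠ 0) :
    ∃ a, A ![a, a] ≠ 0 ∨ ∃ p q, elemAct (fun _ => true) p q A ![a, a] ≠ 0 := by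
  obtain ⟨a, ha⟩ := Function.ne_iff.mp h
  rw [vec2_eta a] at ha
  refine ⟨a 0, Or.inr ⟨a 1, a 0, ?_⟩⟩
  rw [elemAct2]
  simp only [if_true, hA (a 0) (a 1)]
  rw [← two_mul]
  exact mul_ne_zero two_ne_zero ha

theorem skew3_reach {A : Arr 3 m} (h01 : ∀ a b c, A ![b, a, c] = - A ![a, b, c])
    (h12 : ∀ a b c, A ![a, c, b] = - A ![a, b, c]) (h : A ≠ 0) :
    ∃ a b c, a ≠ b ∧ a ≠ c ∧ b ≠ c ∧ A ![a, b, c] ≠ 0 := by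
  obtain ⟨a, ha⟩ := Function.ne_iff.mp h
  rw [vec3_eta a] at ha
  have e3 := h01 (a 0) (a 0) (a 2)
  have e5 := h12 (a 0) (a 1) (a 1)
  have e6 : A ![a 0, a 1, a 0] = 0 := by
    have := h01 (a 0) (a 1) (a 0)
    have := h12 (a 1) (a 0) (a 0)
    grind
  simp only [Pi.zero_apply] at ha
  refine ⟨a 0, a 1, a 2, ?_, ?_, ?_, ha⟩ <;> grind

/-- At (a,a,b) the elementary action produces A(p,a,b) + A(a,p,b). If these sums vanish along with
all entries at repeated indices, A is totally skew, its cyclic sum is 3A, and the cyclic identity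
gives A = 0. -/
theorem young_reach {A : Arr 3 m} (h12 : ∀ a b c, A ![a, c, b] = - A ![a, b, c])
    (hc : ∀ a b c, A ![a, b, c] + A ![b, c, a] + A ![c, a, b] = 0) (h : A ≠ 0) :
    ∃ a b, a ≠ b ∧ (A ![a, a, b] ≠ 0 ∨ ∃ p q, elemAct (fun _ => true) p q A ![a, a, b] ≠ 0) := by
  obtain ⟨a, ha⟩ := Function.ne_iff.mp h
  rw [vec3_eta a, Pi.zero_apply] at ha
  generalize a 0 = x at ha
  generalize a 1 = y at ha
  generalize a 2 = z at ha
  have hyz : y ≠ z := by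
    rintro rfl
    have := h12 x y y
    grind
  by_cases hxy : x = y
  · subst hxy
    exact ⟨x, z, hyz, Or.inl ha⟩
  by_cases hxz : x = z
  · subst hxz
    exact ⟨x, y, Ne.symm hyz, Or.inl (by rw [h12]; simpa using ha)⟩
  have key : ∀ p a b : Fin m, b ≠ a → elemAct (fun _ => true) p a A ![a, a, b] =
      A ![p, a, b] + A ![a, p, b] := by
    intro p a b hb
    rw [elemAct3]
    simp [hb]
  by_contra! hcon
  have k1 := (hcon y z hyz).2 x y
  have k2 := (hcon x z hxz).2 y x
  have k3 := (hcon x y hxy).2 z x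
  rw [key _ _ _ (Ne.symm hyz)] at k1
  rw [key _ _ _ (Ne.symm hxz)] at k2
  rw [key _ _ _ (Ne.symm hxy)] at k3
  have := hc x y z
  have := h12 x y z
  have := h12 y x z
  have := h12 z x y
  grind

/-- At an off-diagonal position the elementary action produces differences of diagonal entries. If
they vanish together with the off-diagonal entries, A is a multiple of the identity, and
tracelessness makes it zero. -/
theorem mixed2_reach {A : Arr 2 m} (ht : ∑ c, A ![c, c] = 0) (h : A ≠ 0) :
    ∃ a b, a ≠ b ∧ (A ![a, b] ≠ 0 ∨ ∃ p q, elemAct ![true, false] p q A ![a, b] ≠ 0) := by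
  by_contra! hcon
  have hdiag : ∀ a b, a ≠ b → A ![a, a] = A ![b, b] := by
    intro a b hab
    have := (hcon a b hab).2 b a
    rw [elemAct2] at this
    simp at this
    grind
  have hd : ∀ a, A ![a, a] = 0 := by
    intro a
    have : ∀ c, A ![c, c] = A ![a, a] := fun c => by
      by_cases hca : c = a
      · rw [hca]
      · exact hdiag c a hca
    simp only [this, Finset.sum_const, Finset.card_univ, Fintype.card_fin, nsmul_eq_mul,
      mul_eq_zero, Nat.cast_eq_zero] at ht
    exact ht.resolve_left (by have := a.2; omega)
  apply h
  funext a
  rw [vec2_eta a, Pi.zero_apply]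
  by_cases hab : a 0 = a 1
  · rw [hab]; exact hd _
  · exact (hcon _ _ hab).1

/-- With the last index d fixed, the argument for two indices shows that A(c,c,d) does not depend on
c ≠ d, while it vanishes for c = d by skew symmetry. The trace is then m - 1 times the common value,
which explains the bound on m. -/
theorem mixed3_reach {A : Arr 3 m} (h12 : ∀ a b c, A ![a, c, b] = - A ![a, b, c])
    (ht : ∀ d, ∑ c, A ![c, c, d] = 0) (hm : 1 < m) (h : A ≠ 0) :
    ∃ a b c, a ≠ b ∧ a ≠ c ∧ b ≠ c ∧
      (A ![a, b, c] ≠ 0 ∨ ∃ p q, elemAct ![true, false, false] p q A ![a, b, c] ≠ 0) := by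
  by_contra! hcon
  have h11 : ∀ a b, A ![a, b, b] = 0 := fun a b => self_eq_neg.mp (h12 a b b)
  have hdiag : ∀ d a b, a ≠ b → a ≠ d → b ≠ d → A ![a, a, d] = A ![b, b, d] := by
    intro d a b hab had hbd
    have := (hcon a b d hab had hbd).2 b a
    rw [elemAct3] at this
    simp [Ne.symm hbd] at this
    grind
  have hd : ∀ a d, A ![a, a, d] = 0 := by
    intro a d
    by_cases had : a = d
    · rw [had]; exact h11 _ _
    have h1 : ∀ c ∈ Finset.univ.erase d, A ![c, c, d] = A ![a, a, d] := fun c hc => by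
      by_cases hca : c = a
      · rw [hca]
      · exact hdiag d c a hca (Finset.ne_of_mem_erase hc) had
    have h2 := ht d
    rw [← Finset.add_sum_erase _ _ (Finset.mem_univ d), h11, zero_add, Finset.sum_congr rfl h1,
      Finset.sum_const, Finset.card_erase_of_mem (Finset.mem_univ d), Finset.card_univ,
      Fintype.card_fin, nsmul_eq_mul, mul_eq_zero, Nat.cast_eq_zero] at h2
    exact h2.resolve_left (by omega)
  apply h
  funext a
  rw [vec3_eta a, Pi.zero_apply]
  by_cases hbc : a 1 = a 2
  · rw [hbc]; exact h11 _ _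
  by_cases hab : a 0 = a 1
  · rw [hab]; exact hd _ _
  by_cases hac : a 0 = a 2
  · rw [h12, hac, hd, neg_zero]
  · exact (hcon _ _ _ hab hac hbc).1

end SmallArrays

end Robinson

namespace RobinsonStructure

open Robinson

variable {m : ℕ} {V : Type*} [AddCommGroup V] [Module ℝ V] {M : MinkowskiMetric m V}
  {R : RobinsonStructure M}

/-! ### Orthonormal bases of the screen space -/

variable (R) in
theorem exists_orthonormal : ∃ e : Fin (2 * m) → R.H,
    ∀ i j, R.h (e i) (e j) = if i = j then 1 else 0 := by
  let core : InnerProductSpace.Core ℝ R.H :=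
    { inner x y := R.h x y
      conj_inner_symm x y := R.h_symm y x
      re_inner_nonneg x := by
        by_cases hx : x = 0
        · simp [hx]
        · exact (R.h_pos hx).le
      add_left x y z := by simp
      smul_left x y r := by simp
      definite x hx := by
        by_contra h
        exact (R.h_pos h).ne' hx }
  let : NormedAddCommGroup R.H := InnerProductSpace.Core.toNormedAddCommGroup (𝕜 := ℝ) (cd := core)
  let : InnerProductSpace ℝ R.H := InnerProductSpace.ofCore core.toCore
  let b := (stdOrthonormalBasis ℝ R.H).reindex (finCongr R.finrank_H)
  exact ⟨b, fun i j => b.inner_eq_ite i j⟩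

theorem eq_sum_orthonormal {e : Fin (2 * m) → R.H}
    (he : ∀ i j, R.h (e i) (e j) = if i = j then 1 else 0) (x : R.H) :
    x = ∑ i, R.h (e i) x • e i := by
  have h1 : ∀ (c : Fin (2 * m) → ℝ) j, R.h (e j) (∑ i, c i • e i) = c j := by
    intro c j
    simp [he]
  have h2 : LinearIndependent ℝ e := by
    rw [Fintype.linearIndependent_iff]
    intro c hc j
    rw [← h1 c j, hc, map_zero]
  have h3 : x ∈ Submodule.span ℝ (Set.range e) := by
    rw [h2.span_eq_top_of_card_eq_finrank' (by rw [R.finrank_H, Fintype.card_fin])]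
    trivial
  obtain ⟨c, rfl⟩ := (Submodule.mem_span_range_iff_exists_fun ℝ).mp h3
  simp only [h1]

theorem eq_sum_orthonormalC {e : Fin (2 * m) → R.H}
    (he : ∀ i j, R.h (e i) (e j) = if i = j then 1 else 0) (x : ℂ ⊗[ℝ] R.H) :
    x = ∑ i, R.hC (1 ⊗ₜ e i) x • ((1 : ℂ) ⊗ₜ[ℝ] e i) := by
  have : LinearMap.id = ∑ i, (R.hC (1 ⊗ₜ e i)).smulRight ((1 : ℂ) ⊗ₜ[ℝ] e i) := by
    refine ext_real fun w => ?_
    conv_lhs => rw [LinearMap.id_apply, eq_sum_orthonormal he w, TensorProduct.tmul_sum]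
    simp only [LinearMap.sum_apply, LinearMap.smulRight_apply]
    refine Finset.sum_congr rfl fun i _ => ?_
    rw [TensorProduct.tmul_smul, LinearMap.BilinForm.baseChange_tmul, ← ofReal_smul_tensor]
    congr 1
    simp
  conv_lhs => rw [← LinearMap.id_apply (R := ℂ) x, this]
  simp

namespace UnitaryFrame

variable (F : R.UnitaryFrame) {k : ℕ}

/-- The inverse of h, a sum of e_i ⊗ e_i, equals the sum of z_a ⊗ z̄_a + z̄_a ⊗ z_a in the frame.
This turns traces over real orthonormal bases into traces over the frame. -/
theorem sum_orthonormal {e : Fin (2 * m) → R.H}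
    (he : ∀ i j, R.h (e i) (e j) = if i = j then 1 else 0)
    (b : (ℂ ⊗[ℝ] R.H) →ₗ[ℂ] (ℂ ⊗[ℝ] R.H) →ₗ[ℂ] ℂ) :
    ∑ i, b (1 ⊗ₜ e i) (1 ⊗ₜ e i) =
      ∑ a, b (F.ζ true a) (F.ζ false a) + ∑ a, b (F.ζ false a) (F.ζ true a) := by
  have key : ∀ s a, b (F.ζ s a) (F.ζ (!s) a) =
      ∑ i, F.co s a (1 ⊗ₜ e i) * b (F.ζ s a) (1 ⊗ₜ e i) := by
    intro s a
    conv_lhs => rw [eq_sum_orthonormalC he (F.ζ (!s) a)]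
    simp only [map_sum, map_smul, smul_eq_mul, co, R.hC_symm (F.ζ (!s) a)]
  have h1 : ∀ x y, b x y = ∑ a, F.co true a x * b (F.ζ true a) y +
      ∑ a, F.co false a x * b (F.ζ false a) y := by
    intro x y
    conv_lhs => rw [F.expand_ζ x]
    simp only [map_add, map_sum, map_smul, LinearMap.add_apply, LinearMap.sum_apply,
      LinearMap.smul_apply, smul_eq_mul]
  simp only [fun i => h1 (1 ⊗ₜ e i) (1 ⊗ₜ e i), Finset.sum_add_distrib]
  rw [Finset.sum_comm, Finset.sum_comm (f := fun i a => F.co false a _ * _)]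
  congr 1
  · exact Finset.sum_congr rfl fun a _ => (key true a).symm
  · exact Finset.sum_congr rfl fun a _ => (key false a).symm

/-- Of the two sums over the frame, the one which inserts vectors of the wrong types vanishes. -/
theorem mem_traceFree_iff {ε : Fin k → Bool} {T : R.Tensors k} (hT : T ∈ R.typed ε) {a b : Fin k}
    (ha : ε a = true) (hb : ε b = false) : T ∈ (R.traceFree k a b).toSubmodule ↔
      ∀ x, ∑ c, T (Function.update (Function.update x a (F.ζ true c)) b (F.ζ false c)) = 0 := by
  have hab : a ≠ b := fun h => by rw [h, hb] at ha; exact absurd ha (by decide)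
  have key : ∀ e : Fin (2 * m) → R.H, (∀ i j, R.h (e i) (e j) = if i = j then 1 else 0) → ∀ x,
      ∑ i, T (Function.update (Function.update x a (1 ⊗ₜ e i)) b (1 ⊗ₜ e i)) =
      ∑ c, T (Function.update (Function.update x a (F.ζ true c)) b (F.ζ false c)) := by
    intro e he x
    have h0 : ∀ c, T (Function.update (Function.update x a (F.ζ false c)) b (F.ζ true c)) = 0 :=
      fun c => hT b _ (by rw [Function.update_self, hb]; exact F.ζ_mem true c)
    let B : (ℂ ⊗[ℝ] R.H) →ₗ[ℂ] (ℂ ⊗[ℝ] R.H) →ₗ[ℂ] ℂ :=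
      LinearMap.mk₂ ℂ (fun u v => T (Function.update (Function.update x a u) b v))
        (fun u u' v => by simp only [Function.update_comm hab]; exact T.map_update_add _ _ _ _)
        (fun c u v => by simp only [Function.update_comm hab]; exact T.map_update_smul _ _ _ _)
        (fun u v v' => T.map_update_add _ _ _ _) (fun c u v => T.map_update_smul _ _ _ _)
    have := F.sum_orthonormal he B
    simp only [B, LinearMap.mk₂_apply, h0, Finset.sum_const_zero, add_zero] at this
    exact this
  obtain ⟨e, he⟩ := R.exists_orthonormal
  exact ⟨fun h x => by rw [← key e he x]; exact h e he x, fun h e he x => by rw [key e he x, h x]⟩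

theorem mem_swapSign_iff {ε : Fin k → Bool} {T : R.Tensors k} (hT : T ∈ R.typed ε) {a b : Fin k}
    (hab : ε a = ε b) (s : ℝ) : T ∈ (R.swapSign s k a b).toSubmodule ↔
      ∀ i, F.arr ε T (fun j => i (Equiv.swap a b j)) = s • F.arr ε T i := by
  have hε : ∀ i, ε (Equiv.swap a b i) = ε i := by
    intro i
    rw [Equiv.swap_apply_def]
    split_ifs with h1 h2
    · rw [h1, hab]
    · rw [h2, hab]
    · rfl
  have h1 : T.domDomCongr (Equiv.swap a b) ∈ R.typed ε := fun i x hx =>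
    hT (Equiv.swap a b i) _ (by
      change x (Equiv.swap a b (Equiv.swap a b i)) ∈ _
      rwa [Equiv.swap_apply_self, hε])
  have h2 : ∀ i, F.arr ε (T.domDomCongr (Equiv.swap a b)) i =
      F.arr ε T (fun j => i (Equiv.swap a b j)) := by
    intro i
    rw [arr_apply, arr_apply, MultilinearMap.domDomCongr_apply]
    simp only [hε]
  constructor
  · intro h i
    rw [← h2, arr_apply]
    exact h fun j => F.ζ (ε j) (i j)
  · intro h x
    have : T.domDomCongr (Equiv.swap a b) = (s : ℂ) • T :=
      F.eq_of_arr_eq h1 (Submodule.smul_mem _ _ hT) (by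
        funext i
        rw [h2, h i, map_smul]
        simp)
    have := congrArg (fun S => S x) this
    simpa using this

end UnitaryFrame

variable {k : ℕ}

theorem univ_perm3 : (Finset.univ : Finset (Equiv.Perm (Fin 3))) =
    {1, Equiv.swap 0 1, Equiv.swap 0 2, Equiv.swap 1 2, finRotate 3, (finRotate 3)⁻¹} := by
  decide

theorem sum_sign_perm3 (f : Equiv.Perm (Fin 3) → ℂ) :
    ∑ σ, ((Equiv.Perm.sign σ : ℤ) : ℂ) * f σ = f 1 - f (Equiv.swap 0 1) - f (Equiv.swap 0 2) -
      f (Equiv.swap 1 2) + f (finRotate 3) + f (finRotate 3)⁻¹ := by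
  rw [univ_perm3, Finset.sum_insert (by decide), Finset.sum_insert (by decide),
    Finset.sum_insert (by decide), Finset.sum_insert (by decide), Finset.sum_insert (by decide),
    Finset.sum_singleton, show Equiv.Perm.sign (Equiv.swap (0 : Fin 3) 1) = -1 by decide,
    show Equiv.Perm.sign (Equiv.swap (0 : Fin 3) 2) = -1 by decide,
    show Equiv.Perm.sign (Equiv.swap (1 : Fin 3) 2) = -1 by decide,
    show Equiv.Perm.sign (finRotate 3) = 1 by decide,
    show Equiv.Perm.sign (finRotate 3)⁻¹ = 1 by decide, Equiv.Perm.sign_one]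
  push_cast
  ring

theorem mem_swapSign2_iff {s : ℝ} {T : R.Tensors 2} :
    T ∈ (R.swapSign s 2 0 1).toSubmodule ↔ ∀ x y, T ![y, x] = s • T ![x, y] := by
  refine ⟨fun h x y => ?_, fun h x => ?_⟩
  · rw [← h ![x, y], swap2_01]
  · rw [vec2_eta x, swap2_01, h]

theorem mem_swapSign3_iff_01 {s : ℝ} {T : R.Tensors 3} :
    T ∈ (R.swapSign s 3 0 1).toSubmodule ↔ ∀ x y z, T ![y, x, z] = s • T ![x, y, z] := by
  refine ⟨fun h x y z => ?_, fun h x => ?_⟩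
  · rw [← h ![x, y, z], swap3_01]
  · rw [vec3_eta x, swap3_01, h]

theorem mem_swapSign3_iff_12 {s : ℝ} {T : R.Tensors 3} :
    T ∈ (R.swapSign s 3 1 2).toSubmodule ↔ ∀ x y z, T ![x, z, y] = s • T ![x, y, z] := by
  refine ⟨fun h x y z => ?_, fun h x => ?_⟩
  · rw [← h ![x, y, z], swap3_12]
  · rw [vec3_eta x, swap3_12, h]

/-- Skew symmetry in the last two slots pairs the six terms, leaving twice the cyclic sum. -/
theorem mem_noSkewPart3_iff {T : R.Tensors 3} (hT : T ∈ (R.swapSign (-1) 3 1 2).toSubmodule) :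
    T ∈ (R.noSkewPart 3).toSubmodule ↔
      ∀ x y z, T ![x, y, z] + T ![y, z, x] + T ![z, x, y] = 0 := by
  have h12 : ∀ x y z, T ![x, z, y] = - T ![x, y, z] := fun x y z => by
    rw [mem_swapSign3_iff_12.mp hT, neg_one_smul]
  have key : ∀ x y z, ∑ σ : Equiv.Perm (Fin 3),
      ((Equiv.Perm.sign σ : ℤ) : ℂ) * T (fun i => ![x, y, z] (σ i)) =
      2 * (T ![x, y, z] + T ![y, z, x] + T ![z, x, y]) := by
    intro x y z
    rw [sum_sign_perm3 fun σ => T (fun i => ![x, y, z] (σ i)), swap3_01, swap3_12,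
      show (fun i => ![x, y, z] ((1 : Equiv.Perm (Fin 3)) i)) = ![x, y, z] from rfl,
      show (fun i => ![x, y, z] (Equiv.swap 0 2 i)) = ![z, y, x] by
        funext i; fin_cases i <;> simp [Equiv.swap_apply_def],
      show (fun i => ![x, y, z] (finRotate 3 i)) = ![y, z, x] by
        funext i; fin_cases i <;> rfl,
      show (fun i => ![x, y, z] ((finRotate 3)⁻¹ i)) = ![z, x, y] by
        funext i; fin_cases i <;> rfl,
      h12 x y z, h12 z x y, h12 y z x]
    ring
  refine ⟨fun h x y z => ?_, fun h x => ?_⟩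
  · have := h ![x, y, z]
    rw [key] at this
    simpa using this
  · rw [vec3_eta x, key, h, mul_zero]

end RobinsonStructure

namespace Robinson

/-! ### Dimensions of spaces of arrays -/

namespace Arr

variable (m : ℕ)

theorem finrank_map_add_finrank_inf_ker {E E' : Type*} [AddCommGroup E] [Module ℂ E]
    [AddCommGroup E'] [Module ℂ E'] [FiniteDimensional ℂ E] (f : E →ₗ[ℂ] E')
    (W : Submodule ℂ E) : Module.finrank ℂ (W.map f) +
      Module.finrank ℂ (W ⊓ LinearMap.ker f : Submodule ℂ E) = Module.finrank ℂ W := by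
  rw [← (f.domRestrict W).finrank_range_add_finrank_ker, LinearMap.range_domRestrict]
  congr 1
  have h : (LinearMap.ker (f.domRestrict W)).map W.subtype = W ⊓ LinearMap.ker f := by
    ext x
    simp [and_comm]
  rw [← h]
  exact (Submodule.equivMapOfInjective _ W.injective_subtype _).finrank_eq.symm

/-- Skew-symmetric arrays with two indices. -/
def skew2 : Submodule ℂ (Arr 2 m) where
  carrier := {A | ∀ a b, A ![b, a] = - A ![a, b]}
  add_mem' hA hB a b := by simp [hA a b, hB a b]; ring
  zero_mem' := by simp
  smul_mem' c A hA a b := by simp [hA a b]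

/-- Symmetric arrays with two indices. -/
def sym2 : Submodule ℂ (Arr 2 m) where
  carrier := {A | ∀ a b, A ![b, a] = A ![a, b]}
  add_mem' hA hB a b := by simp [hA a b, hB a b]
  zero_mem' := by simp
  smul_mem' c A hA a b := by simp [hA a b]

/-- Tracefree arrays with two indices. -/
def tf2 : Submodule ℂ (Arr 2 m) where
  carrier := {A | ∑ c, A ![c, c] = 0}
  add_mem' {A B} hA hB := by
    have hA : ∑ c, A ![c, c] = 0 := hA
    have hB : ∑ c, B ![c, c] = 0 := hB
    simp [Finset.sum_add_distrib, hA, hB]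
  zero_mem' := by simp
  smul_mem' c A hA := by
    have hA : ∑ c, A ![c, c] = 0 := hA
    simp [← Finset.mul_sum, hA]

/-- Arrays with three indices which are skew-symmetric in the last two. -/
def skew12 : Submodule ℂ (Arr 3 m) where
  carrier := {A | ∀ a b c, A ![a, c, b] = - A ![a, b, c]}
  add_mem' hA hB a b c := by simp [hA a b c, hB a b c]; ring
  zero_mem' := by simp
  smul_mem' c A hA a b c := by simp [hA a b c]

/-- Arrays with three indices which are skew-symmetric in the first two. -/
def skew01 : Submodule ℂ (Arr 3 m) where
  carrier := {A | ∀ a b c, A ![b, a, c] = - A ![a, b, c]}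
  add_mem' hA hB a b c := by simp [hA a b c, hB a b c]; ring
  zero_mem' := by simp
  smul_mem' c A hA a b c := by simp [hA a b c]

/-- The sum over cyclic permutations of the indices. -/
def cyc : Arr 3 m →ₗ[ℂ] Arr 3 m where
  toFun A a := A ![a 0, a 1, a 2] + A ![a 1, a 2, a 0] + A ![a 2, a 0, a 1]
  map_add' A B := by funext a; simp; ring
  map_smul' c A := by funext a; simp; ring

variable {m} in
theorem cyc_apply (A : Arr 3 m) (a b c : Fin m) :
    cyc m A ![a, b, c] = A ![a, b, c] + A ![b, c, a] + A ![c, a, b] := rfl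

/-- The contraction of the first two indices. -/
def contr : Arr 3 m →ₗ[ℂ] (Fin m → ℂ) where
  toFun A d := ∑ c, A ![c, c, d]
  map_add' A B := by funext a; simp [Finset.sum_add_distrib]
  map_smul' c A := by funext a; simp [Finset.mul_sum]

theorem finrank_all (k : ℕ) : Module.finrank ℂ (Arr k m) = m ^ k := by simp [Arr]

theorem finrank_sym2 : Module.finrank ℂ (sym2 m) = (m + 1).choose 2 := by
  let e : (Sym2 (Fin m) → ℂ) ≃ₗ[ℂ] sym2 m :=
    { toFun f := ⟨fun a => f s(a 0, a 1), fun a b => by simp [Sym2.eq_swap]⟩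
      map_add' _ _ := rfl
      map_smul' _ _ := rfl
      invFun A := Sym2.lift ⟨fun a b => A.1 ![a, b], fun a b => A.2 b a⟩
      left_inv f := by
        funext x
        induction x using Sym2.ind
        rfl
      right_inv A := by
        apply Subtype.ext
        funext a
        change A.1 ![a 0, a 1] = A.1 a
        rw [← vec2_eta] }
  rw [← e.finrank_eq, Module.finrank_fintype_fun_eq_card, Sym2.card, Fintype.card_fin]

/-- Symmetrisation A ↦ A + Aᵗ has the symmetric arrays as range and the skew ones as kernel. -/
theorem finrank_skew2 : Module.finrank ℂ (skew2 m) = m.choose 2 := by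
  let f : Arr 2 m →ₗ[ℂ] Arr 2 m :=
    { toFun A a := A a + A ![a 1, a 0]
      map_add' A B := by funext a; simp; ring
      map_smul' c A := by funext a; simp; ring }
  have hf : ∀ A a b, f A ![a, b] = A ![a, b] + A ![b, a] := fun A a b => rfl
  have hr : LinearMap.range f = sym2 m := by
    ext A
    constructor
    · rintro ⟨A, rfl⟩ a b
      rw [hf, hf, add_comm]
    · intro hA
      refine ⟨(1 / 2 : ℂ) • A, ?_⟩
      funext a
      rw [vec2_eta a, hf]
      simp only [Pi.smul_apply, hA (a 0) (a 1), smul_eq_mul]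
      ring
  have hk : LinearMap.ker f = skew2 m := by
    ext A
    rw [LinearMap.mem_ker]
    constructor
    · intro h a b
      have := congrFun h ![a, b]
      rw [hf, Pi.zero_apply] at this
      exact (neg_eq_of_add_eq_zero_right this).symm
    · intro h
      funext a
      rw [vec2_eta a, hf, h (a 0) (a 1), Pi.zero_apply, add_neg_cancel]
  have h := f.finrank_range_add_finrank_ker
  rw [hr, hk, finrank_sym2, finrank_all, Nat.choose_succ_succ' m 1, Nat.choose_one_right] at h
  have h2 := Nat.triangle_succ m
  rw [Nat.choose_two_right] at h ⊢
  have h3 : 2 * (m * (m - 1) / 2) = m * (m - 1) :=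
    Nat.mul_div_cancel' (Nat.even_mul_pred_self m).two_dvd
  have h4 : m ^ 2 = m + m * (m - 1) := by
    cases m with
    | zero => rfl
    | succ n => simp; ring
  omega

theorem finrank_skew12 : Module.finrank ℂ (skew12 m) = m * m.choose 2 := by
  let e : skew12 m ≃ₗ[ℂ] (Fin m → skew2 m) :=
    { toFun A i := ⟨fun a => A.1 ![i, a 0, a 1], fun a b => A.2 i a b⟩
      map_add' _ _ := rfl
      map_smul' _ _ := rfl
      invFun B := ⟨fun a => (B (a 0)).1 ![a 1, a 2], fun a b c => (B a).2 b c⟩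
      left_inv A := by
        apply Subtype.ext
        funext a
        change A.1 ![a 0, a 1, a 2] = A.1 a
        rw [← vec3_eta]
      right_inv B := by
        funext i
        apply Subtype.ext
        funext a
        change (B i).1 ![a 0, a 1] = (B i).1 a
        rw [← vec2_eta] }
  rw [e.finrank_eq, Module.finrank_pi_fintype]
  simp [finrank_skew2]

/-- A totally skew array is determined by its entries at strictly increasing triples, and these may
be prescribed freely. -/
theorem finrank_skew3 : Module.finrank ℂ (skew01 m ⊓ skew12 m : Submodule ℂ (Arr 3 m)) =
    m.choose 3 := by
  let f : (skew01 m ⊓ skew12 m : Submodule ℂ (Arr 3 m)) →ₗ[ℂ] ((Fin 3 ↪o Fin m) → ℂ) :=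
    { toFun A s := A.1 s
      map_add' _ _ := rfl
      map_smul' _ _ := rfl }
  have hf : Function.Bijective f := by
    constructor
    · rw [injective_iff_map_eq_zero]
      rintro ⟨A, h01, h12⟩ hA
      have h0 : ∀ a b c, a < b → b < c → A ![a, b, c] = 0 := by
        intro a b c hab hbc
        have hs : StrictMono ![a, b, c] := by
          rw [Fin.strictMono_iff_lt_succ]
          intro i
          fin_cases i
          · exact hab
          · exact hbc
        exact congrFun hA (OrderEmbedding.ofStrictMono _ hs)
      have h01' : ∀ a b c, A ![b, a, c] = - A ![a, b, c] := h01
      have h12' : ∀ a b c, A ![a, c, b] = - A ![a, b, c] := h12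
      apply Subtype.ext
      funext a
      change A a = 0
      rw [vec3_eta a]
      generalize a 0 = x
      generalize a 1 = y
      generalize a 2 = z
      have e1 := h01' x x z
      have e2 := h12' x y y
      have e3 : A ![x, y, x] = 0 := by
        have := h01' x y x
        have := h12' y x x
        grind
      rcases lt_trichotomy x y with h | h | h <;> rcases lt_trichotomy y z with h' | h' | h' <;>
        rcases lt_trichotomy x z with h'' | h'' | h'' <;> grind
    · intro φ
      classical
      -- The prescribed values extended by zero; the preimage is the signed sum of B over
      -- permutations of the arguments, and on increasing triples only one term is nonzero.
      let B : Fin m → Fin m → Fin m → ℂ := fun a b c =>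
        if hs : StrictMono ![a, b, c] then φ (OrderEmbedding.ofStrictMono _ hs) else 0
      have hB : ∀ a b c, ¬ (a < b ∧ b < c) → B a b c = 0 := by
        intro a b c h
        refine dif_neg fun hs => h ⟨hs (by decide : (0 : Fin 3) < 1), hs (by decide : (1 : Fin 3) < 2)⟩
      refine ⟨⟨fun a => B (a 0) (a 1) (a 2) + B (a 1) (a 2) (a 0) + B (a 2) (a 0) (a 1) -
        B (a 1) (a 0) (a 2) - B (a 0) (a 2) (a 1) - B (a 2) (a 1) (a 0), ?_, ?_⟩, ?_⟩
      · intro a b c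
        change B b a c + B a c b + B c b a - B a b c - B b c a - B c a b =
          -(B a b c + B b c a + B c a b - B b a c - B a c b - B c b a)
        ring
      · intro a b c
        change B a c b + B c b a + B b a c - B c a b - B a b c - B b c a =
          -(B a b c + B b c a + B c a b - B b a c - B a c b - B c b a)
        ring
      · funext s
        have h1 : s 0 < s 1 := s.strictMono (by decide)
        have h2 : s 1 < s 2 := s.strictMono (by decide)
        change B (s 0) (s 1) (s 2) + B (s 1) (s 2) (s 0) + B (s 2) (s 0) (s 1) -
          B (s 1) (s 0) (s 2) - B (s 0) (s 2) (s 1) - B (s 2) (s 1) (s 0) = φ s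
        rw [hB (s 1) (s 2) (s 0) (by omega), hB (s 2) (s 0) (s 1) (by omega),
          hB (s 1) (s 0) (s 2) (by omega), hB (s 0) (s 2) (s 1) (by omega),
          hB (s 2) (s 1) (s 0) (by omega)]
        have h3 : ![s 0, s 1, s 2] = s := (vec3_eta s).symm
        have hs : StrictMono ![s 0, s 1, s 2] := by rw [h3]; exact s.strictMono
        have h4 : B (s 0) (s 1) (s 2) = φ (OrderEmbedding.ofStrictMono _ hs) := dif_pos hs
        rw [h4, show OrderEmbedding.ofStrictMono _ hs = s from DFunLike.ext' h3]
        ring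
  rw [(LinearEquiv.ofBijective f hf).finrank_eq, Module.finrank_fintype_fun_eq_card,
    Fintype.card_congr Set.powersetCard.ofFinEmbEquiv, Fintype.card_eq_nat_card,
    Set.powersetCard.card, Nat.card_eq_fintype_card, Fintype.card_fin]

/-- The cyclic sum maps arrays which are skew in the last two slots onto the totally skew ones, so
the dimension follows from rank-nullity. -/
theorem finrank_young : Module.finrank ℂ (skew12 m ⊓ LinearMap.ker (cyc m) : Submodule ℂ (Arr 3 m)) +
    m.choose 3 = m * m.choose 2 := by
  have h := finrank_map_add_finrank_inf_ker (cyc m) (skew12 m)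
  have hr : (skew12 m).map (cyc m) = skew01 m ⊓ skew12 m := by
    ext A
    constructor
    · rintro ⟨A, hA, rfl⟩
      have hA : ∀ a b c, A ![a, c, b] = - A ![a, b, c] := hA
      constructor
      · intro a b c
        rw [cyc_apply, cyc_apply, hA b c a, hA a b c, hA c a b]
        ring
      · intro a b c
        rw [cyc_apply, cyc_apply, hA b c a, hA a b c, hA c a b]
        ring
    · rintro ⟨h01, h12⟩
      have h01 : ∀ a b c, A ![b, a, c] = - A ![a, b, c] := h01
      have h12' : ∀ a b c, A ![a, c, b] = - A ![a, b, c] := h12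
      -- On a totally skew array the cyclic sum is multiplication by 3.
      refine ⟨(1 / 3 : ℂ) • A, (skew12 m).smul_mem _ h12, ?_⟩
      funext a
      rw [vec3_eta a, cyc_apply]
      simp only [Pi.smul_apply, smul_eq_mul]
      rw [h12' (a 1) (a 0) (a 2), h01 (a 0) (a 1) (a 2), h01 (a 0) (a 2) (a 1),
        h12' (a 0) (a 1) (a 2)]
      ring
  rw [hr, finrank_skew3, finrank_skew12] at h
  omega

theorem finrank_tf2 (hm : 0 < m) : Module.finrank ℂ (tf2 m) + 1 = m ^ 2 := by
  let f : Arr 2 m →ₗ[ℂ] ℂ :=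
    { toFun A := ∑ c, A ![c, c]
      map_add' A B := by simp [Finset.sum_add_distrib]
      map_smul' c A := by simp [Finset.mul_sum] }
  have hr : LinearMap.range f = ⊤ := by
    rw [LinearMap.range_eq_top]
    intro c
    refine ⟨fun a => if a = ![⟨0, hm⟩, ⟨0, hm⟩] then c else 0, ?_⟩
    change ∑ b : Fin m, (if ![b, b] = ![⟨0, hm⟩, ⟨0, hm⟩] then c else 0) = c
    rw [Finset.sum_eq_single ⟨0, hm⟩]
    · simp
    · intro b _ hb
      rw [if_neg]
      intro h
      exact hb (congrFun h 0)
    · simp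
  have h := f.finrank_range_add_finrank_ker
  rw [hr, finrank_top, Module.finrank_self, finrank_all,
    show LinearMap.ker f = tf2 m from rfl] at h
  omega

theorem finrank_mixed (hm : 1 < m) :
    Module.finrank ℂ (skew12 m ⊓ LinearMap.ker (contr m) : Submodule ℂ (Arr 3 m)) + m =
      m * m.choose 2 := by
  have h := finrank_map_add_finrank_inf_ker (contr m) (skew12 m)
  have hr : (skew12 m).map (contr m) = ⊤ := by
    rw [eq_top_iff]
    intro θ _
    -- The contraction of δ(a₀,a₁)θ(a₂) - δ(a₀,a₂)θ(a₁) is mθ - θ, which accounts for the factor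
    -- 1/(m-1).
    refine ⟨fun a => ((m : ℂ) - 1)⁻¹ * ((if a 0 = a 1 then θ (a 2) else 0) -
      (if a 0 = a 2 then θ (a 1) else 0)), fun a b c => ?_, ?_⟩
    · change ((m : ℂ) - 1)⁻¹ * ((if a = c then θ b else 0) - (if a = b then θ c else 0)) =
        -(((m : ℂ) - 1)⁻¹ * ((if a = b then θ c else 0) - (if a = c then θ b else 0)))
      ring
    · funext d
      change ∑ c : Fin m, ((m : ℂ) - 1)⁻¹ * ((if c = c then θ d else 0) -
        (if c = d then θ c else 0)) = θ d
      have h0 : (m : ℂ) - 1 ≠ 0 := by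
        rw [sub_ne_zero]
        exact_mod_cast hm.ne'
      rw [← Finset.mul_sum, Finset.sum_sub_distrib]
      simp
      field_simp
  rw [hr, finrank_top, finrank_skew12, Module.finrank_fintype_fun_eq_card, Fintype.card_fin] at h
  omega

end Arr

end Robinson

namespace RobinsonStructure

open Robinson

variable {m : ℕ} {V : Type*} [AddCommGroup V] [Module ℝ V] {M : MinkowskiMetric m V}
  {R : RobinsonStructure M}

/-! ### Complex conjugation of tensors -/

section Conj

variable {k : ℕ}

variable (R k) in
/-- The complex conjugate of a tensor. -/
def conjT : R.Tensors k →ₗ[ℝ] R.Tensors k where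
  toFun T :=
    { toFun x := starRingEnd ℂ (T fun i => conjC _ (x i))
      map_update_add' := by
        intro _ x i u v
        have h : ∀ w, (fun j => conjC _ (Function.update x i w j)) =
            Function.update (fun j => conjC R.H (x j)) i (conjC _ w) := by
          intro w
          funext j
          rcases eq_or_ne j i with rfl | hj
          · simp
          · simp [hj]
        simp only [h, map_add, T.map_update_add]
      map_update_smul' := by
        intro _ x i c u
        have h : ∀ w, (fun j => conjC _ (Function.update x i w j)) =
            Function.update (fun j => conjC R.H (x j)) i (conjC _ w) := by
          intro w
          funext j
          rcases eq_or_ne j i with rfl | hj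
          · simp
          · simp [hj]
        simp only [h, conjC_smul, T.map_update_smul]
        simp }
  map_add' S T := by ext x; simp
  map_smul' c T := by ext x; simp

theorem conjT_apply (T : R.Tensors k) (x : Fin k → ℂ ⊗[ℝ] R.H) :
    R.conjT k T x = starRingEnd ℂ (T fun i => conjC _ (x i)) := rfl

theorem conjT_conjT (T : R.Tensors k) : R.conjT k (R.conjT k T) = T := by
  ext x
  simp [conjT_apply, conjC_conjC]

theorem conjT_tensorRep (q : R.Q₀) (T : R.Tensors k) :
    R.conjT k (R.tensorRep k q T) = R.tensorRep k q (R.conjT k T) := by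
  ext x
  simp only [conjT_apply, tensorRep_apply, conjC_baseChange]

theorem conjT1_apply (T : R.Tensors 1) (x : ℂ ⊗[ℝ] R.H) :
    R.conjT 1 T ![x] = starRingEnd ℂ (T ![conjC _ x]) := by
  rw [conjT_apply, vec1_eta fun i => conjC R.H (![x] i)]
  rfl

theorem conjT2_apply (T : R.Tensors 2) (x y : ℂ ⊗[ℝ] R.H) :
    R.conjT 2 T ![x, y] = starRingEnd ℂ (T ![conjC _ x, conjC _ y]) := by
  rw [conjT_apply, vec2_eta fun i => conjC R.H (![x, y] i)]
  rfl

theorem conjT3_apply (T : R.Tensors 3) (x y z : ℂ ⊗[ℝ] R.H) :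
    R.conjT 3 T ![x, y, z] = starRingEnd ℂ (T ![conjC _ x, conjC _ y, conjC _ z]) := by
  rw [conjT_apply, vec3_eta fun i => conjC R.H (![x, y, z] i)]
  rfl

variable (R) in
/-- The Hermitian adjoint of a tensor of rank two. -/
def starT : R.Tensors 2 →ₗ[ℝ] R.Tensors 2 where
  toFun T := (R.conjT 2 T).domDomCongr (Equiv.swap 0 1)
  map_add' _ _ := by ext x; simp
  map_smul' _ _ := by ext x; simp

theorem starT_apply (T : R.Tensors 2) (x y : ℂ ⊗[ℝ] R.H) :
    R.starT T ![x, y] = starRingEnd ℂ (T ![conjC _ y, conjC _ x]) := by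
  change R.conjT 2 T (fun i => ![x, y] (Equiv.swap 0 1 i)) = _
  rw [swap2_01, conjT2_apply]

theorem ext2 {S T : R.Tensors 2} (h : ∀ x y, S ![x, y] = T ![x, y]) : S = T := by
  ext x
  rw [vec2_eta x, h]

theorem ext1 {S T : R.Tensors 1} (h : ∀ x, S ![x] = T ![x]) : S = T := by
  ext x
  rw [vec1_eta x, h]

theorem ext3 {S T : R.Tensors 3} (h : ∀ x y z, S ![x, y, z] = T ![x, y, z]) : S = T := by
  ext x
  rw [vec3_eta x, h]

theorem starT_starT (T : R.Tensors 2) : R.starT (R.starT T) = T := by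
  refine ext2 fun x y => ?_
  simp [starT_apply, conjC_conjC]

theorem starT_I_smul (T : R.Tensors 2) :
    R.starT (Complex.I • T) = -(Complex.I • R.starT T) := by
  refine ext2 fun x y => ?_
  simp [starT_apply]

theorem starT_tensorRep (q : R.Q₀) (T : R.Tensors 2) :
    R.starT (R.tensorRep 2 q T) = R.tensorRep 2 q (R.starT T) := by
  change (R.conjT 2 (R.tensorRep 2 q T)).domDomCongr _ = _
  rw [conjT_tensorRep]
  rfl

theorem mem_real11_iff (T : R.Tensors 2) : T ∈ R.real11.toSubmodule ↔ R.starT T = -T := by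
  constructor
  · intro h
    refine ext2 fun x y => ?_
    rw [starT_apply, _root_.neg_apply, h x y, neg_neg]
  · intro h x y
    rw [← starT_apply, h, _root_.neg_apply, neg_neg]

end Conj

/-! ### Components of the tensors in the table -/

variable (R) in
/-- The complex module of tracefree `(1,1)`-forms. -/
def tracefree11 : Subrepresentation (R.tensorRep 2) :=
  R.type10 2 0 ⊓ R.type01 2 1 ⊓ R.traceFree 2 0 1

theorem mem_typed1_iff {T : R.Tensors 1} :
    T ∈ R.typed (fun _ => true) ↔ T ∈ (R.type10 1 0).toSubmodule :=
  Fin.forall_fin_one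

theorem mem_typed2_iff {T : R.Tensors 2} : T ∈ R.typed (fun _ => true) ↔
    T ∈ (R.type10 2 0).toSubmodule ∧ T ∈ (R.type10 2 1).toSubmodule :=
  Fin.forall_fin_two

theorem mem_typed11_iff {T : R.Tensors 2} : T ∈ R.typed ![true, false] ↔
    T ∈ (R.type10 2 0).toSubmodule ∧ T ∈ (R.type01 2 1).toSubmodule :=
  Fin.forall_fin_two

theorem forall_fin_three {P : Fin 3 → Prop} : (∀ i, P i) ↔ (P 0 ∧ P 1) ∧ P 2 := by
  refine ⟨fun h => ⟨⟨h 0, h 1⟩, h 2⟩, fun h i => ?_⟩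
  fin_cases i
  exacts [h.1.1, h.1.2, h.2]

theorem mem_typed3_iff {T : R.Tensors 3} : T ∈ R.typed (fun _ => true) ↔
    (T ∈ (R.type10 3 0).toSubmodule ∧ T ∈ (R.type10 3 1).toSubmodule) ∧
      T ∈ (R.type10 3 2).toSubmodule :=
  forall_fin_three

theorem mem_typed12_iff {T : R.Tensors 3} : T ∈ R.typed ![true, false, false] ↔
    (T ∈ (R.type10 3 0).toSubmodule ∧ T ∈ (R.type01 3 1).toSubmodule) ∧
      T ∈ (R.type01 3 2).toSubmodule :=
  forall_fin_three

theorem mem_forms20_iff {T : R.Tensors 2} : T ∈ R.forms20.toSubmodule ↔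
    T ∈ R.typed (fun _ => true) ∧ T ∈ (R.swapSign (-1) 2 0 1).toSubmodule := by
  rw [mem_typed2_iff]
  exact Iff.rfl

theorem mem_sym20_iff {T : R.Tensors 2} : T ∈ R.sym20.toSubmodule ↔
    T ∈ R.typed (fun _ => true) ∧ T ∈ (R.swapSign 1 2 0 1).toSubmodule := by
  rw [mem_typed2_iff]
  exact Iff.rfl

theorem mem_forms30_iff {T : R.Tensors 3} : T ∈ R.forms30.toSubmodule ↔
    T ∈ R.typed (fun _ => true) ∧ T ∈ (R.swapSign (-1) 3 0 1).toSubmodule ∧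
      T ∈ (R.swapSign (-1) 3 1 2).toSubmodule := by
  rw [mem_typed3_iff, ← and_assoc]
  exact Iff.rfl

theorem mem_young21_iff {T : R.Tensors 3} : T ∈ R.young21.toSubmodule ↔
    T ∈ R.typed (fun _ => true) ∧ T ∈ (R.swapSign (-1) 3 1 2).toSubmodule ∧
      T ∈ (R.noSkewPart 3).toSubmodule := by
  rw [mem_typed3_iff, ← and_assoc]
  exact Iff.rfl

theorem mem_tracefree11_iff {T : R.Tensors 2} : T ∈ R.tracefree11.toSubmodule ↔
    T ∈ R.typed ![true, false] ∧ T ∈ (R.traceFree 2 0 1).toSubmodule := by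
  rw [mem_typed11_iff]
  exact Iff.rfl

theorem mem_forms11_iff {T : R.Tensors 2} : T ∈ R.forms11.toSubmodule ↔
    T ∈ R.tracefree11.toSubmodule ∧ R.starT T = -T := by
  rw [← mem_real11_iff]
  exact and_right_comm

theorem mem_forms12_iff {T : R.Tensors 3} : T ∈ R.forms12.toSubmodule ↔
    T ∈ R.typed ![true, false, false] ∧ T ∈ (R.swapSign (-1) 3 1 2).toSubmodule ∧
      T ∈ (R.traceFree 3 0 1).toSubmodule := by
  rw [mem_typed12_iff, ← and_assoc]
  exact Iff.rfl

variable (R) in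
/-- The sum over cyclic permutations of the arguments. -/
def cycT : R.Tensors 3 →ₗ[ℝ] R.Tensors 3 where
  toFun T := T + T.domDomCongr (finRotate 3) + T.domDomCongr (finRotate 3)⁻¹
  map_add' S T := by ext x; simp; ring
  map_smul' c T := by ext x; simp

theorem cycT_apply (T : R.Tensors 3) (x y z : ℂ ⊗[ℝ] R.H) :
    R.cycT T ![x, y, z] = T ![x, y, z] + T ![y, z, x] + T ![z, x, y] := by
  change T ![x, y, z] + T (fun i => ![x, y, z] (finRotate 3 i)) +
    T (fun i => ![x, y, z] ((finRotate 3)⁻¹ i)) = _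
  rw [vec3_eta fun i => ![x, y, z] (finRotate 3 i),
    vec3_eta fun i => ![x, y, z] ((finRotate 3)⁻¹ i)]
  rfl

theorem cycT_mem_typed {T : R.Tensors 3} (hT : T ∈ R.typed fun _ => true) :
    R.cycT T ∈ R.typed fun _ => true := by
  have h0 : ∀ x y z, x ∈ R.H01 ∨ y ∈ R.H01 ∨ z ∈ R.H01 → T ![x, y, z] = 0 := by
    rintro x y z (h | h | h)
    · exact hT 0 _ h
    · exact hT 1 _ h
    · exact hT 2 _ h
  intro i x hx
  rw [vec3_eta x, cycT_apply]
  have hx : x 0 ∈ R.H01 ∨ x 1 ∈ R.H01 ∨ x 2 ∈ R.H01 := by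
    fin_cases i
    exacts [Or.inl hx, Or.inr (Or.inl hx), Or.inr (Or.inr hx)]
  rw [h0 _ _ _ hx, h0 _ _ _ (by tauto), h0 _ _ _ (by tauto), add_zero, add_zero]

theorem cycT_eq_zero_iff {T : R.Tensors 3} (hT : T ∈ (R.swapSign (-1) 3 1 2).toSubmodule) :
    R.cycT T = 0 ↔ T ∈ (R.noSkewPart 3).toSubmodule := by
  rw [mem_noSkewPart3_iff hT]
  constructor
  · intro h x y z
    rw [← cycT_apply, h, _root_.zero_apply]
  · intro h
    refine ext3 fun x y z => ?_
    rw [cycT_apply, h, _root_.zero_apply]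

namespace UnitaryFrame

variable (F : R.UnitaryFrame)

/-- This and the following `_iff_arr` lemmas present a module as a type condition together with a
linear condition on components. In this shape `hasExtremalVector_of_iff` and `finrank_of_iff` reduce
irreducibility and dimension to arrays. -/
theorem forms10_iff_arr {T : R.Tensors 1} : T ∈ R.forms10.toSubmodule ↔
    T ∈ R.typed (fun _ => true) ∧ F.arr (fun _ => true) T ∈ (⊤ : Submodule ℂ (Arr 1 m)) := by
  rw [mem_typed1_iff]
  exact (and_iff_left trivial).symm

theorem forms20_iff_arr {T : R.Tensors 2} : T ∈ R.forms20.toSubmodule ↔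
    T ∈ R.typed (fun _ => true) ∧ F.arr (fun _ => true) T ∈ Arr.skew2 m := by
  rw [mem_forms20_iff]
  refine and_congr_right fun hT => ?_
  rw [F.mem_swapSign_iff hT rfl]
  constructor
  · intro h a b
    rw [← swap2_01, h, neg_one_smul]
  · intro h i
    rw [vec2_eta i, swap2_01, h, neg_one_smul]

theorem sym20_iff_arr {T : R.Tensors 2} : T ∈ R.sym20.toSubmodule ↔
    T ∈ R.typed (fun _ => true) ∧ F.arr (fun _ => true) T ∈ Arr.sym2 m := by
  rw [mem_sym20_iff]
  refine and_congr_right fun hT => ?_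
  rw [F.mem_swapSign_iff hT rfl]
  constructor
  · intro h a b
    rw [← swap2_01, h, one_smul]
  · intro h i
    rw [vec2_eta i, swap2_01, h, one_smul]

theorem swapSign12_iff_arr {ε : Fin 3 → Bool} {T : R.Tensors 3} (hT : T ∈ R.typed ε)
    (hε : ε 1 = ε 2) : T ∈ (R.swapSign (-1) 3 1 2).toSubmodule ↔ F.arr ε T ∈ Arr.skew12 m := by
  rw [F.mem_swapSign_iff hT hε]
  constructor
  · intro h a b c
    rw [← swap3_12, h, neg_one_smul]
  · intro h i
    rw [vec3_eta i, swap3_12, h, neg_one_smul]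

theorem forms30_iff_arr {T : R.Tensors 3} : T ∈ R.forms30.toSubmodule ↔
    T ∈ R.typed (fun _ => true) ∧
      F.arr (fun _ => true) T ∈ (Arr.skew01 m ⊓ Arr.skew12 m : Submodule ℂ (Arr 3 m)) := by
  rw [mem_forms30_iff]
  refine and_congr_right fun hT => ?_
  rw [F.swapSign12_iff_arr hT rfl, F.mem_swapSign_iff hT rfl, Submodule.mem_inf]
  refine and_congr_left fun _ => ?_
  constructor
  · intro h a b c
    rw [← swap3_01, h, neg_one_smul]
  · intro h i
    rw [vec3_eta i, swap3_01, h, neg_one_smul]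

theorem young21_iff_arr {T : R.Tensors 3} : T ∈ R.young21.toSubmodule ↔
    T ∈ R.typed (fun _ => true) ∧ F.arr (fun _ => true) T ∈
      (Arr.skew12 m ⊓ LinearMap.ker (Arr.cyc m) : Submodule ℂ (Arr 3 m)) := by
  rw [mem_young21_iff]
  refine and_congr_right fun hT => ?_
  rw [Submodule.mem_inf, ← F.swapSign12_iff_arr hT rfl]
  refine and_congr_right fun h12 => ?_
  have h : F.arr (fun _ => true) (R.cycT T) = Arr.cyc m (F.arr (fun _ => true) T) := by
    funext a
    rw [vec3_eta a, Arr.cyc_apply]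
    simp only [arr_apply]
    rw [vec3_eta fun i => F.ζ true (![a 0, a 1, a 2] i), cycT_apply,
      vec3_eta fun i => F.ζ true (![a 1, a 2, a 0] i),
      vec3_eta fun i => F.ζ true (![a 2, a 0, a 1] i)]
    rfl
  rw [← cycT_eq_zero_iff h12, LinearMap.mem_ker, ← h]
  refine ⟨fun h0 => by rw [h0, map_zero], fun h0 => ?_⟩
  exact F.eq_of_arr_eq (cycT_mem_typed hT) (Submodule.zero_mem _) (by rw [h0, map_zero])

theorem tracefree11_iff_arr {T : R.Tensors 2} : T ∈ R.tracefree11.toSubmodule ↔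
    T ∈ R.typed ![true, false] ∧ F.arr ![true, false] T ∈ Arr.tf2 m := by
  rw [mem_tracefree11_iff]
  refine and_congr_right fun hT => ?_
  have hv : ∀ c, (fun i => F.ζ (![true, false] i) (![c, c] i)) = ![F.ζ true c, F.ζ false c] :=
    fun c => vec2_eta _
  have h2 : F.arr ![true, false] T ∈ Arr.tf2 m ↔ ∑ c, T ![F.ζ true c, F.ζ false c] = 0 := by
    change ∑ c, F.arr ![true, false] T ![c, c] = 0 ↔ _
    simp only [arr_apply, hv]
  rw [F.mem_traceFree_iff hT rfl rfl, h2]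
  constructor
  · intro h
    have := h ![0, 0]
    simpa only [update2_0, update2_1] using this
  · intro h x
    rw [vec2_eta x]
    simpa only [update2_0, update2_1] using h

theorem forms12_iff_arr {T : R.Tensors 3} : T ∈ R.forms12.toSubmodule ↔
    T ∈ R.typed ![true, false, false] ∧ F.arr ![true, false, false] T ∈
      (Arr.skew12 m ⊓ LinearMap.ker (Arr.contr m) : Submodule ℂ (Arr 3 m)) := by
  rw [mem_forms12_iff]
  refine and_congr_right fun hT => ?_
  rw [F.swapSign12_iff_arr hT rfl, Submodule.mem_inf, F.mem_traceFree_iff hT rfl rfl]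
  refine and_congr_right fun _ => ?_
  have hv : ∀ c d, (fun i => F.ζ (![true, false, false] i) (![c, c, d] i)) =
    ![F.ζ true c, F.ζ false c, F.ζ false d] := fun c d => vec3_eta _
  have h2 : F.arr ![true, false, false] T ∈ LinearMap.ker (Arr.contr m) ↔
      ∀ d, ∑ c, T ![F.ζ true c, F.ζ false c, F.ζ false d] = 0 := by
    rw [LinearMap.mem_ker, funext_iff]
    change (∀ d, ∑ c, F.arr ![true, false, false] T ![c, c, d] = 0) ↔ _
    simp only [arr_apply, hv]
  rw [h2]
  constructor
  · intro h d
    have := h ![0, 0, F.ζ false d]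
    simpa only [update3_0, update3_1] using this
  · intro h x
    rw [vec3_eta x]
    simp only [update3_0, update3_1]
    -- The contraction as a linear function of the last argument: it vanishes on the (0,1) frame
    -- vectors by assumption and on the (1,0) ones by type.
    let f : (ℂ ⊗[ℝ] R.H) →ₗ[ℂ] ℂ := ∑ c, T.toLinearMap ![F.ζ true c, F.ζ false c, 0] 2
    have hf : ∀ w, f w = ∑ c, T ![F.ζ true c, F.ζ false c, w] := by
      intro w
      simp only [f, LinearMap.sum_apply, MultilinearMap.toLinearMap_apply, update3_2]
    have h0 : f = 0 := F.ext_ζ fun s d => by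
      rw [hf, LinearMap.zero_apply]
      cases s
      · exact h d
      · exact Finset.sum_eq_zero fun c _ => hT 2 _ (F.ζ_mem true d)
    rw [← hf, h0, LinearMap.zero_apply]

variable {k : ℕ} {ε : Fin k → Bool} {E : Submodule ℝ (R.Tensors k)} {D : Submodule ℂ (Arr k m)}

theorem I_smul_mem_of_iff (h : ∀ T, T ∈ E ↔ T ∈ R.typed ε ∧ F.arr ε T ∈ D) {T : R.Tensors k}
    (hT : T ∈ E) : Complex.I • T ∈ E := by
  rw [h] at hT ⊢
  exact ⟨Submodule.smul_mem _ _ hT.1, by rw [map_smul]; exact D.smul_mem _ hT.2⟩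

theorem hasExtremalVector_of_iff (h : ∀ T, T ∈ E ↔ T ∈ R.typed ε ∧ F.arr ε T ∈ D)
    {x : Fin k → Fin m}
    (hu : ∀ A ∈ D, (∀ a, A a ≠ 0 → ∀ p, wt ε p a = wt ε p x) → A x = 0 → A = 0)
    (hr : ∀ A ∈ D, A ≠ 0 → ∃ s : Equiv.Perm (Fin m), A (s ∘ x) ≠ 0 ∨
      ∃ p q, elemAct ε p q A (s ∘ x) ≠ 0) : F.HasExtremalVector ε E x where
  typed T hT := ((h T).mp hT).1
  I_smul _ hT := F.I_smul_mem_of_iff h hT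
  unique T hT := hu _ ((h T).mp hT).2
  reach T hT := hr _ ((h T).mp hT).2

/-- Components identify E with D, and the factor 2 comes from counting real dimensions. -/
theorem finrank_of_iff (h : ∀ T, T ∈ E ↔ T ∈ R.typed ε ∧ F.arr ε T ∈ D) :
    Module.finrank ℝ E = 2 * Module.finrank ℂ D := by
  let f : E →ₗ[ℝ] D :=
    { toFun T := ⟨F.arr ε T.1, ((h _).mp T.2).2⟩
      map_add' S T := Subtype.ext (map_add _ _ _)
      map_smul' c T := Subtype.ext (map_smul ((F.arr ε).restrictScalars ℝ) c T.1) }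
  have hf : Function.Bijective f := by
    constructor
    · intro S T hST
      exact Subtype.ext (F.eq_of_arr_eq ((h _).mp S.2).1 ((h _).mp T.2).1
        (congrArg Subtype.val hST))
    · rintro ⟨A, hA⟩
      refine ⟨⟨F.ofArr ε A, (h _).mpr ⟨F.ofArr_mem ε A, ?_⟩⟩, Subtype.ext (F.arr_ofArr ε A)⟩
      rwa [F.arr_ofArr]
  rw [(LinearEquiv.ofBijective f hf).finrank_eq, finrank_real_of_complex]

end UnitaryFrame

end RobinsonStructure

namespace RobinsonStructure

open Robinson

variable {m : ℕ} {V : Type*} [AddCommGroup V] [Module ℝ V] {M : MinkowskiMetric m V}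
  {R : RobinsonStructure M}

/-! ### Irreducibility of the modules in the table -/

variable (R)

theorem finrank_forms10 : Module.finrank ℝ R.forms10.toSubmodule = 2 * m := by
  obtain ⟨F⟩ := R.exists_unitaryFrame
  rw [F.finrank_of_iff fun T => F.forms10_iff_arr, finrank_top, Arr.finrank_all, pow_one]

theorem finrank_forms20 : Module.finrank ℝ R.forms20.toSubmodule = 2 * m.choose 2 := by
  obtain ⟨F⟩ := R.exists_unitaryFrame
  rw [F.finrank_of_iff fun T => F.forms20_iff_arr, Arr.finrank_skew2]

theorem finrank_sym20 : Module.finrank ℝ R.sym20.toSubmodule = 2 * (m + 1).choose 2 := by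
  obtain ⟨F⟩ := R.exists_unitaryFrame
  rw [F.finrank_of_iff fun T => F.sym20_iff_arr, Arr.finrank_sym2]

theorem finrank_forms30 : Module.finrank ℝ R.forms30.toSubmodule = 2 * m.choose 3 := by
  obtain ⟨F⟩ := R.exists_unitaryFrame
  rw [F.finrank_of_iff fun T => F.forms30_iff_arr, Arr.finrank_skew3]

theorem finrank_young21 :
    Module.finrank ℝ R.young21.toSubmodule + 2 * m.choose 3 = 2 * (m * m.choose 2) := by
  obtain ⟨F⟩ := R.exists_unitaryFrame
  rw [F.finrank_of_iff fun T => F.young21_iff_arr, ← Arr.finrank_young m]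
  ring

theorem finrank_forms12 (hm : 1 < m) :
    Module.finrank ℝ R.forms12.toSubmodule + 2 * m = 2 * (m * m.choose 2) := by
  obtain ⟨F⟩ := R.exists_unitaryFrame
  rw [F.finrank_of_iff fun T => F.forms12_iff_arr, ← Arr.finrank_mixed m hm]
  ring

theorem tracefree11_starT {T : R.Tensors 2} (hT : T ∈ R.tracefree11.toSubmodule) :
    R.starT T ∈ R.tracefree11.toSubmodule := by
  obtain ⟨F⟩ := R.exists_unitaryFrame
  rw [F.tracefree11_iff_arr] at hT ⊢
  refine ⟨fun i x hx => ?_, ?_⟩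
  · rw [vec2_eta x, starT_apply]
    fin_cases i
    · rw [hT.1 1 _ (conjC_mem_typeSub hx), map_zero]
    · rw [hT.1 0 _ (conjC_mem_typeSub hx), map_zero]
  · have h : ∀ c, F.arr ![true, false] (R.starT T) ![c, c] =
        starRingEnd ℂ (F.arr ![true, false] T ![c, c]) := by
      intro c
      rw [F.arr_apply, F.arr_apply, vec2_eta fun i => F.ζ (![true, false] i) (![c, c] i),
        starT_apply]
      simp
    have h2 : ∑ c, F.arr ![true, false] T ![c, c] = 0 := hT.2
    change ∑ c, F.arr ![true, false] (R.starT T) ![c, c] = 0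
    simp only [h, ← map_sum, h2, map_zero]

/-- A complex tracefree `(1,1)`-form is the sum of a real one and `i` times a real one. -/
def tracefree11Equiv :
    (R.forms11.toSubmodule × R.forms11.toSubmodule) ≃ₗ[ℝ] R.tracefree11.toSubmodule where
  toFun p := ⟨p.1.1 + Complex.I • p.2.1, R.tracefree11.toSubmodule.add_mem
    (mem_forms11_iff.mp p.1.2).1 (by
      obtain ⟨F⟩ := R.exists_unitaryFrame
      exact F.I_smul_mem_of_iff (fun T => F.tracefree11_iff_arr) (mem_forms11_iff.mp p.2.2).1)⟩
  map_add' p q := Subtype.ext (by simp; abel)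
  map_smul' c p := Subtype.ext (by simp [smul_comm Complex.I c])
  -- Reality means T* = -T here, so the real part is (T - T*)/2 and the imaginary part is -i(T +
  -- T*)/2.
  invFun T := (⟨(1 / 2 : ℝ) • (T.1 - R.starT T.1), mem_forms11_iff.mpr
      ⟨Submodule.smul_mem _ _ (Submodule.sub_mem _ T.2 (R.tracefree11_starT T.2)), by
        rw [map_smul, map_sub, starT_starT, ← smul_neg, neg_sub]⟩⟩,
    ⟨(-1 / 2 : ℝ) • (Complex.I • (T.1 + R.starT T.1)), mem_forms11_iff.mpr
      ⟨Submodule.smul_mem _ _ (by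
        obtain ⟨F⟩ := R.exists_unitaryFrame
        exact F.I_smul_mem_of_iff (fun T => F.tracefree11_iff_arr)
          (Submodule.add_mem _ T.2 (R.tracefree11_starT T.2))), by
        rw [map_smul, starT_I_smul, map_add, starT_starT, smul_neg, add_comm]⟩⟩)
  left_inv p := by
    have h1 := (mem_forms11_iff.mp p.1.2).2
    have h2 := (mem_forms11_iff.mp p.2.2).2
    refine Prod.ext (Subtype.ext ?_) (Subtype.ext ?_)
    · refine ext2 fun x y => ?_
      simp [h1, starT_I_smul, h2]
      ring
    · refine ext2 fun x y => ?_
      simp [h1, starT_I_smul, h2]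
      linear_combination (- (p.2.1 ![x, y])) * Complex.I_sq
  right_inv T := by
    refine Subtype.ext (ext2 fun x y => ?_)
    simp
    linear_combination (-1 / 2 * (T.1 ![x, y] + R.starT T.1 ![x, y])) * Complex.I_sq

theorem finite_tensors (k : ℕ) : Module.Finite ℝ (R.Tensors k) := by
  have := R.finite_H
  have : Module.Finite ℂ (R.Tensors k) := inferInstance
  exact Module.Finite.trans ℂ _

theorem finrank_forms11 (hm : 0 < m) : Module.finrank ℝ R.forms11.toSubmodule + 1 = m ^ 2 := by
  obtain ⟨F⟩ := R.exists_unitaryFrame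
  have := R.finite_tensors 2
  have h := R.tracefree11Equiv.finrank_eq
  rw [Module.finrank_prod, F.finrank_of_iff fun T => F.tracefree11_iff_arr] at h
  have := Arr.finrank_tf2 m hm
  omega

/-- Real `1`-forms are the real parts of `(1,0)`-forms. -/
def formsVEquiv : R.forms10.toSubmodule ≃ₗ[ℝ] R.formsV.toSubmodule := by
  refine LinearEquiv.ofBijective (LinearMap.codRestrict _
    ((LinearMap.id + R.conjT 1).comp R.forms10.toSubmodule.subtype) ?_) ⟨?_, ?_⟩
  · intro T x
    simp [conjT_apply, conjC_conjC, add_comm]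
  · rw [injective_iff_map_eq_zero]
    intro T hT
    obtain ⟨F⟩ := R.exists_unitaryFrame
    have h : T.1 + R.conjT 1 T.1 = 0 := congrArg Subtype.val hT
    refine Subtype.ext (F.eq_of_arr_eq (mem_typed1_iff.mpr T.2) (Submodule.zero_mem _) ?_)
    funext a
    have h2 := congrArg (fun S => S fun i => F.ζ true (a i)) h
    have h3 : T.1 (fun i => conjC _ (F.ζ true (a i))) = 0 :=
      T.2 _ (by rw [F.conjC_ζ]; exact F.ζ_mem false _)
    have h4 : T.1 (fun i => F.ζ true (a i)) + starRingEnd ℂ (T.1 fun i => conjC _ (F.ζ true (a i)))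
        = 0 := h2
    rw [h3, map_zero, add_zero] at h4
    exact h4
  · intro S
    obtain ⟨F⟩ := R.exists_unitaryFrame
    -- The preimage of a real form is its (1,0)-part.
    refine ⟨⟨S.1.compLinearMap fun _ => F.pr true, fun x hx => ?_⟩, Subtype.ext (ext1 fun x => ?_)⟩
    · exact S.1.map_coord_zero 0 (F.pr_eq_zero hx)
    · have hS := S.2 ![F.pr true (conjC _ x)]
      have h1 : (fun i => F.pr true ((![x] : Fin 1 → _) i)) = ![F.pr true x] := vec1_eta _
      have h2 : (fun i => F.pr true ((![conjC _ x] : Fin 1 → _) i)) =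
        ![F.pr true (conjC _ x)] := vec1_eta _
      have h3 : (fun i => conjC R.H ((![F.pr true (conjC _ x)] : Fin 1 → _) i)) =
          ![F.pr false x] := by
        rw [vec1_eta fun i => conjC R.H ((![F.pr true (conjC _ x)] : Fin 1 → _) i)]
        simp [F.conjC_pr, conjC_conjC]
      change S.1 (fun i => F.pr true ((![x] : Fin 1 → _) i)) +
        R.conjT 1 (S.1.compLinearMap fun _ => F.pr true) ![x] = S.1 ![x]
      rw [conjT1_apply, MultilinearMap.compLinearMap_apply, h1, h2, ← hS, h3]
      have h4 : ∀ y, S.1.toLinearMap ![0] 0 y = S.1 ![y] := fun y => by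
        rw [MultilinearMap.toLinearMap_apply]
        congr 1
        funext i
        fin_cases i
        simp
      rw [← h4, ← h4, ← map_add, ← h4]
      congr 1
      exact F.pr_add_pr true x

theorem finrank_formsV : Module.finrank ℝ R.formsV.toSubmodule = 2 * m := by
  rw [← R.formsVEquiv.finrank_eq, finrank_forms10]

theorem finrank_formsR : Module.finrank ℝ R.formsR.toSubmodule = 1 := by
  let e : ℝ ≃ₗ[ℝ] R.formsR.toSubmodule :=
    { toFun r := ⟨MultilinearMap.constOfIsEmpty ℂ _ (r : ℂ), fun x => by simp⟩
      map_add' r s := Subtype.ext (by ext; simp)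
      map_smul' r s := Subtype.ext (by ext; simp)
      invFun T := (T.1 ![]).re
      left_inv r := by simp
      right_inv T := by
        refine Subtype.ext (MultilinearMap.ext fun x => ?_)
        have h := T.2 x
        rw [Subsingleton.elim (fun i => conjC _ (x i)) ![]] at h
        rw [Subsingleton.elim x ![]] at h ⊢
        simpa using Complex.conj_eq_iff_re.mp h.symm }
  rw [← e.finrank_eq, Module.finrank_self]

variable {R}

theorem isIrreducible_of_finrank_eq_one {G X : Type*} [Group G] [AddCommGroup X] [Module ℝ X]
    (ρ : Representation ℝ G X) (h : Module.finrank ℝ X = 1) : ρ.IsIrreducible := by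
  have := Module.nontrivial_of_finrank_pos (R := ℝ) (M := X) (by omega)
  have := isSimpleModule_iff_finrank_eq_one.mpr h
  rw [isIrreducible_iff]
  exact ⟨inferInstance, fun W _ => eq_bot_or_eq_top W⟩

theorem irreducible_formsR : R.formsR.toRepresentation.IsIrreducible :=
  isIrreducible_of_finrank_eq_one _ R.finrank_formsR

theorem nontrivial_of_finrank_pos {k : ℕ} {E : Subrepresentation (R.tensorRep k)}
    (h : 0 < Module.finrank ℝ E.toSubmodule) : Nontrivial E.toSubmodule :=
  Module.nontrivial_of_finrank_pos h

theorem irreducible_forms10 (hm : 0 < m) : R.forms10.toRepresentation.IsIrreducible := by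
  obtain ⟨F⟩ := R.exists_unitaryFrame
  refine (F.hasExtremalVector_of_iff (fun T => F.forms10_iff_arr) (x := ![⟨0, hm⟩])
    ?_ ?_).isIrreducible F (by simp) (nontrivial_of_finrank_pos (by
      rw [finrank_forms10]; omega))
  · intro A _ hs h0
    funext a
    rw [vec1_eta a, Pi.zero_apply]
    by_contra h
    have := hs _ h ⟨0, hm⟩
    rw [wt1, wt1] at this
    simp at this
    rw [this] at h
    exact h h0
  · intro A _ hA
    obtain ⟨a, ha⟩ := Function.ne_iff.mp hA
    obtain ⟨s, hs⟩ := exists_perm1 ⟨0, hm⟩ (a 0)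
    refine ⟨s, Or.inl ?_⟩
    rw [vec1_eta (s ∘ _)]
    simp only [Function.comp_apply, Matrix.cons_val_zero, hs]
    rwa [← vec1_eta a]

theorem irreducible_formsV (hm : 0 < m) : R.formsV.toRepresentation.IsIrreducible := by
  refine isIrreducible_of_linearEquiv R.formsVEquiv (fun g => ⟨g, fun T => Subtype.ext ?_⟩)
    (irreducible_forms10 hm)
  change R.tensorRep 1 g T.1 + R.conjT 1 (R.tensorRep 1 g T.1) =
    R.tensorRep 1 g (T.1 + R.conjT 1 T.1)
  rw [conjT_tensorRep, map_add]

theorem comp_vec2 (s : Equiv.Perm (Fin m)) (a b : Fin m) : s ∘ ![a, b] = ![s a, s b] :=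
  vec2_eta _

theorem comp_vec3 (s : Equiv.Perm (Fin m)) (a b c : Fin m) :
    s ∘ ![a, b, c] = ![s a, s b, s c] :=
  vec3_eta _

theorem irreducible_forms20 (hm : 1 < m) : R.forms20.toRepresentation.IsIrreducible := by
  obtain ⟨F⟩ := R.exists_unitaryFrame
  let i : Fin m := ⟨0, by omega⟩
  let j : Fin m := ⟨1, by omega⟩
  have hij : i ≠ j := by simp [i, j]
  -- An index with distinct entries is extremal here. The analogous proofs use (i,i) for symmetric
  -- forms, (i,i,j) for the Young module, and distinct entries for three skew or mixed slots.
  refine (F.hasExtremalVector_of_iff (fun T => F.forms20_iff_arr) (x := ![i, j])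
    (fun A hA => skew2_unique hA) ?_).isIrreducible F (by simp) (nontrivial_of_finrank_pos (by
      rw [finrank_forms20]
      have := Nat.choose_pos (n := m) (k := 2) hm
      omega))
  intro A hA h
  obtain ⟨a, b, hab, h⟩ := skew2_reach hA h
  obtain ⟨s, rfl, rfl⟩ := exists_perm2 hij hab
  exact ⟨s, Or.inl (by rwa [comp_vec2])⟩

theorem irreducible_sym20 (hm : 1 < m) : R.sym20.toRepresentation.IsIrreducible := by
  obtain ⟨F⟩ := R.exists_unitaryFrame
  let i : Fin m := ⟨0, by omega⟩
  refine (F.hasExtremalVector_of_iff (fun T => F.sym20_iff_arr) (x := ![i, i])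
    (fun A _ => sym2_unique) ?_).isIrreducible F (by simp) (nontrivial_of_finrank_pos (by
      rw [finrank_sym20]
      have := Nat.choose_pos (n := m + 1) (k := 2) (by omega)
      omega))
  intro A hA h
  obtain ⟨a, h⟩ := sym2_reach hA h
  obtain ⟨s, rfl⟩ := exists_perm1 i a
  exact ⟨s, by rwa [comp_vec2]⟩

theorem irreducible_forms30 (hm : 2 < m) : R.forms30.toRepresentation.IsIrreducible := by
  obtain ⟨F⟩ := R.exists_unitaryFrame
  let i : Fin m := ⟨0, by omega⟩
  let j : Fin m := ⟨1, by omega⟩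
  let l : Fin m := ⟨2, by omega⟩
  refine (F.hasExtremalVector_of_iff (fun T => F.forms30_iff_arr) (x := ![i, j, l])
    (fun A hA => skew3_unique hA.1 hA.2) ?_).isIrreducible F (by simp)
    (nontrivial_of_finrank_pos (by
      rw [finrank_forms30]
      have := Nat.choose_pos (n := m) (k := 3) hm
      omega))
  intro A hA h
  obtain ⟨a, b, c, hab, hac, hbc, h⟩ := skew3_reach hA.1 hA.2 h
  obtain ⟨s, rfl, rfl, rfl⟩ := exists_perm3 (a := i) (b := j) (c := l) (by simp [i, j])
    (by simp [i, l]) (by simp [j, l]) hab hac hbc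
  exact ⟨s, Or.inl (by rwa [comp_vec3])⟩

/-- Gives positive dimension, hence nontriviality, of the Young module. -/
theorem choose_three_lt (hm : 1 < m) : m.choose 3 < m * m.choose 2 := by
  have h1 : 0 < m.choose 2 := Nat.choose_pos hm
  have h2 : m.choose 3 * 3 = m.choose 2 * (m - 2) := Nat.choose_succ_right_eq m 2
  have h3 : m.choose 2 * (m - 2) ≤ m.choose 2 * m := Nat.mul_le_mul_left _ (by omega)
  have h4 : 0 < m * m.choose 2 := by positivity
  rw [mul_comm m]
  rw [mul_comm m] at h4
  omega

theorem irreducible_young21 (hm : 1 < m) : R.young21.toRepresentation.IsIrreducible := by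
  obtain ⟨F⟩ := R.exists_unitaryFrame
  let i : Fin m := ⟨0, by omega⟩
  let j : Fin m := ⟨1, by omega⟩
  have hij : i ≠ j := by simp [i, j]
  refine (F.hasExtremalVector_of_iff (fun T => F.young21_iff_arr) (x := ![i, i, j])
    (fun A hA => young_unique hA.1) ?_).isIrreducible F (by simp)
    (nontrivial_of_finrank_pos (by
      have := R.finrank_young21
      have := choose_three_lt hm
      omega))
  intro A hA h
  obtain ⟨a, b, hab, h⟩ := young_reach hA.1 (fun a b c => by
    rw [← Arr.cyc_apply, LinearMap.mem_ker.mp hA.2, Pi.zero_apply]) h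
  obtain ⟨s, rfl, rfl⟩ := exists_perm2 hij hab
  exact ⟨s, by rwa [comp_vec3]⟩

theorem irreducible_forms12 (hm : 2 < m) : R.forms12.toRepresentation.IsIrreducible := by
  obtain ⟨F⟩ := R.exists_unitaryFrame
  let i : Fin m := ⟨0, by omega⟩
  let j : Fin m := ⟨1, by omega⟩
  let l : Fin m := ⟨2, by omega⟩
  have hij : i ≠ j := by simp [i, j]
  have hil : i ≠ l := by simp [i, l]
  have hjl : j ≠ l := by simp [j, l]
  refine (F.hasExtremalVector_of_iff (fun T => F.forms12_iff_arr) (x := ![i, j, l])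
    (fun A hA => mixed3_unique hA.1 hij hil hjl) ?_).isIrreducible F (by simp [Fin.sum_univ_three])
    (nontrivial_of_finrank_pos (by
      have h1 := R.finrank_forms12 (by omega)
      have h2 : 3 ≤ m.choose 2 := Nat.choose_le_choose (c := 2) hm
      have h3 : m * 3 ≤ m * m.choose 2 := Nat.mul_le_mul_left _ h2
      omega))
  intro A hA h
  obtain ⟨a, b, c, hab, hac, hbc, h⟩ := mixed3_reach hA.1
    (fun d => congrFun (LinearMap.mem_ker.mp hA.2) d) (by omega) h
  obtain ⟨s, rfl, rfl, rfl⟩ := exists_perm3 hij hil hjl hab hac hbc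
  exact ⟨s, by rwa [comp_vec3]⟩

/-- Scalars in U(m) act trivially on type (1,1), so an invariant real subspace W need not be
complex. Its complex span is zero or the whole module of tracefree (1,1)-forms. In the second case
every real form is S + iS' with S, S' in W, and reality forces S' = 0. -/
theorem irreducible_forms11 (hm : 1 < m) : R.forms11.toRepresentation.IsIrreducible := by
  obtain ⟨F⟩ := R.exists_unitaryFrame
  let i : Fin m := ⟨0, by omega⟩
  let j : Fin m := ⟨1, by omega⟩
  have hij : i ≠ j := by simp [i, j]
  have hE : F.HasExtremalVector ![true, false] R.tracefree11.toSubmodule ![i, j] := by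
    refine F.hasExtremalVector_of_iff (fun T => F.tracefree11_iff_arr)
      (fun A hA => mixed2_unique hij) ?_
    intro A hA h
    obtain ⟨a, b, hab, h⟩ := mixed2_reach hA h
    obtain ⟨s, rfl, rfl⟩ := exists_perm2 hij hab
    exact ⟨s, by rwa [comp_vec2]⟩
  rw [UnitaryFrame.isIrreducible_subrepresentation_iff]
  refine ⟨nontrivial_of_finrank_pos (by
      have h1 := R.finrank_forms11 (by omega)
      have h2 : 2 ^ 2 ≤ m ^ 2 := Nat.pow_le_pow_left hm 2
      omega), fun W hWE hW => ?_⟩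
  have hW' : ∀ T ∈ W, T ∈ R.tracefree11.toSubmodule ∧ R.starT T = -T :=
    fun T hT => mem_forms11_iff.mp (hWE hT)
  rcases hE.arrSpan_eq F (fun q T hT => R.tracefree11.apply_mem_toSubmodule q hT) hW
    (fun T hT => (hW' T hT).1) with h | h
  · exact Or.inl (F.eq_bot_of_arrSpan_eq_bot (fun T hT => hE.typed T (hW' T hT).1) h)
  · refine Or.inr (le_antisymm hWE fun T hT => ?_)
    have hT' := mem_forms11_iff.mp hT
    have hmem : F.arr ![true, false] T ∈ F.arrSpan ![true, false] W := by
      rw [h]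
      exact Submodule.subset_span ⟨T, hT'.1, rfl⟩
    have key : ∀ A ∈ F.arrSpan ![true, false] W, ∃ S ∈ W, ∃ S' ∈ W,
        A = F.arr ![true, false] (S + Complex.I • S') := by
      intro A hA
      induction hA using Submodule.span_induction with
      | mem A hA =>
        obtain ⟨S, hS, rfl⟩ := hA
        exact ⟨S, hS, 0, W.zero_mem, by simp⟩
      | zero => exact ⟨0, W.zero_mem, 0, W.zero_mem, by simp⟩
      | add A B _ _ hA hB =>
        obtain ⟨S, hS, S', hS', rfl⟩ := hA
        obtain ⟨T, hT, T', hT', rfl⟩ := hB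
        refine ⟨S + T, W.add_mem hS hT, S' + T', W.add_mem hS' hT', ?_⟩
        rw [← map_add, smul_add]
        congr 1
        abel
      | smul c A _ hA =>
        obtain ⟨S, hS, S', hS', rfl⟩ := hA
        refine ⟨c.re • S - c.im • S', W.sub_mem (W.smul_mem _ hS) (W.smul_mem _ hS'),
          c.im • S + c.re • S', W.add_mem (W.smul_mem _ hS) (W.smul_mem _ hS'), ?_⟩
        rw [← map_smul]
        congr 1
        refine ext2 fun x y => ?_
        simp
        linear_combination (c.im * S' ![x, y]) * Complex.I_sq - (S ![x, y] + Complex.I * S' ![x, y])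
          * Complex.re_add_im c
    obtain ⟨S, hS, S', hS', hSS⟩ := key _ hmem
    have hI := F.I_smul_mem_of_iff (fun T => F.tracefree11_iff_arr) (hW' S' hS').1
    have e : T = S + Complex.I • S' := F.eq_of_arr_eq (hE.typed T hT'.1)
      (hE.typed _ (Submodule.add_mem _ (hW' S hS).1 hI)) hSS
    have e2 := hT'.2
    -- Since T* = -S + iS' has to equal -T = -S - iS', it follows that 2iS' = 0.
    rw [e, map_add, starT_I_smul, (hW' S hS).2, (hW' S' hS').2] at e2
    have e3 : S' = 0 := by
      refine ext2 fun x y => ?_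
      have := congrArg (fun U => U ![x, y]) e2
      simp at this
      have h4 : (2 * Complex.I) * S' ![x, y] = 0 := by linear_combination this
      simpa using h4
    rw [e, e3, smul_zero, add_zero]
    exact hS

theorem irreducible_tableForms (hm : 1 < m) (l : Label) (hl : l.Occurs m) :
    (R.tableForms l).toRepresentation.IsIrreducible := by
  have h2 : l = .zero_11 ∨ l = .zero_13 → 2 < m := by
    intro h
    rw [Label.Occurs] at hl
    have : m ≠ 2 := fun h' => hl ⟨h', h⟩
    omega
  cases l
  · exact irreducible_formsV (by omega)
  · exact irreducible_formsR
  · exact irreducible_formsR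
  · exact irreducible_forms20 hm
  · exact irreducible_forms11 hm
  · exact irreducible_forms11 hm
  · exact irreducible_sym20 hm
  · exact irreducible_forms20 hm
  · exact irreducible_formsV (by omega)
  · exact irreducible_forms10 (by omega)
  · exact irreducible_forms30 (h2 (Or.inl rfl))
  · exact irreducible_young21 hm
  · exact irreducible_forms12 (h2 (Or.inr rfl))
  · exact irreducible_forms20 hm

variable (R) in
/-- The module in the table as the space of tensors. -/
def tableEquiv (l : Label) : (R.tableForms l).toSubmodule ≃ₗ[ℝ] R.TableModule l :=
  (TensorProduct.rid ℝ _).symm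

theorem tableEquiv_apply (l : Label) (T : (R.tableForms l).toSubmodule) :
    R.tableEquiv l T = T ⊗ₜ[ℝ] (1 : ℝ) := rfl

theorem tableRep_tableEquiv (l : Label) (q : R.Q₀) (T : (R.tableForms l).toSubmodule) :
    R.tableRep l q (R.tableEquiv l T) =
      R.tableEquiv l (((q.1 : ℝ) ^ l.weight) • (R.tableForms l).toRepresentation q T) := by
  rw [tableEquiv_apply, tableEquiv_apply]
  change ((R.tableForms l).toRepresentation q T) ⊗ₜ[ℝ] (R.weightRep l.weight q 1) = _
  rw [TensorProduct.smul_tmul]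
  congr 1

theorem irreducible_tableRep (hm : 1 < m) (l : Label) (hl : l.Occurs m) :
    (R.tableRep l).IsIrreducible := by
  -- On elements (1, ψ) the factor ℝ(w) is trivial, and these elements already give all operators on
  -- the tensor factor.
  refine isIrreducible_of_linearEquiv (R.tableEquiv l) (fun g => ⟨(1, g.2), fun T => ?_⟩)
    (irreducible_tableForms hm l hl)
  rw [tableRep_tableEquiv]
  simp
  rfl

theorem finrank_tableModule (hm : 1 < m) (l : Label) :
    (Module.finrank ℝ (R.TableModule l) : ℚ) = l.dim m := by
  rw [← (R.tableEquiv l).finrank_eq]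
  have c2 : (m.choose 2 : ℚ) = m * (m - 1) / 2 := Nat.cast_choose_two ℚ m
  have c2' : ((m + 1).choose 2 : ℚ) = (m + 1) * m / 2 := by
    rw [Nat.cast_choose_two ℚ (m + 1)]
    push_cast
    ring
  have c3 : (m.choose 3 : ℚ) = m * (m - 1) * (m - 2) / 6 := by
    have h := Nat.choose_succ_right_eq m 2
    have h' : (m.choose 3 : ℚ) * 3 = m.choose 2 * (m - 2) := by
      have e : ((m - 2 : ℕ) : ℚ) = m - 2 := by rw [Nat.cast_sub hm]; norm_num
      rw [← e]
      exact_mod_cast h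
    rw [c2] at h'
    linarith
  have h20 : (Module.finrank ℝ R.forms20.toSubmodule : ℚ) = m * (m - 1) := by
    rw [finrank_forms20]
    push_cast
    rw [c2]
    ring
  have h11 : (Module.finrank ℝ R.forms11.toSubmodule : ℚ) = (m + 1) * (m - 1) := by
    have h : ((Module.finrank ℝ R.forms11.toSubmodule + 1 : ℕ) : ℚ) = (m ^ 2 : ℕ) := by
      rw [R.finrank_forms11 (by omega)]
    push_cast at h
    linarith
  have hV : (Module.finrank ℝ R.formsV.toSubmodule : ℚ) = 2 * m := by
    rw [finrank_formsV]
    push_cast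
    ring
  have hR : (Module.finrank ℝ R.formsR.toSubmodule : ℚ) = 1 := by
    rw [finrank_formsR]
    push_cast
    ring
  cases l
  · exact hV
  · exact hR
  · exact hR
  · exact h20
  · exact h11
  · exact h11
  · change (Module.finrank ℝ R.sym20.toSubmodule : ℚ) = m * (m + 1)
    rw [finrank_sym20]
    push_cast
    rw [c2']
    ring
  · exact h20
  · exact hV
  · change (Module.finrank ℝ R.forms10.toSubmodule : ℚ) = 2 * m
    rw [finrank_forms10]
    push_cast
    ring
  · change (Module.finrank ℝ R.forms30.toSubmodule : ℚ) = 1 / 3 * m * (m - 1) * (m - 2)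
    rw [finrank_forms30]
    push_cast
    rw [c3]
    ring
  · change (Module.finrank ℝ R.young21.toSubmodule : ℚ) = 2 / 3 * m * (m + 1) * (m - 1)
    have h : ((Module.finrank ℝ R.young21.toSubmodule + 2 * m.choose 3 : ℕ) : ℚ) =
      (2 * (m * m.choose 2) : ℕ) := by rw [R.finrank_young21]
    push_cast at h
    rw [c2, c3] at h
    linarith
  · change (Module.finrank ℝ R.forms12.toSubmodule : ℚ) = m * (m + 1) * (m - 2)
    have h : ((Module.finrank ℝ R.forms12.toSubmodule + 2 * m : ℕ) : ℚ) =
      (2 * (m * m.choose 2) : ℕ) := by rw [R.finrank_forms12 hm]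
    push_cast at h
    rw [c2] at h
    linarith
  · exact h20

end RobinsonStructure

namespace RobinsonStructure

open Robinson

variable {m : ℕ} {V : Type*} [AddCommGroup V] [Module ℝ V] {M : MinkowskiMetric m V}
  {R : RobinsonStructure M}

/-! ### Intrinsic torsions as trilinear forms -/

/-- The complex linear extension of a real functional. -/
def dualC : Module.Dual ℝ V →ₗ[ℝ] ((ℂ ⊗[ℝ] V) →ₗ[ℂ] ℂ) where
  toFun α := LinearMap.liftBaseChange ℂ (Complex.ofRealCLM.toLinearMap ∘ₗ α)
  map_add' α β := ext_real fun v => by simp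
  map_smul' c α := ext_real fun v => by simp

theorem dualC_one_tmul (α : Module.Dual ℝ V) (v : V) : dualC α (1 ⊗ₜ v) = α v := by
  simp [dualC]

theorem gC_so (X : so M) (v w : ℂ ⊗[ℝ] V) :
    gC M (X.1.baseChange ℂ v) w = - gC M v (X.1.baseChange ℂ w) :=
  form_baseChange_skew (mem_so M |>.mp X.2) v w

namespace NullPair

variable (P : R.NullPair) (F : R.UnitaryFrame)

theorem σC_mem_N {x : ℂ ⊗[ℝ] R.H} (hx : x ∈ R.H01) : P.σC x ∈ R.N := P.mem_H01_iff.mp hx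

/-- The projection onto `N` along `l` and `H^{(1,0)}`. -/
def proj : (ℂ ⊗[ℝ] V) →ₗ[ℂ] (ℂ ⊗[ℝ] V) :=
  (gC M (1 ⊗ₜ P.l)).smulRight ((1 : ℂ) ⊗ₜ[ℝ] P.k) + P.σC ∘ₗ F.pr false ∘ₗ P.τC

theorem proj_apply (v : ℂ ⊗[ℝ] V) : P.proj F v =
    gC M (1 ⊗ₜ P.l) v • ((1 : ℂ) ⊗ₜ[ℝ] P.k) + P.σC (F.pr false (P.τC v)) := rfl

theorem proj_mem (v : ℂ ⊗[ℝ] V) : P.proj F v ∈ R.N :=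
  R.N.add_mem (R.N.smul_mem _ P.k_mem_N) (P.σC_mem_N (F.pr_mem false _))

theorem proj_eq_self {v : ℂ ⊗[ℝ] V} (hv : v ∈ R.N) : P.proj F v = v := by
  rw [proj_apply, F.pr_eq_self (s := false) (P.mem_H01_iff.mpr (P.σC_τC_mem hv)),
    ← P.eq_add_of_mem_N hv]

/-- The bilinear form on `N` associated with an element of `𝔤`, extended to the whole space by
means of the projection. -/
def formSo : so M →ₗ[ℝ] ((ℂ ⊗[ℝ] V) →ₗ[ℂ] (ℂ ⊗[ℝ] V) →ₗ[ℂ] ℂ) where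
  toFun X := (gC M).compl₁₂ (X.1.baseChange ℂ ∘ₗ P.proj F) (P.proj F)
  map_add' X Y := by
    refine LinearMap.ext₂ fun v w => ?_
    simp only [LinearMap.compl₁₂_apply, LinearMap.comp_apply, Submodule.coe_add,
      LinearMap.baseChange_add, LinearMap.add_apply, map_add]
  map_smul' c X := by
    refine LinearMap.ext₂ fun v w => ?_
    simp only [LinearMap.compl₁₂_apply, LinearMap.comp_apply, Submodule.coe_smul,
      LinearMap.baseChange_smul, LinearMap.smul_apply, RingHom.id_apply,
      LinearMap.map_smul_of_tower]

theorem formSo_apply (X : so M) (v w : ℂ ⊗[ℝ] V) :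
    P.formSo F X v w = gC M (X.1.baseChange ℂ (P.proj F v)) (P.proj F w) := rfl

/-- The bilinear form on `N` associated with an element of `𝔤/𝔮`, extended to the whole space. -/
def form : (so M ⧸ R.q) →ₗ[ℝ] ((ℂ ⊗[ℝ] V) →ₗ[ℂ] (ℂ ⊗[ℝ] V) →ₗ[ℂ] ℂ) :=
  Submodule.liftQ R.q (P.formSo F) (by
    intro X hX
    rw [LinearMap.mem_ker]
    refine LinearMap.ext₂ fun v w => ?_
    rw [formSo_apply]
    exact R.gC_N (hX _ (P.proj_mem F v)) (P.proj_mem F w))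

theorem form_mk (X : so M) (v w : ℂ ⊗[ℝ] V) : P.form F (Submodule.Quotient.mk X) v w =
    gC M (X.1.baseChange ℂ (P.proj F v)) (P.proj F w) := rfl

/-- If g(Xz, w) = 0 for all z, w in N, then X maps N into N^⊥ = N, so X lies in 𝔮. -/
theorem form_injective : Function.Injective (P.form F) := by
  rw [injective_iff_map_eq_zero]
  intro x hx
  obtain ⟨X, rfl⟩ := Submodule.Quotient.mk_surjective _ x
  rw [Submodule.Quotient.mk_eq_zero]
  intro z hz
  refine R.mem_N_of_forall fun w hw => ?_
  have := LinearMap.congr_fun₂ hx z w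
  rw [form_mk, P.proj_eq_self F hz, P.proj_eq_self F hw] at this
  rw [gC_symm]
  exact this

theorem form_skew (x : so M ⧸ R.q) (v w : ℂ ⊗[ℝ] V) : P.form F x w v = - P.form F x v w := by
  obtain ⟨X, rfl⟩ := Submodule.Quotient.mk_surjective _ x
  rw [form_mk, form_mk, gC_so, gC_symm]

/-- Equivariance is claimed only for arguments in N. There the form is intrinsic, whereas its
extension to ᶜV uses a projection that Q does not preserve. -/
theorem form_repSo (p : R.Q) (x : so M ⧸ R.q) {v w : ℂ ⊗[ℝ] V} (hv : v ∈ R.N) (hw : w ∈ R.N) :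
    P.form F (R.repSo.quotient R.q R.adjoint_q p x) v w =
      P.form F x ((R.repV p⁻¹).baseChange ℂ v) ((R.repV p⁻¹).baseChange ℂ w) := by
  obtain ⟨X, rfl⟩ := Submodule.Quotient.mk_surjective _ x
  change P.form F (Submodule.Quotient.mk (R.repSo p X)) v w = _
  rw [form_mk, form_mk, P.proj_eq_self F hv, P.proj_eq_self F hw,
    P.proj_eq_self F ((R.repV_mem_N _ _).mpr hv), P.proj_eq_self F ((R.repV_mem_N _ _).mpr hw)]
  have h1 : (R.repSo p X).1 = R.repV p ∘ₗ X.1 ∘ₗ R.repV p⁻¹ := rfl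
  have h2 : ∀ z y, gC M ((R.repV p).baseChange ℂ z) y = gC M z ((R.repV p⁻¹).baseChange ℂ y) := by
    intro z y
    have h3 : (R.repV p).baseChange ℂ ((R.repV p⁻¹).baseChange ℂ y) = y := by
      rw [← LinearMap.comp_apply, ← LinearMap.baseChange_comp, ← Module.End.mul_eq_comp, ← map_mul]
      simp
    conv_lhs => rw [← h3]
    exact baseChange_form_comp (R.repV_isometry p) z _
  rw [h1, LinearMap.baseChange_comp, LinearMap.comp_apply, h2, LinearMap.baseChange_comp,
    LinearMap.comp_apply]

/-- The trilinear form associated with an intrinsic torsion. -/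
def ev : R.Torsion →ₗ[ℝ] ((ℂ ⊗[ℝ] V) →ₗ[ℂ] (ℂ ⊗[ℝ] V) →ₗ[ℂ] (ℂ ⊗[ℝ] V) →ₗ[ℂ] ℂ) :=
  TensorProduct.lift (LinearMap.mk₂ ℝ (fun α x => (dualC α).smulRight (P.form F x))
    (fun α β x => by refine LinearMap.ext fun v => ?_; simp [add_smul])
    (fun c α x => by
      refine LinearMap.ext fun v => ?_
      simp only [map_smul, LinearMap.smulRight_apply, LinearMap.smul_apply, smul_assoc])
    (fun α x y => by refine LinearMap.ext fun v => ?_; simp)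
    (fun c α x => by refine LinearMap.ext fun v => ?_; simp [smul_comm c]))

theorem ev_pureTensor (α : Module.Dual ℝ V) (x : so M ⧸ R.q) (v : ℂ ⊗[ℝ] V) :
    P.ev F (R.pureTensor α x) v = dualC α v • P.form F x := by
  rw [ev, pureTensor]
  erw [TensorProduct.lift.tmul]
  rfl

end NullPair

theorem torsion_induction {p : R.Torsion → Prop} (t : R.Torsion) (h0 : p 0)
    (h1 : ∀ α x, p (R.pureTensor α x)) (h2 : ∀ s t, p s → p t → p (s + t)) : p t :=
  TensorProduct.induction_on t h0 h1 h2

theorem torsionRep_pureTensor (p : R.Q) (α : Module.Dual ℝ V) (x : so M ⧸ R.q) :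
    R.torsionRep p (R.pureTensor α x) =
      R.pureTensor (R.repV.dual p α) (R.repSo.quotient R.q R.adjoint_q p x) := rfl

theorem dualC_dual (p : R.Q) (α : Module.Dual ℝ V) (v : ℂ ⊗[ℝ] V) :
    dualC (R.repV.dual p α) v = dualC α ((R.repV p⁻¹).baseChange ℂ v) := by
  have : dualC (R.repV.dual p α) = dualC α ∘ₗ (R.repV p⁻¹).baseChange ℂ :=
    ext_real fun v => by
      rw [LinearMap.comp_apply, LinearMap.baseChange_tmul, dualC_one_tmul, dualC_one_tmul]
      rfl
  rw [this, LinearMap.comp_apply]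

variable (R) in
/-- The contraction of an intrinsic torsion with a vector. -/
def contract (v : V) : R.Torsion →ₗ[ℝ] (so M ⧸ R.q) :=
  TensorProduct.lift ((LinearMap.lsmul ℝ (so M ⧸ R.q)) ∘ₗ Module.Dual.eval ℝ V v)

theorem contract_pureTensor (v : V) (α : Module.Dual ℝ V) (x : so M ⧸ R.q) :
    R.contract v (R.pureTensor α x) = α v • x := by
  rw [contract, pureTensor]
  erw [TensorProduct.lift.tmul]
  rfl

theorem pureTensor_add_left (α β : Module.Dual ℝ V) (x : so M ⧸ R.q) :
    R.pureTensor (α + β) x = R.pureTensor α x + R.pureTensor β x := TensorProduct.add_tmul _ _ _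

theorem pureTensor_smul_left (c : ℝ) (α : Module.Dual ℝ V) (x : so M ⧸ R.q) :
    R.pureTensor (c • α) x = R.pureTensor α (c • x) := TensorProduct.smul_tmul _ _ _

theorem pureTensor_add_right (α : Module.Dual ℝ V) (x y : so M ⧸ R.q) :
    R.pureTensor α (x + y) = R.pureTensor α x + R.pureTensor α y := TensorProduct.tmul_add _ _ _

theorem pureTensor_zero_right (α : Module.Dual ℝ V) :
    R.pureTensor α (0 : so M ⧸ R.q) = 0 := TensorProduct.tmul_zero _ _

theorem pureTensor_zero_left (x : so M ⧸ R.q) :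
    R.pureTensor 0 x = 0 := TensorProduct.zero_tmul _ _

theorem pureTensor_sum_left {ι : Type*} (s : Finset ι) (α : ι → Module.Dual ℝ V)
    (x : so M ⧸ R.q) : R.pureTensor (∑ i ∈ s, α i) x = ∑ i ∈ s, R.pureTensor (α i) x :=
  TensorProduct.sum_tmul _ _ _

namespace NullPair

variable (P : R.NullPair) (F : R.UnitaryFrame)

theorem ev_one_tmul (t : R.Torsion) (v : V) : P.ev F t (1 ⊗ₜ v) = P.form F (R.contract v t) := by
  induction t using torsion_induction with
  | h0 => simp
  | h1 α x =>
    have h : P.form F (α v • x) = α v • P.form F x := map_smul _ _ _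
    rw [ev_pureTensor, contract_pureTensor, dualC_one_tmul, h]
    exact algebraMap_smul ℂ (α v) (P.form F x)
  | h2 s t hs ht => rw [map_add, LinearMap.add_apply, hs, ht, map_add, map_add]

theorem ev_skew (t : R.Torsion) (u v w : ℂ ⊗[ℝ] V) : P.ev F t u w v = - P.ev F t u v w := by
  induction t using torsion_induction with
  | h0 => simp
  | h1 α x =>
    rw [ev_pureTensor, LinearMap.smul_apply, LinearMap.smul_apply, LinearMap.smul_apply,
      LinearMap.smul_apply, form_skew, smul_neg]
  | h2 s t hs ht =>
    simp only [map_add, LinearMap.add_apply, hs, ht]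
    ring

theorem ev_self (t : R.Torsion) (u v : ℂ ⊗[ℝ] V) : P.ev F t u v v = 0 :=
  self_eq_neg.mp (P.ev_skew F t u v v)

theorem ev_torsionRep (p : R.Q) (t : R.Torsion) (u : ℂ ⊗[ℝ] V) {v w : ℂ ⊗[ℝ] V} (hv : v ∈ R.N)
    (hw : w ∈ R.N) : P.ev F (R.torsionRep p t) u v w = P.ev F t ((R.repV p⁻¹).baseChange ℂ u)
      ((R.repV p⁻¹).baseChange ℂ v) ((R.repV p⁻¹).baseChange ℂ w) := by
  induction t using torsion_induction with
  | h0 => simp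
  | h1 α x =>
    rw [torsionRep_pureTensor, ev_pureTensor, ev_pureTensor, LinearMap.smul_apply,
      LinearMap.smul_apply, LinearMap.smul_apply, LinearMap.smul_apply, form_repSo P F p x hv hw,
      dualC_dual]
  | h2 s t hs ht => simp only [map_add, LinearMap.add_apply, hs, ht]

theorem form_proj (x : so M ⧸ R.q) (v w : ℂ ⊗[ℝ] V) :
    P.form F x v w = P.form F x (P.proj F v) (P.proj F w) := by
  obtain ⟨X, rfl⟩ := Submodule.Quotient.mk_surjective _ x
  rw [form_mk, form_mk, P.proj_eq_self F (P.proj_mem F v), P.proj_eq_self F (P.proj_mem F w)]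

theorem ev_proj (t : R.Torsion) (u v w : ℂ ⊗[ℝ] V) :
    P.ev F t u v w = P.ev F t u (P.proj F v) (P.proj F w) := by
  induction t using torsion_induction with
  | h0 => simp
  | h1 α x =>
    rw [ev_pureTensor, LinearMap.smul_apply, LinearMap.smul_apply, LinearMap.smul_apply,
      LinearMap.smul_apply, ← form_proj]
  | h2 s t hs ht => simp only [map_add, LinearMap.add_apply, hs, ht]

/-- The embedding of the screen space with values in `N`. -/
def ν : (ℂ ⊗[ℝ] R.H) →ₗ[ℂ] (ℂ ⊗[ℝ] V) := P.σC ∘ₗ F.pr false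

theorem ν_apply (x : ℂ ⊗[ℝ] R.H) : P.ν F x = P.σC (F.pr false x) := rfl

theorem ν_mem (x : ℂ ⊗[ℝ] R.H) : P.ν F x ∈ R.N := P.σC_mem_N (F.pr_mem false x)

/-- The vector `k` in the complexification. -/
def kC : ℂ ⊗[ℝ] V := 1 ⊗ₜ P.k

/-- The vector `l` in the complexification. -/
def lC : ℂ ⊗[ℝ] V := 1 ⊗ₜ P.l

theorem kC_mem : P.kC ∈ R.N := P.k_mem_N

/-- N is spanned by k and the vectors `ν`, and t(u,k,k) = 0 by skew symmetry. -/
theorem ev_k_eq_zero_iff {t : R.Torsion} {u : ℂ ⊗[ℝ] V} :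
    P.ev F t u P.kC = 0 ↔ ∀ x, P.ev F t u P.kC (P.ν F x) = 0 := by
  refine ⟨fun h x => by rw [h, LinearMap.zero_apply], fun h => LinearMap.ext fun w => ?_⟩
  rw [ev_proj, P.proj_eq_self F P.kC_mem, proj_apply, map_add, map_smul, ← ν_apply, h]
  have := P.ev_self F t u P.kC
  rw [kC] at this ⊢
  rw [this, smul_zero, zero_add, LinearMap.zero_apply]

theorem ev_eq_zero_iff {t : R.Torsion} {u : ℂ ⊗[ℝ] V} :
    P.ev F t u = 0 ↔ P.ev F t u P.kC = 0 ∧ ∀ x y, P.ev F t u (P.ν F x) (P.ν F y) = 0 := by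
  refine ⟨fun h => ⟨by rw [h, LinearMap.zero_apply], fun x y => by rw [h]; simp⟩,
    fun h => LinearMap.ext₂ fun v w => ?_⟩
  have h1 := LinearMap.congr_fun h.1
  have h2 : ∀ x, P.ev F t u x P.kC = 0 := fun x => by rw [ev_skew, h1]; simp
  rw [kC] at h1 h2
  rw [ev_proj, proj_apply, proj_apply]
  simp only [map_add, map_smul, LinearMap.add_apply, LinearMap.smul_apply, h1, h2, ← ν_apply, h.2]
  simp

/-- The identity of V is expanded in l, k and an orthonormal basis of the screen space. The
coefficient functionals g(l,·), h(e_i,τ·) and g(k,·) lie in degrees -1, 0 and 1 of the dual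
filtration, so membership in 𝔾^i can be read off from the contractions of t. -/
theorem eq_sum_pureTensor {e : Fin (2 * m) → R.H}
    (he : ∀ i j, R.h (e i) (e j) = if i = j then 1 else 0) (t : R.Torsion) :
    t = R.pureTensor (M.g P.l) (R.contract P.k t) + R.pureTensor (M.g P.k) (R.contract P.l t) +
      ∑ i, R.pureTensor (R.h (e i) ∘ₗ P.τ) (R.contract (P.σ (e i)) t) := by
  induction t using torsion_induction with
  | h0 => simp [pureTensor_zero_right]
  | h1 α x =>
    simp only [contract_pureTensor, ← pureTensor_smul_left]
    rw [← pureTensor_sum_left, ← pureTensor_add_left, ← pureTensor_add_left]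
    congr 1
    refine LinearMap.ext fun v => ?_
    conv_lhs => rw [P.eq_add v, eq_sum_orthonormal he (P.τ v)]
    simp [mul_comm]
  | h2 s t hs ht =>
    conv_lhs => rw [hs, ht]
    simp only [map_add, pureTensor_add_right, Finset.sum_add_distrib]
    abel

end NullPair

end RobinsonStructure

namespace RobinsonStructure

open Robinson

variable {m : ℕ} {V : Type*} [AddCommGroup V] [Module ℝ V] {M : MinkowskiMetric m V}
  {R : RobinsonStructure M}

/-! ### The filtrations -/

theorem K_le_Kperp : R.K ≤ R.Kperp := fun _ hx _ hk => R.g_K hk hx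

theorem filV_of_le {i : ℤ} (hi : i ≤ -1) : R.filV i = ⊤ := if_pos hi

theorem filV_zero : R.filV 0 = R.Kperp := rfl

theorem filV_one : R.filV 1 = R.K := rfl

theorem filV_of_ge {i : ℤ} (hi : 2 ≤ i) : R.filV i = ⊥ := by
  rw [filV, if_neg (by omega), if_neg (by omega), if_neg (by omega)]

theorem filV_antitone : Antitone R.filV := by
  refine antitone_int_of_succ_le fun i => ?_
  rcases lt_trichotomy i 0 with h | rfl | h
  · rw [filV_of_le (i := i) (by omega)]
    exact le_top
  · rw [zero_add, filV_one, filV_zero]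
    exact K_le_Kperp
  · rw [filV_of_ge (i := i + 1) (by omega)]
    exact bot_le

theorem repV_filV (p : R.Q) (i : ℤ) : R.filV i ≤ (R.filV i).comap (R.repV p) := by
  rw [filV]
  split_ifs
  · exact le_top
  · exact R.repV_Kperp p
  · exact R.repV_K p
  · exact bot_le

theorem filSo_antitone : Antitone R.filSo := fun _ _ hij _ hX k v hv =>
  filV_antitone (by omega) (hX k v hv)

theorem filQuot_antitone : Antitone R.filQuot := fun _ _ hij => Submodule.map_mono (filSo_antitone hij)

theorem fil_antitone : Antitone R.fil := fun _ _ hij => iSup_mono fun _ => Submodule.span_mono (by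
  rintro t ⟨α, hα, x, hx, rfl⟩
  exact ⟨α, hα, x, filQuot_antitone (by omega) hx, rfl⟩)

theorem repV_dual_filDual (p : R.Q) (i : ℤ) {α : Module.Dual ℝ V} (hα : α ∈ R.filDual i) :
    R.repV.dual p α ∈ R.filDual i := by
  rw [filDual, Submodule.mem_dualAnnihilator] at hα ⊢
  intro v hv
  exact hα _ (repV_filV p⁻¹ _ hv)

theorem rep_filQuot (p : R.Q) (i : ℤ) {x : so M ⧸ R.q} (hx : x ∈ R.filQuot i) :
    R.repSo.quotient R.q R.adjoint_q p x ∈ R.filQuot i := by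
  obtain ⟨X, hX, rfl⟩ := hx
  exact ⟨R.repSo p X, fun j v hv => repV_filV p _ (hX j _ (repV_filV p⁻¹ j hv)), rfl⟩

theorem pureTensor_mem_fil {i : ℤ} (j : ℤ) {α : Module.Dual ℝ V} {x : so M ⧸ R.q}
    (hα : α ∈ R.filDual j) (hx : x ∈ R.filQuot (i - j)) : R.pureTensor α x ∈ R.fil i :=
  Submodule.mem_iSup_of_mem j (Submodule.subset_span ⟨α, hα, x, hx, rfl⟩)

theorem fil_le {i : ℤ} {W : Submodule ℝ R.Torsion}
    (h : ∀ j, ∀ α ∈ R.filDual j, ∀ x ∈ R.filQuot (i - j), R.pureTensor α x ∈ W) : R.fil i ≤ W := by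
  refine iSup_le fun j => Submodule.span_le.mpr ?_
  rintro _ ⟨α, hα, x, hx, rfl⟩
  exact h j α hα x hx

theorem fil_le_comap (i : ℤ) (p : R.Q) : R.fil i ≤ (R.fil i).comap (R.torsionRep p) :=
  fil_le fun j α hα x hx => by
    rw [Submodule.mem_comap, torsionRep_pureTensor]
    exact pureTensor_mem_fil j (repV_dual_filDual p j hα) (rep_filQuot p _ hx)

namespace NullPair

variable (P : R.NullPair) (F : R.UnitaryFrame)

theorem so_k (X : so M) : X.1 P.k ∈ R.Kperp := by
  rw [P.mem_Kperp_iff]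
  have := (mem_so M).mp X.2 P.k P.k
  rw [M.symm] at this
  exact self_eq_neg.mp this

/-- Preserving K is enough: by skew symmetry X then preserves K^⊥ too. -/
theorem mem_filSo_zero {X : so M} (h : X.1 P.k ∈ R.K) : X ∈ R.filSo 0 := by
  intro j v hv
  rw [add_zero]
  rcases lt_trichotomy j 0 with hj | rfl | hj
  · rw [filV_of_le (by omega)]; trivial
  · rw [filV_zero, P.mem_Kperp_iff] at hv ⊢
    have := (mem_so M).mp X.2 P.k v
    rw [P.eq_smul_of_mem_K h, map_smul, LinearMap.smul_apply, hv, smul_zero] at this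
    linarith
  · by_cases h1 : j = 1
    · subst h1
      rw [filV_one] at hv ⊢
      rw [P.eq_smul_of_mem_K hv, map_smul]
      exact R.K.smul_mem _ h
    · rw [filV_of_ge (by omega), Submodule.mem_bot] at hv
      rw [hv, map_zero]
      exact Submodule.zero_mem _

/-- Skew symmetry gives g(Xk, k) = 0, so every X maps K into K^⊥ and has degree at least -1. -/
theorem _root_.RobinsonStructure.filSo_of_le {i : ℤ} (hi : i ≤ -1) : R.filSo i = ⊤ := by
  obtain ⟨P⟩ := R.exists_nullPair
  rw [eq_top_iff]
  intro X _
  refine filSo_antitone hi (x := X) fun j v hv => ?_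
  rcases lt_trichotomy j 1 with hj | rfl | hj
  · rw [filV_of_le (by omega)]; trivial
  · rw [filV_one] at hv
    change _ ∈ R.Kperp
    rw [P.eq_smul_of_mem_K hv, map_smul]
    exact R.Kperp.smul_mem _ (P.so_k X)
  · rw [filV_of_ge (by omega), Submodule.mem_bot] at hv
    rw [hv, map_zero]
    exact Submodule.zero_mem _

theorem _root_.RobinsonStructure.filQuot_of_le {i : ℤ} (hi : i ≤ -1) : R.filQuot i = ⊤ := by
  rw [filQuot, filSo_of_le hi, Submodule.map_top, Submodule.range_mkQ]

/-- If g(Xk, w) = 0 for all w in N, then Xk lies in N^⊥ = N and is real, hence lies in K. -/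
theorem mem_filQuot_zero_iff {x : so M ⧸ R.q} : x ∈ R.filQuot 0 ↔ P.form F x P.kC = 0 := by
  constructor
  · rintro ⟨X, hX, rfl⟩
    refine LinearMap.ext fun w => ?_
    change P.form F (Submodule.Quotient.mk X) _ _ = 0
    rw [form_mk, P.proj_eq_self F P.kC_mem, kC, LinearMap.baseChange_tmul]
    exact R.gC_N (hX 1 P.k P.k_mem) (P.proj_mem F w)
  · obtain ⟨X, rfl⟩ := Submodule.Quotient.mk_surjective _ x
    intro h
    refine ⟨X, P.mem_filSo_zero ?_, rfl⟩
    refine R.mem_N_of_forall fun w hw => ?_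
    have := LinearMap.congr_fun h w
    rw [form_mk, P.proj_eq_self F P.kC_mem, P.proj_eq_self F hw, kC,
      LinearMap.baseChange_tmul] at this
    rw [gC_symm]
    exact this

/-- An element of degree 1 kills k and maps K^⊥ into K. As N lies in ᶜK^⊥ and contains ᶜK, such an
element preserves N and belongs to 𝔮. Only the degrees -1 and 0 survive in 𝔤/𝔮. -/
theorem _root_.RobinsonStructure.filQuot_of_ge {i : ℤ} (hi : 1 ≤ i) : R.filQuot i = ⊥ := by
  obtain ⟨P⟩ := R.exists_nullPair
  rw [eq_bot_iff]
  rintro _ ⟨X, hX, rfl⟩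
  have hX := filSo_antitone hi hX
  rw [Submodule.mem_bot]
  change Submodule.Quotient.mk X = 0
  rw [Submodule.Quotient.mk_eq_zero]
  intro z hz
  have h1 : X.1 P.k = 0 := by
    have := hX 1 P.k P.k_mem
    rwa [filV_of_ge (by omega), Submodule.mem_bot] at this
  have h2 : ∀ x : ℂ ⊗[ℝ] R.H, X.1.baseChange ℂ (P.σC x) ∈ R.N := by
    intro x
    induction x using TensorProduct.induction_on with
    | zero => simp
    | tmul c w =>
      rw [σC, LinearMap.baseChange_tmul, LinearMap.baseChange_tmul, ← mul_one c, ← smul_eq_mul,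
        ← TensorProduct.smul_tmul']
      exact R.N.smul_mem _ (hX 0 _ (P.σ_mem w))
    | add x y hx hy => rw [map_add, map_add]; exact R.N.add_mem hx hy
  rw [P.eq_add_of_mem_N hz, map_add, map_smul, LinearMap.baseChange_tmul, h1,
    TensorProduct.tmul_zero, smul_zero, zero_add]
  exact h2 _

theorem filDual_of_le {j : ℤ} (hj : j ≤ -1) : R.filDual j = ⊤ := by
  rw [filDual, filV_of_ge (by omega), Submodule.dualAnnihilator_bot]

theorem filDual_of_ge {j : ℤ} (hj : 2 ≤ j) : R.filDual j = ⊥ := by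
  rw [filDual, filV_of_le (by omega), Submodule.dualAnnihilator_top]

theorem filDual_antitone : Antitone R.filDual := fun _ _ hij =>
  Submodule.dualAnnihilator_anti (filV_antitone (by omega))

theorem filDual_k {j : ℤ} (hj : 0 ≤ j) {α : Module.Dual ℝ V} (hα : α ∈ R.filDual j) :
    dualC α P.kC = 0 := by
  have := (Submodule.mem_dualAnnihilator _).mp (filDual_antitone hj hα) P.k P.k_mem
  rw [kC, dualC_one_tmul, this, Complex.ofReal_zero]

theorem filDual_σ {j : ℤ} (hj : 1 ≤ j) {α : Module.Dual ℝ V} (hα : α ∈ R.filDual j)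
    (x : ℂ ⊗[ℝ] R.H) : dualC α (P.σC x) = 0 := by
  have h := (Submodule.mem_dualAnnihilator _).mp (filDual_antitone hj hα)
  have : dualC α ∘ₗ P.σC = 0 := ext_real fun w => by
    rw [LinearMap.comp_apply, σC, LinearMap.baseChange_tmul, dualC_one_tmul, h _ (P.σ_mem w)]
    simp
  rw [← LinearMap.comp_apply, this, LinearMap.zero_apply]

theorem g_l_mem_filDual : M.g P.l ∈ R.filDual (-1) := by
  rw [filDual_of_le le_rfl]; trivial

theorem g_k_mem_filDual : M.g P.k ∈ R.filDual 1 := by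
  rw [filDual, Submodule.mem_dualAnnihilator]
  intro v hv
  exact P.mem_Kperp_iff.mp hv

theorem h_τ_mem_filDual (x : R.H) : R.h x ∘ₗ P.τ ∈ R.filDual 0 := by
  rw [filDual, Submodule.mem_dualAnnihilator]
  intro v hv
  change v ∈ R.K at hv
  rw [LinearMap.comp_apply, P.eq_smul_of_mem_K hv, map_smul, P.τ_k, smul_zero, map_zero]

theorem _root_.RobinsonStructure.fil_of_le {i : ℤ} (hi : i ≤ -2) : R.fil i = ⊤ := by
  rw [eq_top_iff]
  intro t _
  induction t using torsion_induction with
  | h0 => exact Submodule.zero_mem _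
  | h1 α x =>
    refine pureTensor_mem_fil (-1) ?_ ?_
    · rw [filDual_of_le le_rfl]; trivial
    · rw [filQuot_of_le (by omega)]; trivial
  | h2 s t hs ht => exact Submodule.add_mem _ (hs trivial) (ht trivial)

theorem _root_.RobinsonStructure.fil_of_ge {i : ℤ} (hi : 2 ≤ i) : R.fil i = ⊥ := by
  rw [eq_bot_iff]
  refine fil_le fun j α hα x hx => ?_
  rw [Submodule.mem_bot]
  rcases le_or_gt 2 j with hj | hj
  · rw [filDual_of_ge hj, Submodule.mem_bot] at hα
    rw [hα, pureTensor_zero_left]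
  · rw [filQuot_of_ge (by omega), Submodule.mem_bot] at hx
    rw [hx, pureTensor_zero_right]

theorem ev_kC (t : R.Torsion) : P.ev F t P.kC = P.form F (R.contract P.k t) := P.ev_one_tmul F t P.k

theorem ev_lC (t : R.Torsion) : P.ev F t P.lC = P.form F (R.contract P.l t) := P.ev_one_tmul F t P.l

theorem ev_σ (t : R.Torsion) (x : R.H) :
    P.ev F t (P.σC (1 ⊗ₜ x)) = P.form F (R.contract (P.σ x) t) := by
  rw [σC, LinearMap.baseChange_tmul]
  exact P.ev_one_tmul F t _


/-- The only missing product is (V^*)^{-1} with the degree -1 part of 𝔤/𝔮, and contraction with k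
detects it. The two later criteria follow the same pattern: generators of 𝔾^i satisfy the vanishing
conditions, and conversely each summand of `eq_sum_pureTensor` lies in 𝔾^i. -/
theorem mem_fil_neg_one_iff {t : R.Torsion} : t ∈ R.fil (-1) ↔ P.ev F t P.kC P.kC = 0 := by
  constructor
  · intro ht
    let W : Submodule ℝ R.Torsion :=
      { carrier := {t | P.ev F t P.kC P.kC = 0}
        add_mem' {s t} (hs : P.ev F s P.kC P.kC = 0) (ht : P.ev F t P.kC P.kC = 0) := by
          simp [hs, ht]
        zero_mem' := by simp
        smul_mem' c t (ht : P.ev F t P.kC P.kC = 0) := by simp [ht] }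
    suffices h : R.fil (-1) ≤ W from h ht
    refine fil_le fun j α hα x hx => ?_
    change P.ev F _ P.kC P.kC = 0
    rw [ev_pureTensor]
    rcases le_or_gt 0 j with hj | hj
    · rw [P.filDual_k hj hα, zero_smul, LinearMap.zero_apply]
    · rw [LinearMap.smul_apply, (P.mem_filQuot_zero_iff F).mp (filQuot_antitone (by omega) hx),
        smul_zero]
  · intro h
    obtain ⟨e, he⟩ := R.exists_orthonormal
    rw [P.eq_sum_pureTensor he t]
    refine Submodule.add_mem _ (Submodule.add_mem _ ?_ ?_) (Submodule.sum_mem _ fun i _ => ?_)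
    · refine pureTensor_mem_fil (-1) P.g_l_mem_filDual ?_
      rw [show (-1 : ℤ) - (-1) = 0 by rfl, P.mem_filQuot_zero_iff F, ← ev_kC]
      exact h
    · refine pureTensor_mem_fil 1 P.g_k_mem_filDual ?_
      rw [filQuot_of_le (by omega)]
      trivial
    · refine pureTensor_mem_fil 0 (P.h_τ_mem_filDual _) ?_
      rw [filQuot_of_le (by omega)]
      trivial

theorem contract_k_eq_zero {t : R.Torsion} (h : P.ev F t P.kC = 0) : R.contract P.k t = 0 :=
  P.form_injective F (by rw [← ev_kC, h, map_zero])

theorem mem_fil_zero_iff {t : R.Torsion} :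
    t ∈ R.fil 0 ↔ P.ev F t P.kC = 0 ∧ ∀ x, P.ev F t (P.σC x) P.kC = 0 := by
  constructor
  · intro ht
    let W : Submodule ℝ R.Torsion :=
      { carrier := {t | P.ev F t P.kC = 0 ∧ ∀ x, P.ev F t (P.σC x) P.kC = 0}
        add_mem' hs ht := ⟨by simp [hs.1, ht.1], fun x => by simp [hs.2, ht.2]⟩
        zero_mem' := by simp
        smul_mem' c t ht := ⟨by simp [ht.1], fun x => by simp [ht.2]⟩ }
    suffices h : R.fil 0 ≤ W from h ht
    refine fil_le fun j α hα x hx => ?_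
    change P.ev F _ P.kC = 0 ∧ ∀ x, P.ev F _ (P.σC x) P.kC = 0
    simp only [ev_pureTensor]
    rcases lt_trichotomy j 0 with hj | rfl | hj
    · rw [filQuot_of_ge (by omega), Submodule.mem_bot] at hx
      simp [hx]
    · rw [P.filDual_k le_rfl hα, zero_smul]
      refine ⟨rfl, fun y => ?_⟩
      rw [LinearMap.smul_apply, (P.mem_filQuot_zero_iff F).mp hx, smul_zero]
    · rw [P.filDual_k hj.le hα, zero_smul]
      refine ⟨rfl, fun y => ?_⟩
      rw [P.filDual_σ hj hα, zero_smul, LinearMap.zero_apply]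
  · rintro ⟨h1, h2⟩
    obtain ⟨e, he⟩ := R.exists_orthonormal
    rw [P.eq_sum_pureTensor he t, P.contract_k_eq_zero F h1, pureTensor_zero_right, zero_add]
    refine Submodule.add_mem _ ?_ (Submodule.sum_mem _ fun i _ => ?_)
    · refine pureTensor_mem_fil 1 P.g_k_mem_filDual ?_
      rw [filQuot_of_le (by omega)]
      trivial
    · refine pureTensor_mem_fil 0 (P.h_τ_mem_filDual _) ?_
      rw [sub_zero, P.mem_filQuot_zero_iff F, ← ev_σ]
      exact h2 _

theorem mem_fil_one_iff {t : R.Torsion} : t ∈ R.fil 1 ↔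
    P.ev F t P.kC = 0 ∧ (∀ x, P.ev F t (P.σC x) = 0) ∧ P.ev F t P.lC P.kC = 0 := by
  constructor
  · intro ht
    let W : Submodule ℝ R.Torsion :=
      { carrier := {t | P.ev F t P.kC = 0 ∧ (∀ x, P.ev F t (P.σC x) = 0) ∧
          P.ev F t P.lC P.kC = 0}
        add_mem' hs ht := ⟨by simp [hs.1, ht.1], fun x => by simp [hs.2.1, ht.2.1],
          by simp [hs.2.2, ht.2.2]⟩
        zero_mem' := by simp
        smul_mem' c t ht := ⟨by simp [ht.1], fun x => by simp [ht.2.1], by simp [ht.2.2]⟩ }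
    suffices h : R.fil 1 ≤ W from h ht
    refine fil_le fun j α hα x hx => ?_
    change P.ev F _ P.kC = 0 ∧ (∀ x, P.ev F _ (P.σC x) = 0) ∧ P.ev F _ P.lC P.kC = 0
    simp only [ev_pureTensor]
    rcases le_or_gt 1 j with hj | hj
    · rw [P.filDual_k (by omega) hα, zero_smul]
      refine ⟨rfl, fun y => by rw [P.filDual_σ hj hα, zero_smul], ?_⟩
      by_cases hj' : j = 1
      · subst hj'
        rw [LinearMap.smul_apply, (P.mem_filQuot_zero_iff F).mp hx, smul_zero]
      · rw [filDual_of_ge (by omega), Submodule.mem_bot] at hα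
        rw [hα, map_zero, LinearMap.zero_apply, zero_smul, LinearMap.zero_apply]
    · rw [filQuot_of_ge (by omega), Submodule.mem_bot] at hx
      simp [hx]
  · rintro ⟨h1, h2, h3⟩
    obtain ⟨e, he⟩ := R.exists_orthonormal
    have h4 : ∀ x, R.contract (P.σ x) t = 0 := fun x =>
      P.form_injective F (by rw [← ev_σ, h2, map_zero])
    rw [P.eq_sum_pureTensor he t, P.contract_k_eq_zero F h1, pureTensor_zero_right, zero_add]
    simp only [h4, pureTensor_zero_right, Finset.sum_const_zero, add_zero]
    refine pureTensor_mem_fil 1 P.g_k_mem_filDual ?_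
    rw [sub_self, P.mem_filQuot_zero_iff F, ← ev_lC]
    exact h3

theorem eq_zero_iff {t : R.Torsion} : t = 0 ↔
    P.ev F t P.kC = 0 ∧ (∀ x, P.ev F t (P.σC x) = 0) ∧ P.ev F t P.lC = 0 := by
  constructor
  · rintro rfl
    simp
  · rintro ⟨h1, h2, h3⟩
    obtain ⟨e, he⟩ := R.exists_orthonormal
    have h4 : ∀ x, R.contract (P.σ x) t = 0 := fun x =>
      P.form_injective F (by rw [← ev_σ, h2, map_zero])
    have h5 : R.contract P.l t = 0 := P.form_injective F (by rw [← ev_lC, h3, map_zero])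
    rw [P.eq_sum_pureTensor he t, P.contract_k_eq_zero F h1, h5]
    simp [h4, pureTensor_zero_right]

end NullPair

end RobinsonStructure

namespace RobinsonStructure

open Robinson

variable {m : ℕ} {V : Type*} [AddCommGroup V] [Module ℝ V] {M : MinkowskiMetric m V}
  {R : RobinsonStructure M}

/-! ### Equivariant operations on tensors -/

theorem tensorRep1_apply (q : R.Q₀) (T : R.Tensors 1) (x : ℂ ⊗[ℝ] R.H) :
    R.tensorRep 1 q T ![x] = T ![(q.2⁻¹).1.1.baseChange ℂ x] := by
  rw [tensorRep_apply, vec1_eta fun i => (q.2⁻¹).1.1.baseChange ℂ (![x] i)]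
  rfl

theorem tensorRep2_apply (q : R.Q₀) (T : R.Tensors 2) (x y : ℂ ⊗[ℝ] R.H) :
    R.tensorRep 2 q T ![x, y] =
      T ![(q.2⁻¹).1.1.baseChange ℂ x, (q.2⁻¹).1.1.baseChange ℂ y] := by
  rw [tensorRep_apply, vec2_eta fun i => (q.2⁻¹).1.1.baseChange ℂ (![x, y] i)]
  rfl

theorem tensorRep3_apply (q : R.Q₀) (T : R.Tensors 3) (x y z : ℂ ⊗[ℝ] R.H) :
    R.tensorRep 3 q T ![x, y, z] = T ![(q.2⁻¹).1.1.baseChange ℂ x,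
      (q.2⁻¹).1.1.baseChange ℂ y, (q.2⁻¹).1.1.baseChange ℂ z] := by
  rw [tensorRep_apply, vec3_eta fun i => (q.2⁻¹).1.1.baseChange ℂ (![x, y, z] i)]
  rfl

theorem tensorRep_mem_typed {k : ℕ} {ε : Fin k → Bool} (q : R.Q₀) {T : R.Tensors k}
    (hT : T ∈ R.typed ε) : R.tensorRep k q T ∈ R.typed ε :=
  typed_compLinearMap hT q.2⁻¹

theorem conjT_mem_typed {k : ℕ} {ε : Fin k → Bool} {T : R.Tensors k}
    (hT : T ∈ R.typed fun i => !(ε i)) : R.conjT k T ∈ R.typed ε := by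
  intro i x hx
  rw [conjT_apply, hT i _ (conjC_mem_typeSub hx), map_zero]

variable (R) in
/-- The exchange of the arguments of a tensor of rank two. -/
def swapT : R.Tensors 2 →ₗ[ℝ] R.Tensors 2 where
  toFun T := T.domDomCongr (Equiv.swap 0 1)
  map_add' _ _ := rfl
  map_smul' _ _ := rfl

theorem swapT_apply (T : R.Tensors 2) (x y : ℂ ⊗[ℝ] R.H) : R.swapT T ![x, y] = T ![y, x] := by
  change T (fun i => ![x, y] (Equiv.swap 0 1 i)) = _
  rw [swap2_01]

theorem swapT_tensorRep (q : R.Q₀) (T : R.Tensors 2) :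
    R.swapT (R.tensorRep 2 q T) = R.tensorRep 2 q (R.swapT T) := rfl

theorem cycT_tensorRep (q : R.Q₀) (T : R.Tensors 3) :
    R.cycT (R.tensorRep 3 q T) = R.tensorRep 3 q (R.cycT T) :=
  ext3 fun x y z => by simp only [cycT_apply, tensorRep3_apply]

theorem swapT_mem_typed {T : R.Tensors 2} (hT : T ∈ R.typed fun _ => true) :
    R.swapT T ∈ R.typed fun _ => true := by
  intro i x hx
  exact hT (Equiv.swap 0 1 i) _ (by rwa [Equiv.swap_apply_self])

theorem add_swapT_mem {T : R.Tensors 2} (hT : T ∈ R.typed fun _ => true) :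
    T + R.swapT T ∈ R.sym20.toSubmodule := by
  rw [mem_sym20_iff, mem_swapSign2_iff]
  refine ⟨Submodule.add_mem _ hT (swapT_mem_typed hT), fun x y => ?_⟩
  simp [swapT_apply, add_comm]

theorem sub_swapT_mem {T : R.Tensors 2} (hT : T ∈ R.typed fun _ => true) :
    T - R.swapT T ∈ R.forms20.toSubmodule := by
  rw [mem_forms20_iff, mem_swapSign2_iff]
  refine ⟨Submodule.sub_mem _ hT (swapT_mem_typed hT), fun x y => ?_⟩
  simp [swapT_apply]

theorem cycT_mem_forms30 {T : R.Tensors 3} (hT : T ∈ R.typed fun _ => true)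
    (h12 : ∀ x y z, T ![x, z, y] = - T ![x, y, z]) : R.cycT T ∈ R.forms30.toSubmodule := by
  rw [mem_forms30_iff, mem_swapSign3_iff_01, mem_swapSign3_iff_12]
  refine ⟨cycT_mem_typed hT, fun x y z => ?_, fun x y z => ?_⟩
  · rw [cycT_apply, cycT_apply, h12 x y z, h12 z x y, h12 y z x]
    simp
    ring
  · rw [cycT_apply, cycT_apply, h12 x y z, h12 z x y, h12 y z x]
    simp
    ring

theorem sub_cycT_mem_young21 {T : R.Tensors 3} (hT : T ∈ R.typed fun _ => true)
    (h12 : ∀ x y z, T ![x, z, y] = - T ![x, y, z]) :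
    (3 : ℝ) • T - R.cycT T ∈ R.young21.toSubmodule := by
  have h : (3 : ℝ) • T - R.cycT T ∈ (R.swapSign (-1) 3 1 2).toSubmodule := by
    refine Submodule.sub_mem _ (Submodule.smul_mem _ _ ?_)
      (mem_forms30_iff.mp (cycT_mem_forms30 hT h12)).2.2
    rw [mem_swapSign3_iff_12]
    intro x y z
    rw [h12, neg_one_smul]
  rw [mem_young21_iff]
  refine ⟨Submodule.sub_mem _ (Submodule.smul_of_tower_mem _ (3 : ℝ) hT) (cycT_mem_typed hT), h, ?_⟩
  rw [mem_noSkewPart3_iff h]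
  intro x y z
  simp [cycT_apply]
  ring

theorem add_conjT_mem_formsV (T : R.Tensors 1) : T + R.conjT 1 T ∈ R.formsV.toSubmodule := by
  intro x
  simp [conjT_apply, conjC_conjC, add_comm]

variable (R) in
/-- The real part of a complex number as an element of the trivial module. -/
def reT : ℂ →ₗ[ℝ] R.Tensors 0 where
  toFun z := MultilinearMap.constOfIsEmpty ℂ _ (z.re : ℂ)
  map_add' _ _ := by ext; simp
  map_smul' _ _ := by ext; simp

theorem reT_mem (z : ℂ) : R.reT z ∈ R.formsR.toSubmodule := fun x => by simp [reT]

theorem reT_eq_zero {z : ℂ} (h : R.reT z = 0) : z.re = 0 := by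
  have := congrArg (fun T => T ![]) h
  simpa [reT] using this

theorem tensorRep_reT (q : R.Q₀) (z : ℂ) : R.tensorRep 0 q (R.reT z) = R.reT z := by
  ext x
  simp [reT, tensorRep_apply]

namespace UnitaryFrame

variable (F : R.UnitaryFrame)

/-- The trace of a tensor of type `(1,1)`. -/
def tr : R.Tensors 2 →ₗ[ℂ] ℂ where
  toFun T := ∑ c, T ![F.ζ true c, F.ζ false c]
  map_add' S T := by simp [Finset.sum_add_distrib]
  map_smul' c T := by simp [Finset.mul_sum]

theorem tr_apply (T : R.Tensors 2) : F.tr T = ∑ c, T ![F.ζ true c, F.ζ false c] := rfl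

/-- The Hermitian form as a tensor of type `(1,1)`. -/
def herm : R.Tensors 2 where
  toFun x := R.hC (F.pr true (x 0)) (F.pr false (x 1))
  map_update_add' := by intro _ x i u v; fin_cases i <;> simp
  map_update_smul' := by intro _ x i c u; fin_cases i <;> simp

theorem herm_apply (x y : ℂ ⊗[ℝ] R.H) :
    F.herm ![x, y] = R.hC (F.pr true x) (F.pr false y) := rfl

theorem herm_mem : F.herm ∈ R.typed ![true, false] := by
  intro i x hx
  rw [vec2_eta x, herm_apply]
  fin_cases i
  · have hx : x 0 ∈ R.H01 := hx
    rw [F.pr_eq_zero (s := true) hx, map_zero, LinearMap.zero_apply]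
  · have hx : x 1 ∈ R.H10 := hx
    rw [F.pr_eq_zero (s := false) hx, map_zero]

theorem tensorRep_herm (q : R.Q₀) : R.tensorRep 2 q F.herm = F.herm :=
  ext2 fun x y => by
    rw [tensorRep2_apply, herm_apply, herm_apply, pr_U, pr_U, U_hC]

theorem tr_herm : F.tr F.herm = m := by
  simp [tr_apply, herm_apply, pr_ζ, hC_ζ]

theorem sum_orthonormal2 {T : R.Tensors 2} (hT : T ∈ R.typed ![true, false])
    {e : Fin (2 * m) → R.H} (he : ∀ i j, R.h (e i) (e j) = if i = j then 1 else 0) :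
    F.tr T = ∑ i, T ![1 ⊗ₜ e i, 1 ⊗ₜ e i] := by
  have h := F.sum_orthonormal he (LinearMap.mk₂ ℂ (fun u v => T ![u, v])
    (fun u u' v => by simpa only [update2_0] using T.map_update_add ![0, v] 0 u u')
    (fun c u v => by simpa only [update2_0] using T.map_update_smul ![0, v] 0 c u)
    (fun u v v' => by simpa only [update2_1] using T.map_update_add ![u, 0] 1 v v')
    (fun c u v => by simpa only [update2_1] using T.map_update_smul ![u, 0] 1 c v))
  simp only [LinearMap.mk₂_apply] at h
  have h0 : ∀ a, T ![F.ζ false a, F.ζ true a] = 0 := fun a => hT 0 _ (F.ζ_mem false a)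
  simp only [h0, Finset.sum_const_zero, add_zero] at h
  rw [h, tr_apply]

/-- The trace over the frame equals the trace over any orthonormal basis of H, and elements of U map
such bases to such bases. -/
theorem tr_tensorRep (q : R.Q₀) {T : R.Tensors 2} (hT : T ∈ R.typed ![true, false]) :
    F.tr (R.tensorRep 2 q T) = F.tr T := by
  obtain ⟨e, he⟩ := R.exists_orthonormal
  rw [F.sum_orthonormal2 (tensorRep_mem_typed q hT) he,
    F.sum_orthonormal2 hT (e := fun i => (q.2⁻¹).1.1 (e i))
      (fun i j => by rw [(q.2⁻¹).2.1, he])]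
  simp only [tensorRep2_apply, LinearMap.baseChange_tmul]

/-- The tracefree part of a tensor of type `(1,1)`. -/
def tf : R.Tensors 2 →ₗ[ℝ] R.Tensors 2 where
  toFun T := T - ((m : ℂ)⁻¹ * F.tr T) • F.herm
  map_add' S T := by rw [map_add]; module
  map_smul' c T := by
    rw [LinearMap.map_smul_of_tower, mul_smul_comm, RingHom.id_apply, smul_sub, smul_assoc]

theorem tf_apply (T : R.Tensors 2) : F.tf T = T - ((m : ℂ)⁻¹ * F.tr T) • F.herm := rfl

theorem tf_mem (hm : 0 < m) {T : R.Tensors 2} (hT : T ∈ R.typed ![true, false]) :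
    F.tf T ∈ R.tracefree11.toSubmodule := by
  have h : F.tf T ∈ R.typed ![true, false] :=
    Submodule.sub_mem _ hT (Submodule.smul_mem _ _ F.herm_mem)
  have h0 : F.tr (F.tf T) = 0 := by
    rw [tf_apply, map_sub, map_smul, tr_herm, smul_eq_mul]
    have : (m : ℂ) ≠ 0 := by exact_mod_cast hm.ne'
    field_simp
    ring
  rw [mem_tracefree11_iff, F.mem_traceFree_iff h rfl rfl]
  refine ⟨h, fun x => ?_⟩
  rw [vec2_eta x]
  rw [tr_apply] at h0
  simp only [update2_0, update2_1]
  exact h0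

theorem tf_tensorRep (q : R.Q₀) {T : R.Tensors 2} (hT : T ∈ R.typed ![true, false]) :
    F.tf (R.tensorRep 2 q T) = R.tensorRep 2 q (F.tf T) := by
  rw [tf_apply, F.tr_tensorRep q hT, tf_apply, map_sub]
  congr 1
  conv_lhs => rw [← F.tensorRep_herm q]
  rfl

/-- The contraction of the first two slots of a tensor of type `(1,2)`. -/
def contr : R.Tensors 3 →ₗ[ℝ] R.Tensors 1 where
  toFun T :=
    { toFun x := ∑ c, T ![F.ζ true c, F.ζ false c, x 0]
      map_update_add' := by
        intro _ x i u v
        fin_cases i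
        simp only [Fin.zero_eta, Function.update_self, ← Finset.sum_add_distrib]
        refine Finset.sum_congr rfl fun c _ => ?_
        simpa only [update3_2] using T.map_update_add ![F.ζ true c, F.ζ false c, 0] 2 u v
      map_update_smul' := by
        intro _ x i r u
        fin_cases i
        simp only [Fin.zero_eta, Function.update_self, Finset.smul_sum]
        refine Finset.sum_congr rfl fun c _ => ?_
        simpa only [update3_2] using T.map_update_smul ![F.ζ true c, F.ζ false c, 0] 2 r u }
  map_add' S T := by ext x; simp [Finset.sum_add_distrib]
  map_smul' c T := by ext x; simp [Finset.mul_sum]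

theorem contr_apply (T : R.Tensors 3) (x : ℂ ⊗[ℝ] R.H) :
    F.contr T ![x] = ∑ c, T ![F.ζ true c, F.ζ false c, x] := rfl

theorem contr_mem {T : R.Tensors 3} (hT : T ∈ R.typed ![true, false, false]) :
    F.contr T ∈ R.typed fun _ => false := by
  intro i x hx
  rw [vec1_eta x, contr_apply]
  fin_cases i
  exact Finset.sum_eq_zero fun c _ => hT 2 _ hx

theorem contr_tensorRep (q : R.Q₀) {T : R.Tensors 3} (hT : T ∈ R.typed ![true, false, false]) :
    F.contr (R.tensorRep 3 q T) = R.tensorRep 1 q (F.contr T) := by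
  refine ext1 fun w => ?_
  rw [tensorRep1_apply]
  -- Freezing the last argument reduces the contraction to the trace of a tensor of rank two.
  let S : R.Tensors 3 → (ℂ ⊗[ℝ] R.H) → R.Tensors 2 := fun T w =>
    { toFun x := T ![x 0, x 1, w]
      map_update_add' := by
        intro _ x i u v
        fin_cases i
        · simpa [update3_0] using T.map_update_add ![0, x 1, w] 0 u v
        · simpa [update3_1] using T.map_update_add ![x 0, 0, w] 1 u v
      map_update_smul' := by
        intro _ x i c u
        fin_cases i
        · simpa [update3_0] using T.map_update_smul ![0, x 1, w] 0 c u
        · simpa [update3_1] using T.map_update_smul ![x 0, 0, w] 1 c u }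
  have hS : ∀ T w x y, S T w ![x, y] = T ![x, y, w] := fun _ _ _ _ => rfl
  have hc : ∀ T w, F.contr T ![w] = F.tr (S T w) := fun _ _ => rfl
  have ht : S T ((q.2⁻¹).1.1.baseChange ℂ w) ∈ R.typed ![true, false] := by
    intro i x hx
    rw [vec2_eta x, hS]
    fin_cases i
    · exact hT 0 _ hx
    · exact hT 1 _ hx
  rw [hc, hc, ← F.tr_tensorRep q ht]
  congr 1
  refine ext2 fun x y => ?_
  rw [hS, tensorRep2_apply, hS, tensorRep3_apply]

theorem _root_.RobinsonStructure.toLinearMap_vec1 (θ : R.Tensors 1) (y : ℂ ⊗[ℝ] R.H) :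
    θ.toLinearMap ![0] 0 y = θ ![y] := by
  rw [MultilinearMap.toLinearMap_apply, vec1_eta (Function.update _ _ _)]
  simp

theorem _root_.RobinsonStructure.vec1_add (θ : R.Tensors 1) (u v : ℂ ⊗[ℝ] R.H) :
    θ ![u + v] = θ ![u] + θ ![v] := by
  simp only [← toLinearMap_vec1, map_add]

theorem _root_.RobinsonStructure.vec1_smul (θ : R.Tensors 1) (c : ℂ) (u : ℂ ⊗[ℝ] R.H) :
    θ ![c • u] = c * θ ![u] := by
  simp only [← toLinearMap_vec1, map_smul, smul_eq_mul]

theorem _root_.RobinsonStructure.fin3_ne : (0 : Fin 3) ≠ 1 ∧ (0 : Fin 3) ≠ 2 ∧ (1 : Fin 3) ≠ 0 ∧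
    (1 : Fin 3) ≠ 2 ∧ (2 : Fin 3) ≠ 0 ∧ (2 : Fin 3) ≠ 1 := by decide

/-- The product of the Hermitian form with a `1`-form, skew-symmetrised in the last two slots. -/
def hook : R.Tensors 1 →ₗ[ℝ] R.Tensors 3 where
  toFun θ :=
    { toFun x := F.herm ![x 0, x 1] * θ ![x 2] - F.herm ![x 0, x 2] * θ ![x 1]
      map_update_add' := by
        intro inst x i u v
        obtain rfl : inst = instDecidableEqFin 3 := Subsingleton.elim _ _
        obtain rfl | rfl | rfl : i = 0 ∨ i = 1 ∨ i = 2 := by fin_cases i <;> simp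
        all_goals simp only [Function.update_self, Function.update_of_ne, ne_eq, fin3_ne,
          not_false_eq_true, herm_apply, vec1_add, map_add, LinearMap.add_apply]; ring
      map_update_smul' := by
        intro inst x i c u
        obtain rfl : inst = instDecidableEqFin 3 := Subsingleton.elim _ _
        obtain rfl | rfl | rfl : i = 0 ∨ i = 1 ∨ i = 2 := by fin_cases i <;> simp
        all_goals simp only [Function.update_self, Function.update_of_ne, ne_eq, fin3_ne,
          not_false_eq_true, herm_apply, vec1_smul, map_smul, LinearMap.smul_apply,
          smul_eq_mul]; ring }
  map_add' S T := by ext x; simp; ring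
  map_smul' c T := by ext x; simp; ring

theorem hook_apply (θ : R.Tensors 1) (x y z : ℂ ⊗[ℝ] R.H) :
    F.hook θ ![x, y, z] = F.herm ![x, y] * θ ![z] - F.herm ![x, z] * θ ![y] := rfl

theorem hook_tensorRep (q : R.Q₀) (θ : R.Tensors 1) :
    F.hook (R.tensorRep 1 q θ) = R.tensorRep 3 q (F.hook θ) := by
  refine ext3 fun x y z => ?_
  rw [tensorRep3_apply, hook_apply, hook_apply, tensorRep1_apply, tensorRep1_apply,
    ← tensorRep2_apply, ← tensorRep2_apply, tensorRep_herm]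

theorem hook_mem {θ : R.Tensors 1} (hθ : θ ∈ R.typed fun _ => false) :
    F.hook θ ∈ R.typed ![true, false, false] := by
  have h0 : ∀ x ∈ R.H10, θ ![x] = 0 := fun x hx => hθ 0 _ hx
  have h1 : ∀ x y, x ∈ R.H01 → F.herm ![x, y] = 0 := fun x y hx => F.herm_mem 0 _ hx
  have h2 : ∀ x y, y ∈ R.H10 → F.herm ![x, y] = 0 := fun x y hx => F.herm_mem 1 _ hx
  intro i x hx
  rw [vec3_eta x, hook_apply]
  fin_cases i
  · have hx : x 0 ∈ R.H01 := hx
    rw [h1 _ _ hx, h1 _ _ hx]; ring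
  · have hx : x 1 ∈ R.H10 := hx
    rw [h2 _ _ hx, h0 _ hx]; ring
  · have hx : x 2 ∈ R.H10 := hx
    rw [h2 _ _ hx, h0 _ hx]; ring

/-- The first term contributes the trace m of the Hermitian form and the second one contributes 1,
whence the normalisation of `tf3`. -/
theorem contr_hook {θ : R.Tensors 1} (hθ : θ ∈ R.typed fun _ => false) :
    F.contr (F.hook θ) = ((m : ℝ) - 1) • θ := by
  refine ext1 fun w => ?_
  have h1 : ∑ c, F.herm ![F.ζ true c, w] * θ ![F.ζ false c] = θ ![w] := by
    have h2 : θ ![F.pr false w] = θ ![w] := by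
      rw [← F.typed_apply_pr hθ ![w]]
      congr 1
      exact (vec1_eta fun i => F.pr false (![w] i)).symm
    rw [← h2, ← toLinearMap_vec1, pr_apply, map_sum]
    refine Finset.sum_congr rfl fun c _ => ?_
    rw [map_smul, toLinearMap_vec1, smul_eq_mul, herm_apply, pr_ζ]
    congr 1
    conv_rhs => rw [← F.pr_add_pr false w, map_add, F.co_eq_zero (s := false) (F.pr_mem (!false) w),
      add_zero]
    rfl
  have h4 := F.tr_herm
  rw [tr_apply] at h4
  rw [contr_apply]
  simp only [hook_apply]
  rw [Finset.sum_sub_distrib, ← Finset.sum_mul, h4, h1]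
  simp
  ring

/-- The tracefree part of a tensor of type `(1,2)`. -/
def tf3 : R.Tensors 3 →ₗ[ℝ] R.Tensors 3 :=
  LinearMap.id - ((m : ℝ) - 1)⁻¹ • (F.hook ∘ₗ F.contr)

theorem tf3_apply (T : R.Tensors 3) : F.tf3 T = T - ((m : ℝ) - 1)⁻¹ • F.hook (F.contr T) := rfl

theorem tf3_mem (hm : 1 < m) {T : R.Tensors 3} (hT : T ∈ R.typed ![true, false, false])
    (h12 : ∀ x y z, T ![x, z, y] = - T ![x, y, z]) : F.tf3 T ∈ R.forms12.toSubmodule := by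
  have h : F.tf3 T ∈ R.typed ![true, false, false] :=
    Submodule.sub_mem (x := T) (y := ((m : ℝ) - 1)⁻¹ • F.hook (F.contr T)) _ hT
      (Submodule.smul_of_tower_mem _ _ (F.hook_mem (F.contr_mem hT)))
  have h0 : F.contr (F.tf3 T) = 0 := by
    have : (m : ℝ) - 1 ≠ 0 := by
      rw [sub_ne_zero]
      exact_mod_cast hm.ne'
    rw [tf3_apply, map_sub, map_smul, F.contr_hook (F.contr_mem hT), smul_smul,
      inv_mul_cancel₀ this, one_smul, sub_self]
  rw [mem_forms12_iff, F.mem_traceFree_iff h rfl rfl, mem_swapSign3_iff_12]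
  refine ⟨h, fun x y z => ?_, fun x => ?_⟩
  · simp [tf3_apply, hook_apply, h12 x y z]
    ring
  · rw [vec3_eta x]
    simp only [update3_0, update3_1]
    rw [← contr_apply, h0, _root_.zero_apply]

theorem tf3_tensorRep (q : R.Q₀) {T : R.Tensors 3} (hT : T ∈ R.typed ![true, false, false]) :
    F.tf3 (R.tensorRep 3 q T) = R.tensorRep 3 q (F.tf3 T) := by
  rw [tf3_apply, F.contr_tensorRep q hT, hook_tensorRep, tf3_apply, map_sub, map_smul]

end UnitaryFrame

end RobinsonStructure

namespace RobinsonStructure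

open Robinson

variable {m : ℕ} {V : Type*} [AddCommGroup V] [Module ℝ V] {M : MinkowskiMetric m V}
  {R : RobinsonStructure M}

/-! ### Tensors on the screen space from multilinear forms -/

/-- The pullback of a linear form to the screen space. -/
def pull1 (f : (ℂ ⊗[ℝ] R.H) →ₗ[ℂ] ℂ ⊗[ℝ] V) :
    ((ℂ ⊗[ℝ] V) →ₗ[ℂ] ℂ) →ₗ[ℝ] R.Tensors 1 where
  toFun B :=
    { toFun x := B (f (x 0))
      map_update_add' := by
        intro inst x i u v
        obtain rfl : inst = instDecidableEqFin 1 := Subsingleton.elim _ _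
        obtain rfl : i = 0 := Subsingleton.elim _ _
        simp only [Function.update_self, map_add]
      map_update_smul' := by
        intro inst x i c u
        obtain rfl : inst = instDecidableEqFin 1 := Subsingleton.elim _ _
        obtain rfl : i = 0 := Subsingleton.elim _ _
        simp only [Function.update_self, map_smul] }
  map_add' _ _ := rfl
  map_smul' _ _ := rfl

theorem fin2_ne : (0 : Fin 2) ≠ 1 ∧ (1 : Fin 2) ≠ 0 := by decide

/-- The pullback of a bilinear form to the screen space. -/
def pull2 (f g : (ℂ ⊗[ℝ] R.H) →ₗ[ℂ] ℂ ⊗[ℝ] V) :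
    ((ℂ ⊗[ℝ] V) →ₗ[ℂ] (ℂ ⊗[ℝ] V) →ₗ[ℂ] ℂ) →ₗ[ℝ] R.Tensors 2 where
  toFun B :=
    { toFun x := B (f (x 0)) (g (x 1))
      map_update_add' := by
        intro inst x i u v
        obtain rfl : inst = instDecidableEqFin 2 := Subsingleton.elim _ _
        obtain rfl | rfl : i = 0 ∨ i = 1 := by fin_cases i <;> simp
        all_goals simp only [Function.update_self, Function.update_of_ne, ne_eq, fin2_ne,
          not_false_eq_true, map_add, LinearMap.add_apply]
      map_update_smul' := by
        intro inst x i c u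
        obtain rfl : inst = instDecidableEqFin 2 := Subsingleton.elim _ _
        obtain rfl | rfl : i = 0 ∨ i = 1 := by fin_cases i <;> simp
        all_goals simp only [Function.update_self, Function.update_of_ne, ne_eq, fin2_ne,
          not_false_eq_true, map_smul, LinearMap.smul_apply] }
  map_add' _ _ := rfl
  map_smul' _ _ := rfl

/-- The pullback of a trilinear form to the screen space. -/
def pull3 (f g h : (ℂ ⊗[ℝ] R.H) →ₗ[ℂ] ℂ ⊗[ℝ] V) :
    ((ℂ ⊗[ℝ] V) →ₗ[ℂ] (ℂ ⊗[ℝ] V) →ₗ[ℂ] (ℂ ⊗[ℝ] V) →ₗ[ℂ] ℂ) →ₗ[ℝ] R.Tensors 3 where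
  toFun B :=
    { toFun x := B (f (x 0)) (g (x 1)) (h (x 2))
      map_update_add' := by
        intro inst x i u v
        obtain rfl : inst = instDecidableEqFin 3 := Subsingleton.elim _ _
        obtain rfl | rfl | rfl : i = 0 ∨ i = 1 ∨ i = 2 := by fin_cases i <;> simp
        all_goals simp only [Function.update_self, Function.update_of_ne, ne_eq, fin3_ne,
          not_false_eq_true, map_add, LinearMap.add_apply]
      map_update_smul' := by
        intro inst x i c u
        obtain rfl : inst = instDecidableEqFin 3 := Subsingleton.elim _ _
        obtain rfl | rfl | rfl : i = 0 ∨ i = 1 ∨ i = 2 := by fin_cases i <;> simp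
        all_goals simp only [Function.update_self, Function.update_of_ne, ne_eq, fin3_ne,
          not_false_eq_true, map_smul, LinearMap.smul_apply] }
  map_add' _ _ := rfl
  map_smul' _ _ := rfl

namespace NullPair

variable (P : R.NullPair) (F : R.UnitaryFrame)

/-! ### The action of `Q` with respect to the splitting -/

theorem repV_kC (p : R.Q) :
    (R.repV p⁻¹).baseChange ℂ P.kC = ((R.scale p : ℝ) : ℂ) • P.kC := by
  rw [kC, LinearMap.baseChange_tmul, R.scale_smul p P.k_mem, TensorProduct.tmul_smul,
    ofReal_smul_tensor]

/-- On K^⊥ an element of Q acts modulo K through its screen part. The coefficient a of k can stay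
unspecified, since leading components do not see it. -/
theorem exists_repV_σC (p : R.Q) (x : ℂ ⊗[ℝ] R.H) : ∃ a : ℂ,
    (R.repV p⁻¹).baseChange ℂ (P.σC x) =
      P.σC (((R.toQ₀ p).2⁻¹).1.1.baseChange ℂ x) + a • P.kC := by
  have h1 : gC M (1 ⊗ₜ P.k) ∘ₗ (R.repV p⁻¹).baseChange ℂ ∘ₗ P.σC = 0 := ext_real fun w => by
    change gC M (1 ⊗ₜ P.k) (1 ⊗ₜ (R.repV p⁻¹ (P.σ w))) = 0
    rw [gC_one_tmul, P.mem_Kperp_iff.mp (R.repV_Kperp p⁻¹ (P.σ_mem w)), Complex.ofReal_zero]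
  have h2 : P.τC ∘ₗ (R.repV p⁻¹).baseChange ℂ ∘ₗ P.σC =
      ((R.toQ₀ p).2⁻¹).1.1.baseChange ℂ := ext_real fun w => by
    change (1 : ℂ) ⊗ₜ P.τ (R.repV p⁻¹ (P.σ w)) = 1 ⊗ₜ ((R.toQ₀ p).2⁻¹).1.1 w
    congr 1
    have h3 : ((R.toQ₀ p).2⁻¹).1.1 w = R.repH p⁻¹ w := by
      change ((R.toU p)⁻¹).1.1 w = _
      rw [← map_inv]
      rfl
    rw [h3]
    conv_rhs => rw [← P.mk_σ w]
    exact P.τ_mk ⟨_, R.repV_Kperp p⁻¹ (P.σ_mem w)⟩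
  refine ⟨gC M (1 ⊗ₜ P.l) ((R.repV p⁻¹).baseChange ℂ (P.σC x)), ?_⟩
  have h1 := LinearMap.congr_fun h1 x
  have h2 := LinearMap.congr_fun h2 x
  simp only [LinearMap.comp_apply, LinearMap.zero_apply] at h1 h2
  conv_lhs => rw [P.eq_add_C ((R.repV p⁻¹).baseChange ℂ (P.σC x)), h1, h2, zero_smul, add_zero]
  rw [add_comm, kC]

theorem exists_repV_pr (p : R.Q) (s : Bool) (x : ℂ ⊗[ℝ] R.H) : ∃ a : ℂ,
    (R.repV p⁻¹).baseChange ℂ (P.σC (F.pr s x)) =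
      P.σC (F.pr s (((R.toQ₀ p).2⁻¹).1.1.baseChange ℂ x)) + a • P.kC := by
  rw [F.pr_U]
  exact P.exists_repV_σC p _

/-- Only the coefficient of l matters; it is fixed by preservation of g(k,l) = 1. -/
theorem exists_repV_lC (p : R.Q) : ∃ (a : ℂ) (y : ℂ ⊗[ℝ] R.H),
    (R.repV p⁻¹).baseChange ℂ P.lC = ((R.scale p : ℝ)⁻¹ : ℂ) • P.lC + a • P.kC + P.σC y := by
  have h1 : gC M (1 ⊗ₜ P.k) ((R.repV p⁻¹).baseChange ℂ P.lC) = ((R.scale p : ℝ)⁻¹ : ℂ) := by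
    have h2 := R.repV_isometry p⁻¹ P.k P.l
    rw [R.scale_smul p P.k_mem, map_smul, LinearMap.smul_apply, P.g_kl, smul_eq_mul] at h2
    rw [lC, LinearMap.baseChange_tmul, gC_one_tmul, eq_inv_of_mul_eq_one_right h2,
      Complex.ofReal_inv]
  refine ⟨gC M (1 ⊗ₜ P.l) ((R.repV p⁻¹).baseChange ℂ P.lC),
    P.τC ((R.repV p⁻¹).baseChange ℂ P.lC), ?_⟩
  conv_lhs => rw [P.eq_add_C ((R.repV p⁻¹).baseChange ℂ P.lC), h1]
  rw [add_comm (_ • _) (_ • _)]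
  rfl

/-! ### The components of an intrinsic torsion -/

/-- The component `t(v, k, ·)`. -/
def comp1 (v : ℂ ⊗[ℝ] V) : R.Torsion →ₗ[ℝ] R.Tensors 1 where
  toFun t := pull1 (P.ν F) (P.ev F t v P.kC)
  map_add' _ _ := by simp only [map_add, LinearMap.add_apply]
  map_smul' _ _ := by simp only [map_smul, LinearMap.smul_apply, RingHom.id_apply]

theorem comp1_apply (v : ℂ ⊗[ℝ] V) (t : R.Torsion) (x : ℂ ⊗[ℝ] R.H) :
    P.comp1 F v t ![x] = P.ev F t v P.kC (P.ν F x) := rfl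

/-- The component `t(v, ·, ·)`. -/
def comp2 (v : ℂ ⊗[ℝ] V) : R.Torsion →ₗ[ℝ] R.Tensors 2 where
  toFun t := pull2 (P.ν F) (P.ν F) (P.ev F t v)
  map_add' _ _ := by simp only [map_add, LinearMap.add_apply]
  map_smul' _ _ := by simp only [map_smul, LinearMap.smul_apply, RingHom.id_apply]

theorem comp2_apply (v : ℂ ⊗[ℝ] V) (t : R.Torsion) (x y : ℂ ⊗[ℝ] R.H) :
    P.comp2 F v t ![x, y] = P.ev F t v (P.ν F x) (P.ν F y) := rfl

/-- The component `t(·, k, ·)` with the first argument of type `s`. -/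
def compK (s : Bool) : R.Torsion →ₗ[ℝ] R.Tensors 2 where
  toFun t := pull2 (P.σC ∘ₗ F.pr s) (P.ν F) ((P.ev F t).flip P.kC)
  map_add' _ _ := by
    rw [← map_add]
    congr 1
    refine LinearMap.ext fun v => ?_
    simp only [map_add, LinearMap.add_apply, LinearMap.flip_apply]
  map_smul' _ _ := by
    rw [RingHom.id_apply, ← map_smul]
    congr 1
    refine LinearMap.ext fun v => ?_
    simp only [map_smul, LinearMap.smul_apply, LinearMap.flip_apply]

theorem compK_apply (s : Bool) (t : R.Torsion) (x y : ℂ ⊗[ℝ] R.H) :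
    P.compK F s t ![x, y] = P.ev F t (P.σC (F.pr s x)) P.kC (P.ν F y) := rfl

/-- The component `t(·, ·, ·)` with the first argument of type `s`. -/
def comp3 (s : Bool) : R.Torsion →ₗ[ℝ] R.Tensors 3 where
  toFun t := pull3 (P.σC ∘ₗ F.pr s) (P.ν F) (P.ν F) (P.ev F t)
  map_add' _ _ := by simp only [map_add]
  map_smul' _ _ := by simp only [map_smul, RingHom.id_apply]

theorem comp3_apply (s : Bool) (t : R.Torsion) (x y z : ℂ ⊗[ℝ] R.H) :
    P.comp3 F s t ![x, y, z] = P.ev F t (P.σC (F.pr s x)) (P.ν F y) (P.ν F z) := rfl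

theorem σC_pr_eq_zero {s : Bool} {x : ℂ ⊗[ℝ] R.H} (hx : x ∈ R.typeSub (!s)) :
    P.σC (F.pr s x) = 0 := by rw [F.pr_eq_zero hx, map_zero]

theorem ν_eq_zero {x : ℂ ⊗[ℝ] R.H} (hx : x ∈ R.typeSub true) : P.ν F x = 0 :=
  P.σC_pr_eq_zero F hx

theorem comp1_mem (v : ℂ ⊗[ℝ] V) (t : R.Torsion) :
    P.comp1 F v t ∈ R.typed fun _ => false := by
  intro i x hx
  obtain rfl : i = 0 := Subsingleton.elim _ _
  rw [vec1_eta x, comp1_apply, P.ν_eq_zero F hx, map_zero]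

theorem comp2_mem (v : ℂ ⊗[ℝ] V) (t : R.Torsion) :
    P.comp2 F v t ∈ R.typed fun _ => false := by
  intro i x hx
  rw [vec2_eta x, comp2_apply]
  obtain rfl | rfl : i = 0 ∨ i = 1 := by fin_cases i <;> simp
  · rw [P.ν_eq_zero F hx, map_zero, LinearMap.zero_apply]
  · rw [P.ν_eq_zero F hx, map_zero]

theorem compK_mem (s : Bool) (t : R.Torsion) : P.compK F s t ∈ R.typed ![s, false] := by
  intro i x hx
  rw [vec2_eta x, compK_apply]
  obtain rfl | rfl : i = 0 ∨ i = 1 := by fin_cases i <;> simp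
  · rw [P.σC_pr_eq_zero F (s := s) hx, map_zero, LinearMap.zero_apply, LinearMap.zero_apply]
  · rw [P.ν_eq_zero F hx, map_zero]

theorem comp3_mem (s : Bool) (t : R.Torsion) : P.comp3 F s t ∈ R.typed ![s, false, false] := by
  intro i x hx
  rw [vec3_eta x, comp3_apply]
  obtain rfl | rfl | rfl : i = 0 ∨ i = 1 ∨ i = 2 := by fin_cases i <;> simp
  · rw [P.σC_pr_eq_zero F (s := s) hx, map_zero, LinearMap.zero_apply, LinearMap.zero_apply]
  · rw [P.ν_eq_zero F hx, map_zero, LinearMap.zero_apply]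
  · rw [P.ν_eq_zero F hx, map_zero]

theorem comp2_skew (v : ℂ ⊗[ℝ] V) (t : R.Torsion) (x y : ℂ ⊗[ℝ] R.H) :
    P.comp2 F v t ![y, x] = - P.comp2 F v t ![x, y] := P.ev_skew F t _ _ _

theorem comp3_skew (s : Bool) (t : R.Torsion) (x y z : ℂ ⊗[ℝ] R.H) :
    P.comp3 F s t ![x, z, y] = - P.comp3 F s t ![x, y, z] := P.ev_skew F t _ _ _

/-! ### Equivariance of the components -/

theorem ev_smul_apply (r : ℝ) (q : R.Q₀) {k : ℕ} (T : R.Tensors k) (x : Fin k → ℂ ⊗[ℝ] R.H) :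
    (r • R.tensorRep k q T) x = (r : ℂ) * R.tensorRep k q T x := by
  rw [_root_.smul_apply, Complex.real_smul]

/-- Each argument k contributes a factor c, giving weight 2. The correction from the screen vector
is a multiple of t(k,k,k) = 0, so no assumption on t is needed. -/
theorem comp1_kC_torsionRep (p : R.Q) (t : R.Torsion) :
    P.comp1 F P.kC (R.torsionRep p t) =
      ((R.toQ₀ p).1 : ℝ) ^ (2 : ℤ) • R.tensorRep 1 (R.toQ₀ p) (P.comp1 F P.kC t) := by
  refine ext1 fun x => ?_
  obtain ⟨a, ha⟩ := P.exists_repV_pr F p false x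
  rw [ev_smul_apply, tensorRep1_apply, comp1_apply, comp1_apply,
    ev_torsionRep _ _ _ _ _ P.kC_mem (P.ν_mem F x), ν_apply, ha, repV_kC]
  simp only [map_smul, map_add, LinearMap.smul_apply, ev_self, smul_eq_mul, mul_zero, add_zero,
    ν_apply]
  change _ = (((R.scale p : ℝ) ^ (2 : ℤ) : ℝ) : ℂ) * _
  push_cast
  rw [zpow_two]
  ring

/-- All corrections contain t(k,k,·), which vanishes on 𝔾^{-1}; one factor c remains. -/
theorem comp2_kC_torsionRep (p : R.Q) {t : R.Torsion} (ht : t ∈ R.fil (-1)) :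
    P.comp2 F P.kC (R.torsionRep p t) =
      ((R.toQ₀ p).1 : ℝ) ^ (1 : ℤ) • R.tensorRep 2 (R.toQ₀ p) (P.comp2 F P.kC t) := by
  have h1 := LinearMap.congr_fun ((P.mem_fil_neg_one_iff F).mp ht)
  have h2 : ∀ x, P.ev F t P.kC x P.kC = 0 := fun x => by rw [ev_skew, h1]; simp
  refine ext2 fun x y => ?_
  obtain ⟨a, ha⟩ := P.exists_repV_pr F p false x
  obtain ⟨b, hb⟩ := P.exists_repV_pr F p false y
  rw [ev_smul_apply, tensorRep2_apply, comp2_apply, comp2_apply,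
    ev_torsionRep _ _ _ _ _ (P.ν_mem F x) (P.ν_mem F y), ν_apply, ν_apply, ha, hb, repV_kC]
  simp only [map_smul, map_add, LinearMap.smul_apply, LinearMap.add_apply, h1, h2,
    LinearMap.zero_apply, smul_eq_mul, mul_zero, add_zero, ν_apply, zpow_one]
  rfl

theorem compK_torsionRep (s : Bool) (p : R.Q) {t : R.Torsion} (ht : t ∈ R.fil (-1)) :
    P.compK F s (R.torsionRep p t) =
      ((R.toQ₀ p).1 : ℝ) ^ (1 : ℤ) • R.tensorRep 2 (R.toQ₀ p) (P.compK F s t) := by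
  have h1 := LinearMap.congr_fun ((P.mem_fil_neg_one_iff F).mp ht)
  refine ext2 fun x y => ?_
  obtain ⟨a, ha⟩ := P.exists_repV_pr F p s x
  obtain ⟨b, hb⟩ := P.exists_repV_pr F p false y
  rw [ev_smul_apply, tensorRep2_apply, compK_apply, compK_apply,
    ev_torsionRep _ _ _ _ _ P.kC_mem (P.ν_mem F y), ν_apply, ha, hb, repV_kC]
  simp only [map_smul, map_add, LinearMap.smul_apply, LinearMap.add_apply, h1, ev_self,
    LinearMap.zero_apply, smul_eq_mul, mul_zero, add_zero, ν_apply, zpow_one]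
  rfl

/-- The factor c from k cancels c⁻¹ from l. The corrections to l give values t(k,k,·) and t(x,k,·),
which vanish on 𝔾^0. -/
theorem comp1_lC_torsionRep (p : R.Q) {t : R.Torsion} (ht : t ∈ R.fil 0) :
    P.comp1 F P.lC (R.torsionRep p t) =
      ((R.toQ₀ p).1 : ℝ) ^ (0 : ℤ) • R.tensorRep 1 (R.toQ₀ p) (P.comp1 F P.lC t) := by
  obtain ⟨h1, h2⟩ := (P.mem_fil_zero_iff F).mp ht
  refine ext1 fun x => ?_
  obtain ⟨a, ha⟩ := P.exists_repV_pr F p false x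
  obtain ⟨b, y, hb⟩ := P.exists_repV_lC p
  rw [zpow_zero, one_smul, tensorRep1_apply, comp1_apply, comp1_apply,
    ev_torsionRep _ _ _ _ _ P.kC_mem (P.ν_mem F x), ν_apply, ha, hb, repV_kC]
  simp only [map_smul, map_add, LinearMap.smul_apply, LinearMap.add_apply, h1, h2, ev_self,
    LinearMap.zero_apply, smul_eq_mul, mul_zero, add_zero, ν_apply]
  rw [← mul_assoc, mul_inv_cancel₀, one_mul]
  exact_mod_cast (R.scale p).2.ne'

theorem comp3_torsionRep (s : Bool) (p : R.Q) {t : R.Torsion} (ht : t ∈ R.fil 0) :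
    P.comp3 F s (R.torsionRep p t) =
      ((R.toQ₀ p).1 : ℝ) ^ (0 : ℤ) • R.tensorRep 3 (R.toQ₀ p) (P.comp3 F s t) := by
  obtain ⟨h1, h2⟩ := (P.mem_fil_zero_iff F).mp ht
  have h3 : ∀ x y, P.ev F t (P.σC x) y P.kC = 0 := fun x y => by rw [ev_skew, h2]; simp
  refine ext3 fun x y z => ?_
  obtain ⟨a, ha⟩ := P.exists_repV_pr F p s x
  obtain ⟨b, hb⟩ := P.exists_repV_pr F p false y
  obtain ⟨c, hc⟩ := P.exists_repV_pr F p false z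
  rw [zpow_zero, one_smul, tensorRep3_apply, comp3_apply, comp3_apply,
    ev_torsionRep _ _ _ _ _ (P.ν_mem F y) (P.ν_mem F z), ν_apply, ν_apply, ha, hb, hc]
  simp only [map_smul, map_add, LinearMap.smul_apply, LinearMap.add_apply, h1, h2, h3,
    LinearMap.zero_apply, smul_eq_mul, mul_zero, add_zero, ν_apply]

/-- On 𝔾^1 everything except t(l,·,·) on the screen vanishes, so all corrections disappear and l
leaves the factor c⁻¹. -/
theorem comp2_lC_torsionRep (p : R.Q) {t : R.Torsion} (ht : t ∈ R.fil 1) :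
    P.comp2 F P.lC (R.torsionRep p t) =
      ((R.toQ₀ p).1 : ℝ) ^ (-1 : ℤ) • R.tensorRep 2 (R.toQ₀ p) (P.comp2 F P.lC t) := by
  obtain ⟨h1, h2, h3⟩ := (P.mem_fil_one_iff F).mp ht
  have h4 : ∀ y, P.ev F t P.lC y P.kC = 0 := fun y => by rw [ev_skew, h3]; simp
  refine ext2 fun x y => ?_
  obtain ⟨a, ha⟩ := P.exists_repV_pr F p false x
  obtain ⟨b, hb⟩ := P.exists_repV_pr F p false y
  obtain ⟨c, z, hc⟩ := P.exists_repV_lC p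
  rw [ev_smul_apply, tensorRep2_apply, comp2_apply, comp2_apply,
    ev_torsionRep _ _ _ _ _ (P.ν_mem F x) (P.ν_mem F y), ν_apply, ν_apply, ha, hb, hc]
  simp only [map_smul, map_add, LinearMap.smul_apply, LinearMap.add_apply, h1, h2, h3, h4,
    LinearMap.zero_apply, smul_eq_mul, mul_zero, add_zero, ν_apply]
  rw [zpow_neg_one, Complex.ofReal_inv]
  rfl

/-! ### The filtration in terms of the components -/

theorem comp1_eq_zero_iff {v : ℂ ⊗[ℝ] V} {t : R.Torsion} :
    P.comp1 F v t = 0 ↔ P.ev F t v P.kC = 0 := by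
  rw [ev_k_eq_zero_iff]
  exact ⟨fun h x => by rw [← comp1_apply, h]; rfl, fun h => ext1 fun x => h x⟩

theorem comp2_eq_zero_iff {v : ℂ ⊗[ℝ] V} {t : R.Torsion} :
    P.comp2 F v t = 0 ↔ ∀ x y, P.ev F t v (P.ν F x) (P.ν F y) = 0 :=
  ⟨fun h x y => by rw [← comp2_apply, h]; rfl, fun h => ext2 fun x y => h x y⟩

theorem compK_eq_zero_iff {t : R.Torsion} :
    P.compK F true t = 0 ∧ P.compK F false t = 0 ↔ ∀ x, P.ev F t (P.σC x) P.kC = 0 := by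
  constructor
  · rintro ⟨h1, h2⟩ x
    rw [ev_k_eq_zero_iff]
    intro y
    rw [← F.pr_add_pr true x, map_add, map_add, LinearMap.add_apply, LinearMap.add_apply,
      Bool.not_true, ← compK_apply, ← compK_apply, h1, h2]
    exact add_zero _
  · intro h
    constructor <;> exact ext2 fun x y => by rw [compK_apply, h]; rfl

theorem comp3_eq_zero_iff {t : R.Torsion} :
    P.comp3 F true t = 0 ∧ P.comp3 F false t = 0 ↔
      ∀ x y z, P.ev F t (P.σC x) (P.ν F y) (P.ν F z) = 0 := by
  constructor
  · rintro ⟨h1, h2⟩ x y z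
    rw [← F.pr_add_pr true x, map_add, map_add, LinearMap.add_apply, LinearMap.add_apply,
      Bool.not_true, ← comp3_apply, ← comp3_apply, h1, h2]
    exact add_zero _
  · intro h
    constructor <;> exact ext3 fun x y z => by rw [comp3_apply, h]; rfl

theorem mem_fil_neg_one_iff_comp {t : R.Torsion} : t ∈ R.fil (-1) ↔ P.comp1 F P.kC t = 0 := by
  rw [comp1_eq_zero_iff, P.mem_fil_neg_one_iff F]

theorem mem_fil_zero_iff_comp {t : R.Torsion} (ht : t ∈ R.fil (-1)) : t ∈ R.fil 0 ↔
    P.comp2 F P.kC t = 0 ∧ P.compK F true t = 0 ∧ P.compK F false t = 0 := by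
  rw [compK_eq_zero_iff, comp2_eq_zero_iff, P.mem_fil_zero_iff F, ev_eq_zero_iff,
    and_iff_right ((P.mem_fil_neg_one_iff F).mp ht)]

theorem mem_fil_one_iff_comp {t : R.Torsion} (ht : t ∈ R.fil 0) : t ∈ R.fil 1 ↔
    P.comp1 F P.lC t = 0 ∧ P.comp3 F true t = 0 ∧ P.comp3 F false t = 0 := by
  obtain ⟨h1, h2⟩ := (P.mem_fil_zero_iff F).mp ht
  rw [comp3_eq_zero_iff, comp1_eq_zero_iff, P.mem_fil_one_iff F, and_iff_right h1, and_comm]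
  simp only [ev_eq_zero_iff, h2, true_and]

theorem eq_zero_iff_comp {t : R.Torsion} (ht : t ∈ R.fil 1) : t = 0 ↔ P.comp2 F P.lC t = 0 := by
  obtain ⟨h1, h2, h3⟩ := (P.mem_fil_one_iff F).mp ht
  rw [P.eq_zero_iff F, and_iff_right h1, and_iff_right h2, ev_eq_zero_iff, and_iff_right h3,
    comp2_eq_zero_iff]

end NullPair

end RobinsonStructure

/-! ### Projection of the leading components to the modules of the table -/

namespace RobinsonStructure

open Robinson

variable {m : ℕ} {V : Type*} [AddCommGroup V] [Module ℝ V] {M : MinkowskiMetric m V}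
  {R : RobinsonStructure M}

theorem eq_zero_of_conjT {k : ℕ} {T : R.Tensors k} (h : R.conjT k T = 0) : T = 0 := by
  rw [← conjT_conjT T, h, map_zero]

/-- T and its conjugate have opposite types, so they cannot cancel. -/
theorem eq_zero_of_add_conjT (F : R.UnitaryFrame) {T : R.Tensors 1}
    (hT : T ∈ R.typed fun _ => false) (h : T + R.conjT 1 T = 0) : T = 0 := by
  have h1 : R.conjT 1 T ∈ R.typed fun _ => true := conjT_mem_typed hT
  refine ext1 fun x => ?_
  have h2 : T ![F.pr false x] = T ![x] := by
    rw [← F.typed_apply_pr hT ![x]]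
    congr 1
    exact (vec1_eta fun i => F.pr false (![x] i)).symm
  have h3 : (T + R.conjT 1 T) ![F.pr false x] = 0 := by rw [h]; rfl
  rw [_root_.add_apply, h1 0 _ (F.pr_mem false x), add_zero, h2] at h3
  exact h3

theorem eq_zero_of_add_of_sub {W : Type*} [AddCommGroup W] [Module ℝ W] {x y : W}
    (h1 : x + y = 0) (h2 : x - y = 0) : x = 0 := by
  have : (2 : ℝ) • x = (x + y) + (x - y) := by module
  rw [h1, h2, add_zero, smul_eq_zero] at this
  exact this.resolve_left two_ne_zero

namespace UnitaryFrame

variable (F : R.UnitaryFrame)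

theorem sub_starT_tf_mem (hm : 0 < m) {T : R.Tensors 2} (hT : T ∈ R.typed ![true, false]) :
    F.tf T - R.starT (F.tf T) ∈ R.forms11.toSubmodule := by
  have h := F.tf_mem hm hT
  rw [mem_forms11_iff]
  refine ⟨Submodule.sub_mem _ h (R.tracefree11_starT h), ?_⟩
  rw [map_sub, starT_starT, neg_sub]

theorem _root_.RobinsonStructure.I_smul_mem_tracefree11 {T : R.Tensors 2} (hT : T ∈ R.tracefree11.toSubmodule) :
    Complex.I • T ∈ R.tracefree11.toSubmodule := by
  obtain ⟨F⟩ := R.exists_unitaryFrame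
  exact F.I_smul_mem_of_iff (fun _ => F.tracefree11_iff_arr) hT

theorem I_smul_add_starT_tf_mem (hm : 0 < m) {T : R.Tensors 2}
    (hT : T ∈ R.typed ![true, false]) :
    Complex.I • (F.tf T + R.starT (F.tf T)) ∈ R.forms11.toSubmodule := by
  have h := F.tf_mem hm hT
  rw [mem_forms11_iff]
  refine ⟨I_smul_mem_tracefree11 (Submodule.add_mem _ h (R.tracefree11_starT h)), ?_⟩
  rw [starT_I_smul, map_add, starT_starT, add_comm]

theorem eq_zero_of_tf (hr : (F.tr T).re = 0) (hi : (F.tr T).im = 0)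
    (h1 : F.tf T - R.starT (F.tf T) = 0) (h2 : Complex.I • (F.tf T + R.starT (F.tf T)) = 0) :
    T = 0 := by
  rw [smul_eq_zero_iff_right Complex.I_ne_zero] at h2
  have h := eq_zero_of_add_of_sub h2 h1
  have h0 : F.tr T = 0 := Complex.ext hr hi
  rwa [tf_apply, h0, mul_zero, zero_smul, sub_zero] at h

end UnitaryFrame

namespace NullPair

variable (P : R.NullPair) (F : R.UnitaryFrame)

/-- The component of an intrinsic torsion in the tensor factor of the module with label `l`. -/
def comp : (l : Label) → R.Torsion →ₗ[ℝ] R.Tensors l.rank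
  | .neg2_00 => (LinearMap.id + R.conjT 1) ∘ₗ P.comp1 F P.kC
  | .neg1_00 => R.reT ∘ₗ F.tr.restrictScalars ℝ ∘ₗ P.compK F true
  -- The factor -i turns the imaginary part of the trace into a real part.
  | .neg1_10 => R.reT ∘ₗ (-Complex.I • F.tr).restrictScalars ℝ ∘ₗ P.compK F true
  -- Components with arguments in H^{(0,1)} are forms of type (0,2); conjugation makes them
  -- (2,0)-forms.
  | .neg1_11 => R.conjT 2 ∘ₗ P.comp2 F P.kC
  -- T - T* and i(T + T*) both satisfy the reality condition and together determine T.
  | .neg1_12 => (LinearMap.id - R.starT) ∘ₗ F.tf ∘ₗ P.compK F true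
  | .neg1_20 => (Complex.I • (LinearMap.id + R.starT)) ∘ₗ F.tf ∘ₗ P.compK F true
  | .neg1_21 => (LinearMap.id + R.swapT) ∘ₗ R.conjT 2 ∘ₗ P.compK F false
  | .neg1_30 => (LinearMap.id - R.swapT) ∘ₗ R.conjT 2 ∘ₗ P.compK F false
  | .zero_00 => (LinearMap.id + R.conjT 1) ∘ₗ P.comp1 F P.lC
  | .zero_10 => R.conjT 1 ∘ₗ F.contr ∘ₗ P.comp3 F true
  | .zero_11 => R.cycT ∘ₗ R.conjT 3 ∘ₗ P.comp3 F false
  -- On tensors skew in the last two slots a third of the cyclic sum is the totally skew part, so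
  -- this is three times the projection onto the Young module.
  | .zero_12 => ((3 : ℝ) • LinearMap.id - R.cycT) ∘ₗ R.conjT 3 ∘ₗ P.comp3 F false
  | .zero_13 => F.tf3 ∘ₗ P.comp3 F true
  | .one_00 => R.conjT 2 ∘ₗ P.comp2 F P.lC

theorem vec_const2 : (![false, false] : Fin 2 → Bool) = fun _ => false := by decide

theorem vec_const3 : (![false, false, false] : Fin 3 → Bool) = fun _ => false := by decide

theorem conjT_compK_mem (t : R.Torsion) :
    R.conjT 2 (P.compK F false t) ∈ R.typed fun _ => true :=
  conjT_mem_typed (vec_const2 ▸ P.compK_mem F false t)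

theorem conjT_comp2_mem (v : ℂ ⊗[ℝ] V) (t : R.Torsion) :
    R.conjT 2 (P.comp2 F v t) ∈ R.forms20.toSubmodule := by
  rw [mem_forms20_iff, mem_swapSign2_iff]
  refine ⟨conjT_mem_typed (P.comp2_mem F v t), fun x y => ?_⟩
  rw [conjT2_apply, conjT2_apply, comp2_skew, map_neg, neg_one_smul]

theorem conjT_comp3_mem (t : R.Torsion) :
    R.conjT 3 (P.comp3 F false t) ∈ R.typed fun _ => true :=
  conjT_mem_typed (vec_const3 ▸ P.comp3_mem F false t)

theorem conjT_comp3_skew (t : R.Torsion) (x y z : ℂ ⊗[ℝ] R.H) :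
    R.conjT 3 (P.comp3 F false t) ![x, z, y] = - R.conjT 3 (P.comp3 F false t) ![x, y, z] := by
  rw [conjT3_apply, conjT3_apply, comp3_skew, map_neg]

theorem comp_mem (hm : 1 < m) (l : Label) (t : R.Torsion) :
    P.comp F l t ∈ (R.tableForms l).toSubmodule := by
  cases l
  · exact add_conjT_mem_formsV _
  · exact reT_mem _
  · exact reT_mem _
  · exact P.conjT_comp2_mem F _ t
  · exact F.sub_starT_tf_mem (by omega) (P.compK_mem F true t)
  · exact F.I_smul_add_starT_tf_mem (by omega) (P.compK_mem F true t)
  · exact add_swapT_mem (P.conjT_compK_mem F t)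
  · exact sub_swapT_mem (P.conjT_compK_mem F t)
  · exact add_conjT_mem_formsV _
  · exact mem_typed1_iff.mp (conjT_mem_typed (F.contr_mem (P.comp3_mem F true t)))
  · exact cycT_mem_forms30 (P.conjT_comp3_mem F t) (P.conjT_comp3_skew F t)
  · exact sub_cycT_mem_young21 (P.conjT_comp3_mem F t) (P.conjT_comp3_skew F t)
  · exact F.tf3_mem hm (P.comp3_mem F true t) (P.comp3_skew F true t)
  · exact P.conjT_comp2_mem F _ t

/-- Traces, swaps, conjugation and cyclic sums commute with U(m) and are real linear, so the weight
of the leading component carries over. -/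
theorem comp_torsionRep (l : Label) (p : R.Q) {t : R.Torsion} (ht : t ∈ R.fil l.degree) :
    P.comp F l (R.torsionRep p t) = ((R.toQ₀ p).1 : ℝ) ^ l.weight •
      R.tensorRep l.rank (R.toQ₀ p) (P.comp F l t) := by
  have hK := P.compK_mem F true t
  have h3 := P.comp3_mem F true t
  cases l
  · change P.comp1 F P.kC _ + R.conjT 1 (P.comp1 F P.kC _) =
      _ • R.tensorRep 1 _ (P.comp1 F P.kC t + R.conjT 1 (P.comp1 F P.kC t))
    rw [comp1_kC_torsionRep, map_smul, conjT_tensorRep, ← smul_add, ← map_add]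
    rfl
  · change R.reT (F.tr (P.compK F true _)) = _ • R.tensorRep 0 _ (R.reT (F.tr (P.compK F true t)))
    rw [P.compK_torsionRep F true p ht, F.tr.map_smul_of_tower, F.tr_tensorRep _ hK,
      tensorRep_reT, map_smul]
    rfl
  · change R.reT (-Complex.I • F.tr (P.compK F true _)) =
      (((R.toQ₀ p).1 : ℝ) ^ (1 : ℤ) •
        R.tensorRep 0 _ (R.reT (-Complex.I • F.tr (P.compK F true t))) : R.Tensors 0)
    rw [P.compK_torsionRep F true p ht, F.tr.map_smul_of_tower, F.tr_tensorRep _ hK,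
      tensorRep_reT, smul_comm, map_smul]
  · change R.conjT 2 (P.comp2 F P.kC _) = _ • R.tensorRep 2 _ (R.conjT 2 (P.comp2 F P.kC t))
    rw [P.comp2_kC_torsionRep F p ht, map_smul, conjT_tensorRep]
    rfl
  · change F.tf (P.compK F true _) - R.starT (F.tf (P.compK F true _)) =
      _ • R.tensorRep 2 _ (F.tf (P.compK F true t) - R.starT (F.tf (P.compK F true t)))
    rw [P.compK_torsionRep F true p ht, map_smul, F.tf_tensorRep _ hK, map_smul, starT_tensorRep,
      ← smul_sub, ← map_sub]
    rfl
  · change Complex.I • (F.tf (P.compK F true _) + R.starT (F.tf (P.compK F true _))) =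
      _ • R.tensorRep 2 _
        (Complex.I • (F.tf (P.compK F true t) + R.starT (F.tf (P.compK F true t))))
    rw [P.compK_torsionRep F true p ht, map_smul, F.tf_tensorRep _ hK, map_smul, starT_tensorRep,
      ← smul_add, ← map_add, smul_comm]
    rfl
  · change R.conjT 2 (P.compK F false _) + R.swapT (R.conjT 2 (P.compK F false _)) =
      _ • R.tensorRep 2 _
        (R.conjT 2 (P.compK F false t) + R.swapT (R.conjT 2 (P.compK F false t)))
    rw [P.compK_torsionRep F false p ht, map_smul, map_smul, conjT_tensorRep, swapT_tensorRep,
      ← smul_add, ← map_add]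
    rfl
  · change R.conjT 2 (P.compK F false _) - R.swapT (R.conjT 2 (P.compK F false _)) =
      _ • R.tensorRep 2 _
        (R.conjT 2 (P.compK F false t) - R.swapT (R.conjT 2 (P.compK F false t)))
    rw [P.compK_torsionRep F false p ht, map_smul, map_smul, conjT_tensorRep, swapT_tensorRep,
      ← smul_sub, ← map_sub]
    rfl
  · change P.comp1 F P.lC _ + R.conjT 1 (P.comp1 F P.lC _) =
      _ • R.tensorRep 1 _ (P.comp1 F P.lC t + R.conjT 1 (P.comp1 F P.lC t))
    rw [P.comp1_lC_torsionRep F p ht, map_smul, conjT_tensorRep, ← smul_add, ← map_add]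
    rfl
  · change R.conjT 1 (F.contr (P.comp3 F true _)) =
      _ • R.tensorRep 1 _ (R.conjT 1 (F.contr (P.comp3 F true t)))
    rw [P.comp3_torsionRep F true p ht, map_smul, F.contr_tensorRep _ h3, map_smul,
      conjT_tensorRep]
    rfl
  · change R.cycT (R.conjT 3 (P.comp3 F false _)) =
      _ • R.tensorRep 3 _ (R.cycT (R.conjT 3 (P.comp3 F false t)))
    rw [P.comp3_torsionRep F false p ht, map_smul, map_smul, conjT_tensorRep, cycT_tensorRep]
    rfl
  · change (3 : ℝ) • R.conjT 3 (P.comp3 F false _) - R.cycT (R.conjT 3 (P.comp3 F false _)) =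
      (((R.toQ₀ p).1 : ℝ) ^ (0 : ℤ) • R.tensorRep 3 _
        ((3 : ℝ) • R.conjT 3 (P.comp3 F false t) - R.cycT (R.conjT 3 (P.comp3 F false t))) :
        R.Tensors 3)
    rw [P.comp3_torsionRep F false p ht, map_smul, map_smul, conjT_tensorRep, cycT_tensorRep,
      map_sub, map_smul, smul_sub, smul_comm]
  · change F.tf3 (P.comp3 F true _) = _ • R.tensorRep 3 _ (F.tf3 (P.comp3 F true t))
    rw [P.comp3_torsionRep F true p ht, map_smul, F.tf3_tensorRep _ h3]
    rfl
  · change R.conjT 2 (P.comp2 F P.lC _) = _ • R.tensorRep 2 _ (R.conjT 2 (P.comp2 F P.lC t))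
    rw [P.comp2_lC_torsionRep F p ht, map_smul, conjT_tensorRep]
    rfl

/-- The components of degree i determine the leading components of degree i, and the vanishing of
the latter is membership in 𝔾^{i+1}. This is the joint injectivity on gr_i. -/
theorem mem_fil_add_one_iff {i : ℤ} {t : R.Torsion} (ht : t ∈ R.fil i) :
    t ∈ R.fil (i + 1) ↔ ∀ l : Label, l.degree = i → P.comp F l t = 0 := by
  constructor
  · rintro h l rfl
    cases l
    · have h0 := P.mem_fil_neg_one_iff_comp F |>.mp h
      change P.comp1 F P.kC t + R.conjT 1 (P.comp1 F P.kC t) = 0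
      rw [h0, map_zero, add_zero]
    · have h0 := (P.mem_fil_zero_iff_comp F ht |>.mp h).2.1
      change R.reT (F.tr (P.compK F true t)) = 0
      rw [h0, map_zero, map_zero]
    · have h0 := (P.mem_fil_zero_iff_comp F ht |>.mp h).2.1
      change R.reT (-Complex.I • F.tr (P.compK F true t)) = 0
      rw [h0, map_zero, smul_zero, map_zero]
    · have h0 := (P.mem_fil_zero_iff_comp F ht |>.mp h).1
      change R.conjT 2 (P.comp2 F P.kC t) = 0
      rw [h0, map_zero]
    · have h0 := (P.mem_fil_zero_iff_comp F ht |>.mp h).2.1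
      change F.tf (P.compK F true t) - R.starT (F.tf (P.compK F true t)) = 0
      rw [h0, map_zero, map_zero, sub_zero]
    · have h0 := (P.mem_fil_zero_iff_comp F ht |>.mp h).2.1
      change Complex.I • (F.tf (P.compK F true t) + R.starT (F.tf (P.compK F true t))) = 0
      rw [h0, map_zero, map_zero, add_zero, smul_zero]
    · have h0 := (P.mem_fil_zero_iff_comp F ht |>.mp h).2.2
      change R.conjT 2 (P.compK F false t) + R.swapT (R.conjT 2 (P.compK F false t)) = 0
      rw [h0, map_zero, map_zero, add_zero]
    · have h0 := (P.mem_fil_zero_iff_comp F ht |>.mp h).2.2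
      change R.conjT 2 (P.compK F false t) - R.swapT (R.conjT 2 (P.compK F false t)) = 0
      rw [h0, map_zero, map_zero, sub_zero]
    · have h0 := (P.mem_fil_one_iff_comp F ht |>.mp h).1
      change P.comp1 F P.lC t + R.conjT 1 (P.comp1 F P.lC t) = 0
      rw [h0, map_zero, add_zero]
    · have h0 := (P.mem_fil_one_iff_comp F ht |>.mp h).2.1
      change R.conjT 1 (F.contr (P.comp3 F true t)) = 0
      rw [h0, map_zero, map_zero]
    · have h0 := (P.mem_fil_one_iff_comp F ht |>.mp h).2.2
      change R.cycT (R.conjT 3 (P.comp3 F false t)) = 0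
      rw [h0, map_zero, map_zero]
    · have h0 := (P.mem_fil_one_iff_comp F ht |>.mp h).2.2
      change (3 : ℝ) • R.conjT 3 (P.comp3 F false t) - R.cycT (R.conjT 3 (P.comp3 F false t)) = 0
      rw [h0, map_zero, map_zero, smul_zero, sub_zero]
    · have h0 := (P.mem_fil_one_iff_comp F ht |>.mp h).2.1
      change F.tf3 (P.comp3 F true t) = 0
      rw [h0, map_zero]
    · have h0 : t = 0 := by
        have h1 : t ∈ R.fil 2 := h
        rwa [R.fil_of_ge le_rfl, Submodule.mem_bot] at h1
      rw [h0, map_zero]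
  · intro h
    rcases lt_or_ge i (-2) with hi | hi
    · rw [R.fil_of_le (by omega)]
      trivial
    rcases lt_or_ge 1 i with hi' | hi'
    · rw [R.fil_of_ge (by omega), Submodule.mem_bot] at ht
      rw [ht]
      exact Submodule.zero_mem _
    obtain rfl | rfl | rfl | rfl : i = -2 ∨ i = -1 ∨ i = 0 ∨ i = 1 := by omega
    · exact (P.mem_fil_neg_one_iff_comp F).mpr
        (eq_zero_of_add_conjT F (P.comp1_mem F _ t) (h .neg2_00 rfl))
    · refine (P.mem_fil_zero_iff_comp F ht).mpr
        ⟨eq_zero_of_conjT (h .neg1_11 rfl), ?_, eq_zero_of_conjT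
          (eq_zero_of_add_of_sub (h .neg1_21 rfl) (h .neg1_30 rfl))⟩
      refine F.eq_zero_of_tf (reT_eq_zero (h .neg1_00 rfl)) ?_ (h .neg1_12 rfl) (h .neg1_20 rfl)
      have h1 : (-Complex.I • F.tr (P.compK F true t)).re = 0 := reT_eq_zero (h .neg1_10 rfl)
      simpa using h1
    · refine (P.mem_fil_one_iff_comp F ht).mpr
        ⟨eq_zero_of_add_conjT F (P.comp1_mem F _ t) (h .zero_00 rfl), ?_, eq_zero_of_conjT ?_⟩
      · have h1 : F.contr (P.comp3 F true t) = 0 := eq_zero_of_conjT (h .zero_10 rfl)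
        have h2 : F.tf3 (P.comp3 F true t) = 0 := h .zero_13 rfl
        rwa [F.tf3_apply, h1, map_zero, smul_zero, sub_zero] at h2
      · have h1 : R.cycT (R.conjT 3 (P.comp3 F false t)) = 0 := h .zero_11 rfl
        have h2 : (3 : ℝ) • R.conjT 3 (P.comp3 F false t) -
          R.cycT (R.conjT 3 (P.comp3 F false t)) = 0 := h .zero_12 rfl
        rw [h1, sub_zero, smul_eq_zero] at h2
        exact h2.resolve_left three_ne_zero
    · have h0 := (P.eq_zero_iff_comp F ht).mpr (eq_zero_of_conjT (h .one_00 rfl))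
      rw [h0]
      exact Submodule.zero_mem _

/-- The component of an intrinsic torsion in the module with label `l`. -/
def compTable (hm : 1 < m) (l : Label) : R.Torsion →ₗ[ℝ] R.TableModule l :=
  (R.tableEquiv l).toLinearMap ∘ₗ (P.comp F l).codRestrict _ (P.comp_mem F hm l)

theorem compTable_eq_zero_iff (hm : 1 < m) {l : Label} {t : R.Torsion} :
    P.compTable F hm l t = 0 ↔ P.comp F l t = 0 := by
  rw [compTable, LinearMap.comp_apply, LinearEquiv.coe_coe, LinearEquiv.map_eq_zero_iff,
    ← Submodule.coe_eq_zero]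
  rfl

theorem compTable_torsionRep (hm : 1 < m) (l : Label) (p : R.Q) {t : R.Torsion}
    (ht : t ∈ R.fil l.degree) : P.compTable F hm l (R.torsionRep p t) =
      R.tableRep l (R.toQ₀ p) (P.compTable F hm l t) := by
  rw [compTable, LinearMap.comp_apply, LinearMap.comp_apply, LinearEquiv.coe_coe,
    tableRep_tableEquiv]
  congr 1
  exact Subtype.ext (P.comp_torsionRep F l p ht)

end NullPair

end RobinsonStructure

namespace RobinsonStructure

open Robinson

variable {m : ℕ} {V : Type*} [AddCommGroup V] [Module ℝ V] {M : MinkowskiMetric m V}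
  {R : RobinsonStructure M}

/-! ### The dimension of `𝔤/𝔮` -/

theorem h_nondegenerate : R.h.Nondegenerate := by
  have h1 : ∀ x, R.h x x = 0 → x = 0 := fun x hx => by
    by_contra h0
    exact (R.h_pos h0).ne' hx
  exact ⟨fun x hx => h1 x (hx x), fun x hx => h1 x (hx x)⟩

variable (R) in
/-- The real bilinear form on the screen space given by twice the real part of a tensor. -/
def realForm : R.Tensors 2 →ₗ[ℝ] (R.H →ₗ[ℝ] R.H →ₗ[ℝ] ℝ) where
  toFun T := LinearMap.mk₂ ℝ (fun x y => 2 * (T ![1 ⊗ₜ x, 1 ⊗ₜ y]).re)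
    (fun x x' y => by
      have := T.map_update_add ![0, 1 ⊗ₜ y] 0 (1 ⊗ₜ x) (1 ⊗ₜ x')
      simp only [update2_0] at this
      rw [TensorProduct.tmul_add, this, Complex.add_re, mul_add])
    (fun c x y => by
      have := T.map_update_smul ![0, 1 ⊗ₜ y] 0 (c : ℂ) (1 ⊗ₜ x)
      simp only [update2_0] at this
      rw [TensorProduct.tmul_smul, ← ofReal_smul_tensor, this, smul_eq_mul, Complex.re_ofReal_mul,
        smul_eq_mul, mul_left_comm])
    (fun x y y' => by
      have := T.map_update_add ![1 ⊗ₜ x, 0] 1 (1 ⊗ₜ y) (1 ⊗ₜ y')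
      simp only [update2_1] at this
      rw [TensorProduct.tmul_add, this, Complex.add_re, mul_add])
    (fun c x y => by
      have := T.map_update_smul ![1 ⊗ₜ x, 0] 1 (c : ℂ) (1 ⊗ₜ y)
      simp only [update2_1] at this
      rw [TensorProduct.tmul_smul, ← ofReal_smul_tensor, this, smul_eq_mul, Complex.re_ofReal_mul,
        smul_eq_mul, mul_left_comm])
  map_add' S T := LinearMap.ext₂ fun x y => by simp [mul_add]
  map_smul' c T := LinearMap.ext₂ fun x y => by simp; ring

variable (R) in
/-- The endomorphism of the screen space given by twice the real part of a tensor. -/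
def realEnd : R.Tensors 2 →ₗ[ℝ] (R.H →ₗ[ℝ] R.H) :=
  have := R.finite_H
  (LinearMap.compRight ℝ (R.h.toDual h_nondegenerate).symm.toLinearMap) ∘ₗ R.realForm

theorem h_realEnd (T : R.Tensors 2) (x y : R.H) :
    R.h (R.realEnd T x) y = 2 * (T ![1 ⊗ₜ x, 1 ⊗ₜ y]).re := by
  have := R.finite_H
  exact LinearMap.BilinForm.apply_toDual_symm_apply (hB := h_nondegenerate) (R.realForm T x) y

/-- Twice the real part of T, extended complex bilinearly, is T plus its conjugate. -/
theorem hC_realEnd (T : R.Tensors 2) (x y : ℂ ⊗[ℝ] R.H) :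
    R.hC ((R.realEnd T).baseChange ℂ x) y =
      T ![x, y] + starRingEnd ℂ (T ![conjC _ x, conjC _ y]) := by
  let b : (ℂ ⊗[ℝ] R.H) →ₗ[ℂ] (ℂ ⊗[ℝ] R.H) →ₗ[ℂ] ℂ := LinearMap.mk₂ ℂ
    (fun u v => (T + R.conjT 2 T) ![u, v])
    (fun u u' v => by
      simpa only [update2_0] using (T + R.conjT 2 T).map_update_add ![0, v] 0 u u')
    (fun c u v => by
      simpa only [update2_0] using (T + R.conjT 2 T).map_update_smul ![0, v] 0 c u)
    (fun u v v' => by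
      simpa only [update2_1] using (T + R.conjT 2 T).map_update_add ![u, 0] 1 v v')
    (fun c u v => by
      simpa only [update2_1] using (T + R.conjT 2 T).map_update_smul ![u, 0] 1 c v)
  have hb : ∀ u v, b u v = T ![u, v] + R.conjT 2 T ![u, v] := fun _ _ => rfl
  rw [← conjT2_apply, ← hb, ← LinearMap.comp_apply]
  revert x y
  suffices R.hC ∘ₗ (R.realEnd T).baseChange ℂ = b from fun x y => by rw [this]
  refine ext_real fun x => ext_real fun y => ?_
  rw [hb, conjT2_apply, conjC_tmul, conjC_tmul, map_one, LinearMap.comp_apply,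
    LinearMap.baseChange_tmul]
  have : R.hC (1 ⊗ₜ R.realEnd T x) (1 ⊗ₜ y) = (R.h (R.realEnd T x) y : ℂ) := by
    simp [hC, LinearMap.BilinForm.baseChange_tmul]
  rw [this, h_realEnd, Complex.add_conj]

theorem h_realEnd_skew {T : R.Tensors 2} (hT : T ∈ R.forms20.toSubmodule) (x y : R.H) :
    R.h (R.realEnd T x) y = - R.h x (R.realEnd T y) := by
  rw [R.h_symm x, h_realEnd, h_realEnd, mem_swapSign2_iff.mp (mem_forms20_iff.mp hT).2,
    neg_one_smul, Complex.neg_re]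
  ring

namespace NullPair

variable (P : R.NullPair)

theorem g_σ (x : R.H) (v : V) : M.g (P.σ x) v = R.h x (P.τ v) := by
  conv_lhs => rw [P.eq_add v]
  rw [map_add, map_add, map_smul, map_smul, P.h_eq, M.symm _ P.k, P.g_k_σ, M.symm (P.σ x) P.l,
    P.g_l_σ, smul_zero, smul_zero, zero_add, zero_add]

/-- The skew-symmetric endomorphism of `V` with components `u` and `T`. -/
def endo : (R.H × R.forms20.toSubmodule) →ₗ[ℝ] so M where
  toFun a := ⟨(M.g P.l).smulRight (P.σ a.1) - (M.g (P.σ a.1)).smulRight P.l +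
      P.σ ∘ₗ R.realEnd a.2.1 ∘ₗ P.τ, by
    rw [mem_so]
    intro x y
    simp only [LinearMap.add_apply, LinearMap.sub_apply, LinearMap.smulRight_apply,
      LinearMap.comp_apply, map_add, map_sub, map_smul, LinearMap.smul_apply, smul_eq_mul]
    rw [M.symm x (P.σ a.1), M.symm x P.l, M.symm x (P.σ (R.realEnd a.2.1 (P.τ y))),
      P.g_σ (R.realEnd _ _), P.g_σ (R.realEnd _ _), h_realEnd_skew a.2.2, R.h_symm (P.τ x)]
    ring⟩
  map_add' a b := Subtype.ext <| LinearMap.ext fun v => by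
    simp only [Prod.fst_add, Prod.snd_add, Submodule.coe_add, map_add, LinearMap.add_apply,
      LinearMap.sub_apply, LinearMap.smulRight_apply, LinearMap.comp_apply]
    module
  map_smul' c a := Subtype.ext <| LinearMap.ext fun v => by
    simp only [Prod.smul_fst, Prod.smul_snd, Submodule.coe_smul, map_smul, LinearMap.add_apply,
      LinearMap.sub_apply, LinearMap.smulRight_apply, LinearMap.comp_apply, LinearMap.smul_apply,
      RingHom.id_apply, smul_eq_mul]
    module

theorem endo_apply (a : R.H × R.forms20.toSubmodule) (v : V) : (P.endo a).1 v =
    M.g P.l v • P.σ a.1 - M.g (P.σ a.1) v • P.l + P.σ (R.realEnd a.2.1 (P.τ v)) := rfl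

/-- The form on N attached to the pair (u, T) has the value h(u, y) on (k, y) for y of type (0,1),
and equals the conjugate of T on H^{(0,1)}. A real u orthogonal to H^{(0,1)} lies in H^{(0,1)} ∩
H^{(1,0)} = 0, so both components can be recovered. -/
theorem endo_eq_zero {a : R.H × R.forms20.toSubmodule} (ha : P.endo a ∈ R.q) : a = 0 := by
  obtain ⟨F⟩ := R.exists_unitaryFrame
  obtain ⟨u, T, hT⟩ := a
  have hN : ∀ v ∈ R.N, ∀ w ∈ R.N, gC M ((P.endo (u, ⟨T, hT⟩)).1.baseChange ℂ v) w = 0 :=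
    fun v hv w hw => R.gC_N (ha v hv) hw
  have hu : u = 0 := by
    have h1 : (1 : ℂ) ⊗ₜ[ℝ] u ∈ R.H01 := by
      refine R.mem_H01_of_forall fun y hy => ?_
      have h2 := hN _ P.k_mem_N _ (P.σC_mem_N hy)
      rw [LinearMap.baseChange_tmul, endo_apply, P.g_lk, g_σ, P.τ_k, map_zero, map_zero, map_zero,
        one_smul, zero_smul, sub_zero, add_zero] at h2
      rw [R.hC_symm, ← P.gC_σC]
      exact h2
    have h2 : (1 : ℂ) ⊗ₜ[ℝ] u ∈ R.H10 := by
      rw [mem_H10, conjC_tmul, map_one]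
      exact h1
    exact one_tmul_injective
      ((R.eq_zero_of_mem_H01_of_mem_H10 h1 h2).trans (TensorProduct.tmul_zero _ _).symm)
  subst hu
  have h0 : T = 0 := by
    have ht := (mem_forms20_iff.mp hT).1
    refine ext2 fun x y => ?_
    have h1 : T ![F.pr true x, F.pr true y] = T ![x, y] := by
      rw [← F.typed_apply_pr ht ![x, y]]
      congr 1
      exact (vec2_eta fun i => F.pr true (![x, y] i)).symm
    have hx := conjC_mem_typeSub (F.pr_mem true x)
    have hy := conjC_mem_typeSub (F.pr_mem true y)
    have h2 := hN _ (P.σC_mem_N hx) _ (P.σC_mem_N hy)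
    have h3 : (P.endo (0, ⟨T, hT⟩)).1.baseChange ℂ ∘ₗ P.σC =
        P.σC ∘ₗ (R.realEnd T).baseChange ℂ := ext_real fun z => by
      change (1 : ℂ) ⊗ₜ (P.endo (0, ⟨T, hT⟩)).1 (P.σ z) = 1 ⊗ₜ P.σ (R.realEnd T z)
      rw [endo_apply, P.g_l_σ, P.τ_σ]
      simp
    have h4 := LinearMap.congr_fun h3 (conjC _ (F.pr true x))
    rw [LinearMap.comp_apply, LinearMap.comp_apply] at h4
    rw [h4, P.gC_σC, hC_realEnd, conjC_conjC,
      conjC_conjC, h1, ht 0 _ hx, zero_add] at h2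
    exact (map_eq_zero (starRingEnd ℂ)).mp h2
  subst h0
  rfl

end NullPair

variable (R) in
theorem finite_quot : Module.Finite ℝ (so M ⧸ R.q) := by
  have := M.finite
  infer_instance

-- A lower bound suffices for the final count; no upper bound on dim 𝔤/𝔮 is required.
variable (R) in
theorem finrank_quot_ge : 2 * m + 2 * m.choose 2 ≤ Module.finrank ℝ (so M ⧸ R.q) := by
  obtain ⟨P⟩ := R.exists_nullPair
  have := R.finite_H
  have := R.finite_tensors 2
  have := R.finite_quot
  have h : Function.Injective (R.q.mkQ ∘ₗ P.endo) := by
    rw [injective_iff_map_eq_zero]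
    intro a ha
    exact P.endo_eq_zero ((Submodule.Quotient.mk_eq_zero _).mp ha)
  have := LinearMap.finrank_le_finrank_of_injective h
  rwa [Module.finrank_prod, R.finrank_H, R.finrank_forms20] at this

variable (R) in
theorem finite_torsion : Module.Finite ℝ R.Torsion := by
  have := M.finite
  have := R.finite_quot
  exact inferInstanceAs (Module.Finite ℝ (Module.Dual ℝ V ⊗[ℝ] (so M ⧸ R.q)))

variable (R) in
theorem finrank_torsion_ge :
    (2 * m + 2) * (2 * m + 2 * m.choose 2) ≤ Module.finrank ℝ R.Torsion := by
  have := M.finite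
  have h : Module.finrank ℝ R.Torsion = (2 * m + 2) * Module.finrank ℝ (so M ⧸ R.q) := by
    have h1 : Module.finrank ℝ (Module.Dual ℝ V ⊗[ℝ] (so M ⧸ R.q)) =
        (2 * m + 2) * Module.finrank ℝ (so M ⧸ R.q) := by
      rw [Module.finrank_tensorProduct, Subspace.dual_finrank_eq, M.finrank_eq]
    exact h1
  rw [h]
  exact Nat.mul_le_mul_left _ R.finrank_quot_ge

end RobinsonStructure

/-! ### The total dimension of the table -/

namespace Robinson.Label

instance : Fintype Label where
  elems := ⟨[neg2_00, neg1_00, neg1_10, neg1_11, neg1_12, neg1_20, neg1_21, neg1_30, zero_00,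
    zero_10, zero_11, zero_12, zero_13, one_00], by simp⟩
  complete l := by cases l <;> simp

theorem sum_dim (m : ℚ) : ∑ l : Label, l.dim m = (2 * m + 2) * (2 * m + m * (m - 1)) := by
  change ([neg2_00, neg1_00, neg1_10, neg1_11, neg1_12, neg1_20, neg1_21, neg1_30, zero_00,
    zero_10, zero_11, zero_12, zero_13, one_00].map fun l => l.dim m).sum = _
  simp only [List.map_cons, List.map_nil, List.sum_cons, List.sum_nil, dim]
  ring

theorem degree_mem (l : Label) : l.degree ∈ Finset.Icc (-2 : ℤ) 1 := by
  cases l <;> decide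

end Robinson.Label

namespace RobinsonStructure

open Robinson

variable {m : ℕ} {V : Type*} [AddCommGroup V] [Module ℝ V] {M : MinkowskiMetric m V}
  {R : RobinsonStructure M}

/-! ### The graded pieces -/

namespace NullPair

variable (P : R.NullPair) (F : R.UnitaryFrame)

/-- The component of an element of a graded piece in the module with label `l`. -/
def grComp (hm : 1 < m) (i : ℤ) (l : {l : Label // l.degree = i}) :
    R.Gr i →ₗ[ℝ] R.TableModule l.1 :=
  Submodule.liftQ _ ((P.compTable F hm l.1).domRestrict (R.fil i)) fun t ht =>
    (P.compTable_eq_zero_iff F hm).mpr ((P.mem_fil_add_one_iff F t.2).mp ht l.1 l.2)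

theorem grComp_grRep (hm : 1 < m) (hinv : ∀ i p, R.fil i ≤ (R.fil i).comap (R.torsionRep p))
    (i : ℤ) (l : {l : Label // l.degree = i}) (p : R.Q) (x : R.Gr i) :
    P.grComp F hm i l (R.grRep hinv i p x) =
      ((R.tableRep l.1).comp R.toQ₀) p (P.grComp F hm i l x) := by
  obtain ⟨t, rfl⟩ := Submodule.Quotient.mk_surjective _ x
  exact P.compTable_torsionRep F hm l.1 p (by rw [l.2]; exact t.2)

theorem pi_grComp_injective (hm : 1 < m) (i : ℤ) :
    Function.Injective (LinearMap.pi (P.grComp F hm i)) := by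
  rw [injective_iff_map_eq_zero]
  intro x hx
  obtain ⟨t, rfl⟩ := Submodule.Quotient.mk_surjective _ x
  rw [Submodule.Quotient.mk_eq_zero]
  refine (P.mem_fil_add_one_iff F t.2).mpr fun l hl => ?_
  have := congrFun hx ⟨l, hl⟩
  exact (P.compTable_eq_zero_iff F hm).mp this

end NullPair

variable (R) in
theorem finite_tableModule (l : Label) : Module.Finite ℝ (R.TableModule l) := by
  have := R.finite_tensors l.rank
  exact Module.Finite.equiv (R.tableEquiv l)

variable (R) in
theorem finrank_fil {i j : ℤ} (hij : i + 1 = j) :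
    Module.finrank ℝ (R.Gr i) + Module.finrank ℝ (R.fil j) = Module.finrank ℝ (R.fil i) := by
  subst hij
  have := R.finite_torsion
  rw [← Submodule.finrank_quotient_add_finrank ((R.fil (i + 1)).submoduleOf (R.fil i)),
    (Submodule.submoduleOfEquivOfLe (R.fil_antitone (by omega))).finrank_eq]

-- The dimensions telescope along the filtration from 𝔾^{-2} = 𝔾 to 𝔾^2 = 0.
variable (R) in
theorem sum_finrank_gr :
    ∑ i ∈ Finset.Icc (-2 : ℤ) 1, Module.finrank ℝ (R.Gr i) = Module.finrank ℝ R.Torsion := by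
  have h1 := R.finrank_fil (i := -2) (j := -1) rfl
  have h2 := R.finrank_fil (i := -1) (j := 0) rfl
  have h3 := R.finrank_fil (i := 0) (j := 1) rfl
  have h4 := R.finrank_fil (i := 1) (j := 2) rfl
  have h5 : Module.finrank ℝ (R.fil (-2)) = Module.finrank ℝ R.Torsion := by
    rw [R.fil_of_le le_rfl, finrank_top]
  have h6 : Module.finrank ℝ (R.fil 2) = 0 := by rw [R.fil_of_ge le_rfl, finrank_bot]
  have h7 : Finset.Icc (-2 : ℤ) 1 = {-2, -1, 0, 1} := by decide
  rw [h7, Finset.sum_insert (by decide), Finset.sum_insert (by decide),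
    Finset.sum_insert (by decide), Finset.sum_singleton]
  omega

theorem sum_finrank_tableModule (hm : 1 < m) : ∑ l : Label, Module.finrank ℝ (R.TableModule l) =
    (2 * m + 2) * (2 * m + 2 * m.choose 2) := by
  have : ((∑ l : Label, Module.finrank ℝ (R.TableModule l) : ℕ) : ℚ) =
      ((2 * m + 2) * (2 * m + 2 * m.choose 2) : ℕ) := by
    push_cast
    rw [Finset.sum_congr rfl fun l _ => R.finrank_tableModule hm l, Label.sum_dim,
      Nat.cast_choose_two ℚ m]
    ring
  exact_mod_cast this

/-- Injectivity bounds dim gr_i by the degree i part of the table. Summed over i the right side is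
at most dim 𝔾, which is the sum of the left sides, so equality holds in every degree and each
injection is onto. -/
theorem NullPair.pi_grComp_bijective (P : R.NullPair) (F : R.UnitaryFrame) (hm : 1 < m) (i : ℤ) :
    Function.Bijective (LinearMap.pi (P.grComp F hm i)) := by
  classical
  have := R.finite_tableModule
  have := R.finite_torsion
  have hle : ∀ i, Module.finrank ℝ (R.Gr i) ≤
      ∑ l : Label with l.degree = i, Module.finrank ℝ (R.TableModule l) := by
    intro i
    have h := LinearMap.finrank_le_finrank_of_injective (P.pi_grComp_injective F hm i)
    rw [Module.finrank_pi_fintype] at h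
    refine h.trans_eq ?_
    rw [Finset.sum_subtype (p := fun l : Label => l.degree = i) _ (by simp)]
  have heq : ∑ i ∈ Finset.Icc (-2 : ℤ) 1, Module.finrank ℝ (R.Gr i) =
      ∑ i ∈ Finset.Icc (-2 : ℤ) 1,
        ∑ l : Label with l.degree = i, Module.finrank ℝ (R.TableModule l) := by
    refine le_antisymm (Finset.sum_le_sum fun i _ => hle i) ?_
    rw [Finset.sum_fiberwise_of_maps_to fun l _ => l.degree_mem, sum_finrank_tableModule hm,
      R.sum_finrank_gr]
    exact R.finrank_torsion_ge
  have hi : Module.finrank ℝ (R.Gr i) =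
      ∑ l : Label with l.degree = i, Module.finrank ℝ (R.TableModule l) := by
    by_cases h : i ∈ Finset.Icc (-2 : ℤ) 1
    · exact (Finset.sum_eq_sum_iff_of_le fun i _ => hle i).mp heq i h
    · have h0 : ∑ l : Label with l.degree = i, Module.finrank ℝ (R.TableModule l) = 0 := by
        refine Finset.sum_eq_zero fun l hl => absurd ?_ h
        rw [← (Finset.mem_filter.mp hl).2]
        exact l.degree_mem
      have := hle i
      omega
  have hinj := P.pi_grComp_injective F hm i
  refine ⟨hinj, (LinearMap.injective_iff_surjective_of_finrank_eq_finrank ?_).mp hinj⟩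
  rw [hi, Module.finrank_pi_fintype, Finset.sum_subtype (p := fun l : Label => l.degree = i) _
    (by simp)]

theorem isIrreducible_comp_toQ₀ (hm : 1 < m) (l : Label) (hl : l.Occurs m) :
    Representation.IsIrreducible ((R.tableRep l).comp R.toQ₀) :=
  isIrreducible_of_linearEquiv (LinearEquiv.refl ℝ _)
    (fun g => (R.toQ₀_surjective g).imp fun p hp x => by rw [← hp]; rfl)
    (R.irreducible_tableRep hm l hl)

/-- Both dimension formulas contain the factor m - 2. -/
theorem subsingleton_tableModule (hm : 1 < m) (l : Label) (hl : ¬ l.Occurs m) :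
    Subsingleton (R.TableModule l) := by
  have := R.finite_tableModule l
  rw [Label.Occurs, not_not] at hl
  obtain ⟨rfl, hl⟩ := hl
  rw [← Module.finrank_zero_iff (R := ℝ)]
  have h := R.finrank_tableModule hm l
  obtain rfl | rfl := hl <;> norm_num [Label.dim] at h <;> exact h

end RobinsonStructure
end

/-! ### The decomposition of the graded pieces -/

theorem mainTheorem1 {m : ℕ} (hm : 1 < m) {V : Type*} [AddCommGroup V] [Module ℝ V]
    (M : Robinson.MinkowskiMetric m V) (R : RobinsonStructure M) :
    -- the filtration of `𝔾` by `Q`-submodules `0 = 𝔾^2 ⊆ 𝔾^1 ⊆ 𝔾^0 ⊆ 𝔾^{-1} ⊆ 𝔾^{-2} = 𝔾`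
    ∃ hinv : ∀ i p, R.fil i ≤ (R.fil i).comap (R.torsionRep p),
      Antitone R.fil ∧ R.fil (-2) = ⊤ ∧ R.fil 2 = ⊥ ∧
      -- the `Q₀`-modules of the table, with their dimensions
      (∀ l : Robinson.Label,
        (Module.finrank ℝ (R.TableModule l) : ℚ) = l.dim m ∧
        (l.Occurs m → (R.tableRep l).IsIrreducible)) ∧
      -- the decomposition of each graded piece
      ∀ i : ℤ, ∃ S : {l : Robinson.Label // l.degree = i} → Subrepresentation (R.grRep hinv i),
        iSupIndep (fun l => (S l).toSubmodule) ∧ (⨆ l, (S l).toSubmodule) = ⊤ ∧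
        ∀ l,
          Nonempty ((S l).toRepresentation.Equiv ((R.tableRep l.1).comp R.toQ₀)) ∧
          (l.1.Occurs m → (S l).toRepresentation.IsIrreducible) ∧
          (¬ l.1.Occurs m → (S l).toSubmodule = ⊥) := by
  obtain ⟨P⟩ := R.exists_nullPair
  obtain ⟨F⟩ := R.exists_unitaryFrame
  refine ⟨R.fil_le_comap, R.fil_antitone, R.fil_of_le le_rfl, R.fil_of_ge le_rfl,
    fun l => ⟨R.finrank_tableModule hm l, R.irreducible_tableRep hm l⟩, fun i => ?_⟩
  obtain ⟨S, h1, h2, h3⟩ := Robinson.exists_decomposition (R.grRep R.fil_le_comap i)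
    (fun l : {l : Robinson.Label // l.degree = i} => (R.tableRep l.1).comp R.toQ₀)
    (P.grComp F hm i) (P.grComp_grRep F hm R.fil_le_comap i) (P.pi_grComp_bijective F hm i)
  refine ⟨S, h1, h2, fun l => ⟨h3 l, fun hl => ?_, fun hl => ?_⟩⟩
  · obtain ⟨e⟩ := h3 l
    -- Irreducibility is pulled back from the module of the table along the inverse of the
    -- isomorphism.
    refine Robinson.isIrreducible_of_linearEquiv e.toLinearEquiv.symm (fun g => ⟨g, fun x => ?_⟩)
      (RobinsonStructure.isIrreducible_comp_toQ₀ hm l.1 hl)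
    rw [LinearEquiv.symm_apply_eq]
    have h4 := LinearMap.congr_fun (e.isIntertwining' g) (e.toLinearEquiv.symm x)
    refine Eq.trans ?_ h4.symm
    exact congrArg _ (e.toLinearEquiv.apply_symm_apply x).symm
  · obtain ⟨e⟩ := h3 l
    have := RobinsonStructure.subsingleton_tableModule (R := R) hm l.1 hl
    have := e.toLinearEquiv.toEquiv.subsingleton
    exact Submodule.eq_bot_of_subsingleton
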